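/- Let $X$ be a compact complex threefold with a nowhere vanishing holomorphic three-form $\Omega$ (locally $\Omega=s\,dz^1dz^2dz^3$) and a Kähler form $\omega=i\,g_{i\bar j}\,dz^i\wedge dz^{\bar j}$ (not assumed Ricci-flat), having no non-zero harmonic $(3,2)$-forms. Let $\mathcal B=\bigoplus B^{p,q}$, $B^{p,q}=\Gamma(X,\bigwedge^pTX\otimes\bigwedge^q\overline{T^*X})$, with generators $\theta_i=\partial/\partial z^i$, $\eta^{\bar j}=dz^{\bar j}$; let $\rho:\mathcal B\to\mathcal A$ be contraction with $\Omega$ into differential forms, $\rho(\theta_{i_1}\cdots\theta_{i_p}\eta^J)=\iota_{\theta_{i_1}}\cdots\iota_{\theta_{i_p}}\Omega\wedge\eta^J$, and put on $\mathcal B$ $$\bar\partial=-\rho^{-1}\bar\partial\rho,\quad \Delta=\rho^{-1}\partial\rho,\quad S=\rho^{-1}\partial^\dagger\rho,\quad R=\rho^{-1}\bar\partial^\dagger\rho,\qquad \partial^\dagger=-*\bar\partial*,\ \bar\partial^\dagger=-*\partial*,$$ $$[\alpha\bullet\beta]=(-1)^{|\alpha|}\Delta(\alpha\beta)-(-1)^{|\alpha|}\Delta(\alpha)\beta-\alpha\Delta(\beta),\qquad[\alpha\star\beta]=(-1)^{|\alpha|}R(\alpha\beta)-(-1)^{|\alpha|}R(\alpha)\beta-\alpha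 R(\beta),$$ $\operatorname{Tr}\alpha=\int_X\rho(\alpha)\wedge\Omega$. The Kodaira–Spencer (KS) action is $$S_X[\varphi_1|\Phi]=\operatorname{Tr}\bigl(\tfrac16(\varphi_1+\Phi)^3-\tfrac12\,\bar\partial\Delta^{-1}\Phi\wedge\Phi\bigr),\qquad \Phi\in\operatorname{Im}\Delta\cap B^{1,1},$$ where $\Delta^{-1}\Phi\in B^{2,1}$ is any element with image $\Phi$ under $\Delta$. Let $\varphi_1\in B^{1,1}$ with $\rho(\varphi_1)$ harmonic, and for $n\ge2$ let $\varphi_n\in\rho^{-1}(\operatorname{Im}\partial\bar\partial^\dagger)\cap B^{1,1}$ satisfy $\bar\partial\varphi_n+\frac12\sum_{i+j=n}[\varphi_i\bullet\varphi_j]=0$. Suppose $\varphi=\sum_{n\ge1}\varphi_n$ converges to an element of $B^{1,1}$, absolutely and locally uniformly together with first derivatives. Write $\Phi[\varphi_1]=\sum_{n\ge2}\varphi_n$. For a pair $(\varphi,\psi)$, $\psi=(\psi^{\bar j}_i)$, set $$e_i=\partial_i+\psi^{\bar j}_i\partial_{\bar j},\quad e_{\bar j}=\partial_{\bar j}+\varphi^i_{\bar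 j}\partial_i,\quad f^i=dz^i-\varphi^i_{\bar j}dz^{\bar j},\quad f^{\bar j}=dz^{\bar j}-\psi^{\bar j}_idz^i .$$ Wherever $\det(1-\varphi\psi)\neq0$ declare $f^i$ of type $(1,0)$ and $f^{\bar j}$ of type $(0,1)$. With this bigrading, the three-form $\Omega_{\varphi_1}=s f^1f^2f^3$ and the Kähler form $\omega$, the above definitions give operators $\bar\partial_{\varphi,\psi},\Delta_{\varphi,\psi},S_{\varphi,\psi},R_{\varphi,\psi}$ acting on $\alpha=\sum\alpha^I_{\bar J}e_If^{\bar J}$; they are viewed as acting on the coefficients $\alpha^I_{\bar J}$, that is, on $\mathcal B$ through $e_i\leftrightarrow\theta_i$, $f^{\bar j}\leftrightarrow\eta^{\bar j}$. For $\psi=\bar\varphi$ this is the Calabi–Yau manifold $X_{\varphi_1}$ with complex structure $\varphi$. Let $\psi_\tau=\sum_{n\ge1}\tau^n\bar\varphi_n$, $\tau\in\mathbb C$, $|\tau|\le1$: the continuation of $\bar\varphi$ in which $\bar\varphi_1$ is replaced by $\tau\bar\varphi_1$ and $\varphi_1$ is kept fixed; $\psi_1=\bar\varphi$. The case $\psi=0$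 is $X^{\rm hol}_{\varphi_1}$. Then: 1. **(The operators on $X_{\varphi_1}$.)** Put $\psi=\bar\varphi$, $N=(1-\varphi\bar\varphi)^{-1}$, $M^k_{i\bar j}=e_i\varphi^k_{\bar j}+\varphi^k_{\bar m}e_{\bar j}\bar\varphi^{\bar m}_i$, $e^{\tilde\sigma}=\det(1-\varphi\bar\varphi)\,|s|^2/\det g$, $\Gamma^i_{jk}=g^{\bar l i}\partial_jg_{k\bar l}$, and let $\bar N,\bar M,\bar\Gamma$ be the complex conjugates. Where $\det(1-\varphi\bar\varphi)\ne0$, with $e_i,e_{\bar k}$ and $\partial_i,\partial_{\bar k}$ differentiating coefficients and repeated indices summed, $$\bar\partial_{\varphi_1}=\bar N^{\bar k}_{\bar r}f^{\bar r}\bigl(e_{\bar k}-N^p_sM^s_{i\bar k}e_p\tfrac{\partial}{\partial e_i}-N^i_m\varphi^m_{\bar l}(e_{\bar k}\bar\varphi^{\bar j}_i)f^{\bar l}\tfrac{\partial}{\partial f^{\bar j}}\bigr),$$ $$\Delta_{\varphi_1}=(s\det N^{-1})^{-1}\circ e_i\tfrac{\partial}{\partial e_i}\circ(s\det N^{-1})-f^{\bar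 m}(\partial_{\bar m}\bar\varphi^{\bar j}_i)\tfrac{\partial}{\partial e_i}\tfrac{\partial}{\partial f^{\bar j}},$$ $$S_{\varphi_1}=g^{\bar ul}\bar N^{\bar k}_{\bar u}e_l\Bigl(-e_{\bar k}+N^n_rM^r_{i\bar k}e_n\tfrac{\partial}{\partial e_i}+\bigl(g_{n\bar m}g^{\bar jq}\bar N^{\bar m}_{\bar s}M^n_{q\bar k}+\Gamma^{\bar j}_{\bar k\bar s}+g^{\bar jm}g_{q\bar s}\Gamma^q_{mn}\varphi^n_{\bar k}\bigr)f^{\bar s}\tfrac{\partial}{\partial f^{\bar j}}\Bigr),$$ $$\begin{aligned}R_{\varphi_1}={}&e^{-\tilde\sigma}\circ\bigl(g^{\bar jk}e_k\tfrac{\partial}{\partial f^{\bar j}}\bigr)\circ e^{\tilde\sigma}+g^{\bar tk}(\partial_{\bar t}\bar\varphi^{\bar j}_k)\tfrac{\partial}{\partial f^{\bar j}}-g^{\bar jk}(\partial_{\bar n}\bar\varphi^{\bar l}_k)f^{\bar n}\tfrac{\partial}{\partial f^{\bar j}}\tfrac{\partial}{\partial f^{\bar l}}\\&+N^m_p\bigl(g^{\bar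 jk}e_i(N^{-1})^p_k+g^{\bar lp}\bar M^{\bar j}_{\bar li}+g^{\bar js}(N^{-1})^k_s(\Gamma^p_{ik}+g^{\bar lp}g_{k\bar q}\Gamma^{\bar q}_{\bar n\bar l}\bar\varphi^{\bar n}_i)\bigr)e_m\tfrac{\partial}{\partial e_i}\tfrac{\partial}{\partial f^{\bar j}}.\end{aligned}$$ 2. **(Holomorphic limit.)** For every $\alpha\in\mathcal B$ and every point, the values at that point of $\bar\partial_{\varphi,\psi_\tau}\alpha$, $\Delta_{\varphi,\psi_\tau}\alpha$, $S_{\varphi,\psi_\tau}\alpha$, $R_{\varphi,\psi_\tau}\alpha$ are analytic in $\tau$ on $\{|\tau|<1,\ \det(1-\varphi\psi_\tau)\ne0\}$, continuous on $\{|\tau|\le1,\ \det(1-\varphi\psi_\tau)\neq0\}$, and as $\tau\to0$ they tend respectively to $$\bar\partial\alpha+[\varphi\bullet\alpha],\qquad\Delta\alpha,\qquad S\alpha+[\varphi\star\alpha],\qquad R\alpha .$$ 3. **(Action.)** Let $\Phi'\in\operatorname{Im}\Delta\cap B^{1,1}$, and let $S_{X^{\rm hol}_{\varphi_1}}[0|\Phi']$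 be the KS action formed with the operators and the trace of $X^{\rm hol}_{\varphi_1}$. For all choices of the primitives involved, $$S_X[\varphi_1|\Phi[\varphi_1]+\Phi']-S_X[\varphi_1|\Phi[\varphi_1]]=S_{X^{\rm hol}_{\varphi_1}}[0|\Phi'],$$ and this equals $\operatorname{Tr}\bigl(\frac16\Phi'^3+\frac12\Delta^{-1}(\bar\partial\Phi'+[\varphi\bullet\Phi'])\wedge\Phi'\bigr)$, where $\Delta^{-1}(\cdot)\in B^{2,2}$ is any primitive. 4. **(Trace.)** The trace of $X^{\rm hol}_{\varphi_1}$, $\operatorname{Tr}^{\rm hol}_{\varphi_1}(\alpha)=\int_X\rho^{\rm hol}_{\varphi_1}(\alpha)\wedge\Omega_{\varphi_1}$, equals $\operatorname{Tr}(\alpha)$ for every $\alpha\in\mathcal B$. -/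

import Mathlib

open scoped Manifold ContDiff Topology ComplexOrder

noncomputable section

namespace KS

/-! ### The Grassmann algebra on six generators -/

/-- Local coordinate space of a complex threefold. -/
abbrev E3 : Type := Fin 3 → ℂ

/-- The Grassmann algebra on the generators `ξ_0, …, ξ_5`, an element being given by its
coefficients with respect to the ordered monomials `ξ_K`, `K ⊆ {0, …, 5}`.
For polyvector-valued forms the generators are `θ_1, θ_2, θ_3, η^1, η^2, η^3`;
for differential forms they are `dz^1, dz^2, dz^3, dz̄^1, dz̄^2, dz̄^3`. -/
abbrev Gr : Type := Finset (Fin 6) → ℂ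

/-- Index of `θ_i` (or of `dz^i`). -/
def th (i : Fin 3) : Fin 6 := Fin.castAdd 3 i

/-- Index of `η^j` (or of `dz̄^j`). -/
def et (j : Fin 3) : Fin 6 := Fin.natAdd 3 j

/-- The sign with `ξ_I ξ_J = gsgn I J • ξ_{I ∪ J}` for disjoint `I`, `J`. -/
def gsgn (I J : Finset (Fin 6)) : ℂ :=
  (-1) ^ ((I ×ˢ J).filter (fun p => p.2 < p.1)).card

/-- The product of the Grassmann algebra. -/
def gmul (a b : Gr) : Gr :=
  fun K => ∑ I ∈ K.powerset, gsgn I (K \ I) * a I * b (K \ I)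

/-- The generator `ξ_k`. -/
def gen (k : Fin 6) : Gr := Pi.single {k} 1

/-- All indices of the first kind (`θ` or `dz`). -/
def thAll : Finset (Fin 6) := Finset.univ.image th

/-- Number of generators of the first kind in a monomial. -/
def thDeg (K : Finset (Fin 6)) : ℕ := (K ∩ thAll).card

/-- Number of generators of the second kind in a monomial. -/
def etDeg (K : Finset (Fin 6)) : ℕ := (K \ thAll).card

/-- Projection to bidegree `(p, q)`. -/
def proj (p q : ℕ) (a : Gr) : Gr :=
  fun K => if thDeg K = p ∧ etDeg K = q then a K else 0

/-- The parity involution `α ↦ (-1)^{|α|} α`. -/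
def parity (a : Gr) : Gr := fun K => (-1) ^ K.card * a K

/-- The algebra homomorphism with `ξ_a ↦ ∑_b M b a ξ_b`; its matrix consists of the minors
of `M`. -/
def gsubst (M : Matrix (Fin 6) (Fin 6) ℂ) (a : Gr) : Gr :=
  fun K => ∑ I : Finset (Fin 6),
    if h : I.card = K.card then
      (M.submatrix (K.orderEmbOfFin rfl) (I.orderEmbOfFin h)).det * a I
    else 0

/-- The left derivative `∂/∂ξ_k`. -/
def lder (k : Fin 6) (a : Gr) : Gr :=
  fun K => if k ∈ K then 0 else gsgn {k} K * a (insert k K)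

/-- Replace the part of first kind of a monomial by its complement. -/
def flip (K : Finset (Fin 6)) : Finset (Fin 6) := (thAll \ K) ∪ (K \ thAll)

/-- The sign `(-1)^{p(p-1)/2} ε_{I,I*}` where `I` is the part of first kind of `K`, `p = |I|` and
`I*` is its complement. -/
def rsgn (K : Finset (Fin 6)) : ℂ :=
  (-1) ^ (Nat.choose (thDeg K) 2) * gsgn (K ∩ thAll) (thAll \ K)

/-- A `6 × 6` matrix from four `3 × 3` blocks (first kind, then second kind). -/
def blk (A B C D : Matrix (Fin 3) (Fin 3) ℂ) : Matrix (Fin 6) (Fin 6) ℂ :=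
  (Matrix.fromBlocks A B C D).submatrix
    (finSumFinEquiv (m := 3) (n := 3)).symm (finSumFinEquiv (m := 3) (n := 3)).symm

/-! ### Differentiation in a coordinate chart -/

/-- `pd (th i) f = ∂f/∂z^i` and `pd (et j) f = ∂f/∂z̄^j`. -/
def pd {V : Type*} [NormedAddCommGroup V] [NormedSpace ℝ V] [NormedSpace ℂ V]
    (k : Fin 6) (f : E3 → V) (z : E3) : V :=
  Fin.addCases (m := 3) (n := 3) (motive := fun _ => V)
    (fun i => (1 / 2 : ℂ) • (fderiv ℝ f z (Pi.single i 1)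
      - Complex.I • fderiv ℝ f z (Pi.single i Complex.I)))
    (fun i => (1 / 2 : ℂ) • (fderiv ℝ f z (Pi.single i 1)
      + Complex.I • fderiv ℝ f z (Pi.single i Complex.I)))
    k

/-- The exterior derivative of a differential form given in the coframe `dz, dz̄`. -/
def extd (b : E3 → Gr) (z : E3) : Gr := ∑ k : Fin 6, gmul (gen k) (pd k b z)

/-! ### Local geometry of a deformed Calabi-Yau threefold

`s` is the coefficient of the holomorphic three-form `Ω = s dz^1 dz^2 dz^3`, `g` the Kähler metric
`g_{i j̄}`, `φ i j` is `φ^i_{j̄}` and `ψ j i` is `ψ^{j̄}_i`. The frame of the deformed structure is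
`e_i = ∂_i + ψ^{j̄}_i ∂_{j̄}`, `e_{j̄} = ∂_{j̄} + φ^i_{j̄} ∂_i`, and
`f^i = dz^i - φ^i_{j̄} dz̄^j`, `f^{j̄} = dz̄^j - ψ^{j̄}_i dz^i`, with `f^i` of type `(1,0)` and
`f^{j̄}` of type `(0,1)`. For `ψ` the complex conjugate of `φ` this is the manifold with complex
structure `φ`; an independent `ψ` is its analytic continuation; `φ = ψ = 0` is no deformation. -/
structure Geom where
  s : E3 → ℂ
  g : E3 → Matrix (Fin 3) (Fin 3) ℂ
  φ : E3 → Matrix (Fin 3) (Fin 3) ℂ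
  ψ : E3 → Matrix (Fin 3) (Fin 3) ℂ

namespace Geom

variable (Y : Geom)

/-- Column `a` holds the coefficients of the vector field `e_a` in the frame `∂_z, ∂_{z̄}`. -/
def frame (z : E3) : Matrix (Fin 6) (Fin 6) ℂ := blk 1 (Y.φ z) (Y.ψ z) 1

/-- The pairing `⟨f^i, e_j⟩ = (1 - φψ)^i_j`. -/
def pairing (z : E3) : Matrix (Fin 3) (Fin 3) ℂ := 1 - Y.φ z * Y.ψ z

/-- The pairing `⟨f^{i̅}, e_{j̄}⟩ = (1 - ψφ)^{i̅}_{j̄}`. -/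
def pairingBar (z : E3) : Matrix (Fin 3) (Fin 3) ℂ := 1 - Y.ψ z * Y.φ z

/-- From coefficients with respect to the coframe `F^a` dual to `e_a` (the `F^i` span the same
space as the `f^i`, the `F^{j̄}` the same as the `f^{j̄}`) to the coframe `dz, dz̄`. -/
def toCoord (a : E3 → Gr) (z : E3) : Gr := gsubst ((Y.frame z)⁻¹).transpose (a z)

/-- The exterior derivative in terms of coefficients with respect to `F^a`. -/
def frameD (a : E3 → Gr) (z : E3) : Gr :=
  gsubst (Y.frame z).transpose (extd (Y.toCoord a) z)

/-- The component of type `(1,0)` of the exterior derivative. -/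
def del (a : E3 → Gr) (z : E3) : Gr :=
  ∑ p ∈ Finset.range 4, ∑ q ∈ Finset.range 4,
    proj (p + 1) q (Y.frameD (fun y => proj p q (a y)) z)

/-- The component of type `(0,1)` of the exterior derivative. -/
def delBar (a : E3 → Gr) (z : E3) : Gr :=
  ∑ p ∈ Finset.range 4, ∑ q ∈ Finset.range 4,
    proj p (q + 1) (Y.frameD (fun y => proj p q (a y)) z)

/-- The coefficient of the three-form `s f^1 f^2 f^3` with respect to `F^1 F^2 F^3`. -/
def omegaCoeff (z : E3) : ℂ := Y.s z * (Y.pairing z).det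

/-- The isomorphism `ρ` given by contraction of polyvectors with the three-form `s f^1 f^2 f^3`,
in terms of the dual frames `e_i, F^{j̄}` and `F^i, F^{j̄}`:
`ρ(e_I F^J) = (-1)^{p(p-1)/2} ε_{I,I*} (s f^1 f^2 f^3 / F^1 F^2 F^3) F^{I*} F^J`. -/
def rho (a : E3 → Gr) (z : E3) : Gr :=
  fun K => Y.omegaCoeff z * (rsgn (flip K) * a z (flip K))

/-- The inverse of `ρ`. -/
def rhoInv (b : E3 → Gr) (z : E3) : Gr :=
  fun K => (Y.omegaCoeff z)⁻¹ * (rsgn K * b z (flip K))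

/-- The metric `h_{i l̄}` of the deformed manifold in the frame: the Kähler form
`ω = i g_{k j̄} dz^k dz̄^j` has `ω(e_i, e_{l̄}) = i h_{i l̄}`. -/
def metric (z : E3) : Matrix (Fin 3) (Fin 3) ℂ :=
  Y.g z - (Y.ψ z).transpose * (Y.g z).transpose * Y.φ z

/-- The Hodge operator transferred by `ρ`: on elements of ghost number `n` it is
`i (-1)^{(n+1)(n+2)/2} κ`, with `κ` the algebra homomorphism
`κ(e_i) = - h_{i l̄} F^{l̄}`, `κ(F^{l̄}) = h^{i l̄} e_i`. -/
def star (a : E3 → Gr) (z : E3) : Gr :=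
  fun K => Complex.I * (-1) ^ ((K.card + 1) * (K.card + 2) / 2) *
    gsubst (blk 0 ((Y.metric z)⁻¹).transpose (-(Y.metric z).transpose) 0) (a z) K

/-- `f^{j̄} = (1 - ψφ)^{j̄}_{l̄} F^{l̄}`: from coefficients in `e_I f^J` to those in `e_I F^J`. -/
def toDual (a : E3 → Gr) (z : E3) : Gr :=
  gsubst (blk 1 0 0 (Y.pairingBar z).transpose) (a z)

/-- From coefficients in `e_I F^J` to those in `e_I f^J`. -/
def ofDual (a : E3 → Gr) (z : E3) : Gr :=
  gsubst (blk 1 0 0 ((Y.pairingBar z)⁻¹).transpose) (a z)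

/-- `∂̄` on polyvector-valued forms, `-ρ⁻¹ ∘ ∂̄ ∘ ρ`, in the frame `e_I f^J`. -/
def opDbar (a : E3 → Gr) : E3 → Gr :=
  Y.ofDual (-(Y.rhoInv (Y.delBar (Y.rho (Y.toDual a)))))

/-- `Δ = ρ⁻¹ ∘ ∂ ∘ ρ`, in the frame `e_I f^J`. -/
def opDelta (a : E3 → Gr) : E3 → Gr :=
  Y.ofDual (Y.rhoInv (Y.del (Y.rho (Y.toDual a))))

/-- `S = ρ⁻¹ ∘ ∂† ∘ ρ` with `∂† = - * ∂̄ *`, in the frame `e_I f^J`. -/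
def opS (a : E3 → Gr) : E3 → Gr :=
  Y.ofDual (-(Y.star (Y.rhoInv (Y.delBar (Y.rho (Y.star (Y.toDual a)))))))

/-- `R = ρ⁻¹ ∘ ∂̄† ∘ ρ` with `∂̄† = - * ∂ *`, in the frame `e_I f^J`. -/
def opR (a : E3 → Gr) : E3 → Gr :=
  Y.ofDual (-(Y.star (Y.rhoInv (Y.del (Y.rho (Y.star (Y.toDual a)))))))

/-- The coefficient of `dz^1 dz^2 dz^3 dz̄^1 dz̄^2 dz̄^3` in `ρ(α) ∧ s f^1 f^2 f^3`. -/
def traceDensity (a : E3 → Gr) (z : E3) : ℂ :=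
  gmul (Y.toCoord (Y.rho (Y.toDual a)) z)
    (Y.toCoord (fun y => Y.omegaCoeff y • Pi.single thAll 1) z) Finset.univ

/-! ### Explicit formulas on the deformed manifold -/

/-- The derivative along `e_i`. -/
def eTh {V : Type*} [NormedAddCommGroup V] [NormedSpace ℝ V] [NormedSpace ℂ V]
    (i : Fin 3) (f : E3 → V) (z : E3) : V :=
  pd (th i) f z + ∑ m, Y.ψ z m i • pd (et m) f z

/-- The derivative along `e_{k̄}`. -/
def eEt {V : Type*} [NormedAddCommGroup V] [NormedSpace ℝ V] [NormedSpace ℂ V]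
    (k : Fin 3) (f : E3 → V) (z : E3) : V :=
  pd (et k) f z + ∑ l, Y.φ z l k • pd (th l) f z

/-- `N = (1 - φψ)⁻¹`. -/
def matN (z : E3) : Matrix (Fin 3) (Fin 3) ℂ := (Y.pairing z)⁻¹

/-- `N̄ = (1 - ψφ)⁻¹`. -/
def matNbar (z : E3) : Matrix (Fin 3) (Fin 3) ℂ := (Y.pairingBar z)⁻¹

/-- `M^k_{i j̄} = e_i φ^k_{j̄} + φ^k_{m̄} e_{j̄} ψ^{m̄}_i`. -/
def symM (k i j : Fin 3) (z : E3) : ℂ :=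
  Y.eTh i (fun y => Y.φ y k j) z + ∑ m, Y.φ z k m * Y.eEt j (fun y => Y.ψ y m i) z

/-- `M̄^{k̄}_{i̅ j} = e_{i̅} ψ^{k̄}_j + ψ^{k̄}_m e_j φ^m_{i̅}`. -/
def symMbar (k i j : Fin 3) (z : E3) : ℂ :=
  Y.eEt i (fun y => Y.ψ y k j) z + ∑ m, Y.ψ z k m * Y.eTh j (fun y => Y.φ y m i) z

/-- `g^{j̄ k}`. -/
def gInv (j k : Fin 3) (z : E3) : ℂ := (Y.g z)⁻¹ j k

/-- The Christoffel symbol `Γ^i_{jk} = g^{m̄ i} ∂_j g_{k m̄}`. -/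
def christ (i j k : Fin 3) (z : E3) : ℂ :=
  ∑ m, Y.gInv m i z * pd (th j) (fun y => Y.g y k m) z

/-- The Christoffel symbol `Γ^{i̅}_{j̄ k̄} = g^{i̅ m} ∂_{j̄} g_{m k̄}`. -/
def christBar (i j k : Fin 3) (z : E3) : ℂ :=
  ∑ m, Y.gInv i m z * pd (et j) (fun y => Y.g y m k) z

/-- `e^{σ̃} = det(1 - φψ) |s|² / det g`. -/
def expSigma (z : E3) : ℂ :=
  (Y.pairing z).det * ((‖Y.s z‖ : ℂ) ^ 2 / (Y.g z).det)

/-- `N̄^k_r f^r (e_{k̄} - N^p_s M^s_{i k̄} e_p ∂/∂e_i)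
  - N̄^k_r f^r N^i_m φ^m_{l̄} (e_{k̄} ψ^{j̄}_i) f^{l̄} ∂/∂f^{j̄}`. -/
def explDbar (a : E3 → Gr) (z : E3) : Gr :=
  ∑ k, ∑ r, Y.matNbar z k r • gmul (gen (et r))
    (Y.eEt k a z
      - ∑ p, ∑ i, (∑ s, Y.matN z p s * Y.symM s i k z) • gmul (gen (th p)) (lder (th i) (a z))
      - ∑ l, ∑ j, (∑ i, ∑ m, Y.matN z i m * Y.φ z m l * Y.eEt k (fun y => Y.ψ y j i) z) •
          gmul (gen (et l)) (lder (et j) (a z)))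

/-- `(s det N⁻¹)⁻¹ ∘ e_i ∂/∂e_i ∘ (s det N⁻¹) - f^{m̄} (∂_{m̄} ψ^{j̄}_i) ∂/∂e_i ∂/∂f^{j̄}`. -/
def explDelta (a : E3 → Gr) (z : E3) : Gr :=
  (Y.omegaCoeff z)⁻¹ • ∑ i, Y.eTh i (fun y => lder (th i) (Y.omegaCoeff y • a y)) z
    - ∑ m, ∑ j, ∑ i, pd (et m) (fun y => Y.ψ y j i) z •
        gmul (gen (et m)) (lder (th i) (lder (et j) (a z)))

/-- `g^{u̅ l} N̄^k_u e_l (- e_{k̄} + N^n_r M^r_{i k̄} e_n ∂/∂e_i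
  + (g_{n m̄} g^{j̄ q} N̄^m_s M^n_{q k̄} + Γ^{j̄}_{k̄ s̄} + g^{j̄ m} g_{q s̄} Γ^q_{mn} φ^n_{k̄})
    f^{s̄} ∂/∂f^{j̄})`. -/
def explS (a : E3 → Gr) (z : E3) : Gr :=
  ∑ k, ∑ u, ∑ l, (Y.gInv u l z * Y.matNbar z k u) • gmul (gen (th l))
    (-Y.eEt k a z
      + ∑ n, ∑ i, (∑ r, Y.matN z n r * Y.symM r i k z) • gmul (gen (th n)) (lder (th i) (a z))
      + ∑ s, ∑ j,
          ((∑ n, ∑ m, ∑ q, Y.g z n m * Y.gInv j q z * Y.matNbar z m s * Y.symM n q k z)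
            + Y.christBar j k s z
            + ∑ m, ∑ q, ∑ n, Y.gInv j m z * Y.g z q s * Y.christ q m n z * Y.φ z n k) •
          gmul (gen (et s)) (lder (et j) (a z)))

/-- `e^{-σ̃} ∘ g^{j̄ k} e_k ∂/∂f^{j̄} ∘ e^{σ̃} + g^{t̄ k} (∂_{t̄} ψ^{j̄}_k) ∂/∂f^{j̄}
  - g^{j̄ k} (∂_{n̄} ψ^{l̄}_k) f^{n̄} ∂/∂f^{j̄} ∂/∂f^{l̄}
  + N^m_p (g^{j̄ k} e_i (N⁻¹)^p_k + g^{l̄ p} M̄^{j̄}_{l̄ i}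
      + g^{j̄ s} (N⁻¹)^k_s (Γ^p_{ik} + g^{l̄ p} g_{k q̄} Γ^{q̄}_{n̄ l̄} ψ^{n̄}_i))
    e_m ∂/∂e_i ∂/∂f^{j̄}`. -/
def explR (a : E3 → Gr) (z : E3) : Gr :=
  (Y.expSigma z)⁻¹ • ∑ j, ∑ k, Y.gInv j k z •
      Y.eTh k (fun y => lder (et j) (Y.expSigma y • a y)) z
    + ∑ j, (∑ t, ∑ k, Y.gInv t k z * pd (et t) (fun y => Y.ψ y j k) z) • lder (et j) (a z)
    - ∑ j, ∑ l, ∑ n, (∑ k, Y.gInv j k z * pd (et n) (fun y => Y.ψ y l k) z) •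
        gmul (gen (et n)) (lder (et j) (lder (et l) (a z)))
    + ∑ m, ∑ i, ∑ j,
        (∑ p, Y.matN z m p *
          ((∑ k, Y.gInv j k z * Y.eTh i (fun y => Y.pairing y p k) z)
            + (∑ l, Y.gInv l p z * Y.symMbar j l i z)
            + ∑ s, ∑ k, Y.gInv j s z * Y.pairing z k s *
                (Y.christ p i k z
                  + ∑ l, ∑ q, ∑ n, Y.gInv l p z * Y.g z k q * Y.christBar q n l z * Y.ψ z n i))) •
        gmul (gen (th m)) (lder (th i) (lder (et j) (a z)))

end Geom

/-! ### Global objects -/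

section Global

variable (X : Type*) [TopologicalSpace X] [ChartedSpace E3 X]

/-- The Jacobian matrix `∂z'^i/∂z^k` at `x` of the change from the chart `c` to `c'`. -/
def jac {X : Type*} [TopologicalSpace X] (c c' : OpenPartialHomeomorph X E3) (x : X) :
    Matrix (Fin 3) (Fin 3) ℂ :=
  Matrix.of fun i k => fderiv ℂ (fun y => c' (c.symm y)) (c x) (Pi.single k 1) i

/-- A holomorphic volume form `Ω = s dz^1 dz^2 dz^3` and a Kähler metric `g_{i j̄}` on a complex
threefold, given in every chart of the atlas. -/
structure CalabiYau where
  s : OpenPartialHomeomorph X E3 → E3 → ℂ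
  g : OpenPartialHomeomorph X E3 → E3 → Matrix (Fin 3) (Fin 3) ℂ
  s_holomorphic : ∀ c ∈ atlas E3 X, DifferentiableOn ℂ (s c) c.target
  s_ne_zero : ∀ c ∈ atlas E3 X, ∀ z ∈ c.target, s c z ≠ 0
  s_compat : ∀ c ∈ atlas E3 X, ∀ c' ∈ atlas E3 X, ∀ x ∈ c.source ∩ c'.source,
    s c (c x) = s c' (c' x) * (jac c c' x).det
  g_smooth : ∀ c ∈ atlas E3 X, ∀ i j, ContDiffOn ℝ ∞ (fun z => g c z i j) c.target
  g_posDef : ∀ c ∈ atlas E3 X, ∀ z ∈ c.target, (g c z).PosDef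
  g_compat : ∀ c ∈ atlas E3 X, ∀ c' ∈ atlas E3 X, ∀ x ∈ c.source ∩ c'.source,
    g c (c x) = (jac c c' x).transpose * g c' (c' x) * (jac c c' x).map (starRingEnd ℂ)
  g_closed : ∀ c ∈ atlas E3 X, ∀ z ∈ c.target, ∀ i j k,
    pd (th k) (fun y => g c y i j) z = pd (th i) (fun y => g c y k j) z

/-- A family of local coefficient functions, one for each chart (only charts `c` of the atlas and
points of `c.target` matter). -/
abbrev LField : Type _ := OpenPartialHomeomorph X E3 → E3 → Gr

/-- A family of local matrix-valued functions, one for each chart. -/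
abbrev MatField : Type _ := OpenPartialHomeomorph X E3 → E3 → Matrix (Fin 3) (Fin 3) ℂ

variable {X}

/-- Equality as local coefficient functions in the charts of the atlas. -/
def FieldEq (α β : LField X) : Prop := ∀ c ∈ atlas E3 X, ∀ z ∈ c.target, α c z = β c z

/-- `α` is an element of `𝓑`: a smooth section of `⨁ ⋀^p TX ⊗ ⋀^q T̄*X`. -/
def IsSection (α : LField X) : Prop :=
  (∀ c ∈ atlas E3 X, ContDiffOn ℝ ∞ (α c) c.target) ∧
  ∀ c ∈ atlas E3 X, ∀ c' ∈ atlas E3 X, ∀ x ∈ c.source ∩ c'.source,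
    α c' (c' x) = gsubst (blk (jac c c' x) 0 0 ((jac c c' x)⁻¹).conjTranspose) (α c (c x))

/-- `α` is an element of `B^{p,q}`. -/
def IsB (p q : ℕ) (α : LField X) : Prop :=
  IsSection α ∧ FieldEq α (fun c z => proj p q (α c z))

/-- The product of `𝓑`. -/
def wedge (α β : LField X) : LField X := fun c z => gmul (α c z) (β c z)

/-- The components `φ^i_{j̄}` of an element `φ = φ^i_{j̄} θ_i η^{j̄}` of `B^{1,1}`. -/
def comp (α : LField X) : MatField X := fun c z => Matrix.of fun i j => α c z {th i, et j}

namespace CalabiYau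

variable (Y : CalabiYau X)

/-- The local geometry in the chart `c` of the deformation of `X` by `(φ, ψ)`. -/
def geom (φ ψ : MatField X) (c : OpenPartialHomeomorph X E3) : Geom :=
  ⟨Y.s c, Y.g c, φ c, ψ c⟩

/-- `∂̄` on the deformation by `(φ, ψ)`, acting on coefficients in the frame `e_I f^J`. -/
def dbarDef (φ ψ : MatField X) (α : LField X) : LField X := fun c => (Y.geom φ ψ c).opDbar (α c)

/-- `Δ` on the deformation by `(φ, ψ)`, acting on coefficients in the frame `e_I f^J`. -/
def deltaDef (φ ψ : MatField X) (α : LField X) : LField X := fun c => (Y.geom φ ψ c).opDelta (α c)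

/-- `S` on the deformation by `(φ, ψ)`, acting on coefficients in the frame `e_I f^J`. -/
def sDef (φ ψ : MatField X) (α : LField X) : LField X := fun c => (Y.geom φ ψ c).opS (α c)

/-- `R` on the deformation by `(φ, ψ)`, acting on coefficients in the frame `e_I f^J`. -/
def rDef (φ ψ : MatField X) (α : LField X) : LField X := fun c => (Y.geom φ ψ c).opR (α c)

/-- `∂̄` on `X`. -/
def dbar : LField X → LField X := Y.dbarDef 0 0

/-- `Δ` on `X`. -/
def delta : LField X → LField X := Y.deltaDef 0 0

/-- `S` on `X`. -/
def opS : LField X → LField X := Y.sDef 0 0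

/-- `R` on `X`. -/
def opR : LField X → LField X := Y.rDef 0 0

/-- `[α•β] = (-1)^{|α|} Δ(α ∧ β) - (-1)^{|α|} Δ(α) ∧ β - α ∧ Δ(β)`. -/
def bullet (α β : LField X) : LField X :=
  Y.delta (wedge (fun c z => parity (α c z)) β)
    - wedge (Y.delta (fun c z => parity (α c z))) β - wedge α (Y.delta β)

/-- `[α⋆β] = (-1)^{|α|} R(α ∧ β) - (-1)^{|α|} R(α) ∧ β - α ∧ R(β)`. -/
def starBr (α β : LField X) : LField X :=
  Y.opR (wedge (fun c z => parity (α c z)) β)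
    - wedge (Y.opR (fun c z => parity (α c z))) β - wedge α (Y.opR β)

/-- The Laplacian `ΔS + SΔ`. -/
def laplacian (α : LField X) : LField X := Y.delta (Y.opS α) + Y.opS (Y.delta α)

/-- The measure of the volume form `i Ω ∧ Ω̄`. In a chart it is `8 |s|²` times Lebesgue measure,
since `i dz^1 dz^2 dz^3 dz̄^1 dz̄^2 dz̄^3 = 8 dx^1 dy^1 dx^2 dy^2 dx^3 dy^3`; the local measures agree
on overlaps, and the global one is their supremum. -/
def vol [MeasurableSpace X] : MeasureTheory.Measure X :=
  ⨆ c ∈ atlas E3 X, MeasureTheory.Measure.map c.symm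
    ((MeasureTheory.volume.restrict c.target).withDensity
      (fun z => ENNReal.ofReal (8 * ‖Y.s c z‖ ^ 2)))

/-- `Tr(α) = ∫_X ρ(α) ∧ s f^1 f^2 f^3` on the deformation by `(φ, ψ)`. A six-form is integrated by
writing it as a multiple of `i Ω ∧ Ω̄`. -/
def trDef [MeasurableSpace X] (φ ψ : MatField X) (α : LField X) : ℂ :=
  ∫ x, (Y.geom φ ψ (chartAt E3 x)).traceDensity (α (chartAt E3 x)) (chartAt E3 x x) /
    (Complex.I * (‖Y.s (chartAt E3 x) (chartAt E3 x x)‖ : ℂ) ^ 2) ∂Y.vol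

/-- The trace map of `X`. -/
def tr [MeasurableSpace X] : LField X → ℂ := Y.trDef 0 0

/-- The Kodaira-Spencer action
`Tr(1/6 (φ₁ + Φ)³ - 1/2 ∂̄(Δ⁻¹Φ) ∧ Φ)` of the deformation by `(φ, ψ)`, where `γ` is the chosen
value of `Δ⁻¹Φ`. -/
def action [MeasurableSpace X] (φ ψ : MatField X) (φ₁ Φ γ : LField X) : ℂ :=
  Y.trDef φ ψ ((1 / 6 : ℂ) • wedge (wedge (φ₁ + Φ) (φ₁ + Φ)) (φ₁ + Φ)
    - (1 / 2 : ℂ) • wedge (Y.dbarDef φ ψ γ) Φ)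

/-- `γ ∈ B^{2,1}` is a value of `Δ⁻¹Φ` on the deformation by `(φ, ψ)`. -/
def IsPrimitive (φ ψ : MatField X) (Φ γ : LField X) : Prop :=
  IsB 2 1 γ ∧ FieldEq (Y.deltaDef φ ψ γ) Φ

/-- `φs 1, φs 2, …` is the perturbative solution of the Kodaira-Spencer equation with massless
mode `φs 1`: `φs 1` is harmonic, and for `n ≥ 2` the mode `φs n` lies in `ρ⁻¹(Im ∂∂̄†)` and solves
`∂̄ φ_n + 1/2 ∑_{i+j=n} [φ_i•φ_j] = 0`. The value `φs 0` plays no role. -/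
structure IsSolution (φs : ℕ → LField X) : Prop where
  mem : ∀ n, 1 ≤ n → IsB 1 1 (φs n)
  harmonic : FieldEq (Y.laplacian (φs 1)) 0
  gauge : ∀ n, 2 ≤ n → ∃ β : LField X, IsB 2 2 β ∧ FieldEq (φs n) (Y.delta (Y.opR β))
  eqn : ∀ n, 2 ≤ n →
    FieldEq (Y.dbar (φs n)
      + (1 / 2 : ℂ) • ∑ i ∈ Finset.Ico 1 n, Y.bullet (φs i) (φs (n - i))) 0

end CalabiYau

/-- `φ = ∑_{n ≥ 1} φ_n`. -/
def total (φs : ℕ → LField X) : LField X := fun c z => ∑' n : ℕ, φs (n + 1) c z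

/-- `Φ[φ₁] = ∑_{n ≥ 2} φ_n`. -/
def condensate (φs : ℕ → LField X) : LField X := fun c z => ∑' n : ℕ, φs (n + 2) c z

/-- The series `∑_{n ≥ 1} φ_n` converges to an element of `B^{1,1}`, absolutely and locally
uniformly together with the first derivatives. -/
def Converges (φs : ℕ → LField X) : Prop :=
  IsB 1 1 (total φs) ∧
  ∀ c ∈ atlas E3 X, ∀ K ⊆ c.target, IsCompact K →
    ∃ u : ℕ → ℝ, Summable u ∧ ∀ n, ∀ z ∈ K,
      ‖φs (n + 1) c z‖ ≤ u n ∧ ‖fderiv ℝ (φs (n + 1) c) z‖ ≤ u n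

/-- The analytic continuation of `φ̄`: the massless mode `φ̄₁` is replaced by `τ φ̄₁`, hence
`φ̄_n` by `τ^n φ̄_n`. -/
def conjFamily (φs : ℕ → LField X) (τ : ℂ) : MatField X := fun c z => Matrix.of fun j i =>
  ∑' n : ℕ, τ ^ (n + 1) * (starRingEnd ℂ) (comp (φs (n + 1)) c z j i)

/-- The complex conjugate `φ̄^{j̄}_i` of `φ^j_{i̅}`. -/
def conjMat (φ : MatField X) : MatField X := fun c z => (φ c z).map (starRingEnd ℂ)

/-- The parameters `τ` for which `e_i, e_{j̄}` is a frame at the point `z` of the chart `c`. -/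
def regular (φs : ℕ → LField X) (c : OpenPartialHomeomorph X E3) (z : E3) : Set ℂ :=
  {τ | (1 - comp (total φs) c z * conjFamily φs τ c z).det ≠ 0}

/-- `T τ` is analytic in `τ` on the regular part of the open unit disc, continuous on the regular
part of the closed one (which may contain `τ = 1`), and tends to `L` as `τ → 0`. -/
def IsHolomorphicLimit (P : Set ℂ) (T : ℂ → Gr) (L : Gr) : Prop :=
  AnalyticOnNhd ℂ T (P ∩ Metric.ball 0 1) ∧ ContinuousOn T (P ∩ Metric.closedBall 0 1) ∧
    Filter.Tendsto T (𝓝 0) (𝓝 L)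

end Global

end KS

end

open KS

noncomputable section

namespace KS

open scoped Matrix ComplexConjugate

set_option linter.unusedSectionVars false

open Pi (single single_eq_of_ne single_apply single_smul single_eq_same)
open Finset (univ sum_congr sum_comm sum_add_distrib smul_sum mul_sum sum_neg_distrib sum_sub_distrib
  sum_smul mem_univ sum_eq_zero sum_mul sum_ite_eq sum_ite_eq' sum_eq_single insert_erase
  erase_insert mem_insert_self orderEmbOfFin_mem sum_const_zero notMem_erase mem_erase mem_insert
  card_insert_of_notMem orderEmbOfFin_unique sum_filter)
open Matrix (transpose_mul transpose_apply one_apply mul_nonsing_inv nonsing_inv_mul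
  transpose_transpose transpose_one conjTranspose_mul det_transpose det_fromBlocks_zero₂₁
  inv_eq_left_inv conjTranspose_one transpose_neg transpose_nonsing_inv conjTranspose_apply)

local notation "Mat3" => Matrix (Fin 3) (Fin 3) ℂ
local notation "Mat6" => Matrix (Fin 6) (Fin 6) ℂ
local notation "Idx" => Finset (Fin 6)
local notation "EndGr" => Module.End ℂ Gr
local notation "PHomeo" => OpenPartialHomeomorph
local notation "SmoothOn" => ContDiffOn ℝ ∞
local notation "RDiffAt" => DifferentiableAt ℝ

theorem sum_ext {ι M : Type*} [AddCommMonoid M] {t : Finset ι} {f g : ι → M}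
    (h : ∀ i, f i = g i) : ∑ i ∈ t, f i = ∑ i ∈ t, g i :=
  sum_congr rfl fun i _ => h i

/-! ### The Grassmann algebra: multiplication and derivative operators -/

/-- The exponent of the sign `gsgn`. -/
def gexp (I J : Idx) : ℕ := ((I ×ˢ J).filter (fun p => p.2 < p.1)).card

theorem gsgn_eq (I J : Idx) : gsgn I J = (-1) ^ gexp I J := rfl

theorem gsgn_mul_self (I J : Idx) : gsgn I J * gsgn I J = 1 := by
  rw [gsgn_eq, ← mul_pow]; norm_num

theorem gsgn_union_left {I J : Idx} (K : Idx) (h : Disjoint I J) :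
    gsgn (I ∪ J) K = gsgn I K * gsgn J K := by
  rw [gsgn_eq, gsgn_eq, gsgn_eq, ← pow_add]
  congr 1
  unfold gexp
  rw [Finset.union_product, Finset.filter_union, Finset.card_union_of_disjoint]
  refine Finset.disjoint_filter_filter (Finset.disjoint_product.2 (Or.inl h))

theorem gsgn_union_right (I : Idx) {J K : Idx} (h : Disjoint J K) :
    gsgn I (J ∪ K) = gsgn I J * gsgn I K := by
  rw [gsgn_eq, gsgn_eq, gsgn_eq, ← pow_add]
  congr 1
  unfold gexp
  rw [Finset.product_union, Finset.filter_union, Finset.card_union_of_disjoint]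
  refine Finset.disjoint_filter_filter (Finset.disjoint_product.2 (Or.inr h))

theorem gsgn_singleton (k l : Fin 6) : gsgn {k} {l} = if l < k then -1 else 1 := by
  rw [gsgn_eq, gexp, Finset.singleton_product_singleton, Finset.filter_singleton]
  by_cases h : l < k <;> simp [h]

theorem gsgn_singleton_insert {k l : Fin 6} {K : Idx} (h : l ∉ K) :
    gsgn {k} (insert l K) = (if l < k then -1 else 1) * gsgn {k} K := by
  rw [Finset.insert_eq, gsgn_union_right _ (by simpa using h), gsgn_singleton]

theorem gsgn_empty_left (K : Idx) : gsgn ∅ K = 1 := by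
  simp [gsgn]

/-- The product as a bilinear map. -/
def gmulL : Gr →ₗ[ℂ] Gr →ₗ[ℂ] Gr := LinearMap.mk₂ ℂ gmul
    (fun a a' b => by
      funext K
      simp only [gmul, Pi.add_apply, ← sum_add_distrib]
      exact sum_ext fun I => by ring)
    (fun c a b => by
      funext K
      simp only [gmul, Pi.smul_apply, smul_eq_mul, mul_sum]
      exact sum_ext fun I => by ring)
    (fun a b b' => by
      funext K
      simp only [gmul, Pi.add_apply, ← sum_add_distrib]
      exact sum_ext fun I => by ring)
    (fun c a b => by
      funext K
      simp only [gmul, Pi.smul_apply, smul_eq_mul, mul_sum]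
      exact sum_ext fun I => by ring)

@[simp] theorem gmulL_apply (a b : Gr) : gmulL a b = gmul a b := rfl

theorem gmul_add_left (a a' b : Gr) : gmul (a + a') b = gmul a b + gmul a' b :=
  gmulL.map_add₂ a a' b

theorem gmul_add_right (a b b' : Gr) : gmul a (b + b') = gmul a b + gmul a b' :=
  (gmulL a).map_add b b'

theorem gmul_smul_left (c : ℂ) (a b : Gr) : gmul (c • a) b = c • gmul a b := gmulL.map_smul₂ c a b

theorem gmul_smul_right (c : ℂ) (a b : Gr) : gmul a (c • b) = c • gmul a b := (gmulL a).map_smul c b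

theorem gmul_sub_left (a a' b : Gr) : gmul (a - a') b = gmul a b - gmul a' b :=
  gmulL.map_sub₂ a a' b

theorem gmul_neg_left (a b : Gr) : gmul (-a) b = -gmul a b := gmulL.map_neg₂ a b

theorem gmul_neg_right (a b : Gr) : gmul a (-b) = -gmul a b := (gmulL a).map_neg b

theorem gmul_zero_left (b : Gr) : gmul 0 b = 0 := gmulL.map_zero₂ b

theorem gmul_zero_right (a : Gr) : gmul a 0 = 0 := (gmulL a).map_zero

theorem gmul_sum_left {ι : Type*} (s : Finset ι) (a : ι → Gr) (b : Gr) :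
    gmul (∑ i ∈ s, a i) b = ∑ i ∈ s, gmul (a i) b :=
  gmulL.map_sum₂ s a b

theorem gmul_sum_right {ι : Type*} (s : Finset ι) (a : Gr) (b : ι → Gr) :
    gmul a (∑ i ∈ s, b i) = ∑ i ∈ s, gmul a (b i) :=
  map_sum (gmulL a) b s

/-- Multiplication by the generator `ξ_k`. -/
def mg (k : Fin 6) : EndGr := gmulL (gen k)

/-- The derivative `∂/∂ξ_k` as a linear map. -/
def dg (k : Fin 6) : EndGr where
  toFun := lder k
  map_add' a b := by
    funext K
    simp only [lder, Pi.add_apply]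
    split_ifs <;> simp [mul_add]
  map_smul' c a := by
    funext K
    simp only [lder, Pi.smul_apply, smul_eq_mul, RingHom.id_apply]
    split_ifs <;> ring

theorem gmul_gen (k : Fin 6) (a : Gr) : gmul (gen k) a = mg k a := rfl

theorem lder_eq (k : Fin 6) (a : Gr) : lder k a = dg k a := rfl

theorem mg_apply (k : Fin 6) (a : Gr) (K : Idx) :
    mg k a K = if k ∈ K then gsgn {k} (K.erase k) * a (K.erase k) else 0 := by
  change ∑ I ∈ K.powerset, gsgn I (K \ I) * gen k I * a (K \ I) = _
  split_ifs with h
  · rw [sum_eq_single {k}]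
    · simp [gen, Finset.sdiff_singleton_eq_erase]
    · intro I _ hI
      simp [gen, hI]
    · intro h'
      simp [h] at h'
  · refine sum_eq_zero fun I hI => ?_
    have : I ≠ {k} := by
      rintro rfl
      exact h (by simpa using hI)
    simp [gen, this]

theorem dg_apply (k : Fin 6) (a : Gr) (K : Idx) :
    dg k a K = if k ∈ K then 0 else gsgn {k} K * a (insert k K) := rfl

theorem gsgn_singleton_erase {k l : Fin 6} {K : Idx} (h : l ∈ K) :
    gsgn {k} K = (if l < k then -1 else 1) * gsgn {k} (K.erase l) := by
  conv_lhs => rw [← insert_erase h]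
  exact gsgn_singleton_insert (notMem_erase l K)

theorem mg_mul_mg (k l : Fin 6) : mg k * mg l + mg l * mg k = 0 := by
  refine LinearMap.ext fun a => funext fun K => ?_
  simp only [LinearMap.add_apply, Module.End.mul_apply, Pi.add_apply, mg_apply,
    LinearMap.zero_apply, Pi.zero_apply, mem_erase]
  rcases eq_or_ne k l with rfl | hkl
  · simp
  by_cases hk : k ∈ K <;> by_cases hl : l ∈ K <;> simp only [hk, hl, hkl, hkl.symm, if_true,
    if_false, ne_eq, not_false_eq_true, and_true, and_false, mul_zero, add_zero]
  have h1 : l ∈ K.erase k := mem_erase.2 ⟨hkl.symm, hl⟩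
  have h2 : k ∈ K.erase l := mem_erase.2 ⟨hkl, hk⟩
  rw [gsgn_singleton_erase h1, gsgn_singleton_erase h2, Finset.erase_right_comm]
  rcases lt_or_gt_of_ne hkl with h | h <;> simp only [h, h.not_gt, if_true, if_false] <;> ring

theorem dg_mul_dg (k l : Fin 6) : dg k * dg l + dg l * dg k = 0 := by
  refine LinearMap.ext fun a => funext fun K => ?_
  simp only [LinearMap.add_apply, Module.End.mul_apply, Pi.add_apply, dg_apply,
    LinearMap.zero_apply, Pi.zero_apply, mem_insert]
  rcases eq_or_ne k l with rfl | hkl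
  · simp
  by_cases hk : k ∈ K <;> by_cases hl : l ∈ K <;> simp only [hk, hl, hkl, hkl.symm, if_true,
    if_false, or_true, or_false, mul_zero, add_zero]
  rw [gsgn_singleton_insert hk, gsgn_singleton_insert hl, Finset.insert_comm]
  rcases lt_or_gt_of_ne hkl with h | h <;> simp only [h, h.not_gt, if_true, if_false] <;> ring

theorem dg_mul_mg (k l : Fin 6) :
    dg k * mg l + mg l * dg k = if k = l then 1 else 0 := by
  refine LinearMap.ext fun a => funext fun K => ?_
  simp only [LinearMap.add_apply, Module.End.mul_apply, Pi.add_apply, dg_apply, mg_apply,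
    mem_insert, mem_erase]
  rcases eq_or_ne k l with rfl | hkl
  · by_cases hk : k ∈ K <;> simp [hk, ← mul_assoc, gsgn_mul_self]
  by_cases hk : k ∈ K <;> by_cases hl : l ∈ K <;> simp only [hk, hl, hkl, hkl.symm, if_true,
    if_false, or_true, or_false, mul_zero, add_zero, ne_eq, not_false_eq_true, and_true, true_and,
    LinearMap.zero_apply, Pi.zero_apply]
  have h2 : k ∉ K.erase l := fun h => hk (Finset.mem_of_mem_erase h)
  rw [Finset.erase_insert_of_ne hkl, gsgn_singleton_insert h2, gsgn_singleton_erase hl]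
  rcases lt_or_gt_of_ne hkl with h | h <;> simp only [h, h.not_gt, if_true, if_false] <;> ring

theorem mg_mg (k l : Fin 6) (a : Gr) : mg k (mg l a) = -mg l (mg k a) :=
  eq_neg_of_add_eq_zero_left (LinearMap.congr_fun (mg_mul_mg k l) a)

theorem dg_dg (k l : Fin 6) (a : Gr) : dg k (dg l a) = -dg l (dg k a) :=
  eq_neg_of_add_eq_zero_left (LinearMap.congr_fun (dg_mul_dg k l) a)

theorem dg_mg (k l : Fin 6) (a : Gr) :
    dg k (mg l a) = (if k = l then a else 0) - mg l (dg k a) := by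
  rw [eq_sub_iff_add_eq]
  have := LinearMap.congr_fun (dg_mul_mg k l) a
  simp only [LinearMap.add_apply, Module.End.mul_apply] at this
  rw [this]
  split_ifs <;> rfl

/-! ### Induction over products of generators -/

theorem single_eq_mg {k : Fin 6} {K : Idx} (h : ∀ x ∈ K, k < x) :
    (single (insert k K) 1 : Gr) = mg k (single K 1) := by
  have hk : k ∉ K := fun hk => lt_irrefl _ (h k hk)
  have hs : gsgn {k} K = 1 := by
    rw [gsgn_eq, gexp, Finset.filter_false_of_mem]
    · simp
    · rintro ⟨x, y⟩ hxy
      simp only [Finset.mem_product, Finset.mem_singleton] at hxy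
      obtain ⟨rfl, hy⟩ := hxy
      exact not_lt.2 (h y hy).le
  funext J
  rw [mg_apply]
  by_cases hJ : k ∈ J
  · rw [if_pos hJ]
    by_cases hJK : J.erase k = K
    · rw [hJK, hs, ← hJK, insert_erase hJ]; simp
    · rw [single_eq_of_ne hJK, single_eq_of_ne, mul_zero]
      rintro rfl
      exact hJK (erase_insert hk)
  · rw [if_neg hJ, single_eq_of_ne]
    rintro rfl
    exact hJ (mem_insert_self k K)

/-- The unit of the Grassmann algebra. -/
def gone : Gr := single ∅ 1

theorem Gr.eq_sum (a : Gr) : a = ∑ K, a K • (single K 1 : Gr) := by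
  funext J
  simp [Finset.sum_apply, single_apply]

theorem Gr.induction {p : Gr → Prop} (hadd : ∀ a b, p a → p b → p (a + b))
    (hsmul : ∀ (c : ℂ) a, p a → p (c • a)) (hone : p gone)
    (hgen : ∀ k a, p a → p (mg k a)) (a : Gr) : p a := by
  have hs : ∀ K, p (single K 1 : Gr) := by
    intro K
    induction K using Finset.induction_on_min with
    | empty => exact hone
    | insert k K hk ih => rw [single_eq_mg hk]; exact hgen k _ ih
  rw [Gr.eq_sum a]
  refine Finset.sum_induction _ p hadd ?_ fun K _ => hsmul _ _ (hs K)
  simpa using hsmul 0 _ hone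

theorem dg_gone (k : Fin 6) : dg k gone = 0 := by
  funext K
  rw [dg_apply]
  split_ifs
  · rfl
  · simp [gone]

theorem gone_gmul (a : Gr) : gmul gone a = a := by
  funext K
  change ∑ I ∈ K.powerset, gsgn I (K \ I) * gone I * a (K \ I) = _
  rw [sum_eq_single ∅]
  · simp [gone, gsgn_empty_left]
  · intro I _ hI
    simp [gone, hI]
  · simp

theorem mg_gmul (k : Fin 6) (a b : Gr) : gmul (mg k a) b = mg k (gmul a b) := by
  funext K
  rw [mg_apply]
  change ∑ I ∈ K.powerset, gsgn I (K \ I) * mg k a I * b (K \ I) = _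
  split_ifs with h
  · conv_lhs => rw [← insert_erase h]
    have hk : k ∉ K.erase k := notMem_erase k K
    rw [Finset.sum_powerset_insert hk, sum_eq_zero, zero_add]
    · change _ = gsgn {k} (K.erase k) *
        ∑ I ∈ (K.erase k).powerset, gsgn I (K.erase k \ I) * a I * b (K.erase k \ I)
      rw [mul_sum]
      refine sum_congr rfl fun I hI => ?_
      have hIK : I ⊆ K.erase k := Finset.mem_powerset.1 hI
      have hkI : k ∉ I := fun h' => hk (hIK h')
      have h1 : insert k (K.erase k) \ insert k I = K.erase k \ I := by
        rw [Finset.insert_sdiff_insert, Finset.sdiff_insert_of_notMem hk]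
      have h2 : gsgn {k} (K.erase k) = gsgn {k} I * gsgn {k} (K.erase k \ I) := by
        rw [← gsgn_union_right _ Finset.disjoint_sdiff, Finset.union_sdiff_of_subset hIK]
      rw [h1, mg_apply, if_pos (mem_insert_self k I), erase_insert hkI,
        Finset.insert_eq, gsgn_union_left _ (by simpa using hkI), h2]
      ring
    · intro I hI
      have hkI : k ∉ I := fun h' => hk (Finset.mem_powerset.1 hI h')
      rw [mg_apply, if_neg hkI]
      ring
  · refine sum_eq_zero fun I hI => ?_
    have hkI : k ∉ I := fun h' => h (Finset.mem_powerset.1 hI h')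
    rw [mg_apply, if_neg hkI]
    ring

theorem gmul_assoc (a b c : Gr) : gmul (gmul a b) c = gmul a (gmul b c) := by
  induction a using Gr.induction with
  | hadd a a' ha hb => simp [gmul_add_left, ha, hb]
  | hsmul r a ha => simp [gmul_smul_left, ha]
  | hone => simp [gone_gmul]
  | hgen k a h => simp [mg_gmul, h]

/-- The parity involution as a linear map. -/
def par : EndGr where
  toFun := parity
  map_add' a b := by funext K; simp [parity, mul_add]
  map_smul' c a := by funext K; simp [parity]; ring

theorem par_apply (a : Gr) (K : Idx) : par a K = (-1) ^ K.card * a K := rfl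

theorem par_mg (k : Fin 6) (a : Gr) : par (mg k a) = -mg k (par a) := by
  funext K
  simp only [par_apply, mg_apply, Pi.neg_apply]
  split_ifs with h
  · rw [← Finset.card_erase_add_one h, pow_succ]; ring
  · simp

theorem par_dg (k : Fin 6) (a : Gr) : par (dg k a) = -dg k (par a) := by
  funext K
  simp only [par_apply, dg_apply, Pi.neg_apply]
  split_ifs with h
  · simp
  · rw [card_insert_of_notMem h, pow_succ]; ring

theorem par_gone : par gone = gone := by
  funext K
  rw [par_apply]
  by_cases h : K = ∅
  · simp [h]
  · simp [gone, h]

theorem par_par (a : Gr) : par (par a) = a := by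
  funext K
  rw [par_apply, par_apply, ← mul_assoc, ← mul_pow]; norm_num

theorem par_gmul (a b : Gr) : par (gmul a b) = gmul (par a) (par b) := by
  induction a using Gr.induction with
  | hadd a a' ha hb => simp [gmul_add_left, ha, hb]
  | hsmul r a ha => simp [gmul_smul_left, ha]
  | hone => simp [gone_gmul, par_gone]
  | hgen k a h => simp [mg_gmul, h, par_mg, gmul_neg_left]

theorem gmul_mg (k : Fin 6) (a b : Gr) : gmul a (mg k b) = mg k (gmul (par a) b) := by
  induction a using Gr.induction with
  | hadd a a' ha hb => simp [gmul_add_left, ha, hb]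
  | hsmul r a ha => simp [gmul_smul_left, ha]
  | hone => simp [gone_gmul, par_gone]
  | hgen l a h => rw [mg_gmul, h, mg_mg, par_mg, gmul_neg_left, mg_gmul, map_neg]

theorem gmul_gone (a : Gr) : gmul a gone = a := by
  induction a using Gr.induction with
  | hadd a a' ha hb => simp [gmul_add_left, ha, hb]
  | hsmul r a ha => simp [gmul_smul_left, ha]
  | hone => exact gone_gmul _
  | hgen l a h => rw [mg_gmul, h]

theorem dg_gmul (k : Fin 6) (a b : Gr) :
    dg k (gmul a b) = gmul (dg k a) b + gmul (par a) (dg k b) := by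
  induction a using Gr.induction with
  | hadd a a' ha hb => simp only [gmul_add_left, map_add, ha, hb]; abel
  | hsmul r a ha => simp [gmul_smul_left, ha]
  | hone => simp [gone_gmul, par_gone, dg_gone, gmul_zero_left]
  | hgen l a h =>
    rw [mg_gmul, dg_mg, h, dg_mg, par_mg, gmul_neg_left, mg_gmul, gmul_sub_left, mg_gmul, map_add]
    split_ifs
    · abel
    · rw [gmul_zero_left]; abel

/-- An even element commutes with everything. -/
theorem gmul_comm_of_even {a : Gr} (h : par a = a) (b : Gr) : gmul a b = gmul b a := by
  induction b using Gr.induction with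
  | hadd b b' hb hb' => simp [gmul_add_left, gmul_add_right, hb, hb']
  | hsmul r b hb => simp [gmul_smul_left, gmul_smul_right, hb]
  | hone => rw [gone_gmul, gmul_gone]
  | hgen k b hb => rw [gmul_mg, h, hb, mg_gmul]

/-! ### Substitutions -/

/-- The derivation with `ξ_a ↦ ∑_b A b a ξ_b`. -/
def der (A : Mat6) : EndGr := ∑ b, ∑ a, A b a • (mg b * dg a)

theorem der_apply (A : Mat6) (x : Gr) :
    der A x = ∑ b, ∑ a, A b a • mg b (dg a x) := by
  simp [der, LinearMap.sum_apply]

theorem der_gone (A : Mat6) : der A gone = 0 := by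
  simp [der_apply, dg_gone]

theorem der_mg (A : Mat6) (k : Fin 6) (x : Gr) :
    der A (mg k x) = ∑ b, A b k • mg b x + mg k (der A x) := by
  simp only [der_apply, dg_mg, map_sum, map_smul, map_sub, smul_sub, sum_sub_distrib, apply_ite (mg
    _), map_zero, smul_ite, smul_zero, sum_ite_eq', mem_univ, if_true]
  rw [sub_eq_add_neg]
  congr 1
  rw [← sum_neg_distrib]
  refine sum_ext fun b => ?_
  rw [← sum_neg_distrib]
  refine sum_ext fun a => ?_
  rw [mg_mg b k, smul_neg, neg_neg]

/-- The substitution `gsubst M` as a linear map. -/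
def gs (M : Mat6) : EndGr where
  toFun := gsubst M
  map_add' a b := by
    funext K
    simp only [gsubst, Pi.add_apply, ← sum_add_distrib]
    refine sum_ext fun I => ?_
    split_ifs
    · ring
    · simp
  map_smul' c a := by
    funext K
    simp only [gsubst, Pi.smul_apply, smul_eq_mul, RingHom.id_apply, mul_sum]
    refine sum_ext fun I => ?_
    split_ifs
    · ring
    · simp

theorem gsubst_eq (M : Mat6) (a : Gr) : gsubst M a = gs M a := rfl

theorem gs_single_of_card (M : Mat6) {I K : Idx}
    {n : ℕ} (hI : I.card = n) (hK : K.card = n) :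
    gs M (single I 1) K
      = (M.submatrix (K.orderEmbOfFin hK) (I.orderEmbOfFin hI)).det := by
  subst hK
  change ∑ J : Idx, (if h : J.card = K.card then
      (M.submatrix (K.orderEmbOfFin rfl) (J.orderEmbOfFin h)).det * (single I 1 : Gr) J
    else 0) = _
  rw [sum_eq_single I]
  · rw [dif_pos hI]; simp
  · intro J _ hJ
    split_ifs <;> simp [hJ]
  · simp

theorem gs_single_of_card_ne (M : Mat6) {I K : Idx}
    (h : I.card ≠ K.card) : gs M (single I 1) K = 0 := by
  change ∑ J : Idx, (if h : J.card = K.card then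
      (M.submatrix (K.orderEmbOfFin rfl) (J.orderEmbOfFin h)).det * (single I 1 : Gr) J
    else 0) = _
  refine sum_eq_zero fun J _ => ?_
  by_cases hJ : J = I
  · subst hJ; rw [dif_neg h]
  · split_ifs <;> simp [hJ]

theorem gs_gone (M : Mat6) : gs M gone = gone := by
  funext K
  by_cases h : K = ∅
  · subst h
    rw [gone, gs_single_of_card M (n := 0) rfl rfl]
    simp
  · rw [gone, gs_single_of_card_ne, single_eq_of_ne h]
    rw [Finset.card_empty, ne_eq, eq_comm, Finset.card_eq_zero]
    exact h

theorem gsgn_orderEmb {K : Idx} {n : ℕ} (hK : K.card = n + 1) (i : Fin (n + 1)) :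
    gsgn {K.orderEmbOfFin hK i} (K.erase (K.orderEmbOfFin hK i)) = (-1) ^ (i : ℕ) := by
  rw [gsgn_eq]
  congr 1
  set f := K.orderEmbOfFin hK
  have : ({f i} ×ˢ K.erase (f i)).filter (fun p => p.2 < p.1)
      = ((univ.filter (· < i)).image fun j => (f i, f j)) := by
    ext ⟨x, y⟩
    simp only [Finset.mem_filter, Finset.mem_product, Finset.mem_singleton, mem_erase,
      Finset.mem_image, mem_univ, true_and, Prod.mk.injEq]
    constructor
    · rintro ⟨⟨rfl, _, hy⟩, hlt⟩
      have : y ∈ Set.range f := by rw [Finset.range_orderEmbOfFin]; exact hy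
      obtain ⟨j, rfl⟩ := this
      exact ⟨j, f.lt_iff_lt.1 hlt, rfl, rfl⟩
    · rintro ⟨j, hj, rfl, rfl⟩
      have := f.lt_iff_lt.2 hj
      exact ⟨⟨rfl, this.ne, orderEmbOfFin_mem K hK j⟩, this⟩
  rw [gexp, this, Finset.card_image_of_injective]
  · rw [show univ.filter (· < i) = Finset.Iio i by ext; simp, Fin.card_Iio]
  · intro a b hab
    simpa using hab

theorem orderEmbOfFin_erase {K : Idx} {n : ℕ} (hK : K.card = n + 1) (i : Fin (n + 1))
    (h : (K.erase (K.orderEmbOfFin hK i)).card = n) (j : Fin n) :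
    (K.erase (K.orderEmbOfFin hK i)).orderEmbOfFin h j = K.orderEmbOfFin hK (i.succAbove j) := by
  have := orderEmbOfFin_unique (s := K.erase (K.orderEmbOfFin hK i)) h
    (f := fun j => K.orderEmbOfFin hK (i.succAbove j)) (fun j => by
      rw [mem_erase]
      exact ⟨fun hh => Fin.succAbove_ne i j ((K.orderEmbOfFin hK).injective hh),
        orderEmbOfFin_mem _ _ _⟩)
    ((K.orderEmbOfFin hK).strictMono.comp (Fin.strictMono_succAbove i))
  exact (congrFun this j).symm

theorem orderEmbOfFin_insert_min {k : Fin 6} {I : Idx} {n : ℕ} (hk : ∀ x ∈ I, k < x)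
    (hI : I.card = n) (h : (insert k I).card = n + 1) :
    ((insert k I).orderEmbOfFin h : Fin (n + 1) → Fin 6)
      = Fin.cons k (I.orderEmbOfFin hI) := by
  refine (orderEmbOfFin_unique h (fun j => ?_) ?_).symm
  · refine Fin.cases ?_ (fun j => ?_) j
    · simp
    · simp only [Fin.cons_succ, mem_insert]
      exact Or.inr (orderEmbOfFin_mem _ _ _)
  · rw [Fin.strictMono_iff_lt_succ]
    intro i
    rcases n with _ | n
    · exact i.elim0
    · refine Fin.cases ?_ (fun j => ?_) i
      · rw [Fin.castSucc_zero, Fin.cons_zero, Fin.cons_succ]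
        exact hk _ (orderEmbOfFin_mem _ _ _)
      · rw [← Fin.succ_castSucc, Fin.cons_succ, Fin.cons_succ]
        exact (I.orderEmbOfFin hI).strictMono Fin.castSucc_lt_succ

theorem gs_single_insert (M : Mat6) {k : Fin 6} {I : Idx}
    (hk : ∀ x ∈ I, k < x) :
    gs M (single (insert k I) 1) = ∑ b, M b k • mg b (gs M (single I 1)) := by
  have hkI : k ∉ I := fun h => lt_irrefl _ (hk k h)
  have hc : (insert k I).card = I.card + 1 := card_insert_of_notMem hkI
  funext K
  simp only [Finset.sum_apply, Pi.smul_apply, smul_eq_mul, mg_apply]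
  by_cases hK : K.card = I.card + 1
  · rw [gs_single_of_card M hc hK, Matrix.det_succ_column_zero]
    simp only [mul_ite, mul_zero, ← sum_filter, Finset.filter_mem_eq_inter, Finset.univ_inter]
    have himg : K = Finset.univ.image (K.orderEmbOfFin hK) := by
      rw [← Finset.coe_inj, Finset.coe_image, Finset.coe_univ, Set.image_univ,
        Finset.range_orderEmbOfFin]
    conv_rhs => rw [himg, Finset.sum_image fun a _ b _ h => (K.orderEmbOfFin hK).injective h]
    refine sum_ext fun i => ?_
    rw [← himg]
    have hce : (K.erase (K.orderEmbOfFin hK i)).card = I.card := by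
      rw [Finset.card_erase_of_mem (orderEmbOfFin_mem _ _ _), hK]; rfl
    rw [gsgn_orderEmb hK i, gs_single_of_card M rfl hce]
    simp only [Matrix.submatrix_apply, orderEmbOfFin_insert_min hk rfl hc, Fin.cons_zero]
    have : ((M.submatrix (K.orderEmbOfFin hK)
          (Fin.cons k (I.orderEmbOfFin rfl) : Fin (I.card + 1) → Fin 6)).submatrix
          i.succAbove Fin.succ)
        = M.submatrix ((K.erase (K.orderEmbOfFin hK i)).orderEmbOfFin hce)
          (I.orderEmbOfFin rfl) := by
      ext a b
      simp [orderEmbOfFin_erase hK i hce]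
    rw [this]
    ring
  · rw [gs_single_of_card_ne M (by rw [hc]; exact fun h => hK h.symm)]
    refine (sum_eq_zero fun b _ => ?_).symm
    split_ifs with hb
    · rw [gs_single_of_card_ne, mul_zero, mul_zero]
      rw [Finset.card_erase_of_mem hb]
      intro h
      have := Finset.card_pos.2 ⟨b, hb⟩
      omega
    · rw [mul_zero]

theorem mgsum_mgsum (u v : Fin 6 → ℂ) (x : Gr) :
    ∑ b, u b • mg b (∑ c, v c • mg c x) = -∑ c, v c • mg c (∑ b, u b • mg b x) := by
  simp only [map_sum, map_smul, smul_sum]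
  rw [sum_comm, ← sum_neg_distrib]
  refine sum_ext fun c => ?_
  rw [← sum_neg_distrib]
  refine sum_ext fun b => ?_
  rw [mg_mg b c, smul_neg, smul_neg, smul_comm]

theorem mgsum_mgsum_self (u : Fin 6 → ℂ) (x : Gr) : ∑ b, u b • mg b (∑ c, u c • mg c x) = 0 :=
  self_eq_neg.1 (mgsum_mgsum u u x)

theorem mg_single (k : Fin 6) (I : Idx) :
    mg k (single I 1) = if k ∈ I then 0 else gsgn {k} I • (single (insert k I) 1 : Gr) := by
  funext K
  rw [mg_apply]
  by_cases hk : k ∈ I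
  · rw [if_pos hk]
    split_ifs with h
    · rw [single_eq_of_ne, mul_zero]; · rfl
      rintro rfl
      simp at hk
    · rfl
  · rw [if_neg hk]
    by_cases hK : K = insert k I
    · subst hK
      simp [hk]
    · rw [Pi.smul_apply, single_eq_of_ne hK, smul_zero]
      split_ifs with h
      · rw [single_eq_of_ne, mul_zero]
        rintro rfl
        exact hK (insert_erase h).symm
      · rfl

theorem gs_mg_single (M : Mat6) (I : Idx) :
    ∀ k, gs M (mg k (single I 1)) = ∑ b, M b k • mg b (gs M (single I 1)) := by
  induction I using Finset.induction_on_min with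
  | empty =>
    intro k
    rw [← single_eq_mg (by simp), gs_single_insert M (by simp)]
  | insert i I hi ih =>
    intro k
    rcases lt_trichotomy k i with h | rfl | h
    · have hk : ∀ x ∈ insert i I, k < x := by
        intro x hx
        rcases mem_insert.1 hx with rfl | hx
        · exact h
        · exact h.trans (hi x hx)
      rw [← single_eq_mg hk, gs_single_insert M hk]
    · rw [gs_single_insert M hi, mgsum_mgsum_self, mg_single, if_pos (mem_insert_self _ _),
        map_zero]
    · have key : ∀ y : Gr, (y = 0 ∨ ∃ c : ℂ, ∃ J : Idx, (∀ x ∈ J, i < x) ∧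
          y = c • (single J 1 : Gr)) → gs M (mg i y) = ∑ b, M b i • mg b (gs M y) := by
        rintro y (rfl | ⟨c, J, hJ, rfl⟩)
        · simp
        · rw [map_smul, ← single_eq_mg hJ, map_smul, gs_single_insert M hJ]
          simp only [map_smul, smul_sum]
          exact sum_ext fun b => smul_comm _ _ _
      rw [single_eq_mg hi, mg_mg k i, map_neg, key, ih k, key _ (Or.inr ⟨1, I, hi, by simp⟩),
        ← mgsum_mgsum]
      rw [mg_single]
      split_ifs with hkI
      · exact Or.inl rfl
      · refine Or.inr ⟨_, insert k I, ?_, rfl⟩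
        intro x hx
        rcases mem_insert.1 hx with rfl | hx
        · exact h
        · exact hi x hx

theorem gs_mg (M : Mat6) (k : Fin 6) (a : Gr) :
    gs M (mg k a) = ∑ b, M b k • mg b (gs M a) := by
  conv_lhs => rw [Gr.eq_sum a]
  conv_rhs => rw [Gr.eq_sum a]
  simp only [map_sum, map_smul, smul_sum, gs_mg_single]
  rw [sum_comm]
  exact sum_ext fun b => sum_ext fun K => smul_comm _ _ _

theorem gs_gmul (M : Mat6) (a b : Gr) :
    gs M (gmul a b) = gmul (gs M a) (gs M b) := by
  induction a using Gr.induction with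
  | hadd a a' ha hb => simp [gmul_add_left, ha, hb]
  | hsmul r a ha => simp [gmul_smul_left, ha]
  | hone => simp [gone_gmul, gs_gone]
  | hgen k a h => simp [mg_gmul, gs_mg, h, gmul_sum_left, gmul_smul_left]

theorem gs_mul (A B : Mat6) (a : Gr) : gs (A * B) a = gs A (gs B a) := by
  induction a using Gr.induction with
  | hadd a a' ha hb => simp [ha, hb]
  | hsmul r a ha => simp [ha]
  | hone => simp [gs_gone]
  | hgen k a h =>
    simp only [gs_mg, h, map_sum, map_smul, smul_sum, Matrix.mul_apply, sum_smul, smul_smul]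
    rw [sum_comm]
    exact sum_ext fun b => sum_ext fun c => by rw [mul_comm]

theorem gs_one (a : Gr) : gs 1 a = a := by
  induction a using Gr.induction with
  | hadd a a' ha hb => simp [ha, hb]
  | hsmul r a ha => simp [ha]
  | hone => simp [gs_gone]
  | hgen k a h => simp [gs_mg, h, one_apply, ite_smul]

theorem dg_gs (M : Mat6) (k : Fin 6) (a : Gr) :
    dg k (gs M a) = ∑ b, M k b • gs M (dg b a) := by
  induction a using Gr.induction with
  | hadd a a' ha hb => simp [ha, hb, sum_add_distrib]
  | hsmul r a ha =>
    simp only [map_smul, ha, smul_sum]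
    exact sum_ext fun b => smul_comm _ _ _
  | hone => simp [gs_gone, dg_gone]
  | hgen l a h =>
    simp only [gs_mg, map_sum, map_smul, dg_mg, h, smul_sub, map_sub, sum_sub_distrib, smul_sum,
      smul_ite, smul_zero, apply_ite (gs M), map_zero]
    rw [sum_comm]
    simp only [sum_ite_eq, sum_ite_eq', mem_univ, if_true]
    congr 1
    exact sum_ext fun b => sum_ext fun c => smul_comm _ _ _

theorem par_gs (M : Mat6) (a : Gr) : par (gs M a) = gs M (par a) := by
  induction a using Gr.induction with
  | hadd a a' ha hb => simp [ha, hb]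
  | hsmul r a ha => simp [ha]
  | hone => simp [gs_gone, par_gone]
  | hgen k a h => simp [gs_mg, h, par_mg, map_sum]

theorem gs_neg_one (a : Gr) : gs (-1) a = par a := by
  induction a using Gr.induction with
  | hadd a a' ha hb => simp [ha, hb]
  | hsmul r a ha => simp [ha]
  | hone => simp [gs_gone, par_gone]
  | hgen k a h => simp [gs_mg, h, par_mg, one_apply, ite_smul]

theorem gs_univ (M : Mat6) (a : Gr) :
    gs M a univ = M.det * a univ := by
  have h6 : (univ : Idx).card = 6 := by simp
  conv_lhs => rw [Gr.eq_sum a]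
  simp only [map_sum, map_smul, Finset.sum_apply, Pi.smul_apply, smul_eq_mul]
  rw [sum_eq_single univ]
  · rw [gs_single_of_card M h6 h6]
    have : ((univ : Idx).orderEmbOfFin h6 : Fin 6 → Fin 6) = id :=
      (orderEmbOfFin_unique h6 (fun _ => mem_univ _) strictMono_id).symm
    rw [this]
    simp [mul_comm]
  · intro I _ hI
    rw [gs_single_of_card_ne, mul_zero]
    intro h
    exact hI ((Finset.card_eq_iff_eq_univ I).1 (h.trans (by simp)))
  · simp

/-! ### Contraction with the three-form -/

theorem th_ne_et (i j : Fin 3) : th i ≠ et j := by revert i j; decide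

theorem et_ne_th (i j : Fin 3) : et i ≠ th j := by revert i j; decide

theorem th_inj (i j : Fin 3) : th i = th j ↔ i = j := by revert i j; decide

theorem et_inj (i j : Fin 3) : et i = et j ↔ i = j := by revert i j; decide

theorem sum_six {M : Type*} [AddCommMonoid M] (f : Fin 6 → M) :
    ∑ k, f k = ∑ i, f (th i) + ∑ j, f (et j) :=
  Fin.sum_univ_add (a := 3) (b := 3) f

theorem six_cases {p : Fin 6 → Prop} (hth : ∀ i, p (th i)) (het : ∀ j, p (et j)) (k : Fin 6) :
    p k :=
  Fin.addCases (m := 3) (n := 3) (motive := p) hth het k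

/-- The exponent of the sign `rsgn`. -/
def rexp (K : Idx) : ℕ := Nat.choose (thDeg K) 2 + gexp (K ∩ thAll) (thAll \ K)

theorem rsgn_eq (K : Idx) : rsgn K = (-1) ^ rexp K := by
  rw [rsgn, gsgn_eq, rexp, pow_add]

theorem rsgn_mul_self (K : Idx) : rsgn K * rsgn K = 1 := by
  rw [rsgn_eq, ← mul_pow]; norm_num

set_option maxRecDepth 100000 in
theorem flip_flip : ∀ K : Idx, flip (flip K) = K := by decide +kernel

set_option maxRecDepth 100000 in
theorem flip_insert_th : ∀ i : Fin 3, ∀ K : Idx, th i ∉ K →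
    flip (insert (th i) K) = (flip K).erase (th i) := by decide +kernel

set_option maxRecDepth 100000 in
theorem th_mem_flip : ∀ i : Fin 3, ∀ K : Idx, th i ∈ flip K ↔ th i ∉ K := by
  decide +kernel

set_option maxRecDepth 100000 in
theorem et_mem_flip : ∀ i : Fin 3, ∀ K : Idx, et i ∈ flip K ↔ et i ∈ K := by
  decide +kernel

set_option maxRecDepth 100000 in
theorem flip_erase_et : ∀ i : Fin 3, ∀ K : Idx,
    flip (K.erase (et i)) = (flip K).erase (et i) := by decide +kernel

set_option maxRecDepth 100000 in
theorem rexp_th : ∀ i : Fin 3, ∀ K : Idx, th i ∉ K →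
    (rexp (flip K) + gexp {th i} ((flip K).erase (th i))) % 2
      = (gexp {th i} K + rexp (flip (insert (th i) K))) % 2 := by
  decide +kernel

set_option maxRecDepth 100000 in
theorem rexp_et : ∀ i : Fin 3, ∀ K : Idx, et i ∈ K →
    (rexp (flip K) + gexp {et i} ((flip K).erase (et i))) % 2
      = (1 + (gexp {et i} (K.erase (et i)) + rexp (flip (K.erase (et i))))) % 2 := by
  decide +kernel

theorem neg_one_pow_congr {m n : ℕ} (h : m % 2 = n % 2) : (-1 : ℂ) ^ m = (-1) ^ n := by
  rw [neg_one_pow_eq_pow_mod_two, h, ← neg_one_pow_eq_pow_mod_two]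

/-- The map `ρ` for `Ω = ξ_1 ξ_2 ξ_3`. -/
def rh : EndGr where
  toFun a := fun K => rsgn (flip K) * a (flip K)
  map_add' a b := by funext K; simp [mul_add]
  map_smul' c a := by funext K; simp only [Pi.smul_apply, smul_eq_mul, RingHom.id_apply]; ring

/-- The inverse of `rh`. -/
def rhi : EndGr where
  toFun b := fun K => rsgn K * b (flip K)
  map_add' a b := by funext K; simp [mul_add]
  map_smul' c a := by funext K; simp only [Pi.smul_apply, smul_eq_mul, RingHom.id_apply]; ring

theorem rh_apply (a : Gr) (K : Idx) : rh a K = rsgn (flip K) * a (flip K) := rfl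

theorem rhi_apply (a : Gr) (K : Idx) : rhi a K = rsgn K * a (flip K) := rfl

theorem rhi_rh (a : Gr) : rhi (rh a) = a := by
  funext K
  rw [rhi_apply, rh_apply, flip_flip, ← mul_assoc, rsgn_mul_self, one_mul]

theorem rh_rhi (a : Gr) : rh (rhi a) = a := by
  funext K
  rw [rh_apply, rhi_apply, flip_flip, ← mul_assoc, rsgn_mul_self, one_mul]

theorem rh_mg_th (i : Fin 3) (a : Gr) : rh (mg (th i) a) = dg (th i) (rh a) := by
  funext K
  rw [rh_apply, dg_apply, mg_apply, rh_apply]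
  by_cases h : th i ∈ K
  · rw [if_neg (by simpa [th_mem_flip] using h), if_pos h, mul_zero]
  · rw [if_pos ((th_mem_flip i K).2 h), if_neg h, ← mul_assoc, ← mul_assoc, ← flip_insert_th i K h,
      rsgn_eq, rsgn_eq, gsgn_eq, gsgn_eq, ← pow_add, ← pow_add, flip_insert_th i K h,
      neg_one_pow_congr (rexp_th i K h), flip_insert_th i K h]

theorem rh_mg_et (i : Fin 3) (a : Gr) : rh (mg (et i) a) = -mg (et i) (rh a) := by
  funext K
  rw [rh_apply, Pi.neg_apply, mg_apply, mg_apply, rh_apply]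
  by_cases h : et i ∈ K
  · rw [if_pos ((et_mem_flip i K).2 h), if_pos h, ← mul_assoc, ← mul_assoc, rsgn_eq, rsgn_eq,
      gsgn_eq, gsgn_eq, ← pow_add, ← pow_add, neg_one_pow_congr (rexp_et i K h), flip_erase_et,
      pow_add _ 1]
    ring
  · rw [if_neg (by simpa [et_mem_flip] using h), if_neg h, mul_zero, neg_zero]

theorem rhi_mg_et (i : Fin 3) (a : Gr) : rhi (mg (et i) a) = -mg (et i) (rhi a) := by
  rw [← rhi_rh (mg (et i) (rhi a)), rh_mg_et, rh_rhi, map_neg, neg_neg]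

set_option maxRecDepth 100000 in
theorem rexp_th' : ∀ i : Fin 3, ∀ K : Idx, th i ∉ K →
    (rexp K + gexp {th i} ((flip K).erase (th i))) % 2
      = (gexp {th i} K + rexp (insert (th i) K)) % 2 := by
  decide +kernel

set_option maxRecDepth 100000 in
theorem rexp_et' : ∀ i : Fin 3, ∀ K : Idx, et i ∉ K →
    flip (insert (et i) K) = insert (et i) (flip K) ∧
    (rexp K + gexp {et i} (flip K)) % 2
      = (1 + (gexp {et i} K + rexp (insert (et i) K))) % 2 := by
  decide +kernel

theorem rhi_mg_th (i : Fin 3) (a : Gr) : rhi (mg (th i) a) = dg (th i) (rhi a) := by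
  funext K
  rw [rhi_apply, dg_apply, mg_apply, rhi_apply]
  by_cases h : th i ∈ K
  · rw [if_neg (by simpa [th_mem_flip] using h), if_pos h, mul_zero]
  · rw [if_pos ((th_mem_flip i K).2 h), if_neg h, ← mul_assoc, ← mul_assoc, rsgn_eq, rsgn_eq,
      gsgn_eq, gsgn_eq, ← pow_add, ← pow_add, neg_one_pow_congr (rexp_th' i K h), flip_insert_th i K
      h]

theorem rhi_dg_et (i : Fin 3) (a : Gr) : rhi (dg (et i) a) = -dg (et i) (rhi a) := by
  funext K
  rw [rhi_apply, Pi.neg_apply, dg_apply, dg_apply, rhi_apply]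
  by_cases h : et i ∈ K
  · rw [if_pos ((et_mem_flip i K).2 h), if_pos h, mul_zero, neg_zero]
  · rw [if_neg (by simpa [et_mem_flip] using h), if_neg h, (rexp_et' i K h).1, ← mul_assoc,
      ← mul_assoc, rsgn_eq, rsgn_eq, gsgn_eq, gsgn_eq, ← pow_add, ← pow_add,
      neg_one_pow_congr (rexp_et' i K h).2, pow_add _ 1]
    ring

theorem rh_dg_th (i : Fin 3) (a : Gr) : rh (dg (th i) a) = mg (th i) (rh a) := by
  rw [← rh_rhi (mg (th i) (rh a)), rhi_mg_th, rhi_rh]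

theorem rh_dg_et (i : Fin 3) (a : Gr) : rh (dg (et i) a) = -dg (et i) (rh a) := by
  rw [← rh_rhi (dg (et i) (rh a)), rhi_dg_et, rhi_rh, map_neg, neg_neg]

/-! ### Bidegrees -/

/-- The projection to bidegree `(p, q)` as a linear map. -/
def pr (p q : ℕ) : EndGr where
  toFun := proj p q
  map_add' a b := by
    funext K
    simp only [proj, Pi.add_apply]
    split_ifs <;> simp
  map_smul' c a := by
    funext K
    simp only [proj, Pi.smul_apply, RingHom.id_apply]
    split_ifs <;> simp

theorem proj_eq (p q : ℕ) (a : Gr) : proj p q a = pr p q a := rfl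

theorem pr_apply (p q : ℕ) (a : Gr) (K : Idx) :
    pr p q a K = if thDeg K = p ∧ etDeg K = q then a K else 0 := rfl

set_option maxRecDepth 100000 in
theorem deg_lt : ∀ K : Idx, thDeg K < 4 ∧ etDeg K < 4 := by decide +kernel

theorem sum_pr (a : Gr) : ∑ p ∈ Finset.range 4, ∑ q ∈ Finset.range 4, pr p q a = a := by
  funext K
  simp only [Finset.sum_apply, pr_apply]
  obtain ⟨h1, h2⟩ := deg_lt K
  rw [Finset.sum_eq_single_of_mem _ (Finset.mem_range.2 h1), Finset.sum_eq_single_of_mem _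
    (Finset.mem_range.2 h2)]
  · simp
  · intro q _ hq
    rw [if_neg fun h => hq h.2.symm]
  · intro p _ hp
    exact sum_eq_zero fun q _ => if_neg fun h => hp h.1.symm

/-- `T` maps elements of bidegree `(p, q)` to elements of bidegree `(p + r, q + s)`. -/
def HasBideg (T : EndGr) (r s : ℤ) : Prop :=
  ∀ p q p' q' : ℕ, ((p' : ℤ) ≠ p + r ∨ (q' : ℤ) ≠ q + s) → ∀ a, pr p' q' (T (pr p q a)) = 0

theorem HasBideg.mul {T T' : EndGr} {r s r' s' : ℤ} (h : HasBideg T r s)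
    (h' : HasBideg T' r' s') : HasBideg (T * T') (r + r') (s + s') := by
  intro p q p' q' hne a
  rw [Module.End.mul_apply, ← sum_pr (T' (pr p q a))]
  simp only [map_sum]
  refine sum_eq_zero fun p'' _ => sum_eq_zero fun q'' _ => ?_
  by_cases h1 : (p'' : ℤ) ≠ p + r' ∨ (q'' : ℤ) ≠ q + s'
  · rw [h' p q p'' q'' h1, map_zero, map_zero]
  · refine h p'' q'' p' q' ?_ _
    rcases hne with h2 | h2
    · left; omega
    · right; omega

set_option maxRecDepth 100000 in
theorem deg_erase_th : ∀ i : Fin 3, ∀ K : Idx, th i ∈ K →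
    thDeg (K.erase (th i)) + 1 = thDeg K ∧ etDeg (K.erase (th i)) = etDeg K := by
  decide +kernel

set_option maxRecDepth 100000 in
theorem deg_erase_et : ∀ i : Fin 3, ∀ K : Idx, et i ∈ K →
    etDeg (K.erase (et i)) + 1 = etDeg K ∧ thDeg (K.erase (et i)) = thDeg K := by
  decide +kernel

theorem hasBideg_mg_th (i : Fin 3) : HasBideg (mg (th i)) 1 0 := by
  intro p q p' q' h a
  funext K
  rw [pr_apply, mg_apply, pr_apply]
  split_ifs with h1 h2 h3
  · have := deg_erase_th i K h2
    omega
  · rw [mul_zero]; rfl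
  · rfl
  · rfl

theorem hasBideg_mg_et (i : Fin 3) : HasBideg (mg (et i)) 0 1 := by
  intro p q p' q' h a
  funext K
  rw [pr_apply, mg_apply, pr_apply]
  split_ifs with h1 h2 h3
  · have := deg_erase_et i K h2
    omega
  · rw [mul_zero]; rfl
  · rfl
  · rfl

theorem hasBideg_dg_th (i : Fin 3) : HasBideg (dg (th i)) (-1) 0 := by
  intro p q p' q' h a
  funext K
  rw [pr_apply, dg_apply, pr_apply]
  split_ifs with h1 h2 h3
  · rfl
  · have := deg_erase_th i _ (mem_insert_self (th i) K)
    rw [erase_insert h2] at this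
    omega
  · rw [mul_zero]; rfl
  · rfl

theorem hasBideg_dg_et (i : Fin 3) : HasBideg (dg (et i)) 0 (-1) := by
  intro p q p' q' h a
  funext K
  rw [pr_apply, dg_apply, pr_apply]
  split_ifs with h1 h2 h3
  · rfl
  · have := deg_erase_et i _ (mem_insert_self (et i) K)
    rw [erase_insert h2] at this
    omega
  · rw [mul_zero]; rfl
  · rfl

/-- The component of bidegree `(r, s)` of a linear map. -/
def bicomp (r s : ℕ) : EndGr →ₗ[ℂ] EndGr where
  toFun T := ∑ p ∈ Finset.range 4, ∑ q ∈ Finset.range 4, pr (p + r) (q + s) * T * pr p q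
  map_add' T T' := by
    simp [mul_add, add_mul, sum_add_distrib]
  map_smul' c T := by
    simp [smul_sum]

theorem bicomp_apply (r s : ℕ) (T : EndGr) (a : Gr) : bicomp r s T a
    = ∑ p ∈ Finset.range 4, ∑ q ∈ Finset.range 4, pr (p + r) (q + s) (T (pr p q a)) := by
  simp [bicomp, LinearMap.sum_apply]

theorem HasBideg.bicomp_self {T : EndGr} {r s : ℕ} (h : HasBideg T r s) :
    bicomp r s T = T := by
  refine LinearMap.ext fun a => ?_
  rw [bicomp_apply]
  conv_rhs => rw [← sum_pr a]
  simp only [map_sum]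
  refine sum_ext fun p => sum_ext fun q => ?_
  funext K
  rw [pr_apply]
  split_ifs with hK
  · rfl
  · have hne : ((thDeg K : ℕ) : ℤ) ≠ p + r ∨ ((etDeg K : ℕ) : ℤ) ≠ q + s := by omega
    have := congrFun (h p q (thDeg K) (etDeg K) hne a) K
    rw [pr_apply] at this
    simpa using this.symm

theorem HasBideg.bicomp_of_ne {T : EndGr} {r s : ℤ} (h : HasBideg T r s) {r' s' : ℕ}
    (hne : (r' : ℤ) ≠ r ∨ (s' : ℤ) ≠ s) : bicomp r' s' T = 0 := by
  refine LinearMap.ext fun a => ?_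
  rw [bicomp_apply]
  refine sum_eq_zero fun p _ => sum_eq_zero fun q _ => h p q _ _ ?_ a
  push_cast
  omega

/-! ### The Hermitian pairing -/

/-- The standard Hermitian pairing. -/
def hdot (a b : Gr) : ℂ := ∑ K, a K * conj (b K)

theorem hdot_add_left (a a' b : Gr) : hdot (a + a') b = hdot a b + hdot a' b := by
  simp [hdot, add_mul, sum_add_distrib]

theorem hdot_add_right (a b b' : Gr) : hdot a (b + b') = hdot a b + hdot a b' := by
  simp [hdot, mul_add, sum_add_distrib]

theorem hdot_smul_left (c : ℂ) (a b : Gr) : hdot (c • a) b = c * hdot a b := by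
  simp [hdot, mul_assoc, mul_sum]

theorem hdot_smul_right (c : ℂ) (a b : Gr) : hdot a (c • b) = conj c * hdot a b := by
  simp only [hdot, Pi.smul_apply, smul_eq_mul, map_mul, mul_sum]
  exact sum_ext fun _ => by ring

theorem hdot_neg_left (a b : Gr) : hdot (-a) b = -hdot a b := by
  simp [hdot]

theorem hdot_neg_right (a b : Gr) : hdot a (-b) = -hdot a b := by
  simp [hdot]

theorem hdot_sum_left {ι : Type*} (s : Finset ι) (a : ι → Gr) (b : Gr) :
    hdot (∑ i ∈ s, a i) b = ∑ i ∈ s, hdot (a i) b := by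
  simp only [hdot, Finset.sum_apply, sum_mul]
  exact sum_comm

theorem hdot_sum_right {ι : Type*} (s : Finset ι) (a : Gr) (b : ι → Gr) :
    hdot a (∑ i ∈ s, b i) = ∑ i ∈ s, hdot a (b i) := by
  simp only [hdot, Finset.sum_apply, map_sum, mul_sum]
  exact sum_comm

theorem hdot_conj (a b : Gr) : conj (hdot a b) = hdot b a := by
  simp [hdot, mul_comm]

theorem hdot_mg (k : Fin 6) (a b : Gr) : hdot (mg k a) b = hdot a (dg k b) := by
  simp only [hdot, mg_apply, dg_apply]
  simp only [ite_mul, zero_mul, apply_ite conj, map_zero, mul_ite, mul_zero]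
  rw [← sum_filter]
  have : ∀ f : Idx → ℂ, (∑ K, if k ∈ K then 0 else f K)
      = ∑ K with k ∉ K, f K := by
    intro f
    rw [sum_filter]
    exact sum_ext fun K => by by_cases h : k ∈ K <;> simp [h]
  rw [this]
  refine Finset.sum_nbij' (fun K => K.erase k) (fun K => insert k K) ?_ ?_ ?_ ?_ ?_
  · intro K _; simp
  · intro K _; simp
  · intro K hK; exact insert_erase (Finset.mem_filter.1 hK).2
  · intro K hK; exact erase_insert (Finset.mem_filter.1 hK).2
  · intro K hK
    rw [insert_erase (Finset.mem_filter.1 hK).2, map_mul, gsgn_eq, map_pow]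
    simp only [map_neg, map_one]
    ring

theorem hdot_dg (k : Fin 6) (a b : Gr) : hdot (dg k a) b = hdot a (mg k b) := by
  rw [← hdot_conj, ← hdot_mg, hdot_conj]

theorem hdot_gone (a : Gr) : hdot gone a = conj (a ∅) := by
  simp [hdot, gone, single_apply]

theorem gs_apply_empty (M : Mat6) (a : Gr) : gs M a ∅ = a ∅ := by
  induction a using Gr.induction with
  | hadd a a' ha hb => simp [ha, hb]
  | hsmul r a ha => simp [ha]
  | hone => simp [gs_gone]
  | hgen k a h => simp [gs_mg, mg_apply, Finset.sum_apply]

theorem hdot_gs (M : Mat6) (a b : Gr) :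
    hdot (gs M a) b = hdot a (gs Mᴴ b) := by
  induction a using Gr.induction generalizing b with
  | hadd a a' ha hb => simp [hdot_add_left, ha, hb]
  | hsmul r a ha => simp [hdot_smul_left, ha]
  | hone => rw [gs_gone, hdot_gone, hdot_gone, gs_apply_empty]
  | hgen k a h =>
    simp only [gs_mg, hdot_sum_left, hdot_smul_left, hdot_mg, h, dg_gs, hdot_sum_right,
      hdot_smul_right, conjTranspose_apply]
    simp

theorem hdot_self (a : Gr) : hdot a a = ((∑ K, ‖a K‖ ^ 2 : ℝ) : ℂ) := by
  simp [hdot, Complex.mul_conj']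

theorem hdot_self_eq_zero {a : Gr} (h : hdot a a = 0) : a = 0 := by
  rw [hdot_self, Complex.ofReal_eq_zero, Finset.sum_eq_zero_iff_of_nonneg] at h
  · funext K
    simpa using h K (mem_univ K)
  · intro K _; positivity

/-! ### Block matrices -/

section Blocks

variable (A B C D : Mat3) (i j : Fin 3)

@[simp] theorem blk_th_th : blk A B C D (th i) (th j) = A i j := by
  have h1 : (finSumFinEquiv (m := 3) (n := 3)).symm (th i) = Sum.inl i :=
    finSumFinEquiv_symm_apply_castAdd i
  have h2 : (finSumFinEquiv (m := 3) (n := 3)).symm (th j) = Sum.inl j :=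
    finSumFinEquiv_symm_apply_castAdd j
  simp [blk, h1, h2]

@[simp] theorem blk_th_et : blk A B C D (th i) (et j) = B i j := by
  have h1 : (finSumFinEquiv (m := 3) (n := 3)).symm (th i) = Sum.inl i :=
    finSumFinEquiv_symm_apply_castAdd i
  have h2 : (finSumFinEquiv (m := 3) (n := 3)).symm (et j) = Sum.inr j :=
    finSumFinEquiv_symm_apply_natAdd j
  simp [blk, h1, h2]

@[simp] theorem blk_et_th : blk A B C D (et i) (th j) = C i j := by
  have h1 : (finSumFinEquiv (m := 3) (n := 3)).symm (et i) = Sum.inr i :=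
    finSumFinEquiv_symm_apply_natAdd i
  have h2 : (finSumFinEquiv (m := 3) (n := 3)).symm (th j) = Sum.inl j :=
    finSumFinEquiv_symm_apply_castAdd j
  simp [blk, h1, h2]

@[simp] theorem blk_et_et : blk A B C D (et i) (et j) = D i j := by
  have h1 : (finSumFinEquiv (m := 3) (n := 3)).symm (et i) = Sum.inr i :=
    finSumFinEquiv_symm_apply_natAdd i
  have h2 : (finSumFinEquiv (m := 3) (n := 3)).symm (et j) = Sum.inr j :=
    finSumFinEquiv_symm_apply_natAdd j
  simp [blk, h1, h2]

end Blocks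

theorem six_matrix_ext {M M' : Mat6}
    (h1 : ∀ i j, M (th i) (th j) = M' (th i) (th j))
    (h2 : ∀ i j, M (th i) (et j) = M' (th i) (et j))
    (h3 : ∀ i j, M (et i) (th j) = M' (et i) (th j))
    (h4 : ∀ i j, M (et i) (et j) = M' (et i) (et j)) : M = M' := by
  ext k l
  revert k l
  refine six_cases (fun i => ?_) (fun i => ?_)
  · exact six_cases (fun j => h1 i j) (fun j => h2 i j)
  · exact six_cases (fun j => h3 i j) (fun j => h4 i j)

theorem blk_mul (A B C D A' B' C' D' : Mat3) : blk A B C D * blk A' B' C' D'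
      = blk (A * A' + B * C') (A * B' + B * D') (C * A' + D * C') (C * B' + D * D') := by
  refine six_matrix_ext ?_ ?_ ?_ ?_ <;> intro i j <;>
    simp [Matrix.mul_apply, sum_six]

theorem blk_one : blk 1 0 0 1 = 1 := by
  refine six_matrix_ext ?_ ?_ ?_ ?_ <;> intro i j <;>
    simp [one_apply, th_inj, et_inj, th_ne_et, et_ne_th]

theorem blk_conjTranspose (A B C D : Mat3) : (blk A B C D)ᴴ
      = blk Aᴴ Cᴴ Bᴴ Dᴴ := by
  refine six_matrix_ext ?_ ?_ ?_ ?_ <;> intro i j <;> simp [conjTranspose_apply]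

theorem blk_neg (A B C D : Mat3) :
    -blk A B C D = blk (-A) (-B) (-C) (-D) := by
  refine six_matrix_ext ?_ ?_ ?_ ?_ <;> intro i j <;> simp

theorem blk_det (A B C D : Mat3) :
    (blk A B C D).det = (Matrix.fromBlocks A B C D).det := by
  rw [blk, Matrix.det_submatrix_equiv_self]

/-! ### Wirtinger derivatives -/

theorem addCases_th {V : Type*} (u v : Fin 3 → V) (i : Fin 3) :
    Fin.addCases (m := 3) (n := 3) (motive := fun _ => V) u v (th i) = u i :=
  Fin.addCases_left i

theorem addCases_et {V : Type*} (u v : Fin 3 → V) (i : Fin 3) :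
    Fin.addCases (m := 3) (n := 3) (motive := fun _ => V) u v (et i) = v i :=
  Fin.addCases_right i

section Wirtinger

variable {V W : Type*} [NormedAddCommGroup V] [NormedSpace ℝ V] [NormedSpace ℂ V]
  [NormedAddCommGroup W] [NormedSpace ℝ W] [NormedSpace ℂ W]

/-- The coordinate to which `pd k` refers. -/
def coordIdx (k : Fin 6) : Fin 3 :=
  Fin.addCases (m := 3) (n := 3) (motive := fun _ => Fin 3) id id k

/-- The sign of the imaginary unit in `pd k`. -/
def coordSign (k : Fin 6) : ℂ :=
  Fin.addCases (m := 3) (n := 3) (motive := fun _ => ℂ) (fun _ => -Complex.I)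
    (fun _ => Complex.I) k

theorem pd_eq (k : Fin 6) (f : E3 → V) (z : E3) :
    pd k f z = (1 / 2 : ℂ) • (fderiv ℝ f z (single (coordIdx k) 1)
      + coordSign k • fderiv ℝ f z (single (coordIdx k) Complex.I)) := by
  revert k
  refine six_cases (fun i => ?_) (fun i => ?_)
  · simp [pd, coordIdx, coordSign, addCases_th, sub_eq_add_neg, id]
  · simp [pd, coordIdx, coordSign, addCases_et, id]

variable {f f' : E3 → V} {z : E3} (k : Fin 6)

theorem pd_congr (h : f =ᶠ[𝓝 z] f') : pd k f z = pd k f' z := by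
  rw [pd_eq, pd_eq, h.fderiv_eq]

theorem pd_add (hf : RDiffAt f z) (hf' : RDiffAt f' z) :
    pd k (fun y => f y + f' y) z = pd k f z + pd k f' z := by
  simp only [pd_eq, fderiv_fun_add hf hf', _root_.add_apply, smul_add]
  abel

theorem pd_neg : pd k (fun y => -f y) z = -pd k f z := by
  simp only [pd_eq, fderiv_fun_neg, _root_.neg_apply, smul_neg, smul_add, neg_add]

theorem pd_sub (hf : RDiffAt f z) (hf' : RDiffAt f' z) :
    pd k (fun y => f y - f' y) z = pd k f z - pd k f' z := by
  simp only [pd_eq, fderiv_fun_sub hf hf', _root_.sub_apply, smul_add, smul_sub]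
  abel

theorem pd_const (c : V) : pd k (fun _ => c) z = 0 := by
  simp [pd_eq]

theorem pd_sum {ι : Type*} {s : Finset ι} {F : ι → E3 → V}
    (h : ∀ i ∈ s, RDiffAt (F i) z) :
    pd k (fun y => ∑ i ∈ s, F i y) z = ∑ i ∈ s, pd k (F i) z := by
  simp only [pd_eq, fderiv_fun_sum h, _root_.sum_apply]
  simp [smul_sum, smul_add, sum_add_distrib]

theorem pd_clm [IsScalarTower ℝ ℂ V] [IsScalarTower ℝ ℂ W] (T : V →L[ℂ] W)
    (hf : RDiffAt f z) : pd k (fun y => T (f y)) z = T (pd k f z) := by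
  have : fderiv ℝ (fun y => T (f y)) z = (T.restrictScalars ℝ).comp (fderiv ℝ f z) :=
    ((T.restrictScalars ℝ).hasFDerivAt.comp z hf.hasFDerivAt).fderiv
  simp [pd_eq, this]

theorem pd_smul [IsScalarTower ℝ ℂ V] {c : E3 → ℂ} (hc : RDiffAt c z)
    (hf : RDiffAt f z) :
    pd k (fun y => c y • f y) z = c z • pd k f z + pd k c z • f z := by
  have : fderiv ℝ (fun y => c y • f y) z
      = c z • fderiv ℝ f z + (fderiv ℝ c z).smulRight (f z) := (hc.hasFDerivAt.smul hf.hasFDerivAt).fderiv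
  simp only [pd_eq, this, _root_.add_apply, _root_.smul_apply, ContinuousLinearMap.smulRight_apply,
    smul_eq_mul]
  simp only [smul_add, smul_smul, add_smul, mul_add]
  rw [mul_comm (coordSign k) (c z), mul_left_comm (1 / 2 : ℂ) (c z), mul_comm (1 / 2 : ℂ) (c z)]
  abel

theorem pd_mul {c c' : E3 → ℂ} (hc : RDiffAt c z) (hc' : RDiffAt c' z) :
    pd k (fun y => c y * c' y) z = c z * pd k c' z + pd k c z * c' z :=
  pd_smul k hc hc'

theorem pd_apply {ι : Type*} [Fintype ι] {F : E3 → ι → ℂ} (hF : RDiffAt F z) (i : ι) :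
    pd k F z i = pd k (fun y => F y i) z :=
  (pd_clm k (ContinuousLinearMap.proj (R := ℂ) (φ := fun _ : ι => ℂ) i) hF).symm

theorem differentiableAt_lin {V W : Type*} [NormedAddCommGroup V] [NormedSpace ℝ V]
    [NormedSpace ℂ V] [NormedAddCommGroup W] [NormedSpace ℝ W] [NormedSpace ℂ W]
    [IsScalarTower ℝ ℂ V] [IsScalarTower ℝ ℂ W] [FiniteDimensional ℂ V] {f : E3 → V} {z : E3}
    (T : V →ₗ[ℂ] W) (hf : RDiffAt f z) : RDiffAt (fun y => T (f y)) z :=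
  ((LinearMap.toContinuousLinearMap T).restrictScalars ℝ).differentiableAt.comp z hf

theorem pd_lin [IsScalarTower ℝ ℂ V] [IsScalarTower ℝ ℂ W] [FiniteDimensional ℂ V] (T : V →ₗ[ℂ] W)
    (hf : RDiffAt f z) : pd k (fun y => T (f y)) z = T (pd k f z) :=
  pd_clm k (LinearMap.toContinuousLinearMap T) hf

theorem pd_et_of_holomorphic {s : E3 → ℂ} (hs : DifferentiableAt ℂ s z) (i : Fin 3) :
    pd (et i) s z = 0 := by
  have h : ∀ v, fderiv ℝ s z v = fderiv ℂ s z v := fun v => by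
    rw [hs.fderiv_restrictScalars ℝ]; rfl
  have h2 : (single i Complex.I : E3) = Complex.I • single i 1 := by
    rw [← single_smul]; simp
  simp only [pd, addCases_et, h]
  rw [h2, map_smul, smul_smul]
  simp

theorem pd_th_of_holomorphic {s : E3 → ℂ} (hs : DifferentiableAt ℂ s z) (i : Fin 3) :
    pd (th i) s z = fderiv ℂ s z (single i 1) := by
  have h : ∀ v, fderiv ℝ s z v = fderiv ℂ s z v := fun v => by
    rw [hs.fderiv_restrictScalars ℝ]; rfl
  have h2 : (single i Complex.I : E3) = Complex.I • single i 1 := by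
    rw [← single_smul]; simp
  simp only [pd, addCases_th, h]
  rw [h2, map_smul, smul_smul]
  simp only [smul_eq_mul, Complex.I_mul_I]
  ring

/-- The exchange of the two kinds of indices. -/
def cconj (k : Fin 6) : Fin 6 := Fin.addCases (m := 3) (n := 3) (motive := fun _ => Fin 6) et th k

@[simp] theorem cconj_th (i : Fin 3) : cconj (th i) = et i := addCases_th _ _ _

@[simp] theorem cconj_et (i : Fin 3) : cconj (et i) = th i := addCases_et _ _ _

theorem pd_conj {c : E3 → ℂ} :
    pd k (fun y => conj (c y)) z = conj (pd (cconj k) c z) := by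
  have h : ∀ v, fderiv ℝ (fun y => conj (c y)) z v
      = conj (fderiv ℝ c z v) := by
    intro v
    have := Complex.conjCLE.comp_fderiv (f := c) (x := z)
    exact congrArg (fun T => T v) this
  revert k
  refine six_cases (fun i => ?_) (fun i => ?_)
  · rw [cconj_th]
    simp only [pd, addCases_th, addCases_et, h]
    simp [sub_eq_add_neg, map_ofNat]
  · rw [cconj_et]
    simp only [pd, addCases_th, addCases_et, h]
    simp [sub_eq_add_neg, map_ofNat]

theorem differentiableAt_conj {c : E3 → ℂ} (hc : RDiffAt c z) : RDiffAt (fun y => conj (c y)) z :=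
  Complex.conjCLE.differentiableAt.comp z hc

theorem contDiffOn_pd [IsScalarTower ℝ ℂ V] {U : Set E3} (hU : IsOpen U) (hf : SmoothOn f U) :
    SmoothOn (pd k f) U := by
  have h : SmoothOn (fderiv ℝ f) U := hf.fderiv_of_isOpen hU (by simp)
  have : pd k f = fun z => (1 / 2 : ℂ) • (fderiv ℝ f z (single (coordIdx k) 1)
      + coordSign k • fderiv ℝ f z (single (coordIdx k) Complex.I)) := funext fun z => pd_eq k f z
  rw [this]
  have hs : ∀ (c : ℂ) {g : E3 → V}, SmoothOn g U → SmoothOn (fun z => c • g z) U :=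
    fun c g hg => (c • ContinuousLinearMap.id ℝ V : V →L[ℝ] V).contDiff.comp_contDiffOn hg
  exact hs _ ((h.clm_apply contDiffOn_const).add (hs _ (h.clm_apply contDiffOn_const)))

theorem pd_comm [IsScalarTower ℝ ℂ V] (l : Fin 6) (hf : ContDiffAt ℝ ∞ f z) :
    pd k (pd l f) z = pd l (pd k f) z := by
  have hd : RDiffAt (fderiv ℝ f) z :=
    (hf.fderiv_right (m := ∞) (by simp)).differentiableAt (by simp)
  have hda : ∀ v, RDiffAt (fun y => fderiv ℝ f y v) z :=
    fun v => hd.clm_apply (differentiableAt_const v)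
  have hfd : ∀ v w, fderiv ℝ (fun y => fderiv ℝ f y v) z w = fderiv ℝ (fderiv ℝ f) z w v := by
    intro v w
    rw [fderiv_clm_apply hd (differentiableAt_const v)]
    simp
  have hsymm : ∀ v w, fderiv ℝ (fderiv ℝ f) z w v = fderiv ℝ (fderiv ℝ f) z v w := by
    intro v w
    exact (hf.isSymmSndFDerivAt (by simp; exact WithTop.coe_le_coe.2 le_top)).eq w v
  have hs : ∀ (c : ℂ) {g : E3 → V}, RDiffAt g z → RDiffAt (fun y => c • g y) z :=
    fun c g hg => (c • ContinuousLinearMap.id ℝ V : V →L[ℝ] V).differentiableAt.comp z hg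
  have hsf : ∀ (c : ℂ) {g : E3 → V} (v : E3), RDiffAt g z →
      fderiv ℝ (fun y => c • g y) z v = c • fderiv ℝ g z v := by
    intro c g v hg
    have := ((c • ContinuousLinearMap.id ℝ V : V →L[ℝ] V).hasFDerivAt.comp z hg.hasFDerivAt).fderiv
    exact congrArg (fun T => T v) this
  have key : ∀ k l, pd k (pd l f) z = (1 / 2 : ℂ) • (1 / 2 : ℂ) •
      (fderiv ℝ (fderiv ℝ f) z (single (coordIdx k) 1) (single (coordIdx l) 1)
      + coordSign l • fderiv ℝ (fderiv ℝ f) z (single (coordIdx k) 1)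
          (single (coordIdx l) Complex.I)
      + coordSign k • fderiv ℝ (fderiv ℝ f) z (single (coordIdx k) Complex.I)
          (single (coordIdx l) 1)
      + coordSign k • coordSign l • fderiv ℝ (fderiv ℝ f) z (single (coordIdx k) Complex.I)
          (single (coordIdx l) Complex.I)) := by
    intro k l
    have h1 : pd l f = fun z => (1 / 2 : ℂ) • (fderiv ℝ f z (single (coordIdx l) 1)
      + coordSign l • fderiv ℝ f z (single (coordIdx l) Complex.I)) :=
      funext fun z => pd_eq l f z
    rw [pd_eq, h1]
    rw [hsf _ _ ((hda _).fun_add (hs _ (hda _))), hsf _ _ ((hda _).fun_add (hs _ (hda _))),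
      fderiv_fun_add (hda _) (hs _ (hda _))]
    simp only [_root_.add_apply, hsf _ _ (hda _), hfd]
    simp only [smul_add, smul_smul]
    ring_nf
    abel
  rw [key, key]
  rw [hsymm (single (coordIdx l) 1) (single (coordIdx k) 1), hsymm (single (coordIdx l) 1)
    (single (coordIdx k) Complex.I), hsymm (single (coordIdx l) Complex.I) (single
    (coordIdx k) 1), hsymm (single (coordIdx l) Complex.I) (single (coordIdx k) Complex.I),
    smul_comm (coordSign l) (coordSign k)]
  congr 2
  abel

end Wirtinger

/-! ### Matrix-valued functions -/

section MatrixFunctions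

variable {n m l : Type*} [Fintype n] [DecidableEq n] [Fintype m] [Fintype l]

/-- Entrywise differentiability. -/
def MatDiff (M : E3 → Matrix n m ℂ) (z : E3) : Prop := ∀ i j, RDiffAt (fun y => M y i j) z

/-- Entrywise derivative. -/
def pdm (k : Fin 6) (M : E3 → Matrix n m ℂ) (z : E3) : Matrix n m ℂ :=
  Matrix.of fun i j => pd k (fun y => M y i j) z

@[simp] theorem pdm_apply (k : Fin 6) (M : E3 → Matrix n m ℂ) (z : E3) (i : n) (j : m) :
    pdm k M z i j = pd k (fun y => M y i j) z := rfl

variable {z : E3}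

theorem MatDiff.mul {M : E3 → Matrix n m ℂ} {M' : E3 → Matrix m l ℂ} (h : MatDiff M z)
    (h' : MatDiff M' z) : MatDiff (fun y => M y * M' y) z := by
  intro i j
  simp only [Matrix.mul_apply]
  exact DifferentiableAt.fun_sum fun x _ => (h i x).mul (h' x j)

theorem pdm_mul (k : Fin 6) {M : E3 → Matrix n m ℂ} {M' : E3 → Matrix m l ℂ} (h : MatDiff M z)
    (h' : MatDiff M' z) :
    pdm k (fun y => M y * M' y) z = pdm k M z * M' z + M z * pdm k M' z := by
  ext i j
  simp only [Matrix.add_apply, Matrix.mul_apply, pdm_apply]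
  rw [pd_sum k fun x _ => (h i x).fun_mul (h' x j), ← sum_add_distrib]
  refine sum_ext fun x => ?_
  rw [pd_mul k (h i x) (h' x j)]
  ring

theorem MatDiff.transpose {M : E3 → Matrix n m ℂ} (h : MatDiff M z) :
    MatDiff (fun y => (M y)ᵀ) z := fun i j => h j i

theorem pdm_transpose (k : Fin 6) (M : E3 → Matrix n m ℂ) :
    pdm k (fun y => (M y)ᵀ) z = (pdm k M z)ᵀ := rfl

theorem MatDiff.neg {M : E3 → Matrix n m ℂ} (h : MatDiff M z) : MatDiff (fun y => -M y) z :=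
  fun i j => (h i j).neg

theorem MatDiff.sub {M M' : E3 → Matrix n m ℂ} (h : MatDiff M z) (h' : MatDiff M' z) :
    MatDiff (fun y => M y - M' y) z :=
  fun i j => (h i j).sub (h' i j)

theorem pdm_congr (k : Fin 6) {M M' : E3 → Matrix n m ℂ} (h : M =ᶠ[𝓝 z] M') :
    pdm k M z = pdm k M' z := by
  ext i j
  exact pd_congr k (h.mono fun y hy => by simp only [hy])

theorem MatDiff.det {M : E3 → Matrix n n ℂ} (h : MatDiff M z) :
    RDiffAt (fun y => (M y).det) z := by
  simp only [Matrix.det_apply, Units.smul_def, zsmul_eq_mul]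
  refine DifferentiableAt.fun_sum fun σ _ => (differentiableAt_const _).fun_mul ?_
  exact (HasFDerivAt.finsetProd fun i _ => (h (σ i) i).hasFDerivAt).differentiableAt

theorem MatDiff.inv {M : E3 → Matrix n n ℂ} (h : MatDiff M z) (hd : (M z).det ≠ 0) :
    MatDiff (fun y => (M y)⁻¹) z := by
  intro i j
  simp only [Matrix.inv_def, Matrix.smul_apply, Ring.inverse_eq_inv', smul_eq_mul,
    Matrix.adjugate_apply]
  refine (h.det.inv hd).mul (MatDiff.det fun a b => ?_)
  by_cases ha : a = j
  · subst ha; simp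
  · simpa [Matrix.updateRow_ne ha] using h a b

theorem MatDiff.eventually_det_ne {M : E3 → Matrix n n ℂ} (h : MatDiff M z) (hd : (M z).det ≠ 0) :
    ∀ᶠ y in 𝓝 z, (M y).det ≠ 0 :=
  h.det.continuousAt.eventually_ne hd

theorem pdm_inv (k : Fin 6) {M : E3 → Matrix n n ℂ} (h : MatDiff M z) (hd : (M z).det ≠ 0) :
    pdm k (fun y => (M y)⁻¹) z = -((M z)⁻¹ * pdm k M z * (M z)⁻¹) := by
  have h1 : pdm k (fun y => M y * (M y)⁻¹) z = 0 := by
    rw [pdm_congr k (M' := fun _ => 1) ((h.eventually_det_ne hd).mono fun y hy =>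
      mul_nonsing_inv _ (isUnit_iff_ne_zero.2 hy))]
    ext i j
    exact pd_const k _
  rw [pdm_mul k h (h.inv hd)] at h1
  have h2 := congrArg (fun A => (M z)⁻¹ * A) h1
  simp only [mul_add, mul_zero, ← mul_assoc, nonsing_inv_mul _ (isUnit_iff_ne_zero.2 hd), one_mul]
    at h2
  exact eq_neg_of_add_eq_zero_right h2

theorem MatDiff.blk {A B C D : E3 → Mat3} (hA : MatDiff A z) (hB : MatDiff B z)
    (hC : MatDiff C z) (hD : MatDiff D z) : MatDiff (fun y => blk (A y) (B y) (C y) (D y)) z := by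
  refine six_cases (fun i => ?_) (fun i => ?_)
  · refine six_cases (fun j => ?_) (fun j => ?_)
    · simpa using hA i j
    · simpa using hB i j
  · refine six_cases (fun j => ?_) (fun j => ?_)
    · simpa using hC i j
    · simpa using hD i j

theorem pdm_blk (k : Fin 6) (A B C D : E3 → Mat3) :
    pdm k (fun y => KS.blk (A y) (B y) (C y) (D y)) z
      = KS.blk (pdm k A z) (pdm k B z) (pdm k C z) (pdm k D z) := by
  refine six_matrix_ext ?_ ?_ ?_ ?_ <;> intro i j <;> simp

theorem mdiff_const (M : Matrix n m ℂ) : MatDiff (fun _ => M) z :=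
  fun _ _ => differentiableAt_const _

theorem pdm_const (k : Fin 6) (M : Matrix n m ℂ) : pdm k (fun _ => M) z = 0 := by
  ext i j
  exact pd_const k _

theorem gs_eq_sum (M : Mat6) (a : Gr) :
    gs M a = ∑ K, a K • gs M (single K 1) := by
  conv_lhs => rw [Gr.eq_sum a]
  simp

theorem MatDiff.gs_const {M : E3 → Mat6} (h : MatDiff M z) (a : Gr) :
    RDiffAt (fun y => gs (M y) a) z := by
  induction a using Gr.induction with
  | hadd a b ha hb => simpa using ha.add hb
  | hsmul c a ha => simpa using ha.const_smul c
  | hone => simp [gs_gone]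
  | hgen k a ha =>
    simp only [gs_mg]
    exact DifferentiableAt.fun_sum fun b _ => (h b k).fun_smul (differentiableAt_lin (mg b) ha)

theorem differentiableAt_coeff {a : E3 → Gr} (ha : RDiffAt a z) (K : Idx) :
    RDiffAt (fun y => a y K) z := differentiableAt_pi.1 ha K

theorem MatDiff.gs {M : E3 → Mat6} (h : MatDiff M z) {a : E3 → Gr}
    (ha : RDiffAt a z) : RDiffAt (fun y => gs (M y) (a y)) z := by
  simp only [fun y => gs_eq_sum (M y) (a y)]
  exact DifferentiableAt.fun_sum fun K _ => (differentiableAt_coeff ha K).fun_smul (h.gs_const _)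

theorem pd_gs_const (k : Fin 6) {M : E3 → Mat6} (h : MatDiff M z)
    (hd : (M z).det ≠ 0) (a : Gr) :
    pd k (fun y => KS.gs (M y) a) z = KS.gs (M z) (der ((M z)⁻¹ * pdm k M z) a) := by
  induction a using Gr.induction with
  | hadd a b ha hb =>
    simp only [map_add]
    rw [pd_add k (h.gs_const a) (h.gs_const b), ha, hb]
  | hsmul c a ha =>
    simp only [map_smul]
    rw [pd_smul k (differentiableAt_const c) (h.gs_const a), pd_const, ha]
    simp
  | hone => simp [gs_gone, pd_const, der_gone]
  | hgen l a ha =>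
    simp only [gs_mg]
    rw [pd_sum k fun b _ => (h b l).fun_smul (differentiableAt_lin (mg b) (h.gs_const a))]
    have : ∀ b, pd k (fun y => M y b l • mg b (KS.gs (M y) a)) z
        = M z b l • mg b (KS.gs (M z) (der ((M z)⁻¹ * pdm k M z) a))
          + pdm k M z b l • mg b (KS.gs (M z) a) := by
      intro b
      rw [pd_smul k (h b l) (differentiableAt_lin (mg b) (h.gs_const a)), pd_lin k (mg b)
        (h.gs_const a), ha]
      rfl
    simp only [this, sum_add_distrib, der_mg, map_add, map_sum, map_smul, gs_mg]
    rw [add_comm]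
    congr 1
    simp only [smul_sum, smul_smul]
    rw [sum_comm]
    simp only [← sum_smul]
    refine sum_ext fun b => ?_
    have h2 : M z * ((M z)⁻¹ * pdm k M z) = pdm k M z := by
      rw [← mul_assoc, mul_nonsing_inv _ (isUnit_iff_ne_zero.2 hd), one_mul]
    conv_lhs => rw [← h2, Matrix.mul_apply]
    congr 1
    exact sum_ext fun c => mul_comm _ _

/-- The derivative of a substitution with variable matrix. -/
theorem pd_gs (k : Fin 6) {M : E3 → Mat6} (h : MatDiff M z)
    (hd : (M z).det ≠ 0) {a : E3 → Gr} (ha : RDiffAt a z) :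
    pd k (fun y => KS.gs (M y) (a y)) z
      = KS.gs (M z) (pd k a z + der ((M z)⁻¹ * pdm k M z) (a z)) := by
  simp only [fun y => gs_eq_sum (M y) (a y)]
  rw [pd_sum k fun K _ => (differentiableAt_coeff ha K).fun_smul (h.gs_const _), map_add]
  have h1 : ∀ K, pd k (fun y => a y K • KS.gs (M y) (single K 1)) z
      = pd k a z K • KS.gs (M z) (single K 1)
        + a z K • KS.gs (M z) (der ((M z)⁻¹ * pdm k M z) (single K 1)) := by
    intro K
    rw [pd_smul k (differentiableAt_coeff ha K) (h.gs_const _), pd_gs_const k h hd, pd_apply k ha,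
      add_comm]
  simp only [h1, sum_add_distrib]
  rw [← gs_eq_sum]
  congr 1
  conv_rhs => rw [Gr.eq_sum (a z)]
  simp

theorem der_univ (A : Mat6) (x : Gr) :
    der A x univ = A.trace * x univ := by
  rw [der_apply, Matrix.trace, sum_mul]
  simp only [Finset.sum_apply, Pi.smul_apply, smul_eq_mul]
  refine sum_ext fun b => ?_
  rw [sum_eq_single b]
  · rw [mg_apply, if_pos (mem_univ b), dg_apply, if_neg (notMem_erase _ _), insert_erase (mem_univ
      b), ← mul_assoc (gsgn _ _), gsgn_mul_self, one_mul]
    rfl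
  · intro c _ hc
    rw [mg_apply, if_pos (mem_univ b), dg_apply, if_pos (mem_erase.2 ⟨hc, mem_univ c⟩)]
    simp
  · simp

theorem blk_det_diag (A : Mat3) : (blk A 0 0 1).det = A.det := by
  rw [blk_det, det_fromBlocks_zero₂₁, Matrix.det_one, mul_one]

/-- Jacobi's formula. -/
theorem pd_det (k : Fin 6) {M : E3 → Mat3} (h : MatDiff M z)
    (hd : (M z).det ≠ 0) :
    pd k (fun y => (M y).det) z = (M z).det * ((M z)⁻¹ * pdm k M z).trace := by
  have hB : MatDiff (fun y => blk (M y) 0 0 1) z :=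
    h.blk (mdiff_const 0) (mdiff_const 0) (mdiff_const 1)
  have hBd : (blk (M z) 0 0 1).det ≠ 0 := by rwa [blk_det_diag]
  have h1 := pd_gs_const k hB hBd (single univ 1)
  have h2 := congrFun h1 univ
  rw [pd_apply k (hB.gs_const _), gs_univ, der_univ] at h2
  simp only [gs_univ, blk_det_diag, single_eq_same, mul_one] at h2
  rw [h2]
  congr 1
  have hinv : (blk (M z) 0 0 1)⁻¹ = blk (M z)⁻¹ 0 0 1 := by
    refine Matrix.inv_eq_right_inv ?_
    rw [blk_mul, mul_nonsing_inv _ (isUnit_iff_ne_zero.2 hd)]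
    simp [blk_one]
  rw [hinv, pdm_blk k M (fun _ => 0) (fun _ => 0) (fun _ => 1), blk_mul]
  simp [Matrix.trace, sum_six, pdm_const]

end MatrixFunctions

/-! ### Directional derivatives -/

section Directional

variable {V W : Type*} [NormedAddCommGroup V] [NormedSpace ℝ V] [NormedSpace ℂ V]
  [NormedAddCommGroup W] [NormedSpace ℝ W] [NormedSpace ℂ W]

/-- The derivative along the complexified tangent vector `∑ c_k ∂_k`. -/
def vd (c : Fin 6 → ℂ) (f : E3 → V) (z : E3) : V := ∑ k, c k • pd k f z

variable (c : Fin 6 → ℂ) {f f' : E3 → V} {z : E3}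

theorem vd_congr (h : f =ᶠ[𝓝 z] f') : vd c f z = vd c f' z :=
  sum_ext fun k => by rw [pd_congr k h]

theorem vd_sub (hf : RDiffAt f z) (hf' : RDiffAt f' z) :
    vd c (fun y => f y - f' y) z = vd c f z - vd c f' z := by
  simp [vd, pd_sub _ hf hf', smul_sub, sum_sub_distrib]

theorem vd_const (v : V) : vd c (fun _ => v) z = 0 := by
  simp [vd, pd_const]

theorem vd_sum {ι : Type*} {s : Finset ι} {F : ι → E3 → V}
    (h : ∀ i ∈ s, RDiffAt (F i) z) :
    vd c (fun y => ∑ i ∈ s, F i y) z = ∑ i ∈ s, vd c (F i) z := by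
  simp only [vd, pd_sum _ h, smul_sum]
  exact sum_comm

theorem vd_lin [IsScalarTower ℝ ℂ V] [IsScalarTower ℝ ℂ W] [FiniteDimensional ℂ V]
    (T : V →ₗ[ℂ] W) (hf : RDiffAt f z) :
    vd c (fun y => T (f y)) z = T (vd c f z) := by
  simp [vd, pd_lin _ T hf]

theorem vd_smul [IsScalarTower ℝ ℂ V] {r : E3 → ℂ} (hr : RDiffAt r z)
    (hf : RDiffAt f z) :
    vd c (fun y => r y • f y) z = r z • vd c f z + vd c r z • f z := by
  simp only [vd, pd_smul _ hr hf, smul_add, sum_add_distrib, smul_sum, sum_smul, smul_smul,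
    smul_eq_mul]
  simp [mul_comm]

theorem vd_mul {r r' : E3 → ℂ} (hr : RDiffAt r z) (hr' : RDiffAt r' z) :
    vd c (fun y => r y * r' y) z = r z * vd c r' z + vd c r z * r' z :=
  vd_smul c hr hr'

/-- The entrywise derivative along `∑ c_k ∂_k`. -/
def vdm {n m : Type*} (c : Fin 6 → ℂ) (M : E3 → Matrix n m ℂ) (z : E3) : Matrix n m ℂ :=
  Matrix.of fun i j => vd c (fun y => M y i j) z

@[simp] theorem vdm_apply {n m : Type*} (c : Fin 6 → ℂ) (M : E3 → Matrix n m ℂ) (z : E3) (i : n)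
    (j : m) : vdm c M z i j = vd c (fun y => M y i j) z := rfl

theorem vdm_eq {n m : Type*} [Fintype n] [Fintype m] (c : Fin 6 → ℂ) (M : E3 → Matrix n m ℂ) (z : E3) :
    vdm c M z = ∑ k, c k • pdm k M z := by
  ext i j
  simp [vd, Matrix.sum_apply]

theorem vdm_congr {n m : Type*} {M M' : E3 → Matrix n m ℂ} (h : M =ᶠ[𝓝 z] M') :
    vdm c M z = vdm c M' z := by
  ext i j
  exact vd_congr c (h.mono fun y hy => by simp only [hy])

theorem vdm_transpose {n m : Type*} (M : E3 → Matrix n m ℂ) :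
    vdm c (fun y => (M y)ᵀ) z = (vdm c M z)ᵀ := rfl

theorem vdm_const {n m : Type*} (M : Matrix n m ℂ) : vdm c (fun _ => M) z = 0 := by
  ext i j
  exact vd_const c _

theorem vdm_mul {n m l : Type*} [Fintype n] [Fintype m] [Fintype l] {M : E3 → Matrix n m ℂ}
    {M' : E3 → Matrix m l ℂ} (h : MatDiff M z)
    (h' : MatDiff M' z) :
    vdm c (fun y => M y * M' y) z = vdm c M z * M' z + M z * vdm c M' z := by
  ext i j
  simp only [Matrix.add_apply, Matrix.mul_apply, vdm_apply]
  rw [vd_sum c fun x _ => (h i x).fun_mul (h' x j), ← sum_add_distrib]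
  refine sum_ext fun x => ?_
  rw [vd_mul c (h i x) (h' x j)]
  ring

theorem vdm_sub {n m : Type*} {M M' : E3 → Matrix n m ℂ} (h : MatDiff M z)
    (h' : MatDiff M' z) :
    vdm c (fun y => M y - M' y) z = vdm c M z - vdm c M' z := by
  ext i j
  exact vd_sub c (h i j) (h' i j)

theorem vdm_neg {n m : Type*} (M : E3 → Matrix n m ℂ) :
    vdm c (fun y => -M y) z = -vdm c M z := by
  ext i j
  simp [vd, pd_neg, sum_neg_distrib]

theorem vdm_inv {n : Type*} [Fintype n] [DecidableEq n] {M : E3 → Matrix n n ℂ} (h : MatDiff M z)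
    (hd : (M z).det ≠ 0) :
    vdm c (fun y => (M y)⁻¹) z = -((M z)⁻¹ * vdm c M z * (M z)⁻¹) := by
  simp [vdm_eq, pdm_inv _ h hd, sum_neg_distrib, Matrix.mul_sum, Matrix.sum_mul]

theorem vdm_blk (A B C D : E3 → Mat3) : vdm c (fun y => KS.blk (A y) (B y) (C y) (D y)) z
      = KS.blk (vdm c A z) (vdm c B z) (vdm c C z) (vdm c D z) := by
  refine six_matrix_ext ?_ ?_ ?_ ?_ <;> intro i j <;> simp

theorem vd_det {M : E3 → Mat3} (h : MatDiff M z) (hd : (M z).det ≠ 0) :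
    vd c (fun y => (M y).det) z = (M z).det * ((M z)⁻¹ * vdm c M z).trace := by
  simp only [vd, pd_det _ h hd, vdm_eq, Matrix.mul_smul, Matrix.trace_sum, Matrix.trace_smul,
    smul_eq_mul, mul_sum]
  exact sum_ext fun k => by ring

theorem der_add (A B : Mat6) : der (A + B) = der A + der B := by
  simp [der, add_smul, sum_add_distrib]

theorem der_smul (r : ℂ) (A : Mat6) : der (r • A) = r • der A := by
  simp [der, mul_smul, smul_sum]

theorem der_neg (A : Mat6) : der (-A) = -der A := by
  rw [← neg_one_smul ℂ A, der_smul, neg_one_smul ℂ (der A)]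

theorem der_zero : der 0 = 0 := by simp [der]

theorem der_sum {ι : Type*} (s : Finset ι) (A : ι → Mat6) :
    der (∑ i ∈ s, A i) = ∑ i ∈ s, der (A i) := by
  induction s using Finset.cons_induction with
  | empty => simp [der_zero]
  | cons i s hi ih => rw [Finset.sum_cons, Finset.sum_cons, der_add, ih]

theorem vd_gs {M : E3 → Mat6} (h : MatDiff M z)
    (hd : (M z).det ≠ 0) {a : E3 → Gr} (ha : RDiffAt a z) :
    vd c (fun y => gs (M y) (a y)) z
      = gs (M z) (vd c a z + der ((M z)⁻¹ * vdm c M z) (a z)) := by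
  simp [vd, pd_gs _ h hd ha, vdm_eq, Matrix.mul_sum, der_sum, der_smul, smul_add, sum_add_distrib]

end Directional

theorem der_blk_diag (A D : Mat3) (x : Gr) :
    der (blk A 0 0 D) x = ∑ i, ∑ j, A i j • mg (th i) (dg (th j) x)
      + ∑ i, ∑ j, D i j • mg (et i) (dg (et j) x) := by
  simp [der_apply, sum_six]

/-- A symmetric sum of products of anticommuting generators vanishes. -/
theorem sum_mg_mg_symm {ι : Type*} [Fintype ι] (u : ι → Fin 6) (f : ι → ι → ℂ)
    (hf : ∀ k l, f k l = f l k) (x : Gr) :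
    ∑ k, ∑ l, f k l • mg (u k) (mg (u l) x) = 0 := by
  refine self_eq_neg.1 ?_
  conv_lhs => rw [sum_comm]
  rw [← sum_neg_distrib]
  refine sum_ext fun k => ?_
  rw [← sum_neg_distrib]
  refine sum_ext fun l => ?_
  rw [mg_mg, smul_neg, hf]

theorem sum_dg_dg_symm {ι : Type*} [Fintype ι] (u : ι → Fin 6) (f : ι → ι → ℂ)
    (hf : ∀ k l, f k l = f l k) (x : Gr) :
    ∑ k, ∑ l, f k l • dg (u k) (dg (u l) x) = 0 := by
  refine self_eq_neg.1 ?_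
  conv_lhs => rw [sum_comm]
  rw [← sum_neg_distrib]
  refine sum_ext fun k => ?_
  rw [← sum_neg_distrib]
  refine sum_ext fun l => ?_
  rw [dg_dg, smul_neg, hf]

theorem sum_rotate {ι κ μ M : Type*} [Fintype ι] [Fintype κ] [Fintype μ] [AddCommMonoid M]
    (f : ι → κ → μ → M) : ∑ i, ∑ k, ∑ p, f i k p = ∑ k, ∑ p, ∑ i, f i k p := by
  rw [sum_comm]
  exact sum_ext fun k => sum_comm

/-- The degree of a generator in the generators of first kind. -/
def wth (k : Fin 6) : ℤ :=
  Fin.addCases (m := 3) (n := 3) (motive := fun _ => ℤ) (fun _ => 1) (fun _ => 0) k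

/-- The degree of a generator in the generators of second kind. -/
def wet (k : Fin 6) : ℤ :=
  Fin.addCases (m := 3) (n := 3) (motive := fun _ => ℤ) (fun _ => 0) (fun _ => 1) k

@[simp] theorem wth_th (i : Fin 3) : wth (th i) = 1 := addCases_th _ _ _
@[simp] theorem wth_et (i : Fin 3) : wth (et i) = 0 := addCases_et _ _ _
@[simp] theorem wet_th (i : Fin 3) : wet (th i) = 0 := addCases_th _ _ _
@[simp] theorem wet_et (i : Fin 3) : wet (et i) = 1 := addCases_et _ _ _

theorem hasBideg_mg (k : Fin 6) : HasBideg (mg k) (wth k) (wet k) := by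
  revert k
  refine six_cases (fun i => ?_) (fun i => ?_)
  · simpa using hasBideg_mg_th i
  · simpa using hasBideg_mg_et i

theorem hasBideg_dg (k : Fin 6) : HasBideg (dg k) (-wth k) (-wet k) := by
  revert k
  refine six_cases (fun i => ?_) (fun i => ?_)
  · simpa using hasBideg_dg_th i
  · simpa using hasBideg_dg_et i

theorem HasBideg.bicomp_eq {T : EndGr} {r s : ℤ} (h : HasBideg T r s) (r' s' : ℕ) :
    bicomp r' s' T = if (r' : ℤ) = r ∧ (s' : ℤ) = s then T else 0 := by
  split_ifs with hh
  · obtain ⟨rfl, rfl⟩ := hh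
    exact h.bicomp_self
  · refine h.bicomp_of_ne ?_
    rwa [not_and_or] at hh

theorem bicomp_mg (r s : ℕ) (k : Fin 6) :
    bicomp r s (mg k) = if (r : ℤ) = wth k ∧ (s : ℤ) = wet k then mg k else 0 :=
  (hasBideg_mg k).bicomp_eq r s

theorem bicomp_mmd (r s : ℕ) (b c a : Fin 6) :
    bicomp r s (mg b * (mg c * dg a)) = if (r : ℤ) = wth b + (wth c + -wth a)
      ∧ (s : ℤ) = wet b + (wet c + -wet a) then mg b * (mg c * dg a) else 0 :=
  ((hasBideg_mg b).mul ((hasBideg_mg c).mul (hasBideg_dg a))).bicomp_eq r s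

namespace Geom

variable (Y : Geom) {z : E3}

/-- The coefficients of the vector field `e_b`. -/
def col (z : E3) (b : Fin 6) : Fin 6 → ℂ := fun k => Y.frame z k b

theorem eTh_eq {V : Type*} [NormedAddCommGroup V] [NormedSpace ℝ V] [NormedSpace ℂ V]
    (i : Fin 3) (f : E3 → V) (z : E3) : Y.eTh i f z = vd (Y.col z (th i)) f z := by
  simp [eTh, vd, col, frame, sum_six, one_apply, ite_smul]

theorem eEt_eq {V : Type*} [NormedAddCommGroup V] [NormedSpace ℝ V] [NormedSpace ℂ V]
    (i : Fin 3) (f : E3 → V) (z : E3) : Y.eEt i f z = vd (Y.col z (et i)) f z := by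
  simp [eEt, vd, col, frame, sum_six, one_apply, ite_smul, add_comm]

theorem det_pairingBar (z : E3) : (Y.pairingBar z).det = (Y.pairing z).det :=
  Matrix.det_one_sub_mul_comm _ _

theorem det_frame (z : E3) : (Y.frame z).det = (Y.pairing z).det := by
  rw [frame, blk_det, Matrix.det_fromBlocks_one₁₁, ← det_pairingBar, pairingBar]

variable {Y} {a b : E3 → Gr}

theorem matDiff_frame (hφ : MatDiff Y.φ z) (hψ : MatDiff Y.ψ z) : MatDiff Y.frame z :=
  (mdiff_const 1).blk hφ hψ (mdiff_const 1)

theorem matDiff_pairing (hφ : MatDiff Y.φ z) (hψ : MatDiff Y.ψ z) : MatDiff Y.pairing z :=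
  (mdiff_const 1).sub (hφ.mul hψ)

theorem matDiff_pairingBar (hφ : MatDiff Y.φ z) (hψ : MatDiff Y.ψ z) : MatDiff Y.pairingBar z :=
  (mdiff_const 1).sub (hψ.mul hφ)

/-- The exterior derivative in the frame. -/
theorem frameD_eq (hφ : MatDiff Y.φ z) (hψ : MatDiff Y.ψ z) (hd : (Y.pairing z).det ≠ 0)
    (ha : RDiffAt a z) :
    Y.frameD a z = ∑ b, mg b (vd (Y.col z b) a z
      - der ((Y.frame z)⁻¹ * vdm (Y.col z b) Y.frame z)ᵀ (a z)) := by
  have hF : MatDiff Y.frame z := matDiff_frame hφ hψ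
  have hFd : (Y.frame z).det ≠ 0 := by rwa [det_frame]
  have hu : IsUnit (Y.frame z).det := isUnit_iff_ne_zero.2 hFd
  set M : E3 → Mat6 := fun y => ((Y.frame y)⁻¹)ᵀ with hM
  have hMd : (M z).det ≠ 0 := by
    rw [hM, det_transpose, Matrix.det_nonsing_inv, Ring.inverse_eq_inv']
    exact inv_ne_zero hFd
  have hMinv : (M z)⁻¹ = (Y.frame z)ᵀ := by
    refine Matrix.inv_eq_right_inv ?_
    rw [hM, ← transpose_mul, mul_nonsing_inv _ hu, transpose_one]
  have hMd' : MatDiff M z := (hF.inv hFd).transpose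
  change gs (Y.frame z)ᵀ (∑ k, mg k (pd k (fun y => gs (M y) (a y)) z)) = _
  have h1 : ∀ k, (M z)⁻¹ * pdm k M z = -((Y.frame z)⁻¹ * pdm k Y.frame z)ᵀ := by
    intro k
    rw [hM, pdm_transpose, pdm_inv k hF hFd, ← hM, hMinv, ← transpose_mul, neg_mul, mul_assoc,
      mul_assoc, nonsing_inv_mul _ hu, mul_one, transpose_neg]
  have h2 : ∀ x, gs (Y.frame z)ᵀ (gs (M z) x) = x := by
    intro x
    rw [← gs_mul, ← hMinv, nonsing_inv_mul _ (isUnit_iff_ne_zero.2 hMd), gs_one]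
  simp only [map_sum, gs_mg, pd_gs _ hMd' hMd ha, h1, h2, transpose_apply]
  rw [sum_comm]
  refine sum_ext fun b => ?_
  simp [col, vd, vdm_eq, Matrix.mul_sum, Matrix.transpose_sum,
    Matrix.transpose_smul, der_sum, der_smul, der_neg, smul_add, sub_eq_add_neg, sum_add_distrib,
    sum_neg_distrib]

theorem inv_frame (hd : (Y.pairing z).det ≠ 0) : (Y.frame z)⁻¹
    = blk (Y.matN z) (-(Y.matN z * Y.φ z)) (-(Y.matNbar z * Y.ψ z)) (Y.matNbar z) := by
  have hu : IsUnit (Y.pairing z).det := isUnit_iff_ne_zero.2 hd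
  have hu' : IsUnit (Y.pairingBar z).det := by rwa [det_pairingBar]
  refine inv_eq_left_inv ?_
  have h1 : Y.matN z * Y.pairing z = 1 := nonsing_inv_mul _ hu
  have h2 : Y.matNbar z * Y.pairingBar z = 1 := nonsing_inv_mul _ hu'
  simp only [pairing, pairingBar, mul_sub, mul_one] at h1 h2
  rw [frame, blk_mul, ← blk_one]
  congr 1
  · rw [mul_one, ← h1, neg_mul, mul_assoc, sub_eq_add_neg]
  · simp
  · simp
  · rw [mul_one, ← h2, neg_mul, mul_assoc, sub_eq_add_neg, add_comm]

theorem inv_frame_mul (hd : (Y.pairing z).det ≠ 0) (c : Fin 6 → ℂ) : (Y.frame z)⁻¹ * vdm c Y.frame z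
      = blk (-(Y.matN z * Y.φ z * vdm c Y.ψ z)) (Y.matN z * vdm c Y.φ z)
        (Y.matNbar z * vdm c Y.ψ z) (-(Y.matNbar z * Y.ψ z * vdm c Y.φ z)) := by
  have : vdm c Y.frame z = blk 0 (vdm c Y.φ z) (vdm c Y.ψ z) 0 := by
    change vdm c (fun y => blk 1 (Y.φ y) (Y.ψ y) 1) z = _
    rw [vdm_blk c (fun _ => 1) Y.φ Y.ψ (fun _ => 1), vdm_const]
  rw [this, inv_frame hd, blk_mul]
  simp

/-- The term of order zero of the exterior derivative in the frame. -/
def torsion (Y : Geom) (z : E3) : EndGr :=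
  ∑ b, ∑ c, ∑ a, ((Y.frame z)⁻¹ * vdm (Y.col z b) Y.frame z) a c • (mg b * (mg c * dg a))

theorem frameD_eq' (hφ : MatDiff Y.φ z) (hψ : MatDiff Y.ψ z) (hd : (Y.pairing z).det ≠ 0)
    (ha : RDiffAt a z) :
    Y.frameD a z = ∑ b, mg b (vd (Y.col z b) a z) - Y.torsion z (a z) := by
  rw [frameD_eq hφ hψ hd ha, torsion]
  simp only [map_sub, sum_sub_distrib, der_apply, map_sum, map_smul, LinearMap.sum_apply,
    LinearMap.smul_apply, Module.End.mul_apply, transpose_apply]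

theorem frameD_bicomp (hφ : MatDiff Y.φ z) (hψ : MatDiff Y.ψ z) (hd : (Y.pairing z).det ≠ 0)
    (ha : RDiffAt a z) (r s : ℕ) :
    ∑ p ∈ Finset.range 4, ∑ q ∈ Finset.range 4,
      proj (p + r) (q + s) (Y.frameD (fun y => proj p q (a y)) z)
    = ∑ b, bicomp r s (mg b) (vd (Y.col z b) a z)
      - bicomp r s (Y.torsion z) (a z) := by
  have h1 : ∀ p q, Y.frameD (fun y => pr p q (a y)) z
      = ∑ b, mg b (pr p q (vd (Y.col z b) a z)) - Y.torsion z (pr p q (a z)) := by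
    intro p q
    rw [frameD_eq' hφ hψ hd (differentiableAt_lin (pr p q) ha)]
    simp [vd_lin _ (pr p q) ha]
  simp only [proj_eq, h1, map_sub, map_sum, sum_sub_distrib, bicomp_apply]
  congr 1
  have h3 : ∀ p ∈ Finset.range 4, (∑ q ∈ Finset.range 4, ∑ b,
      pr (p + r) (q + s) (mg b (pr p q (vd (Y.col z b) a z))))
      = ∑ b, ∑ q ∈ Finset.range 4, pr (p + r) (q + s)
        (mg b (pr p q (vd (Y.col z b) a z))) := fun p _ => sum_comm
  rw [sum_congr rfl h3, sum_comm]

theorem matN_mul_symM (Y : Geom) (z : E3) (p i k : Fin 3) : ∑ s, Y.matN z p s * Y.symM s i k z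
    = (Y.matN z * vdm (Y.col z (th i)) Y.φ z) p k
      + (Y.matN z * Y.φ z * vdm (Y.col z (et k)) Y.ψ z) p i := by
  rw [mul_assoc]
  simp [Matrix.mul_apply, ← eTh_eq, ← eEt_eq, symM, mul_add, sum_add_distrib]

theorem matNbar_mul_symMbar (Y : Geom) (z : E3) (j k i : Fin 3) :
    ∑ m, Y.matNbar z j m * Y.symMbar m k i z
    = (Y.matNbar z * vdm (Y.col z (et k)) Y.ψ z) j i
      + (Y.matNbar z * Y.ψ z * vdm (Y.col z (th i)) Y.φ z) j k := by
  rw [mul_assoc]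
  simp [Matrix.mul_apply, ← eTh_eq, ← eEt_eq, symMbar, mul_add, sum_add_distrib]

theorem sum_mg_mg_dg_symm (u : Fin 3 → Fin 6) {A : Fin 3 → Mat3} (h : ∀ k j l, A k j l = A l j k)
    (x : Gr) : ∑ k, ∑ l, ∑ j, A k j l • mg (u k) (mg (u l) (dg (u j) x)) = 0 := by
  rw [sum_ext fun k => sum_comm, sum_comm]
  exact sum_eq_zero fun j _ => sum_mg_mg_symm _ _ (fun k l => h k j l) _

theorem delBar_eq (hφ : MatDiff Y.φ z) (hψ : MatDiff Y.ψ z) (hd : (Y.pairing z).det ≠ 0)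
    (hks : ∀ k l m, Y.eEt k (fun y => Y.φ y m l) z = Y.eEt l (fun y => Y.φ y m k) z)
    (ha : RDiffAt a z) :
    Y.delBar a z = ∑ k, mg (et k) (Y.eEt k a z
      + ∑ p, ∑ i, (∑ s, Y.matN z p s * Y.symM s i k z) • mg (th i) (dg (th p) (a z))) := by
  have h0 : Y.delBar a z = _ := frameD_bicomp hφ hψ hd ha 0 1
  rw [h0, torsion]
  have hz := sum_mg_mg_dg_symm et (A := fun k => -(Y.matNbar z * Y.ψ z * vdm (Y.col z (et k)) Y.φ z))
    (fun k j l => by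
      rw [Matrix.neg_apply, Matrix.neg_apply, Matrix.mul_apply, Matrix.mul_apply]
      simp only [vdm_apply, ← eEt_eq, hks k l]) (a z)
  simp only [inv_frame_mul hd, sum_six, map_add, map_sum, map_smul, bicomp_mg, bicomp_mmd,
    blk_th_th, blk_th_et, blk_et_th, blk_et_et, wth_th, wth_et, wet_th, wet_et]
  simp only [LinearMap.add_apply, LinearMap.sum_apply, LinearMap.smul_apply]
  norm_num
  simp only [Matrix.neg_apply, neg_smul, sum_neg_distrib, neg_eq_zero] at hz
  simp only [matN_mul_symM, add_smul, sum_add_distrib, sum_neg_distrib, hz, ← eEt_eq]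
  rw [sum_rotate fun x k p => (Y.matN z * vdm (Y.col z (th x)) Y.φ z) p k •
    mg (th x) (mg (et k) (dg (th p) (a z)))]
  simp only [mg_mg (th _) (et _), smul_neg, sum_neg_distrib]
  have := fun k : Fin 3 => sum_comm (s := univ) (t := univ) (f := fun i p =>
    (Y.matN z * Y.φ z * vdm (Y.col z (et k)) Y.ψ z) p i • mg (et k) (mg (th i) (dg (th p) (a z))))
  simp only [this]
  abel

theorem del_eq (hφ : MatDiff Y.φ z) (hψ : MatDiff Y.ψ z) (hd : (Y.pairing z).det ≠ 0)
    (hks : ∀ i l m, Y.eTh i (fun y => Y.ψ y m l) z = Y.eTh l (fun y => Y.ψ y m i) z)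
    (ha : RDiffAt a z) :
    Y.del a z = ∑ i, mg (th i) (Y.eTh i a z
      + ∑ j, ∑ k, (∑ m, Y.matNbar z j m * Y.symMbar m k i z) • mg (et k) (dg (et j) (a z))) := by
  have h0 : Y.del a z = _ := frameD_bicomp hφ hψ hd ha 1 0
  rw [h0, torsion]
  have hz := sum_mg_mg_dg_symm th (A := fun k => -(Y.matN z * Y.φ z * vdm (Y.col z (th k)) Y.ψ z))
    (fun k j l => by
      rw [Matrix.neg_apply, Matrix.neg_apply, Matrix.mul_apply, Matrix.mul_apply]
      simp only [vdm_apply, ← eTh_eq, hks k l]) (a z)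
  simp only [inv_frame_mul hd, sum_six, map_add, map_sum, map_smul, bicomp_mg, bicomp_mmd,
    blk_th_th, blk_th_et, blk_et_th, blk_et_et, wth_th, wth_et, wet_th, wet_et]
  simp only [LinearMap.add_apply, LinearMap.sum_apply, LinearMap.smul_apply]
  norm_num
  simp only [Matrix.neg_apply, neg_smul, sum_neg_distrib, neg_eq_zero] at hz
  simp only [matNbar_mul_symMbar, add_smul, sum_add_distrib, sum_neg_distrib, hz, ← eTh_eq]
  rw [sum_rotate fun x k p => (Y.matNbar z * vdm (Y.col z (et x)) Y.ψ z) p k •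
    mg (et x) (mg (th k) (dg (et p) (a z)))]
  simp only [mg_mg (et _) (th _), smul_neg, sum_neg_distrib]
  have := fun k : Fin 3 => sum_comm (s := univ) (t := univ) (f := fun i p =>
    (Y.matNbar z * Y.ψ z * vdm (Y.col z (th k)) Y.φ z) p i • mg (th k) (mg (et i) (dg (et p) (a z))))
  simp only [this]
  abel

end Geom

namespace Geom

variable {Y : Geom} {z : E3} {a b : E3 → Gr}

/-- The matrix of the change from the coframe `f` to the coframe `F`. -/
def tmat (Y : Geom) (z : E3) : Mat6 := blk 1 0 0 (Y.pairingBar z)ᵀ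

theorem matDiff_tmat (hφ : MatDiff Y.φ z) (hψ : MatDiff Y.ψ z) : MatDiff Y.tmat z :=
  (mdiff_const 1).blk (mdiff_const 0) (mdiff_const 0) (matDiff_pairingBar hφ hψ).transpose

theorem det_tmat (Y : Geom) (z : E3) : (Y.tmat z).det = (Y.pairing z).det := by
  rw [tmat, blk_det, det_fromBlocks_zero₂₁, Matrix.det_one, one_mul, det_transpose, det_pairingBar]

theorem inv_tmat (hd : (Y.pairing z).det ≠ 0) :
    (Y.tmat z)⁻¹ = blk 1 0 0 (Y.matNbar z)ᵀ := by
  have hu' : IsUnit (Y.pairingBar z).det := by rw [det_pairingBar]; exact isUnit_iff_ne_zero.2 hd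
  refine inv_eq_left_inv ?_
  rw [tmat, blk_mul, ← transpose_mul, matNbar, mul_nonsing_inv _ hu']
  simp [blk_one]

theorem ofDual_eq (hd : (Y.pairing z).det ≠ 0) (a : E3 → Gr) :
    Y.ofDual a z = gs (Y.tmat z)⁻¹ (a z) := by
  rw [inv_tmat hd]; rfl

theorem rho_eq (a : E3 → Gr) (z : E3) : Y.rho a z = Y.omegaCoeff z • rh (a z) := rfl

theorem rhoInv_eq (a : E3 → Gr) (z : E3) : Y.rhoInv a z = (Y.omegaCoeff z)⁻¹ • rhi (a z) := rfl

theorem pairing_mul_matN (hd : (Y.pairing z).det ≠ 0) : Y.pairing z * Y.matN z = 1 :=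
  mul_nonsing_inv _ (isUnit_iff_ne_zero.2 hd)

theorem matN_mul_pairing (hd : (Y.pairing z).det ≠ 0) : Y.matN z * Y.pairing z = 1 :=
  nonsing_inv_mul _ (isUnit_iff_ne_zero.2 hd)

theorem pairingBar_mul_matNbar (hd : (Y.pairing z).det ≠ 0) : Y.pairingBar z * Y.matNbar z = 1 :=
  mul_nonsing_inv _ (by rw [det_pairingBar]; exact isUnit_iff_ne_zero.2 hd)

theorem φ_mul_matNbar (hd : (Y.pairing z).det ≠ 0) :
    Y.φ z * Y.matNbar z = Y.matN z * Y.φ z := by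
  have h : Y.pairing z * Y.φ z = Y.φ z * Y.pairingBar z := by
    simp [pairing, pairingBar, mul_sub, sub_mul, mul_assoc]
  calc Y.φ z * Y.matNbar z = Y.matN z * (Y.pairing z * Y.φ z) * Y.matNbar z := by
        rw [← mul_assoc (Y.matN z), matN_mul_pairing hd, one_mul]
    _ = Y.matN z * Y.φ z := by
        rw [h, mul_assoc, mul_assoc, pairingBar_mul_matNbar hd, mul_one]

theorem gs_inv_tmat_tmat (hd : (Y.pairing z).det ≠ 0) (x : Gr) :
    gs (Y.tmat z)⁻¹ (gs (Y.tmat z) x) = x := by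
  rw [← gs_mul, nonsing_inv_mul _ (isUnit_iff_ne_zero.2 (by rwa [det_tmat])), gs_one]

theorem gs_tmat_inv_tmat (hd : (Y.pairing z).det ≠ 0) (x : Gr) :
    gs (Y.tmat z) (gs (Y.tmat z)⁻¹ x) = x := by
  rw [← gs_mul, mul_nonsing_inv _ (isUnit_iff_ne_zero.2 (by rwa [det_tmat])), gs_one]

theorem mg_th_tmat (i : Fin 3) (x : Gr) : mg (th i) (gs (Y.tmat z) x) = gs (Y.tmat z) (mg (th i) x) := by
  simp [gs_mg, sum_six, tmat, one_apply, ite_smul]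

theorem dg_th_tmat (i : Fin 3) (x : Gr) : dg (th i) (gs (Y.tmat z) x) = gs (Y.tmat z) (dg (th i) x) := by
  simp [dg_gs, sum_six, tmat, one_apply, ite_smul]

theorem gs_inv_tmat_mg_et (hd : (Y.pairing z).det ≠ 0) (k : Fin 3) (x : Gr) :
    gs (Y.tmat z)⁻¹ (mg (et k) x) = ∑ r, Y.matNbar z k r • mg (et r) (gs (Y.tmat z)⁻¹ x) := by
  simp [gs_mg, sum_six, inv_tmat hd]

theorem dg_et_tmat (j : Fin 3) (x : Gr) :
    dg (et j) (gs (Y.tmat z) x) = ∑ b, Y.pairingBar z b j • gs (Y.tmat z) (dg (et b) x) := by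
  simp [dg_gs, sum_six, tmat]

theorem der_tmat (hφ : MatDiff Y.φ z) (hψ : MatDiff Y.ψ z) (hd : (Y.pairing z).det ≠ 0)
    (c : Fin 6 → ℂ) (x : Gr) :
    der ((Y.tmat z)⁻¹ * vdm c Y.tmat z) x
      = -(∑ l, ∑ j, ((vdm c Y.ψ z * Y.φ z + Y.ψ z * vdm c Y.φ z) * Y.matNbar z) j l •
        mg (et l) (dg (et j) x)) := by
  have h1 : vdm c Y.pairingBar z = -(vdm c Y.ψ z * Y.φ z + Y.ψ z * vdm c Y.φ z) := by
    change vdm c (fun y => 1 - Y.ψ y * Y.φ y) z = _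
    rw [vdm_sub c (mdiff_const 1) (hψ.mul hφ), vdm_const, vdm_mul c hψ hφ, zero_sub]
  have h2 : vdm c Y.tmat z = blk 0 0 0 (vdm c Y.pairingBar z)ᵀ := by
    change vdm c (fun y => blk 1 0 0 (Y.pairingBar y)ᵀ) z = _
    rw [vdm_blk c (fun _ => 1) (fun _ => 0) (fun _ => 0) (fun y => (Y.pairingBar y)ᵀ),
      vdm_const, vdm_const, vdm_transpose]
  rw [h2, inv_tmat hd, blk_mul]
  simp only [mul_zero, add_zero, zero_add, zero_mul, ← transpose_mul, h1, der_blk_diag,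
    transpose_apply, neg_mul, Matrix.neg_apply, neg_smul, sum_neg_distrib, Matrix.zero_apply,
    zero_smul, sum_const_zero]

theorem differentiableAt_omegaCoeff (hs : RDiffAt Y.s z) (hφ : MatDiff Y.φ z)
    (hψ : MatDiff Y.ψ z) : RDiffAt Y.omegaCoeff z :=
  hs.fun_mul (matDiff_pairing hφ hψ).det

/-- `e_{k̄} w = - w tr(N M_k)` for the coefficient `w` of the holomorphic three-form. -/
theorem eEt_omegaCoeff (hs : DifferentiableAt ℂ Y.s z) (hφ : MatDiff Y.φ z)
    (hψ : MatDiff Y.ψ z) (hd : (Y.pairing z).det ≠ 0)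
    (hks : ∀ k l m, Y.eEt k (fun y => Y.φ y m l) z = Y.eEt l (fun y => Y.φ y m k) z)
    (hdiv : ∀ k, ∑ l, pd (th l) (fun y => Y.s y * Y.φ y l k) z = 0) (k : Fin 3) :
    Y.eEt k Y.omegaCoeff z
      + Y.omegaCoeff z * ∑ p, ∑ s, Y.matN z p s * Y.symM s p k z = 0 := by
  have hs' : RDiffAt Y.s z := hs.restrictScalars ℝ
  have hP := matDiff_pairing hφ hψ
  have h1 : Y.eEt k Y.omegaCoeff z = Y.s z * (Y.pairing z).det *
      (Y.matN z * vdm (Y.col z (et k)) Y.pairing z).trace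
      + Y.eEt k Y.s z * (Y.pairing z).det := by
    rw [eEt_eq, eEt_eq]
    change vd _ (fun y => Y.s y * (Y.pairing y).det) z = _
    rw [vd_mul _ hs' hP.det, vd_det _ hP hd, matN]
    ring
  have h2 : Y.eEt k Y.s z = -(Y.s z * ∑ l, pd (th l) (fun y => Y.φ y l k) z) := by
    have := hdiv k
    simp only [pd_mul _ hs' (hφ _ k), sum_add_distrib, ← mul_sum] at this
    rw [eEt, pd_et_of_holomorphic hs, zero_add, eq_neg_iff_add_eq_zero, ← this, add_comm]
    congr 1
    exact sum_ext fun l => by rw [smul_eq_mul, mul_comm]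
  have h3 : vdm (Y.col z (et k)) Y.pairing z
      = -(vdm (Y.col z (et k)) Y.φ z * Y.ψ z + Y.φ z * vdm (Y.col z (et k)) Y.ψ z) := by
    change vdm _ (fun y => 1 - Y.φ y * Y.ψ y) z = _
    rw [vdm_sub _ (mdiff_const 1) (hφ.mul hψ), vdm_const, vdm_mul _ hφ hψ, zero_sub]
  have h4 : (∑ p, ∑ s, Y.matN z p s * Y.symM s p k z)
      = ∑ p, ∑ s, Y.matN z p s * Y.eTh p (fun y => Y.φ y s k) z
        + (Y.matN z * (Y.φ z * vdm (Y.col z (et k)) Y.ψ z)).trace := by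
    simp only [matN_mul_symM, sum_add_distrib, mul_assoc]
    congr 1
    simp [Matrix.mul_apply, eTh_eq]
  have h5 : (Y.matN z * (vdm (Y.col z (et k)) Y.φ z * Y.ψ z)).trace
      = ∑ p, ∑ s, Y.matN z p s * ∑ m, Y.ψ z m p * Y.eEt m (fun y => Y.φ y s k) z := by
    simp only [Matrix.trace, Matrix.diag_apply, Matrix.mul_apply, vdm_apply, ← eEt_eq]
    refine sum_ext fun p => sum_ext fun s => ?_
    congr 1
    exact sum_ext fun m => by rw [hks k m s, mul_comm]
  have h6 : ∑ p, ∑ s, Y.matN z p s * Y.eTh p (fun y => Y.φ y s k) z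
      - (Y.matN z * (vdm (Y.col z (et k)) Y.φ z * Y.ψ z)).trace
      = ∑ l, pd (th l) (fun y => Y.φ y l k) z := by
    rw [h5, ← sum_sub_distrib]
    have e1 : ∀ p s, Y.eTh p (fun y => Y.φ y s k) z
        - ∑ m, Y.ψ z m p * Y.eEt m (fun y => Y.φ y s k) z
        = ∑ l, Y.pairing z l p * pd (th l) (fun y => Y.φ y s k) z := by
      intro p s
      simp only [eTh, eEt, smul_eq_mul, pairing, Matrix.sub_apply, sub_mul, sum_sub_distrib,
        mul_add, sum_add_distrib, one_apply, ite_mul, one_mul, zero_mul, sum_ite_eq', mem_univ,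
        if_true, Matrix.mul_apply, sum_mul, mul_sum]
      rw [sum_comm]
      have : ∀ m l : Fin 3, Y.ψ z m p * (Y.φ z l m * pd (th l) (fun y => Y.φ y s k) z)
        = Y.φ z l m * Y.ψ z m p * pd (th l) (fun y => Y.φ y s k) z := fun m l => by ring
      simp only [this]
      ring
    simp only [← sum_sub_distrib, ← mul_sub, e1]
    simp only [mul_sum]
    have e2 : ∑ p, ∑ s, ∑ l, Y.matN z p s * (Y.pairing z l p * pd (th l) (fun y => Y.φ y s k) z)
        = ∑ s, ∑ l, (Y.pairing z * Y.matN z) l s * pd (th l) (fun y => Y.φ y s k) z := by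
      rw [sum_rotate]
      simp only [Matrix.mul_apply, sum_mul]
      refine sum_ext fun s => sum_ext fun l =>
        sum_ext fun p => by ring
    rw [e2, pairing_mul_matN hd]
    simp [one_apply]
  rw [h1, h2, h3, h4, ← h6, omegaCoeff, mul_neg, Matrix.trace_neg, mul_add, Matrix.trace_add]
  ring

theorem sum_frame_φ_symm
    (hks : ∀ k l m, Y.eEt k (fun y => Y.φ y m l) z = Y.eEt l (fun y => Y.φ y m k) z) (x : Gr) :
    ∑ k, ∑ r, Y.matNbar z k r • mg (et r)
      (∑ l, ∑ j, (Y.ψ z * vdm (Y.col z (et k)) Y.φ z * Y.matNbar z) j l •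
        mg (et l) (dg (et j) x)) = 0 := by
  have h1 : ∀ j, ∑ r, ∑ l, (∑ k, Y.matNbar z k r *
      (Y.ψ z * vdm (Y.col z (et k)) Y.φ z * Y.matNbar z) j l) •
        mg (et r) (mg (et l) (dg (et j) x)) = 0 := by
    intro j
    refine sum_mg_mg_symm _ _ (fun r l => ?_) _
    simp only [Matrix.mul_apply, vdm_apply, ← eEt_eq, mul_sum, sum_mul]
    rw [sum_comm]
    refine sum_ext fun m => sum_ext fun k =>
      sum_ext fun n => ?_
    rw [hks k m n]
    ring
  calc _ = ∑ j, ∑ r, ∑ l, (∑ k, Y.matNbar z k r *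
      (Y.ψ z * vdm (Y.col z (et k)) Y.φ z * Y.matNbar z) j l) •
        mg (et r) (mg (et l) (dg (et j) x)) := by
        simp only [map_sum, map_smul, smul_sum, smul_smul, sum_smul]
        rw [sum_comm]
        rw [sum_ext fun r => sum_ext fun k => sum_comm]
        rw [sum_ext fun r => sum_comm]
        rw [sum_comm]
        exact sum_ext fun j => sum_ext fun r => sum_comm
    _ = 0 := sum_eq_zero fun j _ => h1 j

/-- The operator `∂̄` on the deformation. -/
theorem opDbar_eq (hs : DifferentiableAt ℂ Y.s z) (hs0 : Y.s z ≠ 0) (hφ : MatDiff Y.φ z)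
    (hψ : MatDiff Y.ψ z) (hd : (Y.pairing z).det ≠ 0)
    (hks : ∀ k l m, Y.eEt k (fun y => Y.φ y m l) z = Y.eEt l (fun y => Y.φ y m k) z)
    (hdiv : ∀ k, ∑ l, pd (th l) (fun y => Y.s y * Y.φ y l k) z = 0)
    (ha : RDiffAt a z) :
    Y.opDbar a z = Y.explDbar a z := by
  have hs' : RDiffAt Y.s z := hs.restrictScalars ℝ
  have hw := differentiableAt_omegaCoeff hs' hφ hψ
  have hw0 : Y.omegaCoeff z ≠ 0 := mul_ne_zero hs0 hd
  have hT := matDiff_tmat hφ hψ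
  have hTd : (Y.tmat z).det ≠ 0 := by rwa [det_tmat]
  have hTa : RDiffAt (fun y => gs (Y.tmat y) (a y)) z := hT.gs ha
  have hrTa := differentiableAt_lin rh hTa
  set w := Y.omegaCoeff with hwdef
  have h0 : Y.rho (Y.toDual a) = fun y => w y • rh (gs (Y.tmat y) (a y)) := rfl
  change Y.ofDual (-(Y.rhoInv (Y.delBar (Y.rho (Y.toDual a))))) z = _
  rw [ofDual_eq hd, Pi.neg_apply, rhoInv_eq, h0, delBar_eq hφ hψ hd hks (hw.fun_smul hrTa)]
  have h1 : ∀ k, Y.eEt k (fun y => w y • rh (gs (Y.tmat y) (a y))) z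
      = w z • rh (gs (Y.tmat z) (Y.eEt k a z
        + der ((Y.tmat z)⁻¹ * vdm (Y.col z (et k)) Y.tmat z) (a z)
        - (∑ p, ∑ s, Y.matN z p s * Y.symM s p k z) • a z)) := by
    intro k
    have e := eEt_omegaCoeff hs hφ hψ hd hks hdiv k
    rw [eEt_eq] at e ⊢
    rw [vd_smul _ hw hrTa, vd_lin _ rh hTa, vd_gs _ hT hTd ha, eEt_eq, eq_neg_of_add_eq_zero_left e]
    simp only [map_sub, map_add, map_smul, smul_sub, smul_add, smul_smul, neg_smul]
    abel
  have h2 : ∀ k p i, (∑ s, Y.matN z p s * Y.symM s i k z) • mg (th i) (dg (th p)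
      (w z • rh (gs (Y.tmat z) (a z))))
      = w z • rh (gs (Y.tmat z) ((∑ s, Y.matN z p s * Y.symM s i k z) •
        ((if i = p then a z else 0) - mg (th p) (dg (th i) (a z))))) := by
    intro k p i
    simp only [map_smul]
    rw [← rh_mg_th, ← rh_dg_th, mg_th_tmat, dg_th_tmat, dg_mg, smul_comm]
    simp [th_inj]
  have h3 : ∀ k, Y.eEt k (fun y => w y • rh (gs (Y.tmat y) (a y))) z
      + ∑ p, ∑ i, (∑ s, Y.matN z p s * Y.symM s i k z) • mg (th i) (dg (th p)
      (w z • rh (gs (Y.tmat z) (a z))))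
      = w z • rh (gs (Y.tmat z) (Y.eEt k a z
        + der ((Y.tmat z)⁻¹ * vdm (Y.col z (et k)) Y.tmat z) (a z)
        - ∑ p, ∑ i, (∑ s, Y.matN z p s * Y.symM s i k z) • mg (th p) (dg (th i) (a z)))) := by
    intro k
    simp only [h1, h2, ← smul_sum, ← map_sum, ← smul_add, ← map_add]
    congr 3
    simp only [smul_sub, sum_sub_distrib, smul_ite, smul_zero, sum_ite_eq', mem_univ, if_true, ←
      sum_smul]
    abel
  simp only [h3, ← hwdef]
  simp only [map_smul, map_sum]
  simp only [← smul_sum, smul_smul, inv_mul_cancel₀ hw0, one_smul]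
  simp only [rhi_mg_et, rhi_rh, sum_neg_distrib, neg_neg, map_sum, gs_inv_tmat_mg_et hd,
    gs_inv_tmat_tmat hd, der_tmat hφ hψ hd]
  unfold explDbar
  simp only [gmul_gen, lder_eq]
  have h4 := sum_frame_φ_symm hks (a z)
  have h5 : ∀ k l j, ∑ i, ∑ m, Y.matN z i m * Y.φ z m l * Y.eEt k (fun y => Y.ψ y j i) z
      = (vdm (Y.col z (et k)) Y.ψ z * Y.φ z * Y.matNbar z) j l := by
    intro k l j
    rw [mul_assoc, φ_mul_matNbar hd]
    simp only [Matrix.mul_apply, vdm_apply, eEt_eq, mul_sum]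
    exact sum_ext fun _ => sum_ext fun _ => by ring
  simp only [h5, add_mul, Matrix.add_apply, add_smul, sum_add_distrib, map_add, map_sub, map_neg,
    smul_add, smul_sub, smul_neg, sum_sub_distrib, sum_neg_distrib, h4, neg_add]
  abel

end Geom

theorem sum_rotate_two {ι κ μ ν M : Type*} [Fintype ι] [Fintype κ] [Fintype μ] [Fintype ν]
    [AddCommMonoid M] (f : ι → κ → μ → ν → M) :
    ∑ j, ∑ k, ∑ l, ∑ b, f j k l b = ∑ l, ∑ b, ∑ k, ∑ j, f j k l b := by
  rw [sum_comm, sum_ext fun k => sum_rotate fun j l b => f j k l b,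
    sum_rotate]

namespace Geom

variable {Y : Geom} {z : E3} {a b : E3 → Gr}

theorem mg_et_tmat (hd : (Y.pairing z).det ≠ 0) (k : Fin 3) (x : Gr) :
    mg (et k) (gs (Y.tmat z) x) = gs (Y.tmat z) (∑ r, Y.matNbar z k r • mg (et r) x) := by
  rw [← gs_tmat_inv_tmat hd (mg (et k) (gs (Y.tmat z) x)), gs_inv_tmat_mg_et hd]
  simp [gs_inv_tmat_tmat hd]

theorem eEt_sub_eTh (f : E3 → ℂ) (k : Fin 3) :
    Y.eEt k f z - ∑ m, Y.φ z m k * Y.eTh m f z = ∑ n, Y.pairingBar z n k * pd (et n) f z := by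
  simp only [eEt, eTh, smul_eq_mul, pairingBar, Matrix.sub_apply, sub_mul, sum_sub_distrib, mul_add,
    sum_add_distrib, one_apply, ite_mul, one_mul, zero_mul, sum_ite_eq', mem_univ, if_true,
    Matrix.mul_apply, sum_mul, mul_sum]
  rw [sum_comm]
  have : ∀ m l : Fin 3, Y.φ z l k * (Y.ψ z m l * pd (et m) f z)
    = Y.ψ z m l * Y.φ z l k * pd (et m) f z := fun m l => by ring
  simp only [this]
  ring

theorem frame_ψ_identity (hd : (Y.pairing z).det ≠ 0)
    (hks : ∀ i l m, Y.eTh i (fun y => Y.ψ y m l) z = Y.eTh l (fun y => Y.ψ y m i) z)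
    (i l b : Fin 3) :
    ∑ k, ∑ j, (∑ m, Y.matNbar z j m * Y.symMbar m k i z) * (Y.matNbar z k l * Y.pairingBar z b j)
      - ((vdm (Y.col z (th i)) Y.ψ z * Y.φ z + Y.ψ z * vdm (Y.col z (th i)) Y.φ z)
        * Y.matNbar z) b l = pd (et l) (fun y => Y.ψ y b i) z := by
  have h1 : ∀ k, ∑ j, (∑ m, Y.matNbar z j m * Y.symMbar m k i z)
      * (Y.matNbar z k l * Y.pairingBar z b j) = Y.symMbar b k i z * Y.matNbar z k l := by
    intro k
    have : ∀ j, (∑ m, Y.matNbar z j m * Y.symMbar m k i z)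
        * (Y.matNbar z k l * Y.pairingBar z b j) = ∑ m, Y.pairingBar z b j * Y.matNbar z j m *
          (Y.symMbar m k i z * Y.matNbar z k l) := by
      intro j
      rw [sum_mul]
      exact sum_ext fun m => by ring
    simp only [this]
    rw [sum_comm]
    simp [← sum_mul, ← Matrix.mul_apply, pairingBar_mul_matNbar hd, one_apply]
  have h2 : ∀ k, Y.symMbar b k i z
      - (vdm (Y.col z (th i)) Y.ψ z * Y.φ z + Y.ψ z * vdm (Y.col z (th i)) Y.φ z) b k
      = ∑ n, Y.pairingBar z n k * pd (et n) (fun y => Y.ψ y b i) z := by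
    intro k
    rw [← eEt_sub_eTh, symMbar, Matrix.add_apply, Matrix.mul_apply, Matrix.mul_apply]
    simp only [vdm_apply, ← eTh_eq]
    simp only [mul_comm (Y.φ z _ _)]
    simp only [hks i _ b]
    ring
  simp only [h1]
  rw [Matrix.mul_apply, ← sum_sub_distrib]
  simp only [← sub_mul, h2, sum_mul]
  rw [sum_comm]
  have : ∀ n k, Y.pairingBar z n k * pd (et n) (fun y => Y.ψ y b i) z * Y.matNbar z k l
      = Y.pairingBar z n k * Y.matNbar z k l * pd (et n) (fun y => Y.ψ y b i) z :=
    fun n k => by ring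
  simp [this, ← sum_mul, ← Matrix.mul_apply, pairingBar_mul_matNbar hd, one_apply]

/-- The operator `Δ` on the deformation. -/
theorem opDelta_eq (hs : RDiffAt Y.s z) (hs0 : Y.s z ≠ 0) (hφ : MatDiff Y.φ z)
    (hψ : MatDiff Y.ψ z) (hd : (Y.pairing z).det ≠ 0)
    (hks : ∀ i l m, Y.eTh i (fun y => Y.ψ y m l) z = Y.eTh l (fun y => Y.ψ y m i) z)
    (ha : RDiffAt a z) :
    Y.opDelta a z = Y.explDelta a z := by
  have hw := differentiableAt_omegaCoeff hs hφ hψ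
  have hw0 : Y.omegaCoeff z ≠ 0 := mul_ne_zero hs0 hd
  have hT := matDiff_tmat hφ hψ
  have hTd : (Y.tmat z).det ≠ 0 := by rwa [det_tmat]
  have hTa : RDiffAt (fun y => gs (Y.tmat y) (a y)) z := hT.gs ha
  have hrTa := differentiableAt_lin rh hTa
  set w := Y.omegaCoeff with hwdef
  have h0 : Y.rho (Y.toDual a) = fun y => w y • rh (gs (Y.tmat y) (a y)) := rfl
  change Y.ofDual (Y.rhoInv (Y.del (Y.rho (Y.toDual a)))) z = _
  rw [ofDual_eq hd, rhoInv_eq, h0, del_eq hφ hψ hd hks (hw.fun_smul hrTa), ← hwdef]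
  have h1 : ∀ i, Y.eTh i (fun y => w y • rh (gs (Y.tmat y) (a y))) z
      = rh (gs (Y.tmat z) (w z • Y.eTh i a z + Y.eTh i w z • a z
        + w z • der ((Y.tmat z)⁻¹ * vdm (Y.col z (th i)) Y.tmat z) (a z))) := by
    intro i
    rw [eTh_eq, vd_smul _ hw hrTa, vd_lin _ rh hTa, vd_gs _ hT hTd ha, eTh_eq, eTh_eq]
    simp only [map_add, map_smul, smul_add]
    abel
  have h2 : ∀ i k j, (∑ m, Y.matNbar z j m * Y.symMbar m k i z) • mg (et k) (dg (et j)
      (w z • rh (gs (Y.tmat z) (a z))))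
      = rh (gs (Y.tmat z) (∑ l, ∑ b, (w z * ((∑ m, Y.matNbar z j m * Y.symMbar m k i z) *
        (Y.matNbar z k l * Y.pairingBar z b j))) • mg (et l) (dg (et b) (a z)))) := by
    intro i k j
    have : mg (et k) (dg (et j) (rh (gs (Y.tmat z) (a z))))
        = rh (gs (Y.tmat z) (∑ l, ∑ b, (Y.matNbar z k l * Y.pairingBar z b j) •
          mg (et l) (dg (et b) (a z)))) := by
      rw [← neg_neg (dg (et j) (rh _)), ← rh_dg_et, map_neg, ← rh_mg_et, dg_et_tmat]
      congr 1
      simp only [← map_smul, ← map_sum, mg_et_tmat hd]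
      simp [smul_sum, smul_smul]
    rw [map_smul, map_smul, this, smul_smul, ← map_smul, ← map_smul]
    congr 2
    simp only [smul_sum, smul_smul]
    refine sum_ext fun _ => sum_ext fun _ => ?_
    congr 1
    ring
  have h3 : ∀ i, Y.eTh i (fun y => w y • rh (gs (Y.tmat y) (a y))) z
      + ∑ j, ∑ k, (∑ m, Y.matNbar z j m * Y.symMbar m k i z) • mg (et k) (dg (et j)
      (w z • rh (gs (Y.tmat z) (a z))))
      = rh (gs (Y.tmat z) (w z • Y.eTh i a z + Y.eTh i w z • a z
        + w z • ∑ l, ∑ b, pd (et l) (fun y => Y.ψ y b i) z • mg (et l) (dg (et b) (a z)))) := by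
    intro i
    simp only [h1, h2, ← map_sum, ← map_add]
    congr 2
    rw [add_assoc]
    congr 1
    rw [der_tmat hφ hψ hd]
    simp only [← frame_ψ_identity hd hks, sub_smul, sum_sub_distrib, smul_sub, smul_neg]
    rw [sub_eq_neg_add]
    congr 1
    rw [sum_rotate_two]
    simp [smul_sum, sum_smul, smul_smul]
  simp only [h3]
  simp only [map_sum, ← rh_dg_th, dg_th_tmat, rhi_rh, map_smul, gs_inv_tmat_tmat hd]
  unfold explDelta
  have h4 : ∀ i, Y.eTh i (fun y => lder (th i) (Y.omegaCoeff y • a y)) z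
      = dg (th i) (w z • Y.eTh i a z + Y.eTh i w z • a z) := by
    intro i
    simp only [lder_eq]
    rw [eTh_eq, eTh_eq, eTh_eq, vd_lin _ (dg (th i)) (hw.fun_smul ha), vd_smul _ hw ha]
  simp only [h4]
  simp only [gmul_gen, lder_eq, ← hwdef]
  simp only [map_add, map_smul, map_sum, dg_mg, th_ne_et, if_false, smul_add, sum_add_distrib, ←
    smul_sum, smul_smul, inv_mul_cancel₀ hw0, one_smul, smul_neg, sum_neg_distrib, sub_eq_add_neg]
  simp only [smul_zero, sum_const_zero, zero_add]
  rw [sum_rotate fun i l j => pd (et l) (fun y => Y.ψ y j i) z •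
    mg (et l) (dg (th i) (dg (et j) (a z)))]

end Geom

/-! ### The Hodge operator -/

/-- The sign of the Hodge operator. -/
def sgl : EndGr where
  toFun a := fun K => Complex.I * (-1) ^ ((K.card + 1) * (K.card + 2) / 2) * a K
  map_add' a b := by funext K; simp [mul_add]
  map_smul' c a := by funext K; simp only [Pi.smul_apply, smul_eq_mul, RingHom.id_apply]; ring

theorem sgl_apply (a : Gr) (K : Idx) :
    sgl a K = Complex.I * (-1) ^ ((K.card + 1) * (K.card + 2) / 2) * a K := rfl

theorem sgl_gs (M : Mat6) (a : Gr) : sgl (gs M a) = gs M (sgl a) := by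
  funext K
  rw [sgl_apply]
  change _ * (∑ I : Idx, if h : I.card = K.card then
      (M.submatrix (K.orderEmbOfFin rfl) (I.orderEmbOfFin h)).det * a I else 0)
    = ∑ I : Idx, if h : I.card = K.card then
      (M.submatrix (K.orderEmbOfFin rfl) (I.orderEmbOfFin h)).det * sgl a I else 0
  rw [mul_sum]
  refine sum_ext fun I => ?_
  split_ifs with h
  · rw [sgl_apply, h]; ring
  · ring

theorem sgl_sgl (a : Gr) : sgl (sgl a) = -a := by
  funext K
  rw [sgl_apply, sgl_apply, Pi.neg_apply]
  have : ((-1 : ℂ) ^ ((K.card + 1) * (K.card + 2) / 2)) * (-1) ^ ((K.card + 1) * (K.card + 2) / 2)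
      = 1 := by rw [← mul_pow]; norm_num
  linear_combination (a K * Complex.I * Complex.I) * this + a K * Complex.I_mul_I

theorem triangular_succ (n : ℕ) : (n + 1 + 1) * (n + 1 + 2) / 2 = (n + 1) * (n + 2) / 2 + (n + 2) := by
  rw [show (n + 1 + 1) * (n + 1 + 2) = (n + 1) * (n + 2) + (n + 2) * 2 by ring,
    Nat.add_mul_div_right _ _ (by norm_num)]

theorem sgl_mg (k : Fin 6) (a : Gr) : sgl (mg k a) = mg k (par (sgl a)) := by
  funext K
  rw [sgl_apply, mg_apply, mg_apply]
  split_ifs with h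
  · rw [par_apply, sgl_apply, ← Finset.card_erase_add_one h, triangular_succ, pow_add, pow_add _ _ 2]
    ring
  · ring

theorem sgl_dg (k : Fin 6) (a : Gr) : sgl (dg k a) = -dg k (par (sgl a)) := by
  funext K
  rw [sgl_apply, Pi.neg_apply, dg_apply, dg_apply]
  split_ifs with h
  · ring
  · rw [par_apply, sgl_apply, card_insert_of_notMem h, triangular_succ, pow_add, pow_add _ _ (K.card + 2), pow_add _ _ 2,
      pow_succ]
    have : ((-1 : ℂ) ^ K.card) * (-1) ^ K.card = 1 := by rw [← mul_pow]; norm_num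
    linear_combination (-Complex.I * (-1) ^ ((K.card + 1) * (K.card + 2) / 2) * gsgn {k} K *
      a (insert k K)) * this

namespace Geom

/-- The matrix of the substitution in the Hodge operator in the frame `e_I f^J`. -/
def hmat (Y : Geom) (z : E3) : Mat6 := blk 0 ((Y.g z)⁻¹)ᵀ (-(Y.g z)ᵀ) 0

/-- The Hodge operator in the frame `e_I f^J`. -/
def hodge (Y : Geom) (z : E3) (a : Gr) : Gr := sgl (gs (Y.hmat z) a)

/-- The conditions on a deformation which are needed for the explicit form of the operators. -/
structure Admissible (Y : Geom) (z : E3) : Prop where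
  hs : DifferentiableAt ℂ Y.s z
  hs0 : Y.s z ≠ 0
  hg : MatDiff Y.g z
  hg0 : (Y.g z).det ≠ 0
  hφ : MatDiff Y.φ z
  hψ : MatDiff Y.ψ z
  hd : (Y.pairing z).det ≠ 0
  ksφ : ∀ k l m, Y.eEt k (fun y => Y.φ y m l) z = Y.eEt l (fun y => Y.φ y m k) z
  ksψ : ∀ i l m, Y.eTh i (fun y => Y.ψ y m l) z = Y.eTh l (fun y => Y.ψ y m i) z
  divφ : ∀ k, ∑ l, pd (th l) (fun y => Y.s y * Y.φ y l k) z = 0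
  divψ : ∀ i, ∑ m, pd (et m) (fun y => conj (Y.s y) * Y.ψ y m i) z = 0
  symφ : ∀ᶠ y in 𝓝 z, (Y.φ y)ᵀ * Y.g y = (Y.g y)ᵀ * Y.φ y
  symψ : ∀ᶠ y in 𝓝 z, (Y.ψ y)ᵀ * (Y.g y)ᵀ = Y.g y * Y.ψ y
  closed : ∀ i j k, pd (th k) (fun y => Y.g y i j) z = pd (th i) (fun y => Y.g y k j) z
  closedBar : ∀ i j k, pd (et k) (fun y => Y.g y i j) z = pd (et j) (fun y => Y.g y i k) z

variable {Y : Geom} {z : E3} {a b : E3 → Gr}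

theorem inv_hmat (hg0 : (Y.g z).det ≠ 0) :
    (Y.hmat z)⁻¹ = blk 0 (-((Y.g z)⁻¹)ᵀ) (Y.g z)ᵀ 0 := by
  have hu : IsUnit (Y.g z).det := isUnit_iff_ne_zero.2 hg0
  refine inv_eq_left_inv ?_
  rw [hmat, blk_mul, ← blk_one]
  simp [← transpose_mul, mul_nonsing_inv _ hu, nonsing_inv_mul _ hu]

theorem hmat_mul_hmat (hg0 : (Y.g z).det ≠ 0) : Y.hmat z * Y.hmat z = -1 := by
  have hu : IsUnit (Y.g z).det := isUnit_iff_ne_zero.2 hg0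
  rw [hmat, blk_mul, ← blk_one, blk_neg]
  simp [← transpose_mul, mul_nonsing_inv _ hu, nonsing_inv_mul _ hu]

theorem hodge_hodge (hg0 : (Y.g z).det ≠ 0) (a : Gr) : Y.hodge z (Y.hodge z a) = -par a := by
  rw [hodge, hodge, ← sgl_gs, sgl_sgl, ← gs_mul, hmat_mul_hmat hg0, gs_neg_one]

theorem hodge_mg_et (k : Fin 3) (a : Gr) : Y.hodge z (mg (et k) a)
    = ∑ l, Y.gInv k l z • mg (th l) (par (Y.hodge z a)) := by
  simp [hodge, gs_mg, sum_six, hmat, sgl_mg, gInv]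

theorem hodge_mg_th (i : Fin 3) (a : Gr) : Y.hodge z (mg (th i) a)
    = -∑ l, Y.g z i l • mg (et l) (par (Y.hodge z a)) := by
  simp [hodge, gs_mg, sum_six, hmat, sgl_mg]

theorem gs_dg {M : Mat6} (hM : M.det ≠ 0) (k : Fin 6) (a : Gr) :
    gs M (dg k a) = ∑ b, M⁻¹ k b • dg b (gs M a) := by
  simp only [dg_gs, smul_sum, smul_smul]
  rw [sum_comm]
  simp only [← sum_smul, ← Matrix.mul_apply, nonsing_inv_mul _ (isUnit_iff_ne_zero.2 hM), one_apply]
  simp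

theorem det_hmat_ne (hg0 : (Y.g z).det ≠ 0) : (Y.hmat z).det ≠ 0 := by
  have h := congrArg Matrix.det (hmat_mul_hmat hg0)
  rw [Matrix.det_mul, Matrix.det_neg, Matrix.det_one] at h
  intro h0
  rw [h0] at h
  norm_num at h

theorem hodge_dg_et (hg0 : (Y.g z).det ≠ 0) (j : Fin 3) (a : Gr) : Y.hodge z (dg (et j) a)
    = -∑ i, Y.g z i j • dg (th i) (par (Y.hodge z a)) := by
  simp [hodge, gs_dg (det_hmat_ne hg0), sum_six, inv_hmat hg0, sgl_dg]

theorem hodge_dg_th (hg0 : (Y.g z).det ≠ 0) (i : Fin 3) (a : Gr) : Y.hodge z (dg (th i) a)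
    = ∑ j, Y.gInv j i z • dg (et j) (par (Y.hodge z a)) := by
  simp [hodge, gs_dg (det_hmat_ne hg0), sum_six, inv_hmat hg0, sgl_dg, gInv]

theorem hodge_add (a b : Gr) : Y.hodge z (a + b) = Y.hodge z a + Y.hodge z b := by
  simp [hodge]

theorem hodge_sub (a b : Gr) : Y.hodge z (a - b) = Y.hodge z a - Y.hodge z b := by
  simp [hodge]

theorem hodge_neg (a : Gr) : Y.hodge z (-a) = -Y.hodge z a := by
  simp [hodge]

theorem hodge_smul (c : ℂ) (a : Gr) : Y.hodge z (c • a) = c • Y.hodge z a := by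
  simp [hodge]

theorem hodge_sum {ι : Type*} (s : Finset ι) (a : ι → Gr) :
    Y.hodge z (∑ i ∈ s, a i) = ∑ i ∈ s, Y.hodge z (a i) := by
  simp [hodge]

theorem matDiff_hmat (hg : MatDiff Y.g z) (hg0 : (Y.g z).det ≠ 0) : MatDiff Y.hmat z :=
  (mdiff_const 0).blk (hg.inv hg0).transpose hg.transpose.neg (mdiff_const 0)

theorem differentiableAt_hodge (hg : MatDiff Y.g z) (hg0 : (Y.g z).det ≠ 0)
    (ha : RDiffAt a z) : RDiffAt (fun y => Y.hodge y (a y)) z :=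
  differentiableAt_lin sgl ((matDiff_hmat hg hg0).gs ha)

theorem vd_hodge (hg : MatDiff Y.g z) (hg0 : (Y.g z).det ≠ 0)
    (ha : RDiffAt a z) (c : Fin 6 → ℂ) :
    vd c (fun y => Y.hodge y (a y)) z = Y.hodge z (vd c a z
      + ∑ p, ∑ q, (((Y.g z)⁻¹)ᵀ * (vdm c Y.g z)ᵀ) p q • mg (th p) (dg (th q) (a z))
      - ∑ p, ∑ q, ((vdm c Y.g z)ᵀ * ((Y.g z)⁻¹)ᵀ) p q •
        mg (et p) (dg (et q) (a z))) := by
  have hu : IsUnit (Y.g z).det := isUnit_iff_ne_zero.2 hg0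
  have h1 : vd c (fun y => Y.hodge y (a y)) z
      = sgl (vd c (fun y => gs (Y.hmat y) (a y)) z) :=
    vd_lin c sgl ((matDiff_hmat hg hg0).gs ha)
  rw [h1, vd_gs c (matDiff_hmat hg hg0) (det_hmat_ne hg0) ha, hodge, add_sub_assoc]
  congr 3
  have h2 : vdm c Y.hmat z = blk 0 (vdm c (fun y => (Y.g y)⁻¹) z)ᵀ
      (-(vdm c Y.g z)ᵀ) 0 := by
    change vdm c (fun y => blk 0 ((Y.g y)⁻¹)ᵀ (-(Y.g y)ᵀ) 0) z = _
    rw [vdm_blk c (fun _ => 0) (fun y => ((Y.g y)⁻¹)ᵀ) (fun y => -(Y.g y)ᵀ)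
      (fun _ => 0), vdm_const, vdm_transpose, vdm_neg, vdm_transpose]
  rw [h2, inv_hmat hg0, blk_mul, vdm_inv c hg hg0]
  simp only [zero_mul, zero_add, add_zero, mul_zero]
  rw [der_blk_diag]
  simp only [neg_mul, mul_neg, neg_neg, sub_eq_add_neg, ← sum_neg_distrib, ← neg_smul]
  congr 1
  refine sum_ext fun p => sum_ext fun q => ?_
  congr 1
  rw [transpose_neg, mul_neg, Matrix.neg_apply, ← transpose_mul, mul_assoc, mul_assoc,
    nonsing_inv_mul _ hu, mul_one, transpose_mul]

/-- The Hodge operator in the coframes `F` and `f`. -/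
theorem star_toDual (hd : (Y.pairing z).det ≠ 0)
    (hsym : (Y.ψ z)ᵀ * (Y.g z)ᵀ = Y.g z * Y.ψ z) (a : Gr) :
    sgl (gs (blk 0 ((Y.metric z)⁻¹)ᵀ (-(Y.metric z)ᵀ) 0) (gs (Y.tmat z) a))
      = gs (Y.tmat z) (Y.hodge z a) := by
  rw [hodge, ← sgl_gs, ← gs_mul, ← gs_mul]
  refine congrArg (fun M => sgl (gs M a)) ?_
  have hm : Y.metric z = Y.g z * Y.pairingBar z := by
    rw [metric, hsym, pairingBar, mul_sub, mul_one, mul_assoc]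
  rw [tmat, hmat, blk_mul, blk_mul, hm, Matrix.mul_inv_rev, ← transpose_mul, ← mul_assoc]
  have : Y.pairingBar z * (Y.pairingBar z)⁻¹ = 1 := pairingBar_mul_matNbar hd
  rw [this]
  simp [transpose_mul]

theorem frameD_congr (h : a =ᶠ[𝓝 z] b) : Y.frameD a z = Y.frameD b z := by
  have hk : ∀ k, pd k (Y.toCoord a) z = pd k (Y.toCoord b) z := fun k => pd_congr k <| by
    filter_upwards [h] with y hy
    rw [toCoord, toCoord, hy]
  have he : extd (Y.toCoord a) z = extd (Y.toCoord b) z :=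
    sum_ext fun k => congrArg (gmul (gen k)) (hk k)
  exact congrArg (gsubst (Y.frame z)ᵀ) he

theorem delBar_congr (h : a =ᶠ[𝓝 z] b) : Y.delBar a z = Y.delBar b z := by
  unfold delBar
  refine sum_ext fun p => sum_ext fun q => ?_
  exact congrArg (proj _ _) (frameD_congr (h.fun_comp (proj p q)))

theorem del_congr (h : a =ᶠ[𝓝 z] b) : Y.del a z = Y.del b z := by
  unfold del
  refine sum_ext fun p => sum_ext fun q => ?_
  exact congrArg (proj _ _) (frameD_congr (h.fun_comp (proj p q)))

theorem ofDual_star_conj (hφ : MatDiff Y.φ z) (hψ : MatDiff Y.ψ z) (hd : (Y.pairing z).det ≠ 0)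
    (hsym : ∀ᶠ y in 𝓝 z, (Y.ψ y)ᵀ * (Y.g y)ᵀ = Y.g y * Y.ψ y) {D : (E3 → Gr) → E3 → Gr}
    (hD : ∀ {a b : E3 → Gr}, a =ᶠ[𝓝 z] b → D a z = D b z) (a : E3 → Gr) :
    Y.ofDual (Y.star (Y.rhoInv (D (Y.rho (Y.star (Y.toDual a)))))) z
      = Y.hodge z (Y.ofDual (Y.rhoInv (D (Y.rho (Y.toDual fun y => Y.hodge y (a y))))) z) := by
  have h2 : Y.rho (Y.star (Y.toDual a)) =ᶠ[𝓝 z] Y.rho (Y.toDual (fun y => Y.hodge y (a y))) := by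
    filter_upwards [hsym, (matDiff_pairing hφ hψ).eventually_det_ne hd] with y hy hdy
    rw [rho_eq, rho_eq, show Y.star (Y.toDual a) y = _ from star_toDual hdy hy (a y)]
    rfl
  rw [ofDual_eq hd, ofDual_eq hd, rhoInv_eq (D (Y.rho (Y.toDual _))), ← hD h2, ← rhoInv_eq]
  generalize Y.rhoInv (D (Y.rho (Y.star (Y.toDual a)))) = b
  have h3 := star_toDual hd hsym.self_of_nhds (gs (Y.tmat z)⁻¹ (b z))
  rw [gs_tmat_inv_tmat hd] at h3
  have h4 : Y.star b z = gs (Y.tmat z) (Y.hodge z (gs (Y.tmat z)⁻¹ (b z))) := h3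
  rw [h4, gs_inv_tmat_tmat hd]

theorem opS_eq_hodge (hφ : MatDiff Y.φ z) (hψ : MatDiff Y.ψ z) (hd : (Y.pairing z).det ≠ 0)
    (hsym : ∀ᶠ y in 𝓝 z, (Y.ψ y)ᵀ * (Y.g y)ᵀ = Y.g y * Y.ψ y) (a : E3 → Gr) :
    Y.opS a z = Y.hodge z (Y.opDbar (fun y => Y.hodge y (a y)) z) := by
  have h := ofDual_star_conj hφ hψ hd hsym (D := Y.delBar) delBar_congr a
  rw [ofDual_eq hd, ofDual_eq hd] at h
  rw [opS, opDbar, ofDual_eq hd, ofDual_eq hd, Pi.neg_apply, Pi.neg_apply, map_neg, map_neg, h,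
    hodge_neg]

theorem opR_eq_hodge (hφ : MatDiff Y.φ z) (hψ : MatDiff Y.ψ z) (hd : (Y.pairing z).det ≠ 0)
    (hsym : ∀ᶠ y in 𝓝 z, (Y.ψ y)ᵀ * (Y.g y)ᵀ = Y.g y * Y.ψ y) (a : E3 → Gr) :
    Y.opR a z = -Y.hodge z (Y.opDelta (fun y => Y.hodge y (a y)) z) := by
  have h := ofDual_star_conj hφ hψ hd hsym (D := Y.del) del_congr a
  rw [ofDual_eq hd] at h
  rw [opR, opDelta, ofDual_eq hd, Pi.neg_apply, map_neg, h]

end Geom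

/-- The operator `∑ A_{pq} θ_p ∂/∂θ_q`. -/
def qth (A : Mat3) : EndGr := ∑ p, ∑ q, A p q • (mg (th p) * dg (th q))

/-- The operator `∑ A_{pq} η^p ∂/∂η^q`. -/
def qet (A : Mat3) : EndGr := ∑ p, ∑ q, A p q • (mg (et p) * dg (et q))

theorem qth_apply (A : Mat3) (x : Gr) :
    qth A x = ∑ p, ∑ q, A p q • mg (th p) (dg (th q) x) := by
  simp [qth, LinearMap.sum_apply]

theorem qet_apply (A : Mat3) (x : Gr) :
    qet A x = ∑ p, ∑ q, A p q • mg (et p) (dg (et q) x) := by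
  simp [qet, LinearMap.sum_apply]

theorem gs_quad {u v : Fin 3 → Fin 6} {M : Mat6} {A B C D : Mat3} {x : Gr}
    (hd : ∀ q, dg (v q) (gs M x) = ∑ b, D q b • gs M (dg (v b) x))
    (hm : ∀ k y, gs M (mg (u k) y) = ∑ p, C p k • mg (u p) (gs M y)) (h : A * D = C * B) :
    ∑ p, ∑ q, A p q • mg (u p) (dg (v q) (gs M x))
      = gs M (∑ p, ∑ q, B p q • mg (u p) (dg (v q) x)) := by
  have e1 : ∑ p, ∑ q, A p q • mg (u p) (dg (v q) (gs M x))
      = ∑ p, ∑ b, (A * D) p b • mg (u p) (gs M (dg (v b) x)) := by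
    simp only [hd, map_sum, map_smul, smul_sum, smul_smul, Matrix.mul_apply, sum_smul]
    exact sum_ext fun p => sum_comm
  rw [e1, h]
  simp only [hm, map_sum, map_smul, smul_sum, smul_smul, Matrix.mul_apply, sum_smul]
  refine (sum_rotate fun m b p => (B m b * C p m) • mg (u p) (gs M (dg (v b) x))).trans ?_ |>.symm
  rw [sum_comm]
  simp [mul_comm]

theorem pd_quad (u v : Fin 3 → Fin 6) {A : E3 → Mat3} {a : E3 → Gr} {z : E3} (hA : MatDiff A z)
    (ha : RDiffAt a z) (k : Fin 6) :
    pd k (fun y => ∑ p, ∑ q, A y p q • mg (u p) (dg (v q) (a y))) z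
      = ∑ p, ∑ q, A z p q • mg (u p) (dg (v q) (pd k a z))
        + ∑ p, ∑ q, pdm k A z p q • mg (u p) (dg (v q) (a z)) := by
  have h1 : ∀ p q, RDiffAt (fun y => mg (u p) (dg (v q) (a y))) z := fun p q =>
    differentiableAt_lin (mg (u p) * dg (v q)) ha
  rw [pd_sum k fun p _ => DifferentiableAt.fun_sum fun q _ => (hA p q).fun_smul (h1 p q),
    ← sum_add_distrib]
  refine sum_ext fun p => ?_
  rw [pd_sum k fun q _ => (hA p q).fun_smul (h1 p q), ← sum_add_distrib]
  refine sum_ext fun q => ?_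
  rw [pd_smul k (hA p q) (h1 p q)]
  congr 2
  exact pd_lin k (mg (u p) * dg (v q)) ha

theorem qth_add (A B : Mat3) : qth (A + B) = qth A + qth B := by
  simp [qth, add_smul, sum_add_distrib]

theorem qet_add (A B : Mat3) : qet (A + B) = qet A + qet B := by
  simp [qet, add_smul, sum_add_distrib]

theorem qth_neg (A : Mat3) : qth (-A) = -qth A := by
  refine LinearMap.ext fun x => ?_
  simp [qth_apply, sum_neg_distrib]

theorem qet_neg (A : Mat3) : qet (-A) = -qet A := by
  refine LinearMap.ext fun x => ?_
  simp [qet_apply, sum_neg_distrib]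

theorem qth_sub (A B : Mat3) : qth (A - B) = qth A - qth B := by
  rw [sub_eq_add_neg, qth_add, qth_neg, sub_eq_add_neg]

namespace Geom

variable {Y : Geom} {z : E3} {a b : E3 → Gr}

theorem par_hodge_qth_hodge (hg0 : (Y.g z).det ≠ 0) (A : Mat3) (x : Gr) :
    par (Y.hodge z (qth A (Y.hodge z x)))
      = -qet ((Y.g z)ᵀ * A * ((Y.g z)⁻¹)ᵀ) x := by
  rw [qth_apply, qet_apply]
  simp only [hodge_sum, hodge_smul, hodge_mg_th, hodge_dg_th hg0, hodge_hodge hg0, map_sum,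
    map_smul, map_neg, par_mg, par_dg, par_par, smul_neg, neg_neg, sum_neg_distrib]
  congr 1
  simp only [smul_sum, smul_smul]
  rw [sum_rotate_two]
  refine sum_ext fun l => sum_ext fun j => ?_
  simp only [Matrix.mul_apply, sum_mul, sum_smul, transpose_apply]
  refine sum_ext fun q => sum_ext fun p => ?_
  congr 1
  rw [gInv]; ring

theorem par_hodge_qet_hodge (hg0 : (Y.g z).det ≠ 0) (A : Mat3) (x : Gr) :
    par (Y.hodge z (qet A (Y.hodge z x)))
      = -qth (((Y.g z)⁻¹)ᵀ * A * (Y.g z)ᵀ) x := by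
  rw [qth_apply, qet_apply]
  simp only [hodge_sum, hodge_smul, hodge_mg_et, hodge_dg_et hg0, hodge_hodge hg0, map_sum,
    map_smul, map_neg, par_mg, par_dg, par_par, smul_neg, neg_neg, sum_neg_distrib]
  congr 1
  simp only [smul_sum, smul_smul]
  rw [sum_rotate_two]
  refine sum_ext fun l => sum_ext fun j => ?_
  simp only [Matrix.mul_apply, sum_mul, sum_smul, transpose_apply]
  refine sum_ext fun q => sum_ext fun p => ?_
  congr 1
  rw [gInv]; ring

/-- The matrix `N M_k`. -/
def nm (Y : Geom) (z : E3) (k : Fin 3) : Mat3 :=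
  Matrix.of fun p i => ∑ s, Y.matN z p s * Y.symM s i k z

theorem explDbar_eq (b : E3 → Gr) : Y.explDbar b z = ∑ k, ∑ r, Y.matNbar z k r • mg (et r)
    (Y.eEt k b z - qth (Y.nm z k) (b z)
      - qet (vdm (Y.col z (et k)) Y.ψ z * Y.matN z * Y.φ z)ᵀ (b z)) := by
  unfold explDbar
  refine sum_ext fun k => sum_ext fun r => ?_
  rw [gmul_gen, qth_apply, qet_apply]
  simp only [gmul_gen, lder_eq]
  congr 3
  refine sum_ext fun l => sum_ext fun j => ?_
  congr 1
  simp only [transpose_apply, Matrix.mul_apply, vdm_apply, sum_mul, eEt_eq]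
  rw [sum_comm]
  exact sum_ext fun m => sum_ext fun i => by ring

theorem eEt_hodge (hg : MatDiff Y.g z) (hg0 : (Y.g z).det ≠ 0)
    (ha : RDiffAt a z) (k : Fin 3) :
    Y.eEt k (fun y => Y.hodge y (a y)) z = Y.hodge z (Y.eEt k a z
      + qth (((Y.g z)⁻¹)ᵀ * (vdm (Y.col z (et k)) Y.g z)ᵀ) (a z)
      - qet ((vdm (Y.col z (et k)) Y.g z)ᵀ * ((Y.g z)⁻¹)ᵀ) (a z)) := by
  rw [eEt_eq, eEt_eq, vd_hodge hg hg0 ha, qth_apply, qet_apply]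

theorem eTh_hodge (hg : MatDiff Y.g z) (hg0 : (Y.g z).det ≠ 0)
    (ha : RDiffAt a z) (k : Fin 3) :
    Y.eTh k (fun y => Y.hodge y (a y)) z = Y.hodge z (Y.eTh k a z
      + qth (((Y.g z)⁻¹)ᵀ * (vdm (Y.col z (th k)) Y.g z)ᵀ) (a z)
      - qet ((vdm (Y.col z (th k)) Y.g z)ᵀ * ((Y.g z)⁻¹)ᵀ) (a z)) := by
  rw [eTh_eq, eTh_eq, vd_hodge hg hg0 ha, qth_apply, qet_apply]

theorem hodge_explDbar_hodge (hg : MatDiff Y.g z) (hg0 : (Y.g z).det ≠ 0)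
    (ha : RDiffAt a z) :
    Y.hodge z (Y.explDbar (fun y => Y.hodge y (a y)) z)
    = ∑ k, ∑ r, ∑ l, (Y.gInv r l z * Y.matNbar z k r) • mg (th l) (-Y.eEt k a z
      - qth (((Y.g z)⁻¹)ᵀ * (vdm (Y.col z (et k)) Y.g z)ᵀ
          - ((Y.g z)⁻¹)ᵀ * (vdm (Y.col z (et k)) Y.ψ z * Y.matN z * Y.φ z)ᵀ * (Y.g z)ᵀ) (a z)
      + qet ((vdm (Y.col z (et k)) Y.g z)ᵀ * ((Y.g z)⁻¹)ᵀ
          + (Y.g z)ᵀ * Y.nm z k * ((Y.g z)⁻¹)ᵀ) (a z)) := by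
  rw [explDbar_eq, hodge_sum]
  refine sum_ext fun k => ?_
  rw [hodge_sum]
  refine sum_ext fun r => ?_
  rw [hodge_smul, hodge_mg_et, eEt_hodge hg hg0 ha, hodge_sub, hodge_sub, hodge_hodge hg0, map_sub,
    map_sub, par_hodge_qth_hodge hg0, par_hodge_qet_hodge hg0, map_neg, par_par, smul_sum]
  refine sum_ext fun l => ?_
  rw [smul_smul, mul_comm, qth_sub, qet_add]
  congr 2
  simp only [LinearMap.add_apply, LinearMap.sub_apply]
  abel

namespace Admissible

variable (h : Y.Admissible z)

include h

theorem isUnit_g : IsUnit (Y.g z).det := isUnit_iff_ne_zero.2 h.hg0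

/-- `(1 - φψ)ᵀ g = g (1 - ψφ)`. -/
theorem pairing_transpose_mul_g :
    (Y.pairing z)ᵀ * Y.g z = Y.g z * Y.pairingBar z := by
  have h1 := h.symφ.self_of_nhds
  have h2 := h.symψ.self_of_nhds
  rw [pairing, pairingBar, Matrix.transpose_sub, transpose_one, transpose_mul, sub_mul, mul_sub,
    one_mul, mul_one, mul_assoc, h1, ← mul_assoc, h2, mul_assoc]

theorem matN_transpose_mul_g : (Y.matN z)ᵀ * Y.g z = Y.g z * Y.matNbar z := by
  have h1 : (Y.matN z)ᵀ * (Y.pairing z)ᵀ = 1 := by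
    rw [← transpose_mul, pairing_mul_matN h.hd, transpose_one]
  calc (Y.matN z)ᵀ * Y.g z
      = (Y.matN z)ᵀ * (Y.g z * Y.pairingBar z) * Y.matNbar z := by
        rw [mul_assoc, mul_assoc, pairingBar_mul_matNbar h.hd, mul_one]
    _ = _ := by
        rw [← h.pairing_transpose_mul_g, ← mul_assoc, h1, one_mul]

/-- The derivative of the symmetry condition on `ψ`. -/
theorem vdm_symψ (c : Fin 6 → ℂ) : (vdm c Y.ψ z)ᵀ * (Y.g z)ᵀ + (Y.ψ z)ᵀ * (vdm c Y.g z)ᵀ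
      = vdm c Y.g z * Y.ψ z + Y.g z * vdm c Y.ψ z := by
  have h1 := vdm_congr c h.symψ
  rwa [vdm_mul c h.hψ.transpose h.hg.transpose, vdm_mul c h.hg h.hψ, vdm_transpose, vdm_transpose]
    at h1

theorem vdm_symφ (c : Fin 6 → ℂ) : (vdm c Y.φ z)ᵀ * Y.g z + (Y.φ z)ᵀ * vdm c Y.g z
      = (vdm c Y.g z)ᵀ * Y.φ z + (Y.g z)ᵀ * vdm c Y.φ z := by
  have h1 := vdm_congr c h.symφ
  rwa [vdm_mul c h.hφ.transpose h.hg, vdm_mul c h.hg.transpose h.hφ, vdm_transpose, vdm_transpose]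
    at h1

theorem symm_aux (k c b : Fin 3) :
    ∑ s, Y.eTh b (fun y => Y.φ y s k) z * Y.g z s c + Y.eEt k (fun y => Y.g y b c) z
      - ∑ s, ∑ t, Y.ψ z s b * Y.eEt k (fun y => Y.g y t s) z * Y.φ z t c
    = ∑ s, Y.eTh b (fun y => Y.φ y s c) z * Y.g z s k + Y.eEt c (fun y => Y.g y b k) z
      - ∑ s, ∑ t, Y.ψ z s b * Y.eEt c (fun y => Y.g y t s) z * Y.φ z t k := by
  have h1 : ∑ s, Y.eTh b (fun y => Y.φ y s k) z * Y.g z s c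
      + ∑ s, Y.φ z s k * Y.eTh b (fun y => Y.g y s c) z
      = ∑ s, Y.eTh b (fun y => Y.φ y s c) z * Y.g z s k
      + ∑ s, Y.φ z s c * Y.eTh b (fun y => Y.g y s k) z := by
    have := congrFun (congrFun (h.vdm_symφ (Y.col z (th b))) k) c
    simp only [Matrix.add_apply, Matrix.mul_apply, transpose_apply, vdm_apply, ← eTh_eq]
      at this
    rw [this, add_comm]
    congr 1 <;> exact sum_ext fun s => mul_comm _ _
  have h2 : ∀ k c, Y.eEt k (fun y => Y.g y b c) z = pd (et k) (fun y => Y.g y b c) z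
      + ∑ l, Y.φ z l k * pd (th b) (fun y => Y.g y l c) z := by
    intro k c
    simp [eEt, h.closed b c]
  have h3 : ∀ k c, ∑ s, ∑ t, Y.ψ z s b * Y.eEt k (fun y => Y.g y t s) z * Y.φ z t c
      = ∑ s, ∑ t, Y.ψ z s b * pd (et s) (fun y => Y.g y t k) z * Y.φ z t c
        + ∑ s, ∑ t, ∑ l, Y.ψ z s b * pd (th t) (fun y => Y.g y l s) z * Y.φ z t c * Y.φ z l k := by
    intro k c
    rw [← sum_add_distrib]
    refine sum_ext fun s => ?_
    rw [← sum_add_distrib]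
    refine sum_ext fun t => ?_
    simp only [eEt, smul_eq_mul, mul_add, add_mul, mul_sum, sum_mul]
    rw [h.closedBar t s k]
    congr 1
    refine sum_ext fun l => ?_
    rw [h.closed t s l]; ring
  have h4 : ∀ k c, ∑ s, Y.φ z s k * Y.eTh b (fun y => Y.g y s c) z
      = ∑ s, Y.φ z s k * pd (th b) (fun y => Y.g y s c) z
        + ∑ s, ∑ t, Y.ψ z s b * pd (et s) (fun y => Y.g y t c) z * Y.φ z t k := by
    intro k c
    rw [sum_comm, ← sum_add_distrib]
    refine sum_ext fun s => ?_
    simp only [eTh, smul_eq_mul, mul_add, mul_sum]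
    congr 1
    exact sum_ext fun l => by ring
  have h5 : ∑ s, ∑ t, ∑ l, Y.ψ z s b * pd (th t) (fun y => Y.g y l s) z * Y.φ z t c * Y.φ z l k
      = ∑ s, ∑ t, ∑ l, Y.ψ z s b * pd (th t) (fun y => Y.g y l s) z * Y.φ z t k * Y.φ z l c := by
    refine sum_ext fun s => ?_
    rw [sum_comm]
    refine sum_ext fun t => sum_ext fun l => ?_
    rw [h.closed l s t]; ring
  rw [h2 k c, h2 c k, h3 k c, h3 c k, h.closedBar b c k]
  rw [h4, h4] at h1
  linear_combination h1 - h5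

theorem explS_eq (a : E3 → Gr) : Y.explS a z
    = ∑ k, ∑ r, ∑ l, (Y.gInv r l z * Y.matNbar z k r) • mg (th l) (-Y.eEt k a z
      + qth (Y.nm z k) (a z)
      + qet ((vdm (Y.col z (et k)) Y.g z)ᵀ * ((Y.g z)⁻¹)ᵀ
          + (Y.g z)ᵀ * Y.nm z k * ((Y.g z)⁻¹)ᵀ) (a z)) := by
  unfold explS
  refine sum_ext fun k => sum_ext fun r =>
    sum_ext fun l => ?_
  rw [gmul_gen, qth_apply, qet_apply]
  simp only [gmul_gen, lder_eq]
  congr 3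
  refine sum_ext fun s => sum_ext fun j => ?_
  congr 1
  have h1 : ∑ n, ∑ m, ∑ q, Y.g z n m * Y.gInv j q z * Y.matNbar z m s * Y.symM n q k z
      = ((Y.g z)ᵀ * Y.nm z k * ((Y.g z)⁻¹)ᵀ) s j := by
    have e : (Y.g z)ᵀ * Y.nm z k * ((Y.g z)⁻¹)ᵀ
        = (Y.g z * Y.matNbar z)ᵀ * (Matrix.of fun n q => Y.symM n q k z) *
          ((Y.g z)⁻¹)ᵀ := by
      rw [← h.matN_transpose_mul_g, transpose_mul, transpose_transpose, mul_assoc _ (Y.matN z)]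
      rfl
    rw [e]
    simp only [Matrix.mul_apply, transpose_apply, Matrix.of_apply, sum_mul]
    rw [sum_rotate, sum_rotate]
    refine sum_ext fun q => ?_
    refine sum_ext fun n => sum_ext fun m => ?_
    rw [gInv]; ring
  have h2 : Y.christBar j k s z
      + ∑ m, ∑ q, ∑ n, Y.gInv j m z * Y.g z q s * Y.christ q m n z * Y.φ z n k
      = ((vdm (Y.col z (et k)) Y.g z)ᵀ * ((Y.g z)⁻¹)ᵀ) s j := by
    have e : ∀ m n, ∑ q, Y.g z q s * Y.christ q m n z = pd (th m) (fun y => Y.g y n s) z := by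
      intro m n
      simp only [christ, mul_sum]
      rw [sum_comm]
      have : ∀ t, ∑ q, Y.gInv t q z * Y.g z q s = if t = s then 1 else 0 := fun t => by
        have := congrFun (congrFun (nonsing_inv_mul _ h.isUnit_g) t) s
        simpa [Matrix.mul_apply, one_apply, gInv] using this
      calc _ = ∑ t, (∑ q, Y.gInv t q z * Y.g z q s) * pd (th m) (fun y => Y.g y n t) z := by
            simp only [sum_mul]
            exact sum_ext fun t => sum_ext fun q => by ring
        _ = _ := by simp [this]
    have e2 : ∑ m, ∑ q, ∑ n, Y.gInv j m z * Y.g z q s * Y.christ q m n z * Y.φ z n k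
        = ∑ m, ∑ n, Y.gInv j m z * Y.φ z n k * pd (th n) (fun y => Y.g y m s) z := by
      refine sum_ext fun m => ?_
      rw [sum_comm]
      refine sum_ext fun n => ?_
      rw [h.closed m s n, ← e m n, mul_sum]
      exact sum_ext fun q => by ring
    rw [e2]
    simp only [Matrix.mul_apply, transpose_apply, vdm_apply, ← eEt_eq, christBar, eEt, smul_eq_mul,
      add_mul, sum_add_distrib, sum_mul]
    congr 1
    · exact sum_ext fun m => by rw [gInv]; ring
    · exact sum_ext fun m => sum_ext fun n => by rw [gInv]; ring
  rw [Matrix.add_apply, ← h1, ← h2]; ring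

/-- The difference between the two forms of the part of `S` of second order in `θ`. -/
theorem nm_identity (k : Fin 3) : Y.nm z k + ((Y.g z)⁻¹)ᵀ * (vdm (Y.col z (et k)) Y.g z)ᵀ
      - ((Y.g z)⁻¹)ᵀ * (vdm (Y.col z (et k)) Y.ψ z * Y.matN z * Y.φ z)ᵀ * (Y.g z)ᵀ
    = (Y.matNbar z * (Y.g z)⁻¹)ᵀ * (Matrix.of fun b c =>
      ∑ s, Y.eTh b (fun y => Y.φ y s k) z * Y.g z s c + Y.eEt k (fun y => Y.g y b c) z
      - ∑ s, ∑ t, Y.ψ z s b * Y.eEt k (fun y => Y.g y t s) z * Y.φ z t c)ᵀ := by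
  set G := Y.g z
  set A := Y.matNbar z * G⁻¹ with hA
  set E := vdm (Y.col z (et k)) Y.g z with hE
  set F := vdm (Y.col z (et k)) Y.ψ z with hF
  set D : Mat3 := Matrix.of fun s i => Y.eTh i (fun y => Y.φ y s k) z with hD
  have hG : G * G⁻¹ = 1 := mul_nonsing_inv _ h.isUnit_g
  have hZ : (Matrix.of fun b c =>
      ∑ s, Y.eTh b (fun y => Y.φ y s k) z * Y.g z s c + Y.eEt k (fun y => Y.g y b c) z
      - ∑ s, ∑ t, Y.ψ z s b * Y.eEt k (fun y => Y.g y t s) z * Y.φ z t c)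
      = Dᵀ * G + E - (Y.ψ z)ᵀ * Eᵀ * Y.φ z := by
    ext b c
    simp only [Matrix.of_apply, Matrix.sub_apply, Matrix.add_apply, Matrix.mul_apply,
      transpose_apply, hD, hE, vdm_apply, ← eEt_eq, sum_mul]
    congr 1
    exact sum_comm
  have hnm : Y.nm z k = Y.matN z * (D + Y.φ z * F) := by
    ext p i
    simp [nm, Matrix.mul_apply, hD, hF, ← eEt_eq, symM]
  have hNA : (Y.matN z)ᵀ = G * A := by
    rw [hA, ← mul_assoc, ← h.matN_transpose_mul_g, mul_assoc, hG, mul_one]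
  have hφN : Y.matN z * Y.φ z * G⁻¹ = Y.φ z * A := by
    rw [← φ_mul_matNbar h.hd, hA, mul_assoc]
  have hPA : G⁻¹ = Y.pairingBar z * A := by
    rw [hA, ← mul_assoc, pairingBar_mul_matNbar h.hd, one_mul]
  rw [hZ]
  apply Matrix.transpose_injective
  have e3 : (G⁻¹.transpose * (F * Y.matN z * Y.φ z)ᵀ * Gᵀ)ᵀ
      = G * (F * (Y.φ z * A)) := by
    rw [transpose_mul, transpose_transpose, ← transpose_mul, transpose_transpose, mul_assoc F,
      mul_assoc F, hφN]
  have e4 : (G⁻¹.transpose * Eᵀ)ᵀ = E * G⁻¹ := by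
    rw [transpose_mul, transpose_transpose, transpose_transpose]
  rw [Matrix.transpose_sub, Matrix.transpose_add, hnm, transpose_mul, hNA, e3, e4, transpose_mul,
    transpose_transpose, transpose_transpose]
  have hsψ : Fᵀ * Gᵀ + (Y.ψ z)ᵀ * Eᵀ = E * Y.ψ z + G * F := h.vdm_symψ _
  have hsφ : (Y.φ z)ᵀ * G = Gᵀ * Y.φ z := h.symφ.self_of_nhds
  clear_value A
  have e1 : (D + Y.φ z * F)ᵀ * (G * A)
      = Dᵀ * G * A + Fᵀ * Gᵀ * Y.φ z * A := by
    rw [Matrix.transpose_add, transpose_mul, add_mul, mul_assoc Fᵀ Gᵀ, ← hsφ]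
    simp [mul_assoc]
  have e2 : E * G⁻¹ = E * A - E * Y.ψ z * Y.φ z * A := by
    rw [hPA, pairingBar, sub_mul, one_mul, mul_sub]
    simp [mul_assoc]
  rw [e1, e2, eq_sub_of_add_eq hsψ]
  simp only [sub_mul, add_mul, mul_assoc]
  abel

theorem sum_nm_symm (x : Gr) : ∑ k, ∑ r, ∑ l, (Y.gInv r l z * Y.matNbar z k r) • mg (th l) (qth
      (Y.nm z k + ((Y.g z)⁻¹)ᵀ * (vdm (Y.col z (et k)) Y.g z)ᵀ
      - ((Y.g z)⁻¹)ᵀ * (vdm (Y.col z (et k)) Y.ψ z * Y.matN z * Y.φ z)ᵀ *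
            (Y.g z)ᵀ) x) = 0 := by
  set A := Y.matNbar z * (Y.g z)⁻¹ with hA
  set Z : Fin 3 → Fin 3 → Fin 3 → ℂ := fun k b c =>
      ∑ s, Y.eTh b (fun y => Y.φ y s k) z * Y.g z s c + Y.eEt k (fun y => Y.g y b c) z
      - ∑ s, ∑ t, Y.ψ z s b * Y.eEt k (fun y => Y.g y t s) z * Y.φ z t c with hZ
  have hZs : ∀ k b c, Z k b c = Z c b k := fun k b c => h.symm_aux k c b
  have h0 : ∀ k l, ∑ r, Y.gInv r l z * Y.matNbar z k r = A k l := fun k l => by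
    simp [hA, Matrix.mul_apply, gInv, mul_comm]
  have h1 : ∀ k : Fin 3, ∑ r, ∑ l, (Y.gInv r l z * Y.matNbar z k r) • mg (th l) (qth
      (Y.nm z k + ((Y.g z)⁻¹)ᵀ * (vdm (Y.col z (et k)) Y.g z)ᵀ
      - ((Y.g z)⁻¹)ᵀ * (vdm (Y.col z (et k)) Y.ψ z * Y.matN z * Y.φ z)ᵀ * (Y.g z)ᵀ) x)
      = ∑ q, ∑ l, ∑ p, (∑ c, A k l * A c p * Z k q c) • mg (th l) (mg (th p) (dg (th q) x)) := by
    intro k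
    rw [sum_comm]
    simp only [← sum_smul, h0]
    rw [h.nm_identity k, qth_apply]
    simp only [map_sum, map_smul, smul_sum, smul_smul]
    rw [sum_rotate, sum_rotate]
    refine sum_ext fun q => sum_ext fun l =>
      sum_ext fun p => ?_
    congr 1
    rw [Matrix.mul_apply, mul_sum]
    refine sum_ext fun c => ?_
    rw [mul_assoc]
    rfl
  simp only [h1]
  rw [sum_comm]
  refine sum_eq_zero fun q _ => ?_
  rw [sum_rotate]
  simp only [← sum_smul]
  refine sum_mg_mg_symm th _ (fun l p => ?_) _
  rw [sum_comm]
  refine sum_ext fun k => sum_ext fun c => ?_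
  rw [hZs]; ring

/-- The explicit form of `S`. -/
theorem opS_eq (ha : RDiffAt a z) : Y.opS a z = Y.explS a z := by
  rw [opS_eq_hodge h.hφ h.hψ h.hd h.symψ, opDbar_eq h.hs h.hs0 h.hφ h.hψ h.hd h.ksφ h.divφ
    (differentiableAt_hodge h.hg h.hg0 ha), hodge_explDbar_hodge h.hg h.hg0 ha, h.explS_eq, ←
    sub_eq_zero, ← neg_eq_zero, ← h.sum_nm_symm (a z)]
  simp only [← sum_sub_distrib, ← sum_neg_distrib, ← smul_sub, ← smul_neg, ← map_sub, ← map_neg]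
  refine sum_ext fun k => sum_ext fun r =>
    sum_ext fun l => ?_
  congr 2
  simp only [qth_add, qth_sub, LinearMap.add_apply, LinearMap.sub_apply]
  abel

end Admissible
end Geom

theorem vd_single {V : Type*} [NormedAddCommGroup V] [NormedSpace ℝ V] [NormedSpace ℂ V] (k : Fin 6)
    (f : E3 → V) (z : E3) : vd (single k 1) f z = pd k f z := by
  simp [vd, single_apply, ite_smul]

theorem sum_pull {ι κ μ ν M : Type*} [Fintype ι] [Fintype κ] [Fintype μ] [Fintype ν]
    [AddCommMonoid M] (f : ι → κ → μ → ν → M) :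
    ∑ i, ∑ j, ∑ k, ∑ l, f i j k l = ∑ l, ∑ i, ∑ j, ∑ k, f i j k l :=
  (sum_ext fun _ => (sum_ext fun _ => sum_comm).trans
    sum_comm).trans sum_comm

theorem dg_et_qth (A : Mat3) (j : Fin 3) (x : Gr) :
    dg (et j) (qth A x) = ∑ p, ∑ q, A p q • mg (th p) (dg (th q) (dg (et j) x)) := by
  simp [qth_apply, dg_mg, et_ne_th, dg_dg (et j) (th _)]

theorem dg_et_qet (A : Mat3) (j : Fin 3) (x : Gr) : dg (et j) (qet A x) = ∑ q, A j q • dg (et q) x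
      - ∑ p, ∑ q, A p q • mg (et p) (dg (et j) (dg (et q) x)) := by
  simp only [qet_apply, map_sum, map_smul, dg_mg, et_inj, smul_sub, sum_sub_distrib, smul_ite,
    smul_zero]
  congr 1
  rw [sum_comm]
  simp

namespace Geom

variable {Y : Geom} {z : E3} {a b : E3 → Gr}

/-- The general form of an operator with the principal part of `R`. -/
def rform (Y : Geom) (z : E3) (e : Fin 3 → Gr) (α : Fin 3 → ℂ) (β γ : Fin 3 → Fin 3 → Fin 3 → ℂ)
    (x : Gr) : Gr :=
  ∑ k, ∑ j, Y.gInv j k z • dg (et j) (e k) + ∑ q, α q • dg (et q) x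
    + ∑ p, ∑ j, ∑ q, β p j q • mg (et p) (dg (et j) (dg (et q) x))
    + ∑ m, ∑ b, ∑ c, γ m b c • mg (th m) (dg (th b) (dg (et c) x))

theorem hodge_mg_dg_dg_hodge (hg0 : (Y.g z).det ≠ 0) (m i j : Fin 3) (x : Gr) :
    Y.hodge z (mg (et m) (dg (th i) (dg (et j) (Y.hodge z x))))
      = ∑ l, ∑ b, ∑ c, (Y.gInv m l z * Y.gInv c i z * Y.g z b j) •
        mg (th l) (dg (th b) (dg (et c) x)) := by
  simp only [hodge_mg_et, hodge_dg_th hg0, hodge_dg_et hg0, hodge_hodge hg0, map_sum, map_smul,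
    map_neg, par_dg, par_par, smul_neg, neg_neg, smul_sum, smul_smul, dg_dg (et _) (th _),
    sum_neg_distrib]
  refine sum_ext fun l => ?_
  rw [sum_comm]
  simp [mul_assoc]

theorem explDelta_eq (hs : RDiffAt Y.s z) (hs0 : Y.s z ≠ 0) (hφ : MatDiff Y.φ z)
    (hψ : MatDiff Y.ψ z) (hd : (Y.pairing z).det ≠ 0) (ha : RDiffAt a z) :
    Y.explDelta a z
      = ∑ i, dg (th i) (Y.eTh i a z + ((Y.omegaCoeff z)⁻¹ * Y.eTh i Y.omegaCoeff z) • a z)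
        - ∑ m, ∑ j, ∑ i, pd (et m) (fun y => Y.ψ y j i) z •
        mg (et m) (dg (th i) (dg (et j) (a z))) := by
  have hw := differentiableAt_omegaCoeff hs hφ hψ
  have hw0 : Y.omegaCoeff z ≠ 0 := mul_ne_zero hs0 hd
  have h4 : ∀ i, Y.eTh i (fun y => dg (th i) (Y.omegaCoeff y • a y)) z
      = dg (th i) (Y.omegaCoeff z • Y.eTh i a z + Y.eTh i Y.omegaCoeff z • a z) := by
    intro i
    rw [eTh_eq, eTh_eq, eTh_eq, vd_lin _ (dg (th i)) (hw.fun_smul ha), vd_smul _ hw ha]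
  unfold explDelta
  simp only [lder_eq, gmul_gen, h4, smul_sum, ← map_smul, smul_add, smul_smul, inv_mul_cancel₀ hw0,
    one_smul]

theorem hodge_explDelta_hodge (hs : RDiffAt Y.s z) (hs0 : Y.s z ≠ 0)
    (hg : MatDiff Y.g z) (hg0 : (Y.g z).det ≠ 0) (hφ : MatDiff Y.φ z)
    (hψ : MatDiff Y.ψ z) (hd : (Y.pairing z).det ≠ 0) (ha : RDiffAt a z) :
    -Y.hodge z (Y.explDelta (fun y => Y.hodge y (a y)) z)
      = Y.rform z (fun k => Y.eTh k a z)
        (fun q => ∑ k, Y.gInv q k z * ((Y.omegaCoeff z)⁻¹ * Y.eTh k Y.omegaCoeff z)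
          - ∑ k, ∑ j, Y.gInv j k z * ((vdm (Y.col z (th k)) Y.g z)ᵀ * ((Y.g z)⁻¹)ᵀ) j q)
        (fun p j q => ∑ k, Y.gInv j k z * ((vdm (Y.col z (th k)) Y.g z)ᵀ *
            ((Y.g z)⁻¹)ᵀ) p q)
        (fun m b c => ∑ k, Y.gInv c k z * (((Y.g z)⁻¹)ᵀ *
            (vdm (Y.col z (th k)) Y.g z)ᵀ) m b
          + ∑ n, ∑ j, ∑ i, pd (et n) (fun y => Y.ψ y j i) z *
            (Y.gInv n m z * Y.gInv c i z * Y.g z b j)) (a z) := by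
  have e1 : ∀ i, Y.hodge z (dg (th i) (Y.eTh i (fun y => Y.hodge y (a y)) z
      + ((Y.omegaCoeff z)⁻¹ * Y.eTh i Y.omegaCoeff z) • Y.hodge z (a z)))
      = -∑ j, Y.gInv j i z • dg (et j) (Y.eTh i a z
      + qth (((Y.g z)⁻¹)ᵀ * (vdm (Y.col z (th i)) Y.g z)ᵀ) (a z)
      - qet ((vdm (Y.col z (th i)) Y.g z)ᵀ * ((Y.g z)⁻¹)ᵀ) (a z)
      + ((Y.omegaCoeff z)⁻¹ * Y.eTh i Y.omegaCoeff z) • a z) := by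
    intro i
    rw [eTh_hodge hg hg0 ha, ← hodge_smul, ← hodge_add, hodge_dg_th hg0, hodge_hodge hg0]
    simp only [map_neg, par_par, smul_neg, sum_neg_distrib]
  have e2 : Y.hodge z (Y.explDelta (fun y => Y.hodge y (a y)) z)
      = -∑ i, ∑ j, Y.gInv j i z • dg (et j) (Y.eTh i a z
      + qth (((Y.g z)⁻¹)ᵀ * (vdm (Y.col z (th i)) Y.g z)ᵀ) (a z)
      - qet ((vdm (Y.col z (th i)) Y.g z)ᵀ * ((Y.g z)⁻¹)ᵀ) (a z)
      + ((Y.omegaCoeff z)⁻¹ * Y.eTh i Y.omegaCoeff z) • a z)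
      - ∑ n, ∑ j, ∑ i, ∑ l, ∑ b, ∑ c, (pd (et n) (fun y => Y.ψ y j i) z *
        (Y.gInv n l z * Y.gInv c i z * Y.g z b j)) •
        mg (th l) (dg (th b) (dg (et c) (a z))) := by
    rw [explDelta_eq hs hs0 hφ hψ hd (differentiableAt_hodge hg hg0 ha), hodge_sub, hodge_sum]
    simp only [e1, hodge_sum, hodge_smul, hodge_mg_dg_dg_hodge hg0, smul_sum, smul_smul,
      sum_neg_distrib]
  have e3 : ∑ n, ∑ j, ∑ i, ∑ l, ∑ b, ∑ c, (pd (et n) (fun y => Y.ψ y j i) z *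
        (Y.gInv n l z * Y.gInv c i z * Y.g z b j)) •
        mg (th l) (dg (th b) (dg (et c) (a z)))
      = ∑ l, ∑ b, ∑ c, (∑ n, ∑ j, ∑ i, pd (et n) (fun y => Y.ψ y j i) z *
        (Y.gInv n l z * Y.gInv c i z * Y.g z b j)) •
        mg (th l) (dg (th b) (dg (et c) (a z))) := by
    simp only [sum_smul]
    rw [sum_pull]
    refine sum_ext fun l => ?_
    rw [sum_pull]
    refine sum_ext fun b => ?_
    rw [sum_pull]
  rw [e2, e3]
  simp only [map_add, map_sub, map_smul, dg_et_qth, dg_et_qet, smul_add, smul_sub, sum_add_distrib,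
    sum_sub_distrib, rform, add_smul, sub_smul]
  have t1 : ∀ A : Fin 3 → Mat3, ∑ k, ∑ j, Y.gInv j k z • ∑ p, ∑ q, A k p q •
      mg (th p) (dg (th q) (dg (et j) (a z)))
      = ∑ m, ∑ b, ∑ c, (∑ k, Y.gInv c k z * A k m b) • mg (th m) (dg (th b) (dg (et c) (a z))) := by
    intro A
    simp only [smul_sum, smul_smul, sum_smul]
    rw [← sum_pull fun j p q k => (Y.gInv j k z * A k p q) •
      mg (th p) (dg (th q) (dg (et j) (a z))), sum_rotate]
  have t2 : ∀ B : Fin 3 → Mat3, ∑ k, ∑ j, Y.gInv j k z • ∑ q, B k j q •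
      dg (et q) (a z) = ∑ q, (∑ k, ∑ j, Y.gInv j k z * B k j q) • dg (et q) (a z) := by
    intro B
    simp only [smul_sum, smul_smul, sum_smul]
    rw [sum_rotate, sum_rotate]
  have t3 : ∀ B : Fin 3 → Mat3, ∑ k, ∑ j, Y.gInv j k z • ∑ p, ∑ q, B k p q •
      mg (et p) (dg (et j) (dg (et q) (a z)))
      = ∑ p, ∑ j, ∑ q, (∑ k, Y.gInv j k z * B k p q) •
        mg (et p) (dg (et j) (dg (et q) (a z))) := by
    intro B
    simp only [smul_sum, smul_smul, sum_smul]
    rw [← sum_pull fun j p q k => (Y.gInv j k z * B k p q) •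
      mg (et p) (dg (et j) (dg (et q) (a z))), sum_comm]
  have t4 : ∀ c : Fin 3 → ℂ, ∑ k, ∑ j, Y.gInv j k z • c k • dg (et j) (a z)
      = ∑ q, (∑ k, Y.gInv q k z * c k) • dg (et q) (a z) := by
    intro c
    simp only [smul_smul, sum_smul]
    exact sum_comm
  rw [t1, t2, t3, t4]
  abel

theorem explR_form (ha : RDiffAt a z)
    (hσ : RDiffAt Y.expSigma z) (hσ0 : Y.expSigma z ≠ 0) :
    Y.explR a z
      = Y.rform z (fun k => Y.eTh k a z)
        (fun q => ∑ k, Y.gInv q k z * ((Y.expSigma z)⁻¹ * Y.eTh k Y.expSigma z)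
          + ∑ t, ∑ k, Y.gInv t k z * pd (et t) (fun y => Y.ψ y q k) z)
        (fun p j q => -∑ k, Y.gInv j k z * pd (et p) (fun y => Y.ψ y q k) z)
        (fun m b c => ∑ p, Y.matN z m p *
          ((∑ k, Y.gInv c k z * Y.eTh b (fun y => Y.pairing y p k) z)
            + (∑ l, Y.gInv l p z * Y.symMbar c l b z)
            + ∑ s, ∑ k, Y.gInv c s z * Y.pairing z k s * (Y.christ p b k z
                  + ∑ l, ∑ q, ∑ n, Y.gInv l p z * Y.g z k q * Y.christBar q n l z * Y.ψ z n b)))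
        (a z) := by
  have h4 : ∀ j k, Y.eTh k (fun y => dg (et j) (Y.expSigma y • a y)) z
      = dg (et j) (Y.expSigma z • Y.eTh k a z + Y.eTh k Y.expSigma z • a z) := by
    intro j k
    rw [eTh_eq, eTh_eq, eTh_eq, vd_lin _ (dg (et j)) (hσ.fun_smul ha), vd_smul _ hσ ha]
  have t1 : (Y.expSigma z)⁻¹ • ∑ j, ∑ k, Y.gInv j k z •
      dg (et j) (Y.expSigma z • Y.eTh k a z + Y.eTh k Y.expSigma z • a z)
      = ∑ k, ∑ j, Y.gInv j k z • dg (et j) (Y.eTh k a z)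
        + ∑ q, (∑ k, Y.gInv q k z * ((Y.expSigma z)⁻¹ * Y.eTh k Y.expSigma z)) •
          dg (et q) (a z) := by
    rw [sum_comm (f := fun k j => Y.gInv j k z • dg (et j) (Y.eTh k a z)),
      ← sum_add_distrib, smul_sum]
    refine sum_ext fun j => ?_
    rw [sum_smul, ← sum_add_distrib, smul_sum]
    refine sum_ext fun k => ?_
    rw [map_add, map_smul, map_smul, smul_add, smul_add, smul_smul, smul_smul, smul_smul, smul_smul]
    congr 2
    · field_simp
    · ring
  unfold explR
  simp only [lder_eq, gmul_gen, h4]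
  rw [t1, rform]
  simp only [add_smul, sum_add_distrib, neg_smul, sum_neg_distrib]
  rw [sum_rotate (fun j l n => (∑ k, Y.gInv j k z * pd (et n) (fun y => Y.ψ y l k) z) •
    mg (et n) (dg (et j) (dg (et l) (a z)))),
    sum_rotate (fun l n j => (∑ k, Y.gInv j k z * pd (et n) (fun y => Y.ψ y l k) z) •
    mg (et n) (dg (et j) (dg (et l) (a z))))]
  abel

namespace Admissible

variable (h : Y.Admissible z)

include h

theorem gInv_mul_g (i j : Fin 3) : ∑ k, Y.gInv i k z * Y.g z k j = if i = j then 1 else 0 := by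
  have := congrFun (congrFun (nonsing_inv_mul _ h.isUnit_g) i) j
  simpa [Matrix.mul_apply, one_apply, gInv] using this

theorem curl_g (i c a : Fin 3) : Y.eTh i (fun y => Y.g y c a) z - Y.eTh c (fun y => Y.g y i a) z
      = ∑ m, (Y.g z i m * pd (et a) (fun y => Y.ψ y m c) z
        - Y.g z c m * pd (et a) (fun y => Y.ψ y m i) z) := by
  have h1 := congrFun (congrFun (h.vdm_symψ (single (et a) 1)) i) c
  simp only [Matrix.add_apply, Matrix.mul_apply, transpose_apply, vdm_apply, vd_single]
    at h1
  simp only [eTh, smul_eq_mul, sum_sub_distrib, h.closed c a i, h.closedBar _ a]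
  have e1 : ∀ f f' : Fin 3 → ℂ, ∑ m, f m * f' m = ∑ m, f' m * f m := fun f f' =>
    sum_ext fun _ => mul_comm _ _
  rw [e1 (fun m => pd (et a) (fun y => Y.ψ y m i) z), e1 (fun m => pd (et a) (fun y => Y.g y i m) z)]
    at h1
  linear_combination h1

theorem inner_identity (b i n : Fin 3) : ∑ a, Y.eTh i (fun y => Y.g y b a) z * Y.ψ z a n
      + ∑ a, Y.g z b a * Y.eTh n (fun y => Y.ψ y a i) z
      - ∑ a, Y.g z b a * pd (th n) (fun y => Y.ψ y a i) z
      + ∑ a, Y.g z i a * pd (th n) (fun y => Y.ψ y a b) z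
    = ∑ a, Y.eTh b (fun y => Y.g y i a) z * Y.ψ z a n
      + ∑ a, Y.g z i a * Y.eTh b (fun y => Y.ψ y a n) z := by
  have h1 : ∑ a, Y.eTh i (fun y => Y.g y b a) z * Y.ψ z a n
      - ∑ a, Y.eTh b (fun y => Y.g y i a) z * Y.ψ z a n
      = ∑ a, ∑ m, Y.g z i a * (Y.ψ z m n * pd (et m) (fun y => Y.ψ y a b) z)
        - ∑ a, ∑ m, Y.g z b a * (Y.ψ z m n * pd (et m) (fun y => Y.ψ y a i) z) := by
    rw [sum_comm (f := fun a m => Y.g z i a * (Y.ψ z m n * pd (et m) (fun y => Y.ψ y a b) z)),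
      sum_comm (f := fun a m => Y.g z b a * (Y.ψ z m n * pd (et m) (fun y => Y.ψ y a i) z)),
      ← sum_sub_distrib, ← sum_sub_distrib]
    refine sum_ext fun a => ?_
    rw [← sub_mul, h.curl_g, sum_mul, ← sum_sub_distrib]
    exact sum_ext fun m => by ring
  have h2 : ∀ c i, ∑ a, Y.g z c a * Y.eTh n (fun y => Y.ψ y a i) z
      = ∑ a, Y.g z c a * pd (th n) (fun y => Y.ψ y a i) z
        + ∑ a, ∑ m, Y.g z c a * (Y.ψ z m n * pd (et m) (fun y => Y.ψ y a i) z) := by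
    intro c i
    rw [← sum_add_distrib]
    refine sum_ext fun a => ?_
    simp [eTh, mul_add, mul_sum]
  simp only [h.ksψ b n]
  rw [h2, h2]
  linear_combination h1

theorem theta_identity (b l i : Fin 3) : ∑ c, Y.pairingBar z c l * (Y.eTh i (fun y => Y.g y b c) z
        + ∑ a, Y.g z b a * pd (et c) (fun y => Y.ψ y a i) z)
    = ((vdm (Y.col z (th b)) Y.g z)ᵀ * Y.pairing z
        + (Y.g z)ᵀ * vdm (Y.col z (th b)) Y.pairing z) l i
      + ∑ j, Y.g z i j * Y.symMbar j l b z := by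
  set c := Y.col z (th b) with hc
  have hP : vdm c Y.pairing z = -(vdm c Y.φ z * Y.ψ z + Y.φ z * vdm c Y.ψ z) := by
    change vdm c (fun y => 1 - Y.φ y * Y.ψ y) z = _
    rw [vdm_sub c (mdiff_const 1) (h.hφ.mul h.hψ), vdm_const, vdm_mul c h.hφ h.hψ, zero_sub]
  have hsφ := h.vdm_symφ c
  have hsφ0 := h.symφ.self_of_nhds
  have h1 : (vdm c Y.g z)ᵀ * Y.pairing z + (Y.g z)ᵀ * vdm c Y.pairing z
      = (vdm c Y.g z)ᵀ - (vdm c Y.φ z)ᵀ * (Y.g z * Y.ψ z)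
        - (Y.φ z)ᵀ * (vdm c Y.g z * Y.ψ z + Y.g z * vdm c Y.ψ z) := by
    have e1 : (vdm c Y.g z)ᵀ * Y.pairing z = (vdm c Y.g z)ᵀ
        - (vdm c Y.g z)ᵀ * Y.φ z * Y.ψ z := by
      rw [pairing, mul_sub, mul_one, mul_assoc]
    have e2 : (Y.g z)ᵀ * vdm c Y.pairing z
        = -((Y.g z)ᵀ * vdm c Y.φ z * Y.ψ z
          + (Y.φ z)ᵀ * Y.g z * vdm c Y.ψ z) := by
      rw [hP, hsφ0, mul_neg, mul_add]
      simp only [mul_assoc]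
    rw [e1, e2, eq_sub_of_add_eq hsφ.symm]
    simp only [mul_add, add_mul, sub_mul, mul_assoc]
    abel
  have h2 : ∑ j, Y.g z i j * Y.symMbar j l b z
      = ∑ j, Y.g z i j * Y.eEt l (fun y => Y.ψ y j b) z
        + ((vdm c Y.φ z)ᵀ * (Y.g z * Y.ψ z)) l i := by
    rw [← h.symψ.self_of_nhds]
    simp only [symMbar, mul_add, sum_add_distrib, Matrix.mul_apply, transpose_apply, vdm_apply, hc,
      ← eTh_eq, mul_sum]
    congr 1
    rw [sum_comm]
    exact sum_ext fun _ => sum_ext fun _ => by ring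
  have h3 : ((Y.φ z)ᵀ * (vdm c Y.g z * Y.ψ z + Y.g z * vdm c Y.ψ z)) l i
      = ∑ n, Y.φ z n l * (∑ a, Y.eTh b (fun y => Y.g y i a) z * Y.ψ z a n
      + ∑ a, Y.g z i a * Y.eTh b (fun y => Y.ψ y a n) z) := by
    have e : (vdm c Y.g z * Y.ψ z + Y.g z * vdm c Y.ψ z)
        = (vdm c Y.g z * Y.ψ z + Y.g z * vdm c Y.ψ z)ᵀ := by
      have := h.vdm_symψ c
      rw [Matrix.transpose_add, transpose_mul, transpose_mul, add_comm _ (_ * (Y.g z)ᵀ), this]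
    rw [e]
    simp only [Matrix.mul_apply, transpose_apply, Matrix.add_apply, vdm_apply, hc, ← eTh_eq]
  have h4 : ∑ k, Y.pairingBar z k l * Y.eTh i (fun y => Y.g y b k) z
      = Y.eTh i (fun y => Y.g y b l) z
        - ∑ n, Y.φ z n l * ∑ a, Y.eTh i (fun y => Y.g y b a) z * Y.ψ z a n := by
    simp only [pairingBar, Matrix.sub_apply, sub_mul, sum_sub_distrib, one_apply, ite_mul, one_mul,
      zero_mul, sum_ite_eq', mem_univ, if_true, Matrix.mul_apply, sum_mul, mul_sum]
    congr 1
    rw [sum_comm]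
    exact sum_ext fun _ => sum_ext fun _ => by ring
  have h5 : ∑ k, Y.pairingBar z k l * ∑ a, Y.g z b a * pd (et k) (fun y => Y.ψ y a i) z
      = ∑ a, Y.g z b a * Y.eEt l (fun y => Y.ψ y a i) z
        - ∑ n, Y.φ z n l * ∑ a, Y.g z b a * Y.eTh n (fun y => Y.ψ y a i) z := by
    have e : ∑ k, Y.pairingBar z k l * ∑ a, Y.g z b a * pd (et k) (fun y => Y.ψ y a i) z
        = ∑ a, Y.g z b a * ∑ k, Y.pairingBar z k l * pd (et k) (fun y => Y.ψ y a i) z := by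
      simp only [mul_sum]
      rw [sum_comm]
      exact sum_ext fun _ => sum_ext fun _ => by ring
    rw [e]
    simp only [← eEt_sub_eTh, mul_sub, sum_sub_distrib, mul_sum]
    congr 1
    rw [sum_comm]
    exact sum_ext fun _ => sum_ext fun _ => by ring
  have h6 : ∀ c i, ∑ a, Y.g z c a * Y.eEt l (fun y => Y.ψ y a i) z
      = ∑ a, Y.g z c a * pd (et l) (fun y => Y.ψ y a i) z
        + ∑ n, Y.φ z n l * ∑ a, Y.g z c a * pd (th n) (fun y => Y.ψ y a i) z := by
    intro c i
    simp only [eEt, smul_eq_mul, mul_add, sum_add_distrib, mul_sum]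
    congr 1
    rw [sum_comm]
    exact sum_ext fun _ => sum_ext fun _ => by ring
  have h7 := h.curl_g i b l
  rw [sum_sub_distrib] at h7
  have h8 : ∑ n, Y.φ z n l * (∑ a, Y.eTh i (fun y => Y.g y b a) z * Y.ψ z a n
      + ∑ a, Y.g z b a * Y.eTh n (fun y => Y.ψ y a i) z
      - ∑ a, Y.g z b a * pd (th n) (fun y => Y.ψ y a i) z
      + ∑ a, Y.g z i a * pd (th n) (fun y => Y.ψ y a b) z)
      = ∑ n, Y.φ z n l * (∑ a, Y.eTh b (fun y => Y.g y i a) z * Y.ψ z a n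
      + ∑ a, Y.g z i a * Y.eTh b (fun y => Y.ψ y a n) z) :=
    sum_ext fun n => by rw [h.inner_identity]
  rw [h1, Matrix.sub_apply, Matrix.sub_apply, h3, h2, h6, ← h8]
  simp only [mul_add, mul_sub, sum_add_distrib, sum_sub_distrib] at h4 h5 h6 ⊢
  rw [h4, h5, h6, transpose_apply, vdm_apply, hc, ← eTh_eq]
  linear_combination h7

theorem g_mul_gInv (i j : Fin 3) : ∑ k, Y.g z i k * Y.gInv k j z = if i = j then 1 else 0 := by
  have := congrFun (congrFun (mul_nonsing_inv _ h.isUnit_g) i) j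
  simpa [Matrix.mul_apply, one_apply, gInv] using this

theorem differentiableAt_s : RDiffAt Y.s z := h.hs.restrictScalars ℝ

theorem expSigma_mul_det : ∀ᶠ y in 𝓝 z, Y.expSigma y * (Y.g y).det
    = Y.omegaCoeff y * conj (Y.s y) := by
  filter_upwards [h.hg.eventually_det_ne h.hg0] with y hy
  rw [expSigma, omegaCoeff, mul_assoc, div_mul_cancel₀ _ hy, ← Complex.mul_conj', mul_comm (Y.s y) (Y.pairing y).det]
  ring

theorem expSigma_ne_zero : Y.expSigma z ≠ 0 := by
  have := h.hs0
  refine mul_ne_zero h.hd (div_ne_zero (pow_ne_zero _ ?_) h.hg0)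
  simpa using this

theorem differentiableAt_expSigma : RDiffAt Y.expSigma z := by
  have h1 := (differentiableAt_omegaCoeff h.differentiableAt_s h.hφ h.hψ).fun_mul
    (differentiableAt_conj h.differentiableAt_s)
  refine (h1.fun_mul (h.hg.det.inv h.hg0)).congr_of_eventuallyEq ?_
  filter_upwards [h.expSigma_mul_det, h.hg.eventually_det_ne h.hg0] with y hy hy0
  rw [← hy, mul_assoc]
  change _ = _ * ((Y.g y).det * ((Y.g y).det)⁻¹)
  rw [mul_inv_cancel₀ hy0, mul_one]

theorem log_deriv_expSigma (k : Fin 3) : (Y.expSigma z)⁻¹ * Y.eTh k Y.expSigma z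
      = (Y.omegaCoeff z)⁻¹ * Y.eTh k Y.omegaCoeff z
        - ∑ m, pd (et m) (fun y => Y.ψ y m k) z
        - ((Y.g z)⁻¹ * vdm (Y.col z (th k)) Y.g z).trace := by
  set c := Y.col z (th k) with hc
  have hs := h.differentiableAt_s
  have hw := differentiableAt_omegaCoeff hs h.hφ h.hψ
  have hw0 : Y.omegaCoeff z ≠ 0 := mul_ne_zero h.hs0 h.hd
  have hcs : conj (Y.s z) ≠ 0 := by simpa using h.hs0
  have h1 := vd_congr c h.expSigma_mul_det
  rw [vd_mul c h.differentiableAt_expSigma h.hg.det, vd_mul c hw (differentiableAt_conj hs), vd_det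
    c h.hg h.hg0] at h1
  have h2 : vd c (fun y => conj (Y.s y)) z
      = -(conj (Y.s z) * ∑ m, pd (et m) (fun y => Y.ψ y m k) z) := by
    have h3 := h.divψ k
    simp only [pd_mul _ (differentiableAt_conj hs) (h.hψ _ k), sum_add_distrib, ← mul_sum] at h3
    rw [hc, ← eTh_eq, eTh, pd_conj, cconj_th, pd_et_of_holomorphic h.hs, map_zero, zero_add]
    simp only [smul_eq_mul, mul_comm (Y.ψ z _ k)]
    linear_combination h3
  have h4 := h.expSigma_mul_det.self_of_nhds
  have hσ0 := h.expSigma_ne_zero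
  have hg0 := h.hg0
  rw [h2] at h1
  rw [eTh_eq, eTh_eq, ← hc]
  have h5 : vd c Y.expSigma z = Y.expSigma z * ((Y.omegaCoeff z)⁻¹ * vd c Y.omegaCoeff z
        - ∑ m, pd (et m) (fun y => Y.ψ y m k) z - ((Y.g z)⁻¹ * vdm c Y.g z).trace) := by
    have : vd c Y.omegaCoeff z = Y.omegaCoeff z * ((Y.omegaCoeff z)⁻¹ * vd c Y.omegaCoeff z) := by
      rw [mul_inv_cancel_left₀ hw0]
    refine mul_right_cancel₀ hg0 ?_
    rw [this] at h1
    linear_combination h1 + (((Y.omegaCoeff z)⁻¹ * vd c Y.omegaCoeff z)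
      - ∑ m, pd (et m) (fun y => Y.ψ y m k) z) * (-h4)
  rw [h5, inv_mul_cancel_left₀ hσ0]

theorem sum_gInv_g (f : Fin 3 → ℂ) (q : Fin 3) :
    ∑ c, Y.gInv q c z * ∑ m, Y.g z c m * f m = f q := by
  simp only [mul_sum]
  rw [sum_comm]
  simp only [← mul_assoc, ← sum_mul, h.gInv_mul_g]
  simp

theorem coeff_one_eq (q : Fin 3) : ∑ k, Y.gInv q k z * ((Y.omegaCoeff z)⁻¹ * Y.eTh k Y.omegaCoeff z)
          - ∑ k, ∑ j, Y.gInv j k z * ((vdm (Y.col z (th k)) Y.g z)ᵀ * ((Y.g z)⁻¹)ᵀ) j q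
    = ∑ k, Y.gInv q k z * ((Y.expSigma z)⁻¹ * Y.eTh k Y.expSigma z)
          + ∑ t, ∑ k, Y.gInv t k z * pd (et t) (fun y => Y.ψ y q k) z := by
  have h1 : ∑ k, ∑ j, Y.gInv j k z * ((vdm (Y.col z (th k)) Y.g z)ᵀ * ((Y.g z)⁻¹)ᵀ) j q
      = ∑ c, Y.gInv q c z * ∑ i, ∑ j, Y.gInv j i z * Y.eTh i (fun y => Y.g y c j) z := by
    simp only [Matrix.mul_apply, transpose_apply, vdm_apply, ← eTh_eq, mul_sum]
    rw [← sum_rotate]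
    exact sum_ext fun c => sum_ext fun i =>
      sum_ext fun j => by simp only [gInv]; ring
  have h2 : ∀ c, ((Y.g z)⁻¹ * vdm (Y.col z (th c)) Y.g z).trace
      = ∑ i, ∑ j, Y.gInv j i z * Y.eTh c (fun y => Y.g y i j) z := by
    intro c
    simp only [Matrix.trace, Matrix.diag_apply, Matrix.mul_apply, vdm_apply, ← eTh_eq]
    exact sum_comm
  have h3 : ∀ c, ∑ i, ∑ j, Y.gInv j i z * Y.eTh c (fun y => Y.g y i j) z
      - ∑ i, ∑ j, Y.gInv j i z * Y.eTh i (fun y => Y.g y c j) z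
      = ∑ m, Y.g z c m * (∑ j, ∑ i, Y.gInv j i z * pd (et j) (fun y => Y.ψ y m i) z)
        - ∑ m, pd (et m) (fun y => Y.ψ y m c) z := by
    intro c
    have e : ∀ i j, Y.gInv j i z * Y.eTh c (fun y => Y.g y i j) z
        - Y.gInv j i z * Y.eTh i (fun y => Y.g y c j) z
        = ∑ m, Y.g z c m * (Y.gInv j i z * pd (et j) (fun y => Y.ψ y m i) z)
          - Y.gInv j i z * ∑ m, Y.g z i m * pd (et j) (fun y => Y.ψ y m c) z := by
      intro i j
      have := h.curl_g i c j
      rw [sum_sub_distrib] at this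
      have e' : ∑ m, Y.g z c m * (Y.gInv j i z * pd (et j) (fun y => Y.ψ y m i) z)
          = Y.gInv j i z * ∑ m, Y.g z c m * pd (et j) (fun y => Y.ψ y m i) z := by
        rw [mul_sum]
        exact sum_ext fun _ => by ring
      rw [e']
      linear_combination -Y.gInv j i z * this
    simp only [← sum_sub_distrib, e]
    simp only [sum_sub_distrib]
    congr 1
    · simp only [mul_sum]
      rw [sum_rotate, sum_rotate]
      exact sum_ext fun _ => sum_comm
    · rw [sum_comm]
      exact sum_ext fun j => h.sum_gInv_g _ j
  have h4 := h.sum_gInv_g (fun m => ∑ j, ∑ i, Y.gInv j i z * pd (et j) (fun y => Y.ψ y m i) z) q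
  rw [h1]
  simp only [h.log_deriv_expSigma, h2]
  rw [← h4, ← sub_eq_zero, ← sum_sub_distrib, ← sum_add_distrib, ← sum_sub_distrib]
  refine sum_eq_zero fun c _ => ?_
  linear_combination Y.gInv q c z * h3 c

theorem coeff_two_symm (p j q : Fin 3) :
    ∑ k, Y.gInv j k z * ((vdm (Y.col z (th k)) Y.g z)ᵀ * ((Y.g z)⁻¹)ᵀ) p q
      - (-∑ k, Y.gInv j k z * pd (et p) (fun y => Y.ψ y q k) z)
    = ∑ k, Y.gInv q k z * ((vdm (Y.col z (th k)) Y.g z)ᵀ * ((Y.g z)⁻¹)ᵀ) p j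
      - (-∑ k, Y.gInv q k z * pd (et p) (fun y => Y.ψ y j k) z) := by
  have h1 : ∀ j q, ∑ k, Y.gInv j k z * ((vdm (Y.col z (th k)) Y.g z)ᵀ * ((Y.g z)⁻¹)ᵀ) p q
      = ∑ i, ∑ c, Y.gInv j i z * Y.gInv q c z * Y.eTh i (fun y => Y.g y c p) z := by
    intro j q
    simp only [Matrix.mul_apply, transpose_apply, vdm_apply, ← eTh_eq, mul_sum]
    exact sum_ext fun i => sum_ext fun c => by
      simp only [gInv]; ring
  have h2 : ∑ i, ∑ c, Y.gInv j i z * Y.gInv q c z * Y.eTh i (fun y => Y.g y c p) z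
      - ∑ i, ∑ c, Y.gInv j i z * Y.gInv q c z * Y.eTh c (fun y => Y.g y i p) z
      = ∑ c, Y.gInv q c z * (∑ i, Y.gInv j i z * ∑ m, Y.g z i m * pd (et p) (fun y => Y.ψ y m c) z)
        - ∑ i, Y.gInv j i z * (∑ c, Y.gInv q c z *
          ∑ m, Y.g z c m * pd (et p) (fun y => Y.ψ y m i) z) := by
    have e1 : ∀ (u : Fin 3 → ℂ) (F : Fin 3 → Fin 3 → ℂ),
        ∑ c, u c * ∑ i, F c i = ∑ i, ∑ c, u c * F c i := by
      intro u F
      simp only [mul_sum]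
      exact sum_comm
    rw [e1 (fun c => Y.gInv q c z), e1 (fun c => Y.gInv j c z),
      sum_comm (f := fun c i => Y.gInv j i z * _)]
    simp only [← sum_sub_distrib]
    refine sum_ext fun i => sum_ext fun c => ?_
    have := h.curl_g i c p
    rw [sum_sub_distrib] at this
    linear_combination Y.gInv j i z * Y.gInv q c z * this
  simp only [h.sum_gInv_g] at h2
  rw [h1, h1, sum_comm (f := fun i c => Y.gInv q i z * Y.gInv j c z * _)]
  simp only [mul_comm (Y.gInv q _ z) (Y.gInv j _ z)]
  linear_combination h2

theorem coeff_three_eq (m b c : Fin 3) :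
    ∑ k, Y.gInv c k z * (((Y.g z)⁻¹)ᵀ * (vdm (Y.col z (th k)) Y.g z)ᵀ) m b
          + ∑ n, ∑ j, ∑ i, pd (et n) (fun y => Y.ψ y j i) z *
            (Y.gInv n m z * Y.gInv c i z * Y.g z b j)
    = ∑ p, Y.matN z m p * ((∑ k, Y.gInv c k z * Y.eTh b (fun y => Y.pairing y p k) z)
            + (∑ l, Y.gInv l p z * Y.symMbar c l b z)
            + ∑ s, ∑ k, Y.gInv c s z * Y.pairing z k s * (Y.christ p b k z
                  + ∑ l, ∑ q, ∑ n, Y.gInv l p z * Y.g z k q * Y.christBar q n l z * Y.ψ z n b)) := by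
  set G' := ((Y.g z)⁻¹)ᵀ with hG'
  set W : Mat3 := Matrix.of fun n i => Y.eTh i (fun y => Y.g y b n) z
    + ∑ j, Y.g z b j * pd (et n) (fun y => Y.ψ y j i) z with hW
  set U : Mat3 := Matrix.of fun l j => Y.symMbar j l b z with hU
  set E := vdm (Y.col z (th b)) Y.g z with hE
  set F := vdm (Y.col z (th b)) Y.pairing z with hF
  have hGG : (Y.g z)ᵀ * G' = 1 := by
    rw [hG', ← transpose_mul, nonsing_inv_mul _ h.isUnit_g, transpose_one]
  have hGG' : G' * (Y.g z)ᵀ = 1 := by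
    rw [hG', ← transpose_mul, mul_nonsing_inv _ h.isUnit_g, transpose_one]
  have hth : (Y.pairingBar z)ᵀ * W
      = Eᵀ * Y.pairing z + (Y.g z)ᵀ * F + U * (Y.g z)ᵀ := by
    ext l i
    rw [Matrix.add_apply]
    refine (Matrix.mul_apply ..).trans ((h.theta_identity b l i).trans ?_)
    congr 1
    exact sum_ext fun _ => mul_comm _ _
  have hPG : G' * (Y.pairingBar z)ᵀ = Y.pairing z * G' := by
    have e := congrArg Matrix.transpose h.pairing_transpose_mul_g
    rw [transpose_mul, transpose_mul, transpose_transpose] at e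
    calc G' * (Y.pairingBar z)ᵀ
        = G' * ((Y.pairingBar z)ᵀ * (Y.g z)ᵀ) * G' := by
          rw [mul_assoc, mul_assoc, hGG, mul_one]
      _ = _ := by rw [← e, ← mul_assoc, hGG', one_mul]
  have hK : F * G' + G' * U + G' * Eᵀ * Y.pairing z * G' = Y.pairing z * (G' * W * G') := by
    calc _ = G' * (Eᵀ * Y.pairing z + (Y.g z)ᵀ * F + U * (Y.g z)ᵀ) * G' := by
          simp only [mul_add, add_mul, mul_assoc, hGG, mul_one]
          rw [← mul_assoc G' (Y.g z)ᵀ, hGG', one_mul]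
          abel
      _ = _ := by
          rw [← hth, ← mul_assoc G', hPG]
          simp [mul_assoc]
  have hl : ∑ k, Y.gInv c k z * (G' * (vdm (Y.col z (th k)) Y.g z)ᵀ) m b
          + ∑ n, ∑ j, ∑ i, pd (et n) (fun y => Y.ψ y j i) z *
            (Y.gInv n m z * Y.gInv c i z * Y.g z b j) = (G' * W * G') m c := by
    simp only [Matrix.mul_apply, hW, Matrix.of_apply, mul_add, sum_add_distrib, add_mul,
      transpose_apply, vdm_apply, ← eTh_eq, mul_sum, sum_mul, hG']
    congr 1
    · exact sum_ext fun _ => sum_ext fun _ => by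
        simp only [gInv]; ring
    · rw [sum_rotate, sum_rotate]
      exact sum_ext fun _ => sum_ext fun _ =>
        sum_ext fun _ => by simp only [gInv]; ring
  have hr : ∀ p, (∑ k, Y.gInv c k z * Y.eTh b (fun y => Y.pairing y p k) z)
            + (∑ l, Y.gInv l p z * Y.symMbar c l b z)
            + ∑ s, ∑ k, Y.gInv c s z * Y.pairing z k s * (Y.christ p b k z
                  + ∑ l, ∑ q, ∑ n, Y.gInv l p z * Y.g z k q * Y.christBar q n l z * Y.ψ z n b)
      = (F * G' + G' * U + G' * Eᵀ * Y.pairing z * G') p c := by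
    intro p
    have e1 : ∀ k, Y.christ p b k z
        + ∑ l, ∑ q, ∑ n, Y.gInv l p z * Y.g z k q * Y.christBar q n l z * Y.ψ z n b
        = (G' * Eᵀ) p k := by
      intro k
      have e2 : ∀ n l, ∑ q, Y.g z k q * Y.christBar q n l z = pd (et n) (fun y => Y.g y k l) z := by
        intro n l
        simp only [christBar, mul_sum]
        rw [sum_comm]
        simp only [← mul_assoc, ← sum_mul, h.g_mul_gInv]
        simp
      have e3 : ∀ l, ∑ q, ∑ n, Y.gInv l p z * Y.g z k q * Y.christBar q n l z * Y.ψ z n b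
          = Y.gInv l p z * ∑ n, Y.ψ z n b * pd (et n) (fun y => Y.g y k l) z := by
        intro l
        rw [sum_comm]
        simp only [← e2, mul_sum]
        exact sum_ext fun _ => sum_ext fun _ => by ring
      simp only [e3, christ, ← sum_add_distrib, Matrix.mul_apply, transpose_apply, hE, vdm_apply, ←
        eTh_eq, eTh, smul_eq_mul, hG', mul_add]
      rfl
    simp only [e1]
    rw [Matrix.add_apply, Matrix.add_apply]
    congr 1
    · congr 1
      · rw [Matrix.mul_apply]
        exact sum_ext fun k => by rw [hF, vdm_apply, ← eTh_eq, mul_comm]; rfl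
    · rw [Matrix.mul_apply]
      refine sum_ext fun s => ?_
      rw [Matrix.mul_apply, sum_mul]
      refine sum_ext fun k => ?_
      rw [hG', transpose_apply (Y.g z)⁻¹ s c, gInv]; ring
  rw [hl]
  simp only [hr]
  rw [← Matrix.mul_apply, hK, ← mul_assoc, matN_mul_pairing h.hd, one_mul]

/-- The explicit form of `R`. -/
theorem opR_eq (ha : RDiffAt a z) : Y.opR a z = Y.explR a z := by
  rw [opR_eq_hodge h.hφ h.hψ h.hd h.symψ, opDelta_eq h.differentiableAt_s h.hs0 h.hφ h.hψ h.hd h.ksψ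
    (differentiableAt_hodge h.hg h.hg0 ha), hodge_explDelta_hodge h.differentiableAt_s h.hs0 h.hg
    h.hg0 h.hφ h.hψ h.hd ha, explR_form ha h.differentiableAt_expSigma h.expSigma_ne_zero]
  unfold rform
  simp only [h.coeff_one_eq, h.coeff_three_eq]
  congr 2
  rw [← sub_eq_zero]
  simp only [← sum_sub_distrib, ← sub_smul]
  refine sum_eq_zero fun p _ => ?_
  have e := congrArg (mg (et p)) (sum_dg_dg_symm et _ (fun j q => h.coeff_two_symm p j q) (a z))
  simpa only [map_sum, map_smul, map_zero] using e

end Admissible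

end Geom

/-! ### Smoothness of holomorphic functions of several variables -/

section Holomorphic

variable {E : Type*} [NormedAddCommGroup E] [NormedSpace ℂ E]

theorem hasDerivAt_comp_line {f : E → ℂ} {z v : E} (t : ℂ) (hf : DifferentiableAt ℂ f (z + t • v)) :
    HasDerivAt (fun t : ℂ => f (z + t • v)) (fderiv ℂ f (z + t • v) v) t := by
  have h : HasDerivAt (fun t : ℂ => z + t • v) v t := by
    simpa using ((hasDerivAt_id t).smul_const v).const_add z
  exact hf.hasFDerivAt.comp_hasDerivAt t h

/-- Cauchy's estimate. -/
theorem norm_fderiv_le_of_bound {f : E → ℂ} {z : E} {R M : ℝ} (hR : 0 < R)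
    (hf : ∀ y ∈ Metric.closedBall z R, DifferentiableAt ℂ f y)
    (hM : ∀ y ∈ Metric.closedBall z R, ‖f y‖ ≤ M) : ‖fderiv ℂ f z‖ ≤ M / R := by
  have hM0 : 0 ≤ M := (norm_nonneg _).trans (hM z (Metric.mem_closedBall_self hR.le))
  refine ContinuousLinearMap.opNorm_le_of_unit_norm (𝕜 := ℂ) (by positivity) fun v hv => ?_
  have hmem : ∀ t : ℂ, ‖t‖ ≤ R → z + t • v ∈ Metric.closedBall z R := fun t ht => by
    simpa [norm_smul, hv] using ht
  have hd : deriv (fun t : ℂ => f (z + t • v)) 0 = fderiv ℂ f z v := by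
    have := (hasDerivAt_comp_line (f := f) (z := z) (v := v) 0
      (by simpa using hf z (Metric.mem_closedBall_self hR.le))).deriv
    simpa using this
  rw [← hd]
  refine Complex.norm_deriv_le_of_forall_mem_sphere_norm_le hR ?_ ?_
  · refine DifferentiableOn.diffContOnCl fun t ht => ?_
    rw [closure_ball _ hR.ne'] at ht
    exact (hasDerivAt_comp_line t
      (hf _ (hmem t (by simpa using ht)))).differentiableAt.differentiableWithinAt
  · intro t ht
    exact hM _ (hmem t (by simpa using (mem_sphere_iff_norm.1 ht).le))

variable [FiniteDimensional ℂ E]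

/-- The derivative of a holomorphic function in a given direction is holomorphic. -/
theorem differentiableOn_fderiv_apply {f : E → ℂ} {U : Set E} (hU : IsOpen U)
    (hf : DifferentiableOn ℂ f U) (v : E) : DifferentiableOn ℂ (fun z => fderiv ℂ f z v) U := by
  intro z₀ hz₀
  have : ProperSpace E := FiniteDimensional.proper ℂ E
  obtain ⟨R, hR, hRU⟩ := Metric.isOpen_iff.1 hU z₀ hz₀
  have hsub : Metric.closedBall z₀ (R / 2) ⊆ U :=
    (Metric.closedBall_subset_ball (by linarith)).trans hRU
  have hda : ∀ y ∈ Metric.closedBall z₀ (R / 2), DifferentiableAt ℂ f y := fun y hy =>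
    hf.differentiableAt (hU.mem_nhds (hsub hy))
  obtain ⟨M, hM⟩ := (isCompact_closedBall z₀ (R / 2)).exists_bound_of_continuousOn
    (hf.continuousOn.mono hsub)
  set ρ := R / 8 with hρ
  have hρ0 : 0 < ρ := by positivity
  have hfd : ∀ y ∈ Metric.ball z₀ (2 * ρ), ‖fderiv ℂ f y‖ ≤ M / ρ := by
    intro y hy
    have : Metric.closedBall y ρ ⊆ Metric.closedBall z₀ (R / 2) := by
      refine Metric.closedBall_subset_closedBall' ?_
      have := Metric.mem_ball.1 hy
      linarith
    exact norm_fderiv_le_of_bound hρ0 (fun w hw => hda w (this hw)) fun w hw => hM w (this hw)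
  by_cases hv : v = 0
  · subst hv
    simp only [map_zero]
    exact differentiableWithinAt_const _
  have hv0 : 0 < ‖v‖ := norm_pos_iff.2 hv
  set r := ρ / ‖v‖ with hr
  have hr0 : 0 < r := by positivity
  have hmem : ∀ z ∈ Metric.ball z₀ ρ, ∀ t : ℂ, ‖t‖ ≤ r → z + t • v ∈ Metric.ball z₀ (2 * ρ) := by
    intro z hz t ht
    rw [mem_ball_iff_norm] at hz ⊢
    have h1 : ‖t • v‖ ≤ ρ := by
      rw [norm_smul]
      calc ‖t‖ * ‖v‖ ≤ r * ‖v‖ := by gcongr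
        _ = ρ := by rw [hr]; field_simp
    calc ‖z + t • v - z₀‖ = ‖(z - z₀) + t • v‖ := by congr 1; abel
      _ ≤ ‖z - z₀‖ + ‖t • v‖ := norm_add_le _ _
      _ < 2 * ρ := by linarith
  have hin : Metric.ball z₀ (2 * ρ) ⊆ Metric.closedBall z₀ (R / 2) :=
    fun y hy => Metric.mem_closedBall.2 ((Metric.mem_ball.1 hy).le.trans (by rw [hρ]; linarith))
  have hcm : ∀ θ, ‖circleMap 0 r θ‖ ≤ r := fun θ => by
    rw [norm_circleMap_zero, abs_of_pos hr0]
  set κ : ℝ → ℂ := fun θ => deriv (circleMap 0 r) θ * (1 / circleMap 0 r θ ^ 2) with hκ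
  have hκc : Continuous κ := by
    simp only [hκ, deriv_circleMap]
    refine ((continuous_circleMap 0 r).mul continuous_const).mul (continuous_const.div
      ((continuous_circleMap 0 r).pow 2) fun θ => pow_ne_zero _ ?_)
    rw [← norm_ne_zero_iff, norm_circleMap_zero, abs_of_pos hr0]
    exact hr0.ne'
  set F : E → ℝ → ℂ := fun z θ => κ θ * f (z + circleMap 0 r θ • v) with hF
  have hcauchy : ∀ z ∈ Metric.ball z₀ ρ,
      (2 * Real.pi * Complex.I : ℂ)⁻¹ * ∫ θ in 0..2 * Real.pi, F z θ = fderiv ℂ f z v := by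
    intro z hz
    have h0 : z ∈ Metric.ball z₀ (2 * ρ) := by simpa using hmem z hz 0 (by simpa using hr0.le)
    have hd : deriv (fun t : ℂ => f (z + t • v)) 0 = fderiv ℂ f z v := by
      have := (hasDerivAt_comp_line (f := f) (z := z) (v := v) 0
        (by simpa using hda z (hin h0))).deriv
      simpa using this
    have hdo : DifferentiableOn ℂ (fun t : ℂ => f (z + t • v)) (Metric.closedBall 0 r) :=
      fun t ht => (hasDerivAt_comp_line t
        (hda _ (hin (hmem z hz t (by simpa using ht))))).differentiableAt.differentiableWithinAt
    have h1 := hdo.deriv_eq_smul_circleIntegral hr0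
    rw [hd, circleIntegral] at h1
    have h2 : ∫ θ in 0..2 * Real.pi, F z θ = (2 * Real.pi * Complex.I : ℂ) • fderiv ℂ f z v := by
      rw [← h1]
      refine intervalIntegral.integral_congr fun θ _ => ?_
      simp [hF, hκ, mul_assoc]
    rw [h2, smul_eq_mul, inv_mul_cancel_left₀ Complex.two_pi_I_ne_zero]
  borelize E
  have hline : ∀ z : E, Continuous fun θ => z + circleMap 0 r θ • v := fun z =>
    continuous_const.add ((continuous_circleMap 0 r).smul continuous_const)
  have hFc : ∀ z ∈ Metric.ball z₀ ρ, Continuous (F z) := fun z hz =>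
    hκc.mul (continuous_iff_continuousAt.2 fun θ =>
      ContinuousAt.comp (g := f) (hda _ (hin (hmem z hz _ (hcm θ)))).continuousAt
        (hline z).continuousAt)
  have hder := (intervalIntegral.hasFDerivAt_integral_of_dominated_of_fderiv_le (𝕜 := ℂ)
    (μ := MeasureTheory.volume) (a := 0) (b := 2 * Real.pi) (F := F) (x₀ := z₀)
    (F' := fun z θ => κ θ • fderiv ℂ f (z + circleMap 0 r θ • v))
    (bound := fun θ => ‖κ θ‖ * (M / ρ)) (Metric.ball_mem_nhds z₀ hρ0) ?_ ?_ ?_ ?_ ?_ ?_)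
  · refine (DifferentiableAt.congr_of_eventuallyEq
      (hder.differentiableAt.const_mul (2 * Real.pi * Complex.I : ℂ)⁻¹)
      ?_).differentiableWithinAt
    filter_upwards [Metric.ball_mem_nhds z₀ hρ0] with z hz
    exact (hcauchy z hz).symm
  · filter_upwards [Metric.ball_mem_nhds z₀ hρ0] with z hz
    exact (hFc z hz).aestronglyMeasurable
  · exact (hFc z₀ (Metric.mem_ball_self hρ0)).intervalIntegrable _ _
  · refine (hκc.measurable.smul ?_).aestronglyMeasurable
    exact (measurable_fderiv ℂ f).comp (hline z₀).measurable
  · refine .of_forall fun θ _ z hz => ?_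
    rw [norm_smul]
    exact mul_le_mul_of_nonneg_left (hfd _ (hmem z hz _ (hcm θ))) (norm_nonneg _)
  · exact (hκc.norm.mul continuous_const).intervalIntegrable _ _
  · refine .of_forall fun θ _ z hz => ?_
    exact ((hasFDerivAt_comp_add_right _).2 (hda _ (hin (hmem z hz _ (hcm θ)))).hasFDerivAt).const_mul _

theorem contDiffOn_of_differentiableOn {U : Set E} (hU : IsOpen U) {f : E → ℂ}
    (hf : DifferentiableOn ℂ f U) : ContDiffOn ℂ ∞ f U := by
  refine contDiffOn_infty.2 fun n => ?_
  induction n generalizing f with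
  | zero => exact contDiffOn_zero.2 hf.continuousOn
  | succ n ih =>
    rw [Nat.cast_succ, contDiffOn_succ_iff_fderiv_of_isOpen hU]
    refine ⟨hf, by simp, contDiffOn_clm_apply.2 fun v => ih (differentiableOn_fderiv_apply hU hf v)⟩

end Holomorphic

/-! ### The undeformed operators and the Kähler identities -/

/-- The operator `∑ A_{pq} θ_p ∂/∂η^q`. -/
def qte (A : Mat3) : EndGr := ∑ p, ∑ q, A p q • (mg (th p) * dg (et q))

/-- The operator `∑ A_{pq} η^p ∂/∂θ_q`. -/
def qed (A : Mat3) : EndGr := ∑ p, ∑ q, A p q • (mg (et p) * dg (th q))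

theorem qte_apply (A : Mat3) (x : Gr) :
    qte A x = ∑ p, ∑ q, A p q • mg (th p) (dg (et q) x) := by
  simp [qte, LinearMap.sum_apply]

theorem qed_apply (A : Mat3) (x : Gr) :
    qed A x = ∑ p, ∑ q, A p q • mg (et p) (dg (th q) x) := by
  simp [qed, LinearMap.sum_apply]

theorem qte_mg_et (A : Mat3) (k : Fin 3) (x : Gr) :
    qte A (mg (et k) x) = mg (et k) (qte A x) + ∑ p, A p k • mg (th p) x := by
  have h : ∀ p q, mg (th p) (dg (et q) (mg (et k) x))
      = (if q = k then mg (th p) x else 0) + mg (et k) (mg (th p) (dg (et q) x)) := by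
    intro p q
    rw [dg_mg, map_sub, mg_mg (th p) (et k), sub_neg_eq_add]
    split_ifs with h1 h2 h2
    · rfl
    · exact absurd ((et_inj _ _).1 h1) h2
    · exact absurd (congrArg et h2) h1
    · rw [map_zero]
  simp only [qte_apply, h, smul_add, smul_ite, smul_zero, sum_add_distrib, map_sum, map_smul,
    sum_ite_eq', mem_univ, if_true]
  exact add_comm _ _

theorem qed_mg_et (A : Mat3) (k : Fin 3) (x : Gr) :
    qed A (mg (et k) x) = mg (et k) (qed A x) := by
  simp [qed_apply, dg_mg, th_ne_et, zero_sub, mg_mg (et k) (et _), sum_neg_distrib]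

theorem dg_th_qte (A : Mat3) (k : Fin 3) (x : Gr) :
    dg (th k) (qte A x) = qte A (dg (th k) x) + ∑ q, A k q • dg (et q) x := by
  have h : ∀ p q, dg (th k) (mg (th p) (dg (et q) x))
      = (if k = p then dg (et q) x else 0) + mg (th p) (dg (et q) (dg (th k) x)) := by
    intro p q
    rw [dg_mg, dg_dg (th k) (et q), map_neg, sub_neg_eq_add]
    split_ifs with h1 h2 h2
    · rfl
    · exact absurd ((th_inj _ _).1 h1) h2
    · exact absurd (congrArg th h2) h1
    · rfl
  simp only [qte_apply, map_sum, map_smul, h, smul_add, smul_ite, smul_zero, sum_add_distrib]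
  rw [add_comm, sum_comm (f := fun p q => if k = p then _ else _)]
  simp

theorem dg_th_qed (A : Mat3) (k : Fin 3) (x : Gr) :
    dg (th k) (qed A x) = qed A (dg (th k) x) := by
  simp [qed_apply, dg_mg, th_ne_et, dg_dg (th k) (th _)]

section pd

variable {A : E3 → Mat3} {a : E3 → Gr} {z : E3}

theorem pd_qte (hA : MatDiff A z) (ha : RDiffAt a z) (k : Fin 6) :
    pd k (fun y => qte (A y) (a y)) z = qte (A z) (pd k a z) + qte (pdm k A z) (a z) := by
  simp only [qte_apply]
  exact pd_quad th et hA ha k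

theorem pd_qed (hA : MatDiff A z) (ha : RDiffAt a z) (k : Fin 6) :
    pd k (fun y => qed (A y) (a y)) z = qed (A z) (pd k a z) + qed (pdm k A z) (a z) := by
  simp only [qed_apply]
  exact pd_quad et th hA ha k

end pd

/-- `Δ` on the undeformed manifold. -/
def dl (s : E3 → ℂ) (a : E3 → Gr) (z : E3) : Gr :=
  ∑ i, dg (th i) (pd (th i) a z + ((s z)⁻¹ * pd (th i) s z) • a z)

/-- `∂̄` on the undeformed manifold. -/
def db (a : E3 → Gr) (z : E3) : Gr := ∑ k, mg (et k) (pd (et k) a z)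

/-- Contraction with the Kähler form. -/
def lo (g : E3 → Mat3) (z : E3) : EndGr := qed (g z)ᵀ

/-- The adjoint of the contraction with the Kähler form. -/
def lam (g : E3 → Mat3) (z : E3) : EndGr := qte ((g z)⁻¹)ᵀ

/-- The undeformed geometry. -/
def base (s : E3 → ℂ) (g : E3 → Mat3) : Geom := ⟨s, g, 0, 0⟩

/-- The conditions on the undeformed geometry on an open set. -/
structure Kahler (s : E3 → ℂ) (g : E3 → Mat3) (U : Set E3) : Prop where
  isOpen : IsOpen U
  hs : DifferentiableOn ℂ s U
  hs0 : ∀ z ∈ U, s z ≠ 0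
  hg : ∀ i j, SmoothOn (fun z => g z i j) U
  hg0 : ∀ z ∈ U, (g z).det ≠ 0
  closed : ∀ z ∈ U, ∀ i j k, pd (th k) (fun y => g y i j) z = pd (th i) (fun y => g y k j) z
  closedBar : ∀ z ∈ U, ∀ i j k, pd (et k) (fun y => g y i j) z = pd (et j) (fun y => g y i k) z

theorem vd_col_zero {V : Type*} [NormedAddCommGroup V] [NormedSpace ℝ V] [NormedSpace ℂ V]
    (s : E3 → ℂ) (g : E3 → Mat3) (z : E3) (k : Fin 6) (f : E3 → V) :
    vd ((base s g).col z k) f z = pd k f z := by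
  revert k
  refine six_cases (fun i => ?_) fun i => ?_
  · rw [← Geom.eTh_eq]; simp [Geom.eTh, base]
  · rw [← Geom.eEt_eq]; simp [Geom.eEt, base]

namespace Kahler

variable {s : E3 → ℂ} {g : E3 → Mat3} {U : Set E3} {a b : E3 → Gr}

theorem matNbar_base (z : E3) : (base s g).matNbar z = 1 := by
  simp [Geom.matNbar, Geom.pairingBar, base]

theorem nm_base (z : E3) (k : Fin 3) : (base s g).nm z k = 0 := by
  ext p i
  simp only [Geom.nm, Geom.symM, Geom.eTh, Geom.eEt]
  simp [base, pd_const]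

theorem omegaCoeff_base : (base s g).omegaCoeff = s := by
  funext z
  simp [Geom.omegaCoeff, Geom.pairing, base]

theorem smooth_lin {V W : Type*} [NormedAddCommGroup V] [NormedSpace ℝ V]
    [NormedSpace ℂ V] [NormedAddCommGroup W] [NormedSpace ℝ W] [NormedSpace ℂ W]
    [IsScalarTower ℝ ℂ V] [IsScalarTower ℝ ℂ W] [FiniteDimensional ℂ V] {a : E3 → V}
    (T : V →ₗ[ℂ] W) (ha : SmoothOn a U) : SmoothOn (fun y => T (a y)) U :=
  ((LinearMap.toContinuousLinearMap T).restrictScalars ℝ).contDiff.comp_contDiffOn ha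

variable (K : Kahler s g U)

include K

theorem matDiff_g {z : E3} (hz : z ∈ U) : MatDiff g z := fun i j =>
  ((K.hg i j).contDiffAt (K.isOpen.mem_nhds hz)).differentiableAt (by simp)

theorem isUnit_g {z : E3} (hz : z ∈ U) : IsUnit (g z).det := isUnit_iff_ne_zero.2 (K.hg0 z hz)

theorem contDiffOn_s : SmoothOn s U :=
  (contDiffOn_of_differentiableOn K.isOpen K.hs).restrict_scalars ℝ

theorem differentiableAt {V : Type*} [NormedAddCommGroup V] [NormedSpace ℝ V] {a : E3 → V}
    (ha : SmoothOn a U) {z : E3} (hz : z ∈ U) : RDiffAt a z :=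
  (ha.contDiffAt (K.isOpen.mem_nhds hz)).differentiableAt (by simp)

theorem differentiableAt_s {z : E3} (hz : z ∈ U) : DifferentiableAt ℂ s z :=
  K.hs.differentiableAt (K.isOpen.mem_nhds hz)

theorem admissible {z : E3} (hz : z ∈ U) : (base s g).Admissible z where
  hs := K.differentiableAt_s hz
  hs0 := K.hs0 z hz
  hg := K.matDiff_g hz
  hg0 := K.hg0 z hz
  hφ := mdiff_const 0
  hψ := mdiff_const 0
  hd := by simp [Geom.pairing, base]
  ksφ k l m := by simp [Geom.eEt, base, pd_const]
  ksψ i l m := by simp [Geom.eTh, base, pd_const]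
  divφ k := by simp [base, pd_const]
  divψ i := by simp [base, pd_const]
  symφ := by simp [base]
  symψ := by simp [base]
  closed := K.closed z hz
  closedBar := K.closedBar z hz

theorem opDbar_base {z : E3} (hz : z ∈ U) (ha : RDiffAt a z) :
    (base s g).opDbar a z = db a z := by
  have h := K.admissible hz
  rw [Geom.opDbar_eq h.hs h.hs0 h.hφ h.hψ h.hd h.ksφ h.divφ ha, Geom.explDbar_eq]
  have h2 : ∀ k, (vdm ((base s g).col z (et k)) (base s g).ψ z * (base s g).matN z *
      (base s g).φ z) = 0 := fun k => by
    change _ * (0 : Mat3) = 0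
    rw [mul_zero]
  have h3 : ∀ k, (base s g).eEt k a z = pd (et k) a z := fun k => by simp [Geom.eEt, base]
  have h0 : qth 0 (a z) = 0 := by simp [qth]
  have h0' : qet 0 (a z) = 0 := by simp [qet]
  simp [matNbar_base, nm_base, h2, h3, Matrix.transpose_zero, h0, h0', one_apply, db]

theorem opDelta_base {z : E3} (hz : z ∈ U) (ha : RDiffAt a z) :
    (base s g).opDelta a z = dl s a z := by
  have h := K.admissible hz
  rw [Geom.opDelta_eq h.differentiableAt_s h.hs0 h.hφ h.hψ h.hd h.ksψ ha, Geom.explDelta_eq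
    h.differentiableAt_s h.hs0 h.hφ h.hψ h.hd ha, omegaCoeff_base]
  simp [dl, Geom.eTh, base, pd_const]

theorem matDiff_gInv {z : E3} (hz : z ∈ U) : MatDiff (fun y => (g y)⁻¹) z :=
  (K.matDiff_g hz).inv (K.hg0 z hz)

theorem pd_lam {z : E3} (hz : z ∈ U) (ha : RDiffAt a z) (k : Fin 6) :
    pd k (fun y => lam g y (a y)) z
      = lam g z (pd k a z) - qte ((g z)⁻¹ * pdm k g z * (g z)⁻¹)ᵀ (a z) := by
  unfold lam
  rw [pd_qte (K.matDiff_gInv hz).transpose ha, pdm_transpose, pdm_inv k (K.matDiff_g hz) (K.hg0 z hz),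
    transpose_neg, sub_eq_add_neg]
  congr 1
  simp [qte_apply, sum_neg_distrib]

theorem pd_lo {z : E3} (hz : z ∈ U) (ha : RDiffAt a z) (k : Fin 6) :
    pd k (fun y => lo g y (a y)) z = lo g z (pd k a z) + qed (pdm k g z)ᵀ (a z) := by
  unfold lo
  rw [pd_qed (K.matDiff_g hz).transpose ha, pdm_transpose]

theorem opS_base_eq_sum {z : E3} (hz : z ∈ U) (ha : RDiffAt a z) :
    (base s g).opS a z = ∑ k, ∑ l, (g z)⁻¹ k l • mg (th l) (-pd (et k) a z
      + qet ((pdm (et k) g z)ᵀ * ((g z)⁻¹)ᵀ) (a z)) := by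
  have h := K.admissible hz
  rw [h.opS_eq ha, h.explS_eq]
  have h3 : ∀ k, (base s g).eEt k a z = pd (et k) a z := fun k => by simp [Geom.eEt, base]
  have h0 : qth 0 (a z) = 0 := by simp [qth]
  have red : ∀ (X : Fin 3 → Gr) (k : Fin 3), ∑ r, ∑ l,
      ((base s g).gInv r l z * (1 : Mat3) k r) • X l
      = ∑ l, (g z)⁻¹ k l • X l := by
    intro X k
    rw [sum_comm]
    simp [one_apply, Geom.gInv, base]
  have hE : ∀ k, vdm ((base s g).col z k) (base s g).g z = pdm k g z := fun k => by
    ext i j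
    exact vd_col_zero s g z k _
  simp only [matNbar_base, nm_base, h3, mul_zero, zero_mul, add_zero, h0, hE, red]
  rfl

theorem opS_base {z : E3} (hz : z ∈ U) (ha : RDiffAt a z) :
    (base s g).opS a z = db (fun y => lam g y (a y)) z - lam g z (db a z) := by
  rw [K.opS_base_eq_sum hz ha]
  have e1 : lam g z (db a z) = ∑ k, mg (et k) (lam g z (pd (et k) a z))
      + ∑ k, ∑ l, (g z)⁻¹ k l • mg (th l) (pd (et k) a z) := by
    simp only [db, map_sum, lam, qte_mg_et, sum_add_distrib, transpose_apply]
  have e2 : db (fun y => lam g y (a y)) z = ∑ k, mg (et k) (lam g z (pd (et k) a z))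
      + ∑ k, ∑ p, ∑ q, ((g z)⁻¹ * pdm (et k) g z * (g z)⁻¹) q p •
        mg (th p) (mg (et k) (dg (et q) (a z))) := by
    simp only [db, K.pd_lam hz ha, map_sub, qte_apply, map_sum, map_smul, mg_mg (et
      _) (th _), smul_neg, sum_neg_distrib, sub_neg_eq_add, transpose_apply, sum_add_distrib]
  rw [e1, e2, add_sub_add_left_eq_sub]
  simp only [map_add, map_neg, smul_add, smul_neg, sum_add_distrib, sum_neg_distrib]
  rw [sub_eq_neg_add]
  congr 1
  simp only [qet_apply, map_sum, map_smul, smul_sum, smul_smul]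
  rw [← sum_pull fun l p q k => ((g z)⁻¹ k l * ((pdm (et k) g z)ᵀ *
    ((g z)⁻¹)ᵀ) p q) • mg (th l) (mg (et p) (dg (et q) (a z))), sum_comm]
  simp only [← sum_smul]
  refine sum_ext fun p => sum_ext fun l =>
    sum_ext fun q => ?_
  congr 1
  simp only [Matrix.mul_apply, transpose_apply, mul_sum, sum_mul, pdm_apply]
  refine sum_ext fun k => sum_ext fun m => ?_
  rw [K.closedBar z hz m p k]
  ring

theorem opR_base {z : E3} (hz : z ∈ U) (ha : RDiffAt a z) :
    (base s g).opR a z = dl s (fun y => lam g y (a y)) z - lam g z (dl s a z) := by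
  have h := K.admissible hz
  rw [Geom.opR_eq_hodge h.hφ h.hψ h.hd h.symψ, Geom.opDelta_eq h.differentiableAt_s h.hs0 h.hφ h.hψ
    h.hd h.ksψ (Geom.differentiableAt_hodge h.hg h.hg0 ha), Geom.hodge_explDelta_hodge
    h.differentiableAt_s h.hs0 h.hg h.hg0 h.hφ h.hψ h.hd ha, omegaCoeff_base]
  have h3 : ∀ k, (base s g).eTh k a z = pd (th k) a z := fun k => by simp [Geom.eTh, base]
  have h3' : ∀ k, (base s g).eTh k s z = pd (th k) s z := fun k => by simp [Geom.eTh, base]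
  have h4 : ∀ n j i, pd (et n) (fun y => (base s g).ψ y j i) z = 0 := fun n j i =>
    pd_const (et n) (0 : ℂ)
  have hE : ∀ k, vdm ((base s g).col z k) (base s g).g z = pdm k g z := fun k => by
    ext i j
    exact vd_col_zero s g z k _
  have hgi : ∀ i j, (base s g).gInv i j z = (g z)⁻¹ i j := fun _ _ => rfl
  have hg' : (base s g).g z = g z := rfl
  simp only [h3, h3', h4, hE, hgi, hg', zero_mul, sum_const_zero, add_zero]
  set G := (g z)⁻¹ with hG
  have e1 : dl s (fun y => lam g y (a y)) z - lam g z (dl s a z)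
      = ∑ k, ∑ j, G j k • dg (et j) (pd (th k) a z)
        + ∑ q, (∑ k, G q k * ((s z)⁻¹ * pd (th k) s z)) • dg (et q) (a z)
        - ∑ q, (∑ k, (G * pdm (th k) g z * G) q k) • dg (et q) (a z)
        + ∑ m, ∑ b, ∑ c, (G * pdm (th b) g z * G) c m • mg (th m) (dg (th b) (dg (et c) (a z))) := by
    have t1 : ∀ k, dg (th k) (qte (G * pdm (th k) g z * G)ᵀ (a z))
        = ∑ q, (G * pdm (th k) g z * G) q k • dg (et q) (a z)
          - ∑ p, ∑ q, (G * pdm (th k) g z * G) q p • mg (th p) (dg (th k) (dg (et q) (a z))) := by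
      intro k
      rw [dg_th_qte, qte_apply, add_comm, sub_eq_add_neg]
      simp [dg_dg (et _) (th k), sum_neg_distrib]
    have t2 : ∀ k x, dg (th k) (lam g z x) = lam g z (dg (th k) x) + ∑ q, G q k • dg (et q) x := by
      intro k x
      rw [lam, dg_th_qte]
      rfl
    simp only [dl, K.pd_lam hz ha, map_add, map_sub, map_smul, t1, t2, map_sum, smul_add,
      sum_add_distrib, sum_sub_distrib, ← hG]
    have u1 : ∀ (A : Mat3) (c : Fin 3 → ℂ), ∑ k, ∑ q, c k • A q k • dg (et q) (a z)
        = ∑ q, (∑ k, A q k * c k) • dg (et q) (a z) := by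
      intro A c
      rw [sum_comm]
      simp [sum_smul, smul_smul, mul_comm]
    have u2 : ∑ k, ∑ q, (G * pdm (th k) g z * G) q k • dg (et q) (a z)
        = ∑ q, (∑ k, (G * pdm (th k) g z * G) q k) • dg (et q) (a z) := by
      rw [sum_comm]
      simp [sum_smul]
    have u3 : ∀ f : Fin 3 → Fin 3 → Fin 3 → ℂ,
        ∑ k, ∑ p, ∑ q, f k q p • mg (th p) (dg (th k) (dg (et q) (a z)))
        = ∑ m, ∑ b, ∑ c, f b c m • mg (th m) (dg (th b) (dg (et c) (a z))) := fun f =>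
      sum_comm
    have u4 : ∑ k, ∑ q, G q k • dg (et q) (pd (th k) a z)
        = ∑ k, ∑ j, G j k • dg (et j) (pd (th k) a z) := rfl
    simp only [smul_sum, u1, u2, u3 fun k q p => (G * pdm (th k) g z * G) q p]
    abel
  rw [e1, Geom.rform]
  have e2 : ∑ p, ∑ j, ∑ q, (∑ k, G j k * ((pdm (th k) g z)ᵀ * Gᵀ) p q) •
      mg (et p) (dg (et j) (dg (et q) (a z))) = 0 := by
    refine sum_eq_zero fun p _ => ?_
    simp only [← map_smul, ← map_sum]
    rw [← map_zero (mg (et p))]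
    congr 1
    simp only [map_smul, map_sum]
    refine sum_dg_dg_symm et _ (fun j q => ?_) (a z)
    simp only [Matrix.mul_apply, transpose_apply, mul_sum, pdm_apply]
    rw [sum_comm]
    refine sum_ext fun k => sum_ext fun c => ?_
    rw [K.closed z hz k p c]
    ring
  have e3 : ∀ q, ∑ k, ∑ j, G j k * ((pdm (th k) g z)ᵀ * Gᵀ) j q
      = ∑ k, (G * pdm (th k) g z * G) q k := fun q => by
    refine sum_ext fun k => ?_
    simp only [Matrix.mul_apply, transpose_apply, mul_sum, sum_mul]
    exact sum_ext fun j => sum_ext fun p => by ring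
  have e4 : ∀ m b c, ∑ k, G c k * (Gᵀ * (pdm (th k) g z)ᵀ) m b
      = (G * pdm (th b) g z * G) c m := fun m b c => by
    simp only [Matrix.mul_apply, transpose_apply, mul_sum, sum_mul, pdm_apply]
    rw [sum_comm]
    refine sum_ext fun k => sum_ext fun p => ?_
    rw [K.closed z hz b k p]
    ring
  simp [e2, e3, e4, sub_smul, sum_sub_distrib, hgi, add_sub_assoc]

theorem smooth_pd (ha : SmoothOn a U) (k : Fin 6) :
    SmoothOn (pd k a) U := contDiffOn_pd k K.isOpen ha

theorem smooth_db (ha : SmoothOn a U) : SmoothOn (db a) U :=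
  ContDiffOn.sum fun k _ => smooth_lin (mg (et k)) (K.smooth_pd ha _)

theorem smooth_log : ∀ i, SmoothOn (fun z => (s z)⁻¹ * pd (th i) s z) U := fun i =>
  (K.contDiffOn_s.inv K.hs0).mul (contDiffOn_pd _ K.isOpen K.contDiffOn_s)

theorem smooth_dl (ha : SmoothOn a U) : SmoothOn (dl s a) U :=
  ContDiffOn.sum fun i _ => smooth_lin (dg (th i))
    ((K.smooth_pd ha _).add ((K.smooth_log i).smul ha))

theorem smooth_lo (ha : SmoothOn a U) :
    SmoothOn (fun z => lo g z (a z)) U := by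
  simp only [lo, qed_apply]
  exact ContDiffOn.sum fun p _ => ContDiffOn.sum fun q _ =>
    (K.hg q p).smul (smooth_lin (mg (et p) * dg (th q)) ha)

theorem smooth_gInv (i j : Fin 3) : SmoothOn (fun z => (g z)⁻¹ i j) U := by
  have hdet : ∀ {M : E3 → Mat3}, (∀ i j, SmoothOn (fun z => M z i j) U) →
      SmoothOn (fun z => (M z).det) U := by
    intro M hM
    simp only [Matrix.det_apply, Units.smul_def, zsmul_eq_mul]
    exact ContDiffOn.sum fun σ _ => contDiffOn_const.mul (contDiffOn_prod fun i _ => hM _ _)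
  simp only [Matrix.inv_def, Matrix.smul_apply, Ring.inverse_eq_inv', smul_eq_mul,
    Matrix.adjugate_apply]
  refine ((hdet K.hg).inv K.hg0).mul (hdet fun a b => ?_)
  by_cases ha : a = j
  · subst ha; simpa using contDiffOn_const
  · simpa [Matrix.updateRow_ne ha] using K.hg a b

theorem smooth_lam (ha : SmoothOn a U) :
    SmoothOn (fun z => lam g z (a z)) U := by
  simp only [lam, qte_apply]
  exact ContDiffOn.sum fun p _ => ContDiffOn.sum fun q _ =>
    (K.smooth_gInv q p).smul (smooth_lin (mg (th p) * dg (et q)) ha)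

end Kahler

/-- The operator `θ ∂/∂θ - η ∂/∂η`. -/
def wt : EndGr := qth 1 - qet 1

theorem wt_dg_th (k : Fin 3) (x : Gr) : dg (th k) (wt x) = wt (dg (th k) x) + dg (th k) x := by
  have h1 : dg (th k) (qth 1 x) = qth 1 (dg (th k) x) + dg (th k) x := by
    simp only [qth_apply, one_apply, ite_smul, one_smul, zero_smul, sum_ite_eq, mem_univ, if_true,
      map_sum, dg_mg, th_inj, map_neg, dg_dg (th k) (th _), sub_neg_eq_add, sum_add_distrib]
    exact add_comm _ _
  have h2 : dg (th k) (qet 1 x) = qet 1 (dg (th k) x) := by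
    simp [qet_apply, one_apply, dg_mg, th_ne_et, dg_dg (th k) (et _)]
  rw [wt, LinearMap.sub_apply, map_sub, h1, h2, LinearMap.sub_apply]
  abel

theorem wt_mg_et (k : Fin 3) (x : Gr) : mg (et k) (wt x) = wt (mg (et k) x) + mg (et k) x := by
  have h1 : qth 1 (mg (et k) x) = mg (et k) (qth 1 x) := by
    simp [qth_apply, one_apply, dg_mg, th_ne_et, zero_sub, mg_mg (et k) (th _)]
  have h2 : qet 1 (mg (et k) x) = mg (et k) (qet 1 x) + mg (et k) x := by
    simp only [qet_apply, one_apply, ite_smul, one_smul, zero_smul, sum_ite_eq, mem_univ, if_true,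
      map_sum, dg_mg, et_inj, map_sub, sum_sub_distrib, mg_mg (et k) (et _), sum_neg_distrib]
    rw [sub_eq_add_neg, add_comm]
    congr 1
    rw [sum_eq_single k (fun b _ h => by simp [h]) (by simp)]
    simp
  rw [wt, LinearMap.sub_apply, map_sub, ← h1, LinearMap.sub_apply, h2]
  abel

theorem qte_qed (A B : Mat3) (x : Gr) :
    qte A (qed B x) = qed B (qte A x) + qth (A * B) x - qet (B * A) x := by
  have e1 : qte A (qed B x) = ∑ r, ∑ t, B r t • mg (et r) (qte A (dg (th t) x))
      + ∑ p, ∑ t, (A * B) p t • mg (th p) (dg (th t) x) := by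
    simp only [qed_apply, map_sum, map_smul, qte_mg_et, smul_add, sum_add_distrib, smul_sum,
      smul_smul, Matrix.mul_apply, sum_smul]
    congr 1
    refine (sum_rotate fun r t p => (B r t * A p r) • mg (th p) (dg (th t) x)).trans ?_
    rw [sum_comm]
    simp [mul_comm]
  have e2 : qed B (qte A x) = ∑ r, ∑ t, B r t • mg (et r) (qte A (dg (th t) x))
      + ∑ r, ∑ q, (B * A) r q • mg (et r) (dg (et q) x) := by
    simp only [qed_apply B, dg_th_qte, map_add, map_sum, map_smul, smul_add, sum_add_distrib,
      smul_sum, smul_smul, Matrix.mul_apply, sum_smul]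
    congr 1
    exact sum_ext fun r => sum_comm
  rw [e1, e2, qth_apply, qet_apply]
  abel

theorem qed_gmul (A : Mat3) (a b : Gr) :
    qed A (gmul a b) = gmul (qed A a) b + gmul a (qed A b) := by
  simp [qed_apply, dg_gmul, smul_add, sum_add_distrib, gmul_sum_left, gmul_sum_right,
    gmul_smul_left, gmul_smul_right, mg_gmul, gmul_mg]

theorem contDiffOn_gs {M : E3 → Mat6} {U : Set E3}
    (hM : ∀ i j, SmoothOn (fun z => M z i j) U) {a : E3 → Gr} (ha : SmoothOn a U) :
    SmoothOn (fun z => gs (M z) (a z)) U := by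
  have h : ∀ x : Gr, SmoothOn (fun z => gs (M z) x) U := fun x => by
    induction x using Gr.induction with
    | hadd a b ha hb => simpa using ha.add hb
    | hsmul c a ha => 
      simp only [map_smul]
      exact Kahler.smooth_lin (c • LinearMap.id) ha
    | hone => simpa [gs_gone] using contDiffOn_const
    | hgen k a ha =>
      simp only [gs_mg]
      exact ContDiffOn.sum fun b _ => (hM b k).smul (Kahler.smooth_lin (mg b) ha)
  simp only [fun z => gs_eq_sum (M z) (a z)]
  exact ContDiffOn.sum fun K _ => (contDiffOn_pi.1 ha K).smul (h _)

/-- The divergence of a polyvector field in coordinates. -/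
def dv (a : E3 → Gr) (z : E3) : Gr := ∑ i, dg (th i) (pd (th i) a z)

theorem sum_antisymm {T : Fin 3 → Fin 3 → Gr} (h : ∀ i j, T i j = -T j i) :
    ∑ i, ∑ j, T i j = 0 := by
  refine self_eq_neg.1 ?_
  conv_lhs => rw [sum_comm]
  simp only [← sum_neg_distrib]
  exact sum_ext fun i => sum_ext fun j => h j i

theorem db_congr {a b : E3 → Gr} {z : E3} (h : a =ᶠ[𝓝 z] b) : db a z = db b z := by
  simp [db, pd_congr _ h]

theorem dv_congr {a b : E3 → Gr} {z : E3} (h : a =ᶠ[𝓝 z] b) : dv a z = dv b z := by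
  simp [dv, pd_congr _ h]

theorem dl_congr {s : E3 → ℂ} {a b : E3 → Gr} {z : E3} (h : a =ᶠ[𝓝 z] b) :
    dl s a z = dl s b z := by
  simp [dl, pd_congr _ h, h.eq_of_nhds]

section linear

variable {s : E3 → ℂ} {a b : E3 → Gr} {z : E3}

theorem db_add (ha : RDiffAt a z) (hb : RDiffAt b z) :
    db (fun y => a y + b y) z = db a z + db b z := by
  simp [db, pd_add _ ha hb, sum_add_distrib]

theorem dl_add (ha : RDiffAt a z) (hb : RDiffAt b z) :
    dl s (fun y => a y + b y) z = dl s a z + dl s b z := by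
  simp only [dl, pd_add _ ha hb, map_add, smul_add, sum_add_distrib]
  abel

theorem dl_neg : dl s (fun y => -a y) z = -dl s a z := by
  simp only [dl, pd_neg, map_neg, map_add, smul_neg, sum_neg_distrib, sum_add_distrib, neg_add]

theorem dl_par (ha : RDiffAt a z) :
    dl s (fun y => par (a y)) z = -par (dl s a z) := by
  simp only [dl, pd_lin _ par ha, ← map_smul, ← map_add, map_sum, par_dg, sum_neg_distrib, neg_neg]

theorem dl_wt (ha : RDiffAt a z) :
    dl s (fun y => wt (a y)) z = wt (dl s a z) + dl s a z := by
  simp only [dl, pd_lin _ wt ha, ← map_smul, ← map_add wt, wt_dg_th, sum_add_distrib, map_sum]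

theorem db_wt (ha : RDiffAt a z) :
    db (fun y => wt (a y)) z = wt (db a z) + db a z := by
  simp [db, pd_lin _ wt ha, wt_mg_et, sum_add_distrib]

theorem gmul_eq_sum (a b : Gr) : gmul a b = ∑ K, a K • gmul (single K 1) b := by
  conv_lhs => rw [Gr.eq_sum a, gmul_sum_left]
  simp [gmul_smul_left]

theorem differentiableAt_gmul (ha : RDiffAt a z) (hb : RDiffAt b z) :
    RDiffAt (fun y => gmul (a y) (b y)) z := by
  simp only [fun y => gmul_eq_sum (a y) (b y)]
  exact DifferentiableAt.fun_sum fun K _ => (differentiableAt_coeff ha K).fun_smul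
    (differentiableAt_lin (gmulL (single K 1)) hb)

theorem pd_gmul (k : Fin 6) (ha : RDiffAt a z) (hb : RDiffAt b z) :
    pd k (fun y => gmul (a y) (b y)) z = gmul (pd k a z) (b z) + gmul (a z) (pd k b z) := by
  have h : ∀ K, RDiffAt (fun y => gmul (single K 1) (b y)) z := fun K =>
    differentiableAt_lin (gmulL (single K 1)) hb
  simp only [fun y => gmul_eq_sum (a y) (b y)]
  rw [pd_sum k fun K _ => (differentiableAt_coeff ha K).fun_smul (h K), gmul_eq_sum (pd k a z),
    gmul_eq_sum (a z), ← sum_add_distrib]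
  refine sum_ext fun K => ?_
  rw [pd_smul k (differentiableAt_coeff ha K) (h K), pd_apply k ha, add_comm]
  congr 2
  exact pd_lin k (gmulL (single K 1)) hb

theorem db_gmul (ha : RDiffAt a z) (hb : RDiffAt b z) :
    db (fun y => gmul (a y) (b y)) z = gmul (db a z) (b z) + gmul (par (a z)) (db b z) := by
  simp [db, pd_gmul _ ha hb, sum_add_distrib, gmul_sum_left, gmul_sum_right, mg_gmul, gmul_mg,
    par_par]

end linear

namespace Kahler

variable {s : E3 → ℂ} {g : E3 → Mat3} {U : Set E3} {a b : E3 → Gr} (K : Kahler s g U)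

include K

theorem smul_dl {z : E3} (hz : z ∈ U) (ha : RDiffAt a z) :
    s z • dl s a z = dv (fun y => s y • a y) z := by
  have h1 := (K.differentiableAt_s hz).restrictScalars ℝ
  simp only [dl, dv, smul_sum, ← map_smul, smul_add, smul_smul, mul_inv_cancel_left₀ (K.hs0 z hz),
    pd_smul _ h1 ha]

theorem mem_nhds {z : E3} (hz : z ∈ U) : U ∈ 𝓝 z := K.isOpen.mem_nhds hz

theorem smooth_smul (ha : SmoothOn a U) : SmoothOn (fun y => s y • a y) U := K.contDiffOn_s.smul ha

theorem dl_dl (ha : SmoothOn a U) {z : E3} (hz : z ∈ U) :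
    dl s (dl s a) z = 0 := by
  have hb := K.smooth_smul ha
  refine (smul_eq_zero.1 ?_).resolve_left (K.hs0 z hz)
  rw [K.smul_dl hz (K.differentiableAt (K.smooth_dl ha) hz), dv_congr (b := dv fun y => s y • a y)
    (by filter_upwards [K.mem_nhds hz] with y hy using K.smul_dl hy (K.differentiableAt ha hy))]
  have h1 : ∀ i : Fin 3, pd (th i) (dv fun y => s y • a y) z
      = ∑ j, dg (th j) (pd (th i) (pd (th j) (fun y => s y • a y)) z) := fun i => by
    unfold dv
    have h2 := fun j => K.differentiableAt (K.smooth_pd hb (th j)) hz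
    rw [pd_sum _ fun j _ => differentiableAt_lin (dg (th j)) (h2 j)]
    exact sum_ext fun j => pd_lin _ (dg (th j)) (h2 j)
  rw [dv]
  simp only [h1, map_sum]
  exact sum_antisymm fun i j => by
    rw [dg_dg, pd_comm _ _ (hb.contDiffAt (K.mem_nhds hz))]

theorem db_smul_s {z : E3} (hz : z ∈ U) (ha : RDiffAt a z) :
    db (fun y => s y • a y) z = s z • db a z := by
  have h1 := (K.differentiableAt_s hz).restrictScalars ℝ
  simp [db, pd_smul _ h1 ha, pd_et_of_holomorphic (K.differentiableAt_s hz), smul_sum]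

theorem db_dl (ha : SmoothOn a U) {z : E3} (hz : z ∈ U) :
    db (dl s a) z = -dl s (db a) z := by
  have hb := K.smooth_smul ha
  refine smul_right_injective Gr (K.hs0 z hz) ?_
  dsimp only
  rw [smul_neg, K.smul_dl hz (K.differentiableAt (K.smooth_db ha) hz),
    ← K.db_smul_s hz (K.differentiableAt (K.smooth_dl ha) hz),
    dv_congr (b := db fun y => s y • a y) (by
      filter_upwards [K.mem_nhds hz] with y hy using (K.db_smul_s hy (K.differentiableAt ha hy)).symm),
    db_congr (b := dv fun y => s y • a y)
    (by filter_upwards [K.mem_nhds hz] with y hy using K.smul_dl hy (K.differentiableAt ha hy))]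
  have h2 := fun k => K.differentiableAt (K.smooth_pd hb k) hz
  have h1 : ∀ i : Fin 3, pd (et i) (dv fun y => s y • a y) z
      = ∑ j, dg (th j) (pd (et i) (pd (th j) (fun y => s y • a y)) z) := fun i => by
    unfold dv
    rw [pd_sum _ fun j _ => differentiableAt_lin (dg (th j)) (h2 _)]
    exact sum_ext fun j => pd_lin _ (dg (th j)) (h2 _)
  have h3 : ∀ i : Fin 3, pd (th i) (db fun y => s y • a y) z
      = ∑ j, mg (et j) (pd (th i) (pd (et j) (fun y => s y • a y)) z) := fun i => by
    unfold db
    rw [pd_sum _ fun j _ => differentiableAt_lin (mg (et j)) (h2 _)]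
    exact sum_ext fun j => pd_lin _ (mg (et j)) (h2 _)
  rw [dv, db]
  simp only [h1, h3, map_sum, dg_mg, th_ne_et, if_false, zero_sub, sum_neg_distrib, neg_neg]
  rw [sum_comm]
  refine sum_ext fun i => sum_ext fun j => ?_
  rw [pd_comm _ _ (hb.contDiffAt (K.mem_nhds hz))]

theorem dl_lo {z : E3} (hz : z ∈ U) (ha : RDiffAt a z) :
    dl s (fun y => lo g y (a y)) z = lo g z (dl s a z) := by
  have e : ∑ i, dg (th i) (qed (pdm (th i) g z)ᵀ (a z)) = 0 := by
    simp only [dg_th_qed]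
    simp only [qed_apply]
    rw [sum_comm]
    refine sum_eq_zero fun p _ => ?_
    refine sum_antisymm fun i j => ?_
    rw [dg_dg, map_neg, smul_neg]
    simp only [transpose_apply, pdm_apply]
    rw [K.closed z hz j p i]
  have h1 : ∀ k x, dg (th k) (lo g z x) = lo g z (dg (th k) x) := fun k x => dg_th_qed _ k x
  simp only [dl, K.pd_lo hz ha, map_add, map_smul, map_sum, h1, sum_add_distrib]
  rw [e, add_zero]

theorem db_lo {z : E3} (hz : z ∈ U) (ha : RDiffAt a z) :
    db (fun y => lo g y (a y)) z = lo g z (db a z) := by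
  have e : ∑ i, mg (et i) (qed (pdm (et i) g z)ᵀ (a z)) = 0 := by
    simp only [qed_apply, map_sum, map_smul]
    refine sum_antisymm fun i j => ?_
    rw [← sum_neg_distrib]
    refine sum_ext fun p => ?_
    rw [mg_mg, smul_neg]
    simp only [transpose_apply, pdm_apply]
    rw [K.closedBar z hz p j i]
  have h1 : ∀ k x, mg (et k) (lo g z x) = lo g z (mg (et k) x) := fun k x => (qed_mg_et _ k x).symm
  simp only [db, K.pd_lo hz ha, map_add, map_sum, h1, sum_add_distrib]
  rw [e, add_zero]

theorem lam_lo {z : E3} (hz : z ∈ U) (x : Gr) : lam g z (lo g z x) = lo g z (lam g z x) + wt x := by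
  have h1 : ((g z)⁻¹)ᵀ * (g z)ᵀ = 1 := by
    rw [← transpose_mul, mul_nonsing_inv _ (K.isUnit_g hz), transpose_one]
  have h2 : (g z)ᵀ * ((g z)⁻¹)ᵀ = 1 := by
    rw [← transpose_mul, nonsing_inv_mul _ (K.isUnit_g hz), transpose_one]
  rw [lam, lo, qte_qed, h1, h2, wt, LinearMap.sub_apply, add_sub_assoc]

end Kahler

/-- `S` on the undeformed manifold. -/
def sl (g : E3 → Mat3) (a : E3 → Gr) (z : E3) : Gr :=
  db (fun y => lam g y (a y)) z - lam g z (db a z)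

/-- `R` on the undeformed manifold. -/
def rl (s : E3 → ℂ) (g : E3 → Mat3) (a : E3 → Gr) (z : E3) : Gr :=
  dl s (fun y => lam g y (a y)) z - lam g z (dl s a z)

namespace Kahler

variable {s : E3 → ℂ} {g : E3 → Mat3} {U : Set E3} {a b : E3 → Gr} (K : Kahler s g U)

include K

theorem smooth_rl (ha : SmoothOn a U) : SmoothOn (rl s g a) U :=
  (K.smooth_dl (K.smooth_lam ha)).sub (K.smooth_lam (K.smooth_dl ha))

theorem rl_dl (ha : SmoothOn a U) {z : E3} (hz : z ∈ U) :
    rl s g (dl s a) z = -dl s (rl s g a) z := by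
  have h1 := K.differentiableAt (K.smooth_dl (K.smooth_lam ha)) hz
  have h2 := K.differentiableAt (K.smooth_lam (K.smooth_dl ha)) hz
  have h3 : dl s (rl s g a) z = dl s (dl s fun y => lam g y (a y)) z
      + dl s (fun y => -lam g y (dl s a y)) z := by
    rw [← dl_add h1 h2.fun_neg]
    simp only [← sub_eq_add_neg]
    rfl
  rw [h3, rl, K.dl_dl ha hz, K.dl_dl (K.smooth_lam ha) hz, dl_neg, map_zero]
  abel

theorem rl_lo (ha : SmoothOn a U) {z : E3} (hz : z ∈ U) :
    rl s g (fun y => lo g y (a y)) z = lo g z (rl s g a z) + dl s a z := by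
  have h1 := K.differentiableAt ha hz
  have h2 := K.differentiableAt (K.smooth_lam ha) hz
  have h3 := K.differentiableAt (K.smooth_lo (K.smooth_lam ha)) hz
  rw [rl, dl_congr (b := fun y => lo g y (lam g y (a y)) + wt (a y)) (by
    filter_upwards [K.mem_nhds hz] with y hy using K.lam_lo hy _),
    dl_add h3 (differentiableAt_lin wt h1), K.dl_lo hz h2, dl_wt h1, K.dl_lo hz h1,
    K.lam_lo hz, rl, map_sub]
  abel

theorem sl_lo (ha : SmoothOn a U) {z : E3} (hz : z ∈ U) :
    sl g (fun y => lo g y (a y)) z = lo g z (sl g a z) + db a z := by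
  have h1 := K.differentiableAt ha hz
  have h2 := K.differentiableAt (K.smooth_lam ha) hz
  have h3 := K.differentiableAt (K.smooth_lo (K.smooth_lam ha)) hz
  rw [sl, db_congr (b := fun y => lo g y (lam g y (a y)) + wt (a y)) (by
    filter_upwards [K.mem_nhds hz] with y hy using K.lam_lo hy _),
    db_add h3 (differentiableAt_lin wt h1), K.db_lo hz h2, db_wt h1, K.db_lo hz h1,
    K.lam_lo hz, sl, map_sub]
  abel

theorem rl_eq_hodge {z : E3} (hz : z ∈ U) (ha : RDiffAt a z) :
    rl s g a z = -(base s g).hodge z (dl s (fun y => (base s g).hodge y (a y)) z) := by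
  have h := K.admissible hz
  rw [rl, ← K.opR_base hz ha, Geom.opR_eq_hodge h.hφ h.hψ h.hd h.symψ, K.opDelta_base hz
    (Geom.differentiableAt_hodge h.hg h.hg0 ha)]

theorem smooth_hodge (ha : SmoothOn a U) :
    SmoothOn (fun y => (base s g).hodge y (a y)) U := by
  refine smooth_lin sgl (contDiffOn_gs (M := (base s g).hmat) ?_ ha)
  have hg : ∀ i j, SmoothOn (fun z => -g z i j) U := fun i j => (K.hg i j).neg
  refine six_cases (fun i => six_cases (fun j => ?_) fun j => ?_) fun i =>
    six_cases (fun j => ?_) fun j => ?_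
  · simpa [Geom.hmat] using contDiffOn_const
  · simpa [Geom.hmat, base] using K.smooth_gInv j i
  · simpa [Geom.hmat, base] using hg j i
  · simpa [Geom.hmat] using contDiffOn_const

theorem rl_rl (ha : SmoothOn a U) {z : E3} (hz : z ∈ U) :
    rl s g (rl s g a) z = 0 := by
  set h : E3 → Gr := fun y => (base s g).hodge y (a y) with hh
  have h0 : SmoothOn h U := K.smooth_hodge ha
  have h1 := K.smooth_dl h0
  have h2 : (fun y => (base s g).hodge y (rl s g a y)) =ᶠ[𝓝 z] fun y => par (dl s h y) := by
    filter_upwards [K.mem_nhds hz] with y hy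
    rw [K.rl_eq_hodge hy (K.differentiableAt ha hy), Geom.hodge_neg, Geom.hodge_hodge (Y := base s
      g) (K.hg0 y hy), neg_neg]
  rw [K.rl_eq_hodge hz (K.differentiableAt (K.smooth_rl ha) hz), dl_congr h2, dl_par
    (K.differentiableAt h1 hz), K.dl_dl h0 hz, map_zero, neg_zero]
  simp [Geom.hodge]

/-- If `w` is annihilated by `Δ`, `∂̄` and `R`, then it is harmonic. -/
theorem dl_sl_eq_zero (ha : SmoothOn a U) (h0 : ∀ z ∈ U, dl s a z = 0)
    (h1 : ∀ z ∈ U, db a z = 0) (h2 : ∀ z ∈ U, rl s g a z = 0) {z : E3} (hz : z ∈ U) :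
    dl s (sl g a) z = 0 := by
  have h3 : ∀ y ∈ U, dl s (fun y => lam g y (a y)) y = 0 := fun y hy => by
    have := h2 y hy
    rwa [rl, h0 y hy, map_zero, sub_zero] at this
  have h5 : sl g a =ᶠ[𝓝 z] db (fun y => lam g y (a y)) := by
    filter_upwards [K.mem_nhds hz] with y hy
    rw [sl, h1 y hy, map_zero, sub_zero]
  have h6 : db (fun _ => (0 : Gr)) z = 0 := by simp [db, pd_const]
  rw [dl_congr h5, ← neg_neg (dl s _ z), ← K.db_dl (K.smooth_lam ha) hz, db_congr (b := fun _ => 0)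
    (by filter_upwards [K.mem_nhds hz] with y hy using h3 y hy), h6, neg_zero]

/-- `R` annihilates the contraction of `ΔRβ` with the Kähler form. -/
theorem rl_lo_dl_rl {b : E3 → Gr} (hb : SmoothOn b U) {z : E3} (hz : z ∈ U) :
    rl s g (fun y => lo g y (dl s (rl s g b) y)) z = 0 := by
  have h1 := K.smooth_rl hb
  have h2 : rl s g (rl s g b) =ᶠ[𝓝 z] fun _ => 0 := by
    filter_upwards [K.mem_nhds hz] with y hy using K.rl_rl hb hy
  have h3 : dl s (fun _ => (0 : Gr)) z = 0 := by simp [dl, pd_const]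
  rw [K.rl_lo (K.smooth_dl h1) hz, K.dl_dl h1 hz, K.rl_dl h1 hz, dl_congr h2, h3, neg_zero, map_zero,
    add_zero]

end Kahler

/-! ### The bracket and the holomorphic deformation -/

theorem sum_pair_comm {M : Type*} [AddCommMonoid M] (f : Fin 3 → Fin 3 → Fin 3 → Fin 3 → M) :
    ∑ p, ∑ q, ∑ m, ∑ l, f p q m l = ∑ m, ∑ l, ∑ p, ∑ q, f p q m l := by
  have h := sum_comm (s := univ) (t := univ)
    (f := fun (x y : Fin 3 × Fin 3) => f x.1 x.2 y.1 y.2)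
  simpa only [Fintype.sum_prod_type] using h

/-- Multiplication by `∑ A_{pq} θ_p η^q`. -/
def wm (A : Mat3) : EndGr := ∑ p, ∑ q, A p q • (mg (th p) * mg (et q))

theorem wm_apply (A : Mat3) (x : Gr) :
    wm A x = ∑ p, ∑ q, A p q • mg (th p) (mg (et q) x) := by
  simp [wm, LinearMap.sum_apply]

theorem wm_gone_gmul (A : Mat3) (x : Gr) : gmul (wm A gone) x = wm A x := by
  simp [wm_apply, gmul_sum_left, gmul_smul_left, mg_gmul, gone_gmul]

theorem dg_th_wm (A : Mat3) (k : Fin 3) (x : Gr) :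
    dg (th k) (wm A x) = ∑ q, A k q • mg (et q) x + wm A (dg (th k) x) := by
  simp only [wm_apply, map_sum, map_smul, dg_mg, th_inj, th_ne_et, if_false, zero_sub, map_neg,
    sub_neg_eq_add, smul_add, sum_add_distrib, smul_ite, smul_zero]
  congr 1
  rw [sum_eq_single k (fun b _ h => by simp [Ne.symm h]) (by simp)]
  simp

theorem mg_th_mg_et_gone (i j : Fin 3) : mg (th i) (mg (et j) gone) = single {th i, et j} 1 := by
  have h : ∀ i j : Fin 3, th i < et j := by decide
  rw [single_eq_mg (by simpa using h i j), ← insert_empty_eq, single_eq_mg (by simp)]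
  rfl

theorem wm_gone_apply (A : Mat3) (i j : Fin 3) :
    wm A gone {th i, et j} = A i j := by
  have h : ∀ i j p q : Fin 3, ({th i, et j} : Idx) = {th p, et q} ↔ p = i ∧ q = j := by
    decide
  simp [wm_apply, mg_th_mg_et_gone, Finset.sum_apply, single_apply, h, ite_and,
    Finset.sum_ite_irrel]

theorem eq_wm {a : Gr} (h : a = proj 1 1 a) :
    a = wm (Matrix.of fun i j => a {th i, et j}) gone := by
  have h1 : ∀ K : Idx, thDeg K = 1 ∧ etDeg K = 1 → ∃ i j, K = {th i, et j} := by decide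
  have h2 : ∀ i j : Fin 3, thDeg {th i, et j} = 1 ∧ etDeg {th i, et j} = 1 := by decide
  funext K
  by_cases hK : thDeg K = 1 ∧ etDeg K = 1
  · obtain ⟨i, j, rfl⟩ := h1 K hK
    rw [wm_gone_apply]
    rfl
  · rw [congrFun h K, wm_apply]
    simp only [mg_th_mg_et_gone, Finset.sum_apply, Pi.smul_apply]
    rw [proj, if_neg hK]
    refine (sum_eq_zero fun i _ => sum_eq_zero fun j _ => ?_).symm
    rw [single_eq_of_ne (by rintro rfl; exact hK (h2 i j)), smul_zero]

theorem par_wm (A : Mat3) (x : Gr) : par (wm A x) = wm A (par x) := by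
  simp [wm_apply, par_mg]

/-- The bracket of an even element with an arbitrary one. -/
def bl (f a : E3 → Gr) (z : E3) : Gr :=
  ∑ i, (gmul (pd (th i) f z) (dg (th i) (a z)) + gmul (dg (th i) (f z)) (pd (th i) a z))

theorem dl_smul {s : E3 → ℂ} {a : E3 → Gr} {z : E3} (c : ℂ) (ha : RDiffAt a z) :
    dl s (fun y => c • a y) z = c • dl s a z := by
  have h : ∀ k, pd k (fun y => c • a y) z = c • pd k a z := fun k =>
    pd_lin k (c • (LinearMap.id : Gr →ₗ[ℂ] Gr)) ha
  simp [dl, h, smul_comm _ c (a z), ← smul_add, smul_sum]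

theorem dl_gmul {s : E3 → ℂ} {f a : E3 → Gr} {z : E3} (hf : RDiffAt f z)
    (ha : RDiffAt a z) (hp : par (f z) = f z) (hp' : ∀ i, par (pd (th i) f z) = pd (th i) f z) :
    dl s (fun y => gmul (f y) (a y)) z = gmul (dl s f z) (a z) + gmul (f z) (dl s a z) + bl f a z := by
  simp only [dl, bl, pd_gmul _ hf ha, map_add, map_smul, dg_gmul, hp, hp', gmul_sum_left,
    gmul_sum_right, gmul_add_left, gmul_add_right, gmul_smul_left, gmul_smul_right, smul_add,
    sum_add_distrib]
  abel

section

variable {s : E3 → ℂ} {g A : E3 → Mat3} {f a : E3 → Gr} {z : E3}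

theorem pd_wm_gone (hA : MatDiff A z) (k : Fin 6) :
    pd k (fun y => wm (A y) gone) z = wm (pdm k A z) gone := by
  simp only [wm_apply]
  rw [pd_sum k fun p _ => DifferentiableAt.fun_sum fun q _ => (hA p q).fun_smul
    (differentiableAt_const _)]
  refine sum_ext fun p => ?_
  rw [pd_sum k fun q _ => (hA p q).fun_smul (differentiableAt_const _)]
  refine sum_ext fun q => ?_
  rw [pd_smul k (hA p q) (differentiableAt_const _), pd_const, smul_zero, zero_add]
  rfl

theorem bl_wm (hA : MatDiff A z) (hf : f =ᶠ[𝓝 z] fun y => wm (A y) gone) :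
    bl f a z = ∑ k, mg (et k) (∑ l, A z l k • pd (th l) a z)
      + ∑ i, wm (pdm (th i) A z) (dg (th i) (a z)) := by
  simp only [bl, pd_congr _ hf, pd_wm_gone hA, hf.eq_of_nhds, dg_th_wm, dg_gone, map_zero, add_zero,
    wm_gone_gmul, gmul_sum_left, gmul_smul_left, mg_gmul, gone_gmul, sum_add_distrib, map_sum,
    map_smul]
  rw [add_comm, sum_comm]

/-- The holomorphic deformation. -/
def hol (s : E3 → ℂ) (g A : E3 → Mat3) : Geom := ⟨s, g, A, 0⟩

theorem opDbar_hol (hs : DifferentiableAt ℂ s z) (hs0 : s z ≠ 0) (hA : MatDiff A z)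
    (hks : ∀ k l m, pd (et k) (fun y => A y m l) z + ∑ p, A z p k * pd (th p) (fun y => A y m l) z
      = pd (et l) (fun y => A y m k) z + ∑ p, A z p l * pd (th p) (fun y => A y m k) z)
    (hdiv : ∀ k, ∑ l, pd (th l) (fun y => s y * A y l k) z = 0)
    (ha : RDiffAt a z) (hf : f =ᶠ[𝓝 z] fun y => wm (A y) gone) :
    (hol s g A).opDbar a z = db a z + bl f a z := by
  rw [Geom.opDbar_eq (Y := hol s g A) hs hs0 hA (mdiff_const 0) (by simp [Geom.pairing, hol])
      (by simpa [Geom.eEt, hol] using hks) hdiv ha,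
    Geom.explDbar_eq, bl_wm hA hf]
  have h1 : (hol s g A).matNbar z = 1 := by simp [Geom.matNbar, Geom.pairingBar, hol]
  have h2 : ∀ k, vdm ((hol s g A).col z k) (hol s g A).ψ z = 0 := fun k => by
    ext i j; exact vd_const _ _
  have h0 : qet 0 (a z) = 0 := by simp [qet]
  have h3 : ∀ k, (hol s g A).nm z k = Matrix.of fun p i => pdm (th i) A z p k := fun k => by
    ext p i
    simp only [Geom.nm, Geom.symM, Geom.eTh, Geom.eEt, Geom.matN, Geom.pairing]
    simp [hol, pd_const, one_apply, pdm_apply]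
  simp only [h1, h2, h3, zero_mul, Matrix.transpose_zero, h0, sub_zero, one_apply, ite_smul,
    one_smul, zero_smul, sum_ite_eq, mem_univ, if_true, map_sub, sum_sub_distrib]
  have h4 : ∑ k, mg (et k) (qth (Matrix.of fun p i => pdm (th i) A z p k) (a z))
      = -∑ i, wm (pdm (th i) A z) (dg (th i) (a z)) := by
    simp only [qth_apply, wm_apply, map_sum, map_smul, mg_mg (et _) (th _), smul_neg,
      sum_neg_distrib, Matrix.of_apply]
    congr 1
    refine (sum_rotate fun k p i =>
      pdm (th i) A z p k • mg (th p) (mg (et k) (dg (th i) (a z)))).trans ?_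
    exact sum_comm
  rw [h4]
  simp only [Geom.eEt, map_add, sum_add_distrib, sub_neg_eq_add, add_assoc, db, hol]

theorem opDelta_hol (hs : DifferentiableAt ℂ s z) (hs0 : s z ≠ 0) (hA : MatDiff A z)
    (ha : RDiffAt a z) : (hol s g A).opDelta a z = dl s a z := by
  have h1 : (hol s g A).omegaCoeff = s := by
    funext z; simp [Geom.omegaCoeff, Geom.pairing, hol]
  have h2 : ((hol s g A).pairing z).det ≠ 0 := by simp [Geom.pairing, hol]
  rw [Geom.opDelta_eq (hs.restrictScalars ℝ) hs0 hA (mdiff_const 0) h2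
    (fun i l m => by simp [Geom.eTh, hol, pd_const]) ha,
    Geom.explDelta_eq (hs.restrictScalars ℝ) hs0 hA (mdiff_const 0) h2 ha, h1]
  simp [dl, Geom.eTh, hol, pd_const]

theorem traceDensity_hol (a : E3 → Gr) (z : E3) :
    (hol s g A).traceDensity a z = s z ^ 2 * a z univ := by
  have hF : ((hol s g A).frame z).det = 1 := by
    simp [Geom.frame, hol, blk_det]
  have hw : (hol s g A).omegaCoeff z = s z := by simp [Geom.omegaCoeff, Geom.pairing, hol]
  have hT : (hol s g A).toDual a z = a z := by
    simp [Geom.toDual, Geom.pairingBar, hol, gsubst_eq, blk_one, gs_one]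
  simp only [Geom.traceDensity, Geom.toCoord, gsubst_eq]
  rw [← gs_gmul, gs_univ, det_transpose, Matrix.det_nonsing_inv, hF, Ring.inverse_one, one_mul, hw]
  have h1 : ∀ I : Idx, univ \ I = thAll ↔ I = univ \ thAll := by decide
  have h2 : flip (univ \ thAll) = univ := by decide
  have h3 : gsgn (univ \ thAll) thAll * rsgn univ = 1 := by
    have e1 : gexp (univ \ thAll) thAll = 9 := by decide
    have e2 : thDeg univ = 3 := by decide
    have e3 : gexp (univ ∩ thAll) (thAll \ univ) = 0 := by decide
    rw [rsgn, gsgn_eq, gsgn_eq, e1, e2, e3]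
    norm_num [Nat.choose]
  rw [gmul, Finset.powerset_univ, sum_eq_single (univ \ thAll)
    (fun I _ hI => by simp [h1, hI]) (by simp), (h1 _).2 rfl]
  simp only [Geom.rho, hT, hw, h2, Pi.smul_apply, single_eq_same, smul_eq_mul]
  linear_combination (s z ^ 2 * a z univ) * h3

theorem opS_hol_eq_hodge (hA : MatDiff A z) :
    (hol s g A).opS a z = (base s g).hodge z ((hol s g A).opDbar (fun y => (base s g).hodge y (a y)) z) :=
  Geom.opS_eq_hodge hA (mdiff_const 0) (by simp [Geom.pairing, hol])
    (.of_forall fun y => by simp [hol]) a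

theorem opR_hol_eq_hodge (hA : MatDiff A z) :
    (hol s g A).opR a z = -(base s g).hodge z ((hol s g A).opDelta (fun y => (base s g).hodge y (a y)) z) :=
  Geom.opR_eq_hodge hA (mdiff_const 0) (by simp [Geom.pairing, hol])
    (.of_forall fun y => by simp [hol]) a

theorem hodge_wm (hg : (g z).det ≠ 0) {B : Mat3}
    (hB : Bᵀ * g z = (g z)ᵀ * B) (x : Gr) :
    (base s g).hodge z (wm B x) = -wm B ((base s g).hodge z x) := by
  have hG : ((g z)⁻¹)ᵀ * (Bᵀ * g z) = B := by
    rw [hB, ← mul_assoc, ← transpose_mul, mul_nonsing_inv _ (isUnit_iff_ne_zero.2 hg),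
      transpose_one, one_mul]
  have h1 : ∀ m l, B m l = ∑ p, ∑ q, B p q * (g z p l * (g z)⁻¹ q m) := fun m l => by
    conv_lhs => rw [← hG]
    simp only [Matrix.mul_apply, transpose_apply, mul_sum]
    rw [sum_comm]
    exact sum_ext fun _ => sum_ext fun _ => by ring
  have h2 : ∀ p q, (base s g).hodge z (mg (th p) (mg (et q) x))
      = -∑ m, ∑ l, (g z p l * (g z)⁻¹ q m) • mg (th m) (mg (et l) ((base s g).hodge z x)) := by
    intro p q
    simp only [Geom.hodge_mg_th, Geom.hodge_mg_et, map_sum, map_smul, par_mg, par_par, map_neg,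
      smul_neg, smul_sum, smul_smul, mg_mg (et _) (th _), sum_neg_distrib, neg_neg]
    rw [sum_comm]
    rfl
  have h3 : (base s g).hodge z (wm B x)
      = ∑ p, ∑ q, B p q • (base s g).hodge z (mg (th p) (mg (et q) x)) := by
    simp [wm_apply, Geom.hodge]
  rw [h3]
  simp only [h2, smul_neg, sum_neg_distrib]
  congr 1
  have h4 : wm B ((base s g).hodge z x) = ∑ m, ∑ l, (∑ p, ∑ q, B p q * (g z p l * (g z)⁻¹ q m)) •
      mg (th m) (mg (et l) ((base s g).hodge z x)) := by
    simp [wm_apply, ← h1]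
  rw [h4]
  simp only [smul_sum, sum_smul, smul_smul]
  exact sum_pair_comm fun p q m l => (B p q * (g z p l * (g z)⁻¹ q m)) •
    mg (th m) (mg (et l) ((base s g).hodge z x))

end

namespace Kahler

variable {s : E3 → ℂ} {g A : E3 → Mat3} {U : Set E3} {f a : E3 → Gr}
  (K : Kahler s g U)

include K

/-- The Hodge transform of the bracket is the bracket formed with `R`. -/
theorem hodge_bl (hf : SmoothOn f U) (hfA : ∀ y ∈ U, f y = wm (A y) gone)
    (hsym : ∀ y ∈ U, (A y)ᵀ * g y = (g y)ᵀ * A y)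
    (hdl : ∀ y ∈ U, dl s f y = 0) (ha : SmoothOn a U) {z : E3} (hz : z ∈ U) :
    (base s g).hodge z (bl f (fun y => (base s g).hodge y (a y)) z)
      = rl s g (fun y => gmul (f y) (a y)) z - gmul (rl s g f z) (a z)
        - gmul (f z) (rl s g a z) := by
  set κ : E3 → Gr → Gr := (base s g).hodge with hκ
  have hfA' : f =ᶠ[𝓝 z] fun y => wm (A y) gone := by
    filter_upwards [K.mem_nhds hz] with y hy using hfA y hy
  have hpar : ∀ y ∈ U, par (f y) = f y := fun y hy => by rw [hfA y hy, par_wm, par_gone]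
  have hd := K.differentiableAt hf hz
  have hκa := K.differentiableAt (K.smooth_hodge ha) hz
  have hpd : ∀ i, par (pd (th i) f z) = pd (th i) f z := fun i => by
    rw [← pd_lin _ par hd]
    exact pd_congr _ (by filter_upwards [K.mem_nhds hz] with y hy using hpar y hy)
  have h1 : ∀ y ∈ U, ∀ x, κ y (gmul (f y) x) = -gmul (f y) (κ y x) := fun y hy x => by
    rw [hfA y hy, wm_gone_gmul, wm_gone_gmul, hκ, hodge_wm (K.hg0 y hy) (hsym y hy)]
  have h2 : ∀ y ∈ U, κ y (f y) = (-sgl gone ∅) • f y := fun y hy => by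
    have e : κ y gone = sgl gone ∅ • gone := by
      funext L
      rw [hκ, Geom.hodge, gs_gone, Pi.smul_apply, sgl_apply, sgl_apply]
      by_cases hL : L = ∅
      · subst hL; simp [gone]
      · simp [gone, hL]
    rw [← gmul_gone (f y), h1 y hy, e, gmul_smul_right, gmul_gone, neg_smul]
  have h3 : rl s g f z = 0 := by
    rw [K.rl_eq_hodge hz hd, dl_congr (b := fun y => (-sgl gone ∅) • f y)
      (by filter_upwards [K.mem_nhds hz] with y hy using h2 y hy), dl_smul _ hd, hdl z hz]
    simp [Geom.hodge]
  rw [h3, gmul_zero_left, sub_zero, K.rl_eq_hodge hz (differentiableAt_gmul hd (K.differentiableAt ha hz)),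
    K.rl_eq_hodge hz (K.differentiableAt ha hz), dl_congr (b := fun y => -gmul (f y) (κ y (a y)))
      (by filter_upwards [K.mem_nhds hz] with y hy using h1 y hy _), dl_neg,
    dl_gmul hd hκa (hpar z hz) hpd, hdl z hz, gmul_zero_left, zero_add, Geom.hodge_neg, neg_neg,
    Geom.hodge_add, gmul_neg_right, sub_neg_eq_add, ← hκ, h1 z hz]
  abel

end Kahler

/-! ### Change of coordinates -/

/-- The matrix by which the generators transform under a change of coordinates. -/
def cm (J : Mat3) : Mat6 := blk J 0 0 (J⁻¹)ᴴ

section algebra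

variable (J : Mat3) (x : Gr)

theorem dg_th_cm (q : Fin 3) : dg (th q) (gs (cm J) x) = ∑ b, J q b • gs (cm J) (dg (th b) x) := by
  simp [dg_gs, sum_six, cm]

theorem dg_et_cm (q : Fin 3) :
    dg (et q) (gs (cm J) x) = ∑ b, (J⁻¹)ᴴ q b • gs (cm J) (dg (et b) x) := by
  simp [dg_gs, sum_six, cm]

theorem cm_mg_th (k : Fin 3) : gs (cm J) (mg (th k) x) = ∑ p, J p k • mg (th p) (gs (cm J) x) := by
  simp [gs_mg, sum_six, cm]

theorem cm_mg_et (k : Fin 3) :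
    gs (cm J) (mg (et k) x) = ∑ p, (J⁻¹)ᴴ p k • mg (et p) (gs (cm J) x) := by
  simp [gs_mg, sum_six, cm]

variable {J} {A B : Mat3}

theorem qed_cm (h : A * J = (J⁻¹)ᴴ * B) :
    qed A (gs (cm J) x) = gs (cm J) (qed B x) := by
  rw [qed_apply, qed_apply]
  exact gs_quad (fun q => dg_th_cm ..) (fun k y => cm_mg_et ..) h

theorem qte_cm (h : A * (J⁻¹)ᴴ = J * B) :
    qte A (gs (cm J) x) = gs (cm J) (qte B x) := by
  rw [qte_apply, qte_apply]
  exact gs_quad (fun q => dg_et_cm ..) (fun k y => cm_mg_th ..) h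

end algebra

section metric

variable {J g g' : Mat3} (hJ : J.det ≠ 0)
  (hg : g = Jᵀ * g' * J.map conj)

include hJ hg

theorem lo_cm (x : Gr) : qed g'.transpose (gs (cm J) x) = gs (cm J) (qed g.transpose x) := by
  refine qed_cm x ?_
  have h1 : (J⁻¹)ᴴ * Jᴴ = 1 := by
    rw [← conjTranspose_mul, mul_nonsing_inv _ (isUnit_iff_ne_zero.2 hJ), conjTranspose_one]
  have h2 : (J.map conj)ᵀ = Jᴴ := rfl
  rw [hg, transpose_mul, transpose_mul, transpose_transpose, h2, ← mul_assoc, h1, one_mul]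

theorem lam_cm (x : Gr) : qte (g'⁻¹)ᵀ (gs (cm J) x) = gs (cm J) (qte (g⁻¹)ᵀ x) := by
  refine qte_cm x ?_
  have h3 : J * J⁻¹ = 1 := mul_nonsing_inv _ (isUnit_iff_ne_zero.2 hJ)
  have h2 : ((J.map conj)⁻¹)ᵀ = (J⁻¹)ᴴ := by
    have : (J.map conj) = J.conjTranspose.transpose := rfl
    rw [this, ← transpose_nonsing_inv, transpose_transpose, Matrix.conjTranspose_nonsing_inv]
  rw [hg, Matrix.mul_inv_rev, Matrix.mul_inv_rev, transpose_mul, transpose_mul, h2, ←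
    transpose_nonsing_inv, transpose_transpose, ← mul_assoc, ← mul_assoc, h3, one_mul]

end metric

/-- A holomorphic change of coordinates `h` with Jacobian matrix `J`. -/
structure Trans (h : E3 → E3) (J : E3 → Mat3) (V : Set E3) : Prop where
  isOpen : IsOpen V
  hol : DifferentiableOn ℂ h V
  jac : ∀ z ∈ V, ∀ i k, fderiv ℂ h z (single k 1) i = J z i k
  det : ∀ z ∈ V, (J z).det ≠ 0

namespace Trans

variable {h : E3 → E3} {J : E3 → Mat3} {V : Set E3} (T : Trans h J V)
  {z : E3} (hz : z ∈ V)

include T hz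

theorem mem_nhds : V ∈ 𝓝 z := T.isOpen.mem_nhds hz

theorem holAt : DifferentiableAt ℂ h z := T.hol.differentiableAt (T.mem_nhds hz)

theorem hol_apply (i : Fin 3) : DifferentiableAt ℂ (fun y => h y i) z :=
  differentiableAt_pi.1 (T.holAt hz) i

theorem jac_eq (i k : Fin 3) : J z i k = pd (th k) (fun y => h y i) z := by
  rw [pd_th_of_holomorphic (T.hol_apply hz i), ← T.jac z hz i k, fderiv_pi
    (fun i => T.hol_apply hz i)]
  rfl

theorem jac_holomorphic (i k : Fin 3) : DifferentiableAt ℂ (fun y => J y i k) z := by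
  have h1 : DifferentiableOn ℂ (fun y => J y i k) V := by
    refine (differentiableOn_fderiv_apply T.isOpen (fun y hy =>
      (T.hol_apply hy i).differentiableWithinAt) (single k 1)).congr fun y hy => ?_
    rw [T.jac_eq hy, pd_th_of_holomorphic (T.hol_apply hy i)]
  exact h1.differentiableAt (T.mem_nhds hz)

theorem matDiff_jac : MatDiff J z := fun i k => (T.jac_holomorphic hz i k).restrictScalars ℝ

theorem pd_jac_symm (i k l : Fin 3) :
    pd (th l) (fun y => J y i k) z = pd (th k) (fun y => J y i l) z := by
  have h1 : ContDiffAt ℝ ∞ (fun y => h y i) z :=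
    ((contDiffOn_of_differentiableOn T.isOpen (fun y hy =>
      (T.hol_apply hy i).differentiableWithinAt)).restrict_scalars ℝ).contDiffAt (T.mem_nhds hz)
  have h2 : ∀ k, (fun y => J y i k) =ᶠ[𝓝 z] pd (th k) (fun y => h y i) := fun k => by
    filter_upwards [T.mem_nhds hz] with y hy using T.jac_eq hy i k
  rw [pd_congr _ (h2 k), pd_congr _ (h2 l), pd_comm _ _ h1]

theorem fderiv_comp {W : Type*} [NormedAddCommGroup W] [NormedSpace ℝ W] {F : E3 → W}
    (hF : RDiffAt F (h z)) (v : E3) :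
    fderiv ℝ (fun y => F (h y)) z v = fderiv ℝ F (h z) (fderiv ℂ h z v) := by
  have h1 := (T.holAt hz).hasFDerivAt.restrictScalars ℝ
  exact congrArg (fun L => L v) (hF.hasFDerivAt.comp z h1).fderiv

variable {W : Type*} [NormedAddCommGroup W] [NormedSpace ℝ W] [NormedSpace ℂ W]
  [IsScalarTower ℝ ℂ W]

theorem pd_comp {F : E3 → W} (hF : RDiffAt F (h z)) (k : Fin 3) :
    pd (th k) (fun y => F (h y)) z = ∑ l, J z l k • pd (th l) F (h z) ∧
    pd (et k) (fun y => F (h y)) z = ∑ l, conj (J z l k) • pd (et l) F (h z) := by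
  set D := fderiv ℝ F (h z)
  have h2 : (single k Complex.I : E3) = Complex.I • single k 1 := by
    rw [← single_smul]; simp
  have h4 : ∀ (l : Fin 3) (c : ℂ), D (single l c)
      = c.re • D (single l 1) + c.im • D (single l Complex.I) := by
    intro l c
    rw [← map_smul, ← map_smul, ← map_add, ← single_smul, ← single_smul, ← Pi.single_add]
    congr 2
    apply Complex.ext <;> simp
  have h3 : ∀ c : ℂ, D (c • fderiv ℂ h z (single k 1))
      = ∑ l, ((c * J z l k).re • D (single l 1)
        + (c * J z l k).im • D (single l Complex.I)) := by
    intro c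
    have : c • fderiv ℂ h z (single k 1) = ∑ l, single l (c * J z l k) := by
      funext l
      simp [Finset.sum_apply, single_apply, T.jac z hz]
    rw [this, map_sum]
    exact sum_ext fun l => h4 l _
  have h5 := h3 1
  rw [one_smul] at h5
  have key : ∀ (c : ℂ) (u v : W), (c.re • u + c.im • v : W) = (c.re : ℂ) • u + (c.im : ℂ) • v := by
    intro c u v
    rw [← algebraMap_smul ℂ c.re u, ← algebraMap_smul ℂ c.im v]; rfl
  constructor
  · simp only [pd, addCases_th, T.fderiv_comp hz hF, h2, map_smul]
    rw [h3, h5]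
    simp only [key, smul_sum, ← sum_sub_distrib]
    refine sum_ext fun l => ?_
    match_scalars
    · apply Complex.ext <;> simp <;> ring
    · apply Complex.ext <;> simp <;> ring
  · simp only [pd, addCases_et, T.fderiv_comp hz hF, h2, map_smul]
    rw [h3, h5]
    simp only [key, smul_sum, ← sum_add_distrib]
    refine sum_ext fun l => ?_
    match_scalars
    · apply Complex.ext <;> simp <;> ring
    · apply Complex.ext <;> simp <;> ring

end Trans

namespace Trans

variable {h : E3 → E3} {J : E3 → Mat3} {V : Set E3} (T : Trans h J V)
  {z : E3} (hz : z ∈ V)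

include T hz

theorem mul_inv : J z * (J z)⁻¹ = 1 := mul_nonsing_inv _ (isUnit_iff_ne_zero.2 (T.det z hz))

theorem inv_mul : (J z)⁻¹ * J z = 1 := nonsing_inv_mul _ (isUnit_iff_ne_zero.2 (T.det z hz))

theorem cm_inv : (cm (J z))⁻¹ = blk (J z)⁻¹ 0 0 (J z)ᴴ := by
  refine inv_eq_left_inv ?_
  rw [cm, blk_mul]
  simp [T.inv_mul hz, ← conjTranspose_mul, conjTranspose_one, blk_one]

theorem det_cm_ne : (cm (J z)).det ≠ 0 := by
  have h1 : cm (J z) * blk (J z)⁻¹ 0 0 (J z)ᴴ = 1 := by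
    rw [cm, blk_mul]
    simp [T.mul_inv hz, ← conjTranspose_mul, conjTranspose_one, blk_one]
  exact left_ne_zero_of_mul_eq_one ((Matrix.det_mul _ _).symm.trans (h1 ▸ Matrix.det_one))

theorem matDiff_cm : MatDiff (fun y => cm (J y)) z :=
  (T.matDiff_jac hz).blk (mdiff_const 0) (mdiff_const 0) fun i j =>
    differentiableAt_conj ((T.matDiff_jac hz).inv (T.det z hz) j i)

omit T hz in
theorem pdm_inv_conj (k : Fin 6) : pdm k (fun y => ((J y)⁻¹)ᴴ) z
    = (pdm (cconj k) (fun y => (J y)⁻¹) z)ᴴ := by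
  ext i j
  exact pd_conj k

theorem pdm_et_jac (k : Fin 3) : pdm (et k) J z = 0 := by
  ext i j
  exact pd_et_of_holomorphic (T.jac_holomorphic hz i j) k

theorem der_th (k : Fin 3) (x : Gr) : der ((cm (J z))⁻¹ * pdm (th k) (fun y => cm (J y)) z) x
    = qth ((J z)⁻¹ * pdm (th k) J z) x := by
  unfold cm
  rw [pdm_blk, ← cm, T.cm_inv hz, pdm_inv_conj, cconj_th, pdm_inv _ (T.matDiff_jac hz) (T.det z hz),
    T.pdm_et_jac hz, blk_mul, pdm_const]
  simp only [zero_mul, mul_zero, add_zero, neg_zero, Matrix.conjTranspose_zero]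
  rw [der_blk_diag, qth_apply]
  simp

theorem der_et (k : Fin 3) (x : Gr) : der ((cm (J z))⁻¹ * pdm (et k) (fun y => cm (J y)) z) x
    = -qet ((pdm (th k) J z)ᴴ * ((J z)⁻¹)ᴴ) x := by
  have h1 : (J z)ᴴ * ((J z)⁻¹)ᴴ = 1 := by
    rw [← conjTranspose_mul, T.inv_mul hz, conjTranspose_one]
  unfold cm
  rw [pdm_blk, ← cm, T.cm_inv hz, pdm_inv_conj, cconj_et, pdm_inv _ (T.matDiff_jac hz) (T.det z hz),
    T.pdm_et_jac hz, blk_mul, pdm_const, Matrix.conjTranspose_neg, mul_neg, conjTranspose_mul,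
    conjTranspose_mul, mul_neg, ← mul_assoc (J z)ᴴ, h1, one_mul]
  simp only [zero_mul, mul_zero, add_zero, zero_add, neg_zero]
  rw [der_blk_diag, ← LinearMap.neg_apply, ← qet_neg, qet_apply]
  simp

variable {a a' : E3 → Gr} (ha : RDiffAt a z) (ha' : RDiffAt a' (h z))
  (he : (fun y => a' (h y)) =ᶠ[𝓝 z] fun y => gs (cm (J y)) (a y))

include ha ha' he

theorem pd_th_trans (k : Fin 3) : ∑ l, J z l k • pd (th l) a' (h z)
    = gs (cm (J z)) (pd (th k) a z + qth ((J z)⁻¹ * pdm (th k) J z) (a z)) := by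
  rw [← (T.pd_comp hz ha' k).1, pd_congr _ he, pd_gs _ (T.matDiff_cm hz) (T.det_cm_ne hz) ha,
    T.der_th hz]

theorem pd_et_trans (k : Fin 3) : ∑ l, conj (J z l k) • pd (et l) a' (h z)
    = gs (cm (J z)) (pd (et k) a z
      - qet ((pdm (th k) J z)ᴴ * ((J z)⁻¹)ᴴ) (a z)) := by
  rw [← (T.pd_comp hz ha' k).2, pd_congr _ he, pd_gs _ (T.matDiff_cm hz) (T.det_cm_ne hz) ha,
    T.der_et hz, sub_eq_add_neg]

/-- Covariance of `∂̄`. -/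
theorem db_trans : db a' (h z) = gs (cm (J z)) (db a z) := by
  have h0 : ∑ k, mg (et k) (qet ((pdm (th k) J z)ᴴ * ((J z)⁻¹)ᴴ) (a z))
      = 0 := by
    simp only [qet_apply, map_sum, map_smul]
    refine sum_antisymm fun i j => ?_
    rw [← sum_neg_distrib]
    refine sum_ext fun q => ?_
    rw [mg_mg, smul_neg]
    congr 2
    simp only [Matrix.mul_apply, conjTranspose_apply, pdm_apply, T.pd_jac_symm hz _ i j]
  have h1 : db a z = ∑ k, mg (et k) (pd (et k) a z
      - qet ((pdm (th k) J z)ᴴ * ((J z)⁻¹)ᴴ) (a z)) := by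
    simp only [map_sub, sum_sub_distrib, h0, sub_zero, db]
  have h2 : ∀ p l, ∑ k, ((J z)⁻¹)ᴴ p k * conj (J z l k)
      = if p = l then 1 else 0 := fun p l => by
    have := congrFun (congrFun (congrArg Matrix.conjTranspose (T.mul_inv hz)) p) l
    rw [conjTranspose_mul, conjTranspose_one, one_apply] at this
    exact this
  rw [h1, map_sum]
  simp only [cm_mg_et, ← T.pd_et_trans hz ha ha' he, map_sum, map_smul, smul_sum, smul_smul]
  rw [sum_rotate]
  simp only [← sum_smul, h2, ite_smul, one_smul, zero_smul, sum_ite_eq, mem_univ, if_true, db]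

/-- Covariance of `Δ`. -/
theorem dl_trans {s s' : E3 → ℂ} (hs : DifferentiableAt ℂ s' (h z)) (hs0 : s' (h z) ≠ 0)
    (hc : ∀ᶠ y in 𝓝 z, s y = s' (h y) * (J y).det) :
    dl s' a' (h z) = gs (cm (J z)) (dl s a z) := by
  set E := fun k : Fin 3 => (J z)⁻¹ * pdm (th k) J z with hE
  set c' := fun l : Fin 3 => (s' (h z))⁻¹ * pd (th l) s' (h z) with hc'
  have hs' : RDiffAt s' (h z) := hs.restrictScalars ℝ
  have hsh : RDiffAt (fun y => s' (h y)) z := (hs.comp z (T.holAt hz)).restrictScalars ℝ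
  have c0 : ∀ p k q, E k p q = E q p k := fun p k q => by
    simp [hE, Matrix.mul_apply, T.pd_jac_symm hz _ q k]
  have c1 : ∀ k, (s z)⁻¹ * pd (th k) s z = ∑ l, J z l k * c' l + ∑ p, E k p p := fun k => by
    rw [pd_congr _ hc, pd_mul _ hsh (T.matDiff_jac hz).det, pd_det _ (T.matDiff_jac hz) (T.det z hz),
      (T.pd_comp hz hs' k).1, hc.self_of_nhds, Matrix.trace]
    simp only [hE, hc', Matrix.diag_apply, smul_eq_mul, ← mul_sum, mul_left_comm _ (s' (h z))⁻¹]
    have := T.det z hz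
    field_simp
    ring
  have h1 : dl s' a' (h z) = ∑ l, dg (th l) (pd (th l) a' (h z)) + ∑ l, c' l • dg (th l) (a' (h z)) := by
    simp [dl, sum_add_distrib, hc']
  have h2 : ∑ l, dg (th l) (pd (th l) a' (h z))
      = gs (cm (J z)) (∑ k, dg (th k) (pd (th k) a z + qth (E k) (a z))) := by
    have h3 : ∀ l m, ∑ k, J z l k * (J z)⁻¹ k m = if l = m then 1 else 0 := fun l m => by
      have := congrFun (congrFun (T.mul_inv hz) l) m
      rwa [one_apply] at this
    have h4 : ∀ k x, gs (cm (J z)) (dg (th k) x)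
        = ∑ m, (J z)⁻¹ k m • dg (th m) (gs (cm (J z)) x) := fun k x => by
      have h5 : ∀ b, ∑ m, (J z)⁻¹ k m * J z m b = if k = b then 1 else 0 := fun b => by
        have := congrFun (congrFun (T.inv_mul hz) k) b
        rwa [one_apply] at this
      simp only [dg_th_cm, smul_sum, smul_smul]
      rw [sum_comm]
      simp [← sum_smul, h5]
    rw [map_sum]
    simp only [h4, ← T.pd_th_trans hz ha ha' he, hE, map_sum, map_smul, smul_sum, smul_smul]
    rw [sum_rotate, sum_comm]
    simp [← sum_smul, mul_comm ((J z)⁻¹ _ _), h3]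
  have h6 : ∑ k, dg (th k) (qth (E k) (a z)) = ∑ q, (∑ p, E q p p) • dg (th q) (a z) := by
    have h7 : ∀ k, dg (th k) (qth (E k) (a z)) = ∑ q, E k k q • dg (th q) (a z)
        - ∑ p, ∑ q, E k p q • mg (th p) (dg (th k) (dg (th q) (a z))) := fun k => by
      simp only [qth_apply, map_sum, map_smul, dg_mg, th_inj, smul_sub, sum_sub_distrib, smul_ite,
        smul_zero]
      congr 1
      rw [sum_eq_single k (fun b _ h => by simp [Ne.symm h]) (by simp)]
      simp
    have h8 : ∑ k, ∑ p, ∑ q, E k p q • mg (th p) (dg (th k) (dg (th q) (a z))) = 0 := by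
      rw [sum_comm]
      refine sum_eq_zero fun p _ => sum_antisymm fun i j => ?_
      rw [dg_dg, map_neg, smul_neg, c0]
    simp only [h7, sum_sub_distrib, h8, sub_zero, sum_smul]
    rw [sum_comm]
    simp [c0 _ _ _]
  have h9 : ∑ l, c' l • dg (th l) (a' (h z))
      = gs (cm (J z)) (∑ k, (∑ l, J z l k * c' l) • dg (th k) (a z)) := by
    have : a' (h z) = gs (cm (J z)) (a z) := he.self_of_nhds
    simp only [this, dg_th_cm, map_sum, map_smul, smul_sum, smul_smul, sum_smul]
    rw [sum_comm]
    simp [mul_comm]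
  rw [h1, h2, h9, ← map_add]
  congr 1
  simp only [map_add, sum_add_distrib, h6, dl, map_smul, c1, add_smul]
  abel

end Trans

/-! ### The Hermitian inner product -/

/-- The Gram matrix of the generators. -/
def gram (g : Mat3) : Mat6 := blk g.transpose 0 0 (g⁻¹)ᵀ

/-- The Hermitian inner product of polyvector-valued forms. -/
def ip (g : Mat3) (x y : Gr) : ℂ := hdot (gs (gram g) x) y

open scoped MatrixOrder in
theorem exists_conjTranspose_mul_self {A : Mat3} (hA : A.PosDef) :
    ∃ B : Mat3, A = Bᴴ * B := by
  refine ⟨CFC.sqrt A, ?_⟩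
  have h : (CFC.sqrt A)ᴴ = CFC.sqrt A := (Matrix.nonneg_iff_posSemidef.1 (CFC.sqrt_nonneg A)).isHermitian
  rw [h, CFC.sqrt_mul_sqrt_self A hA.posSemidef.nonneg]

theorem ip_self {g : Mat3} (hg : g.PosDef) (x : Gr) :
    ∃ r : ℝ, 0 ≤ r ∧ ip g x x = r ∧ (r = 0 → x = 0) := by
  obtain ⟨A, hA⟩ := exists_conjTranspose_mul_self hg.transpose
  obtain ⟨D, hD⟩ := exists_conjTranspose_mul_self hg.inv.transpose
  have h1 : gram g = (blk A 0 0 D)ᴴ * blk A 0 0 D := by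
    rw [gram, hA, hD, blk_conjTranspose, blk_mul]
    simp
  have h2 : ip g x x = hdot (gs (blk A 0 0 D) x) (gs (blk A 0 0 D) x) := by
    rw [ip, h1, gs_mul, hdot_gs, Matrix.conjTranspose_conjTranspose]
  refine ⟨_, Finset.sum_nonneg fun K _ => by positivity, h2.trans (hdot_self _), fun h => ?_⟩
  have h3 := hdot_self_eq_zero ((hdot_self _).trans (congrArg _ h))
  have h4 : gs (gram g) x = 0 := by rw [h1, gs_mul, h3, map_zero]
  have h5 : (gram g)⁻¹ * gram g = 1 := by
    refine nonsing_inv_mul _ (isUnit_iff_ne_zero.2 ?_)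
    rw [gram, blk_det, det_fromBlocks_zero₂₁, det_transpose, det_transpose]
    exact mul_ne_zero hg.det_pos.ne' hg.inv.det_pos.ne'
  rw [← gs_one x, ← h5, gs_mul, h4, map_zero]

theorem ip_cm {J g g' : Mat3} (hg : g = Jᵀ * g' * J.map conj) (x y : Gr) :
    ip g' (gs (cm J) x) (gs (cm J) y) = ip g x y := by
  have h1 : (cm J)ᴴ * gram g' * cm J = gram g := by
    have h2 : ((J.map conj)⁻¹)ᵀ = (J⁻¹)ᴴ := by
      have : (J.map conj) = J.conjTranspose.transpose := rfl
      rw [this, ← transpose_nonsing_inv, transpose_transpose, Matrix.conjTranspose_nonsing_inv]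
    have h3 : (J.map conj)ᵀ = Jᴴ := rfl
    rw [cm, gram, gram, blk_conjTranspose, blk_mul, blk_mul, hg]
    simp [Matrix.conjTranspose_zero, Matrix.conjTranspose_conjTranspose, transpose_mul,
      Matrix.mul_inv_rev, h2, h3, ← transpose_nonsing_inv J, mul_assoc]
  rw [ip, ip, ← h1, gs_mul, gs_mul, hdot_gs (cm J)ᴴ, Matrix.conjTranspose_conjTranspose]

theorem dg_gs_diag_th (A D : Mat3) (q : Fin 3) (x : Gr) :
    dg (th q) (gs (blk A 0 0 D) x) = ∑ b, A q b • gs (blk A 0 0 D) (dg (th b) x) := by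
  simp [dg_gs, sum_six]

theorem qet_gs_diag {A D X Q : Mat3} (h : X * D = D * Q) (x : Gr) :
    qet X (gs (blk A 0 0 D) x) = gs (blk A 0 0 D) (qet Q x) := by
  rw [qet_apply, qet_apply]
  exact gs_quad (fun q => by simp [dg_gs, sum_six]) (fun k y => by simp [gs_mg, sum_six]) h

theorem hdot_qet (X : Mat3) (x y : Gr) :
    hdot (qet X x) y = hdot x (qet Xᴴ y) := by
  simp only [qet_apply, hdot_sum_left, hdot_sum_right, hdot_smul_left, hdot_smul_right, hdot_mg,
    hdot_dg, conjTranspose_apply, RCLike.star_def, Complex.conj_conj]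
  exact sum_comm

theorem differentiableAt_hdot {x y : E3 → Gr} {z : E3} (hx : RDiffAt x z)
    (hy : RDiffAt y z) : RDiffAt (fun w => hdot (x w) (y w)) z :=
  DifferentiableAt.fun_sum fun K _ => (differentiableAt_coeff hx K).fun_mul
    (differentiableAt_conj (differentiableAt_coeff hy K))

theorem pd_hdot (k : Fin 6) {x y : E3 → Gr} {z : E3} (hx : RDiffAt x z)
    (hy : RDiffAt y z) :
    pd k (fun w => hdot (x w) (y w)) z = hdot (pd k x z) (y z) + hdot (x z) (pd (cconj k) y z) := by
  have h := fun K => differentiableAt_conj (differentiableAt_coeff hy K)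
  unfold hdot
  rw [pd_sum k fun K _ => (differentiableAt_coeff hx K).fun_mul (h K), ← sum_add_distrib]
  refine sum_ext fun K => ?_
  rw [pd_mul k (differentiableAt_coeff hx K) (h K), pd_apply k hx, pd_conj, pd_apply _ hy, add_comm]

namespace Kahler

variable {s : E3 → ℂ} {g : E3 → Mat3} {U : Set E3} {a b : E3 → Gr} (K : Kahler s g U)

include K

theorem opS_eq_sl {z : E3} (hz : z ∈ U) (ha : RDiffAt a z) :
    sl g a z = ∑ k, ∑ l, (g z)⁻¹ k l • mg (th l) (-pd (et k) a z
      + qet ((pdm (et k) g z)ᵀ * ((g z)⁻¹)ᵀ) (a z)) := by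
  rw [← K.opS_base_eq_sum hz ha, K.opS_base hz ha, sl]

theorem ip_dl_sub (hH : ∀ y ∈ U, (g y).IsHermitian) (ha : SmoothOn a U)
    (hb : SmoothOn b U) {z : E3} (hz : z ∈ U) :
    (‖s z‖ : ℂ) ^ 2 * (ip (g z) (dl s a z) (b z) - ip (g z) (a z) (sl g b z))
      = ∑ i, pd (th i) (fun y => conj (s y) *
        hdot (gs (gram (g y)) (dg (th i) (s y • a y))) (b y)) z := by
  have hsd := (K.differentiableAt_s hz).restrictScalars ℝ
  have hb' := K.differentiableAt hb hz
  have hsa := K.smooth_smul ha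
  have hgd := K.matDiff_g hz
  have hgi := K.isUnit_g hz
  have hG : MatDiff (fun y => gram (g y)) z :=
    hgd.transpose.blk (mdiff_const 0) (mdiff_const 0) (K.matDiff_gInv hz).transpose
  have e1 : g z * (g z)⁻¹ = 1 := mul_nonsing_inv _ hgi
  have e2 : (g z)⁻¹ * g z = 1 := nonsing_inv_mul _ hgi
  have e1' : ((g z)⁻¹)ᵀ * (g z)ᵀ = 1 := by
    rw [← transpose_mul, e1, transpose_one]
  have e2' : (g z)ᵀ * ((g z)⁻¹)ᵀ = 1 := by
    rw [← transpose_mul, e2, transpose_one]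
  have hGd : (gram (g z)).det ≠ 0 := by
    rw [gram, blk_det, det_fromBlocks_zero₂₁, det_transpose, det_transpose, ← Matrix.det_mul, e1,
      Matrix.det_one]
    exact one_ne_zero
  have hGi : (gram (g z))⁻¹ = blk ((g z)⁻¹)ᵀ 0 0 (g z)ᵀ := by
    refine inv_eq_left_inv ?_
    rw [gram, blk_mul]
    simp [e1', e2', blk_one]
  set D := ((g z)⁻¹)ᵀ with hD
  set E := fun i : Fin 3 => pdm (th i) g z with hE
  have hEH : ∀ k, (E k)ᴴ = pdm (et k) g z := fun k => by
    ext p q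
    have h1 : (fun y => g y p q) =ᶠ[𝓝 z] fun y => conj (g y q p) := by
      filter_upwards [K.mem_nhds hz] with y hy using ((hH y hy).apply p q).symm
    rw [pdm_apply, pd_congr _ h1, pd_conj, cconj_et]
    rfl
  have hDH : Dᴴ = D := by
    rw [hD]
    exact (hH z hz).inv.transpose.eq
  -- the derivative of the Gram matrix
  have hder : ∀ i x, der ((gram (g z))⁻¹ * pdm (th i) (fun y => gram (g y)) z) x
      = qth (D * (E i)ᵀ) x - qet ((E i)ᵀ * D) x := by
    intro i x
    have h1 : pdm (th i) (fun y => ((g y)⁻¹)ᵀ) z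
        = -(D * ((E i)ᵀ * D)) := by
      rw [pdm_transpose, pdm_inv _ hgd (K.hg0 z hz), transpose_neg, transpose_mul, transpose_mul]
    unfold gram
    rw [pdm_blk, ← gram, hGi, blk_mul, h1, pdm_const, pdm_transpose, mul_neg, mul_neg, ← mul_assoc
      (g z)ᵀ, e2', one_mul]
    simp only [zero_mul, mul_zero, add_zero, zero_add, neg_zero]
    rw [der_blk_diag, sub_eq_add_neg, ← LinearMap.neg_apply, ← qet_neg, qth_apply, qet_apply]
  have hq : ∀ x, ∑ i, qth (D * (E i)ᵀ) (dg (th i) x) = 0 := by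
    intro x
    simp only [qth_apply]
    rw [sum_comm]
    refine sum_eq_zero fun p _ => sum_antisymm fun i j => ?_
    rw [dg_dg, map_neg, smul_neg]
    congr 2
    simp [hE, Matrix.mul_apply, K.closed z hz j _ i]
  have hx := fun i => differentiableAt_lin (dg (th i)) (K.differentiableAt hsa hz)
  have hpd : ∀ i, pd (th i) (fun y => conj (s y) *
        hdot (gs (gram (g y)) (dg (th i) (s y • a y))) (b y)) z
      = conj (s z) * (ip (g z) (dg (th i) (pd (th i) (fun y => s y • a y) z)) (b z)
        + s z * ip (g z) (qth (D * (E i)ᵀ) (dg (th i) (a z))) (b z)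
        + s z * (ip (g z) (dg (th i) (a z)) (pd (et i) b z)
          - ip (g z) (qet ((E i)ᵀ * D) (dg (th i) (a z))) (b z))) := by
    intro i
    rw [pd_mul _ (differentiableAt_conj hsd) (differentiableAt_hdot (hG.gs (hx i)) hb'), pd_conj,
      cconj_th, pd_et_of_holomorphic (K.differentiableAt_s hz), map_zero, zero_mul, add_zero,
      pd_hdot _ (hG.gs (hx i)) hb', pd_gs _ hG hGd (hx i), hder, cconj_th, pd_lin _ (dg (th i))
      (K.differentiableAt hsa hz)]
    simp only [ip, map_add, map_smul, hdot_add_left, hdot_smul_left, sub_eq_add_neg, hdot_neg_left,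
      map_neg]
    ring
  have hadj : ∀ i, ip (g z) (qet ((E i)ᵀ * D) (dg (th i) (a z))) (b z)
      = ip (g z) (dg (th i) (a z)) (qet ((pdm (et i) g z)ᵀ * D) (b z)) := by
    intro i
    rw [ip, gram, ← qet_gs_diag (X := D * (E i)ᵀ) (mul_assoc _ _ _), hdot_qet, conjTranspose_mul,
      hDH, ← hEH]
    rfl
  have hS : ip (g z) (a z) (sl g b z) = ∑ k, ip (g z) (dg (th k) (a z)) (-pd (et k) b z
      + qet ((pdm (et k) g z)ᵀ * D) (b z)) := by
    rw [K.opS_eq_sl hz hb', ip]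
    simp only [hdot_sum_right, hdot_smul_right]
    refine sum_ext fun k => ?_
    have h2 : ∀ l, conj ((g z)⁻¹ k l) = (g z)⁻¹ l k := fun l =>
      (hH z hz).inv.apply l k
    have h3 : ∀ b, ∑ l, (g z)⁻¹ l k * g z b l = if b = k then 1 else 0 := fun b => by
      have := congrFun (congrFun e1 b) k
      rw [one_apply] at this
      rw [← this, Matrix.mul_apply]
      simp [mul_comm]
    simp only [h2, ← hdot_dg, gram, dg_gs_diag_th, hdot_sum_left, hdot_smul_left, mul_sum,
      transpose_apply, ← mul_assoc]
    rw [sum_comm]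
    simp only [← sum_mul, h3, ite_mul, one_mul, zero_mul, sum_ite_eq', mem_univ, if_true]
    rfl
  have hdl : s z * ip (g z) (dl s a z) (b z)
      = ∑ i, ip (g z) (dg (th i) (pd (th i) (fun y => s y • a y) z)) (b z) := by
    rw [ip, ← hdot_smul_left, ← map_smul, K.smul_dl hz (K.differentiableAt ha hz), dv, map_sum,
      hdot_sum_left]
    rfl
  have hq' : ∑ i, ip (g z) (qth (D * (E i)ᵀ) (dg (th i) (a z))) (b z) = 0 := by
    simp only [ip]
    rw [← hdot_sum_left, ← map_sum, hq, map_zero, hdot]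
    simp
  have hS' : ip (g z) (a z) (sl g b z)
      = ∑ k, (ip (g z) (dg (th k) (a z)) (qet ((pdm (et k) g z)ᵀ * D) (b z))
        - ip (g z) (dg (th k) (a z)) (pd (et k) b z)) := by
    rw [hS]
    simp [ip, hdot_add_right, hdot_neg_right, sub_eq_neg_add]
  simp only [hpd, hadj]
  rw [← mul_sum, sum_add_distrib, sum_add_distrib, ← mul_sum, hq', ← hdl, ← mul_sum, hS', ←
    Complex.mul_conj', sum_sub_distrib, sum_sub_distrib]
  ring

end Kahler

/-! ### The volume measure -/

open MeasureTheory

section charts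

variable {X : Type*} [TopologicalSpace X] [ChartedSpace E3 X]
  [IsManifold 𝓘(ℂ, E3) ω X]

theorem trans_contDiffOn {c c' : PHomeo X E3} (hc : c ∈ atlas E3 X)
    (hc' : c' ∈ atlas E3 X) :
    ContDiffOn ℂ ω (fun y => c' (c.symm y)) (c.symm.trans c').source := by
  have h := (contDiffGroupoid ω 𝓘(ℂ, E3)).compatible hc hc'
  rw [contDiffGroupoid, mem_groupoid_of_pregroupoid] at h
  simpa [contDiffPregroupoid, Function.comp_def] using h.1

theorem trans_of_mem_atlas {c c' : PHomeo X E3} (hc : c ∈ atlas E3 X)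
    (hc' : c' ∈ atlas E3 X) :
    Trans (fun y => c' (c.symm y)) (fun z => jac c c' (c.symm z)) (c.symm.trans c').source where
  isOpen := (c.symm.trans c').open_source
  hol := (trans_contDiffOn hc hc').differentiableOn (by simp)
  jac z hz i k := by
    rw [jac, Matrix.of_apply, c.right_inv hz.1]
  det z hz := by
    have h1 : z ∈ c.target := hz.1
    have h2 : c.symm z ∈ c'.source := hz.2
    set w := c' (c.symm z)
    have hw : w ∈ (c'.symm.trans c).source :=
      ⟨c'.map_source h2, by
        change c'.symm w ∈ c.source
        rw [c'.left_inv h2]; exact c.map_target h1⟩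
    have d1 := ((trans_contDiffOn hc hc').differentiableOn (by simp)).differentiableAt
      ((c.symm.trans c').open_source.mem_nhds hz)
    have d2 := ((trans_contDiffOn hc' hc).differentiableOn (by simp)).differentiableAt
      ((c'.symm.trans c).open_source.mem_nhds hw)
    have h3 : (fun y => c (c'.symm (c' (c.symm y)))) =ᶠ[𝓝 z] id := by
      filter_upwards [(c.symm.trans c').open_source.mem_nhds hz] with y hy
      have hy2 : c.symm y ∈ c'.source := hy.2
      rw [c'.left_inv hy2, c.right_inv hy.1, id]
    have h4 : (fderiv ℂ (fun y => c (c'.symm y)) w).comp (fderiv ℂ (fun y => c' (c.symm y)) z)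
        = ContinuousLinearMap.id ℂ E3 := by
      rw [← fderiv_id (𝕜 := ℂ) (x := z), ← h3.fderiv_eq]
      exact (d2.hasFDerivAt.comp z d1.hasFDerivAt).fderiv.symm
    have h5 : jac c c' (c.symm z)
        = LinearMap.toMatrix' (fderiv ℂ (fun y => c' (c.symm y)) z).toLinearMap := by
      ext i k
      rw [jac, Matrix.of_apply, c.right_inv h1, LinearMap.toMatrix'_apply]
      rfl
    rw [h5]
    refine right_ne_zero_of_mul_eq_one (a := (LinearMap.toMatrix'
      (fderiv ℂ (fun y => c (c'.symm y)) w).toLinearMap).det) ?_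
    rw [← Matrix.det_mul, ← LinearMap.toMatrix'_comp, ← ContinuousLinearMap.toLinearMap_comp, h4]
    simp

end charts

namespace CalabiYau

variable {X : Type*} [TopologicalSpace X] [ChartedSpace E3 X] [MeasurableSpace X] [BorelSpace X]
  (Y : CalabiYau X)

/-- The contribution of a chart to the volume measure. -/
def locVol (c : PHomeo X E3) : Measure X :=
  Measure.map c.symm ((volume.restrict c.target).withDensity
      (fun z => ENNReal.ofReal (8 * ‖Y.s c z‖ ^ 2)))

variable {c c' : PHomeo X E3}

theorem measurableSet_inter_preimage (c : PHomeo X E3) {A : Set X}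
    (hA : MeasurableSet A) : MeasurableSet (c.target ∩ c.symm ⁻¹' A) := by
  have h : c.target ∩ c.symm ⁻¹' A
      = Subtype.val '' ((c.target.domRestrict c.symm) ⁻¹' A) := by
    ext z
    exact ⟨fun hz => ⟨⟨z, hz.1⟩, hz.2, rfl⟩, by rintro ⟨w, hw, rfl⟩; exact ⟨w.2, hw⟩⟩
  rw [h]
  exact c.open_target.measurableSet.subtype_image
    (c.continuousOn_symm.domRestrict.measurable hA)

theorem aemeasurable_symm (c : PHomeo X E3) (f : E3 → ENNReal) :
    AEMeasurable c.symm ((volume.restrict c.target).withDensity f) := by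
  refine AEMeasurable.mono_ac ?_ (withDensity_absolutelyContinuous _ _)
  refine aemeasurable_restrict_of_measurable_subtype c.open_target.measurableSet ?_
  exact c.continuousOn_symm.domRestrict.measurable

theorem locVol_apply (c : PHomeo X E3) {A : Set X} (hA : MeasurableSet A) :
    Y.locVol c A = ∫⁻ z in c.target ∩ c.symm ⁻¹' A, ENNReal.ofReal (8 * ‖Y.s c z‖ ^ 2) := by
  rw [locVol, Measure.map_apply_of_aemeasurable (aemeasurable_symm c _) hA, withDensity_apply',
    Measure.restrict_restrict' c.open_target.measurableSet, Set.inter_comm]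

theorem abs_det_fderiv {h : E3 → E3} {z : E3} (J : Mat3)
    (hJ : ∀ i k, fderiv ℂ h z (single k 1) i = J i k) :
    |((fderiv ℂ h z).restrictScalars ℝ).det| = ‖J.det‖ ^ 2 := by
  have h5 : J = LinearMap.toMatrix' (fderiv ℂ h z).toLinearMap := by
    ext i k
    rw [LinearMap.toMatrix'_apply, ← hJ]
    rfl
  have h6 : ((fderiv ℂ h z).restrictScalars ℝ).det
      = LinearMap.det ((fderiv ℂ h z).toLinearMap.restrictScalars ℝ) := rfl
  rw [h6, LinearMap.det_restrictScalars, Algebra.norm_complex_eq, h5, LinearMap.det_toMatrix']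
  simp [Complex.normSq_eq_norm_sq]

variable [IsManifold 𝓘(ℂ, E3) ω X]

theorem locVol_le (hc : c ∈ atlas E3 X) (hc' : c' ∈ atlas E3 X) {A : Set X} (hA : MeasurableSet A)
    (hAc : A ⊆ c.source) : Y.locVol c' A ≤ Y.locVol c A := by
  have T := trans_of_mem_atlas hc hc'
  set h : E3 → E3 := fun y => c' (c.symm y) with hh
  set B := c.target ∩ c.symm ⁻¹' (A ∩ c'.source) with hB
  have hBm : MeasurableSet B := measurableSet_inter_preimage c (hA.inter c'.open_source.measurableSet)
  have hBs : B ⊆ (c.symm.trans c').source := fun z hz => ⟨hz.1, hz.2.2⟩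
  have h1 : c'.target ∩ c'.symm ⁻¹' A = h '' B := by
    ext w
    constructor
    · rintro ⟨hw, hwA : c'.symm w ∈ A⟩
      refine ⟨c (c'.symm w), ⟨c.map_source (hAc hwA), ?_⟩, ?_⟩
      · change c.symm (c (c'.symm w)) ∈ A ∩ c'.source
        rw [c.left_inv (hAc hwA)]
        exact ⟨hwA, c'.map_target hw⟩
      · change c' (c.symm (c (c'.symm w))) = w
        rw [c.left_inv (hAc hwA), c'.right_inv hw]
    · rintro ⟨z, hz, rfl⟩
      refine ⟨c'.map_source hz.2.2, ?_⟩
      change c'.symm (c' (c.symm z)) ∈ A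
      rw [c'.left_inv hz.2.2]
      exact hz.2.1
  have hinj : Set.InjOn h B := fun z hz w hw hzw =>
    c.symm.injOn hz.1 hw.1 (c'.injOn hz.2.2 hw.2.2 hzw)
  have hder : ∀ z ∈ B, HasFDerivWithinAt h ((fderiv ℂ h z).restrictScalars ℝ) B z := fun z hz =>
    ((T.holAt (hBs hz)).hasFDerivAt.restrictScalars ℝ).hasFDerivWithinAt
  rw [Y.locVol_apply c' hA, h1, lintegral_image_eq_lintegral_abs_det_fderiv_mul volume hBm hder hinj,
    Y.locVol_apply c hA]
  refine (setLIntegral_congr_fun hBm fun z hz => ?_).trans_le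
    (lintegral_mono_set fun z hz => ⟨hz.1, hz.2.1⟩)
  have h2 := Y.s_compat c hc c' hc' (c.symm z) ⟨c.map_target hz.1, hz.2.2⟩
  rw [c.right_inv hz.1] at h2
  rw [abs_det_fderiv _ (T.jac z (hBs hz)), h2, ← ENNReal.ofReal_mul (by positivity), norm_mul]
  congr 1
  ring

theorem vol_restrict (hc : c ∈ atlas E3 X) : Y.vol.restrict c.source = Y.locVol c := by
  have h1 : Y.locVol c ≤ Y.vol := le_iSup₂ (f := fun c (_ : c ∈ atlas E3 X) => Y.locVol c) c hc
  have hm := c.open_source.measurableSet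
  have h0 : ∀ A, MeasurableSet A → Y.locVol c (A ∩ c.source) = Y.locVol c A := fun A hA => by
    rw [Y.locVol_apply c (hA.inter hm), Y.locVol_apply c hA]
    congr 2
    ext z
    constructor
    · exact fun hz => ⟨hz.1, hz.2.1⟩
    · exact fun hz => ⟨hz.1, hz.2, c.map_target hz.1⟩
  have h2 : Y.vol ≤ Y.locVol c + Y.vol.restrict c.sourceᶜ := by
    refine iSup₂_le fun c' hc' => Measure.le_iff.2 fun A hA => ?_
    have h3 : Y.locVol c' ≤ Y.vol := le_iSup₂ (f := fun c (_ : c ∈ atlas E3 X) => Y.locVol c) c' hc'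
    change Y.locVol c' A ≤ _
    rw [← measure_inter_add_sdiff A hm, Measure.add_apply, Measure.restrict_apply hA]
    refine add_le_add ?_ (h3 _)
    exact (Y.locVol_le hc hc' (hA.inter hm) Set.inter_subset_right).trans
      (measure_mono Set.inter_subset_left)
  refine Measure.ext fun A hA => ?_
  rw [Measure.restrict_apply hA]
  refine le_antisymm ?_ ?_
  · refine (h2 _).trans ?_
    rw [Measure.add_apply, Measure.restrict_apply (hA.inter hm)]
    have : A ∩ c.source ∩ c.sourceᶜ = ∅ := by
      rw [Set.inter_assoc, Set.inter_compl_self, Set.inter_empty]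
    rw [this, measure_empty, add_zero, h0 A hA]
  · rw [← h0 A hA]
    exact h1 _

theorem continuousOn_density (hc : c ∈ atlas E3 X) :
    ContinuousOn (fun z => 8 * ‖Y.s c z‖ ^ 2) c.target :=
  continuousOn_const.mul ((Y.s_holomorphic c hc).continuousOn.norm.pow 2)

/-- Integration of a function which vanishes outside a chart. -/
theorem integral_vol (hc : c ∈ atlas E3 X) {f : X → ℂ} (hf : ContinuousOn f c.source)
    (h0 : ∀ x ∉ c.source, f x = 0) :
    ∫ x, f x ∂Y.vol = ∫ z in c.target, (8 * ‖Y.s c z‖ ^ 2 : ℝ) • f (c.symm z) := by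
  rw [← setIntegral_eq_integral_of_forall_compl_eq_zero h0, Y.vol_restrict hc, locVol,
    integral_map (aemeasurable_symm c _) (by
      rw [← locVol, ← Y.vol_restrict hc]
      exact hf.aestronglyMeasurable c.open_source.measurableSet),
    integral_withDensity_eq_integral_toReal_smul₀ (((Y.continuousOn_density hc).aemeasurable
      c.open_target.measurableSet).ennreal_ofReal)
      (.of_forall fun _ => ENNReal.ofReal_lt_top)]
  refine setIntegral_congr_fun c.open_target.measurableSet fun z _ => ?_
  rw [ENNReal.toReal_ofReal (by positivity)]

instance isOpenPosMeasure_vol : Y.vol.IsOpenPosMeasure where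
  open_pos W hW := by
    rintro ⟨x, hx⟩ h0
    set c := chartAt E3 x
    have hc : c ∈ atlas E3 X := chart_mem_atlas E3 x
    have h1 : Y.locVol c W = 0 := by
      rw [← Y.vol_restrict hc]
      exact le_antisymm ((Measure.restrict_apply_le _ _).trans h0.le) bot_le
    rw [Y.locVol_apply c hW.measurableSet] at h1
    have hO : IsOpen (c.target ∩ c.symm ⁻¹' W) := c.isOpen_inter_preimage_symm hW
    have h2 : 0 < volume (c.target ∩ c.symm ⁻¹' W) := hO.measure_pos _
      ⟨c x, c.map_source (mem_chart_source E3 x), by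
        change c.symm (c x) ∈ W
        rwa [c.left_inv (mem_chart_source E3 x)]⟩
    refine h2.ne' ?_
    rw [setLIntegral_eq_zero_iff' hO.measurableSet (((Y.continuousOn_density hc).mono
      Set.inter_subset_left).aemeasurable hO.measurableSet).ennreal_ofReal] at h1
    refine measure_mono_null (fun z hz => ?_) h1
    have := norm_pos_iff.2 (Y.s_ne_zero c hc z hz.1)
    simp only [Set.mem_compl_iff, Set.mem_ofPred_eq, Classical.not_imp]
    exact ⟨hz, (ENNReal.ofReal_pos.2 (by positivity)).ne'⟩

theorem isFiniteMeasure_vol [CompactSpace X] [T2Space X] : IsFiniteMeasure Y.vol := by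
  refine ⟨isCompact_univ.measure_lt_top_of_nhdsWithin fun x _ => ?_⟩
  set c := chartAt E3 x
  have hc : c ∈ atlas E3 X := chart_mem_atlas E3 x
  have hx : x ∈ c.source := mem_chart_source E3 x
  obtain ⟨r, hr, hrc⟩ := Metric.nhds_basis_closedBall.mem_iff.1
    (c.open_target.mem_nhds (c.map_source hx))
  have hW : IsOpen (c.source ∩ c ⁻¹' Metric.ball (c x) r) := c.isOpen_inter_preimage Metric.isOpen_ball
  refine ⟨_, mem_nhdsWithin_of_mem_nhds (hW.mem_nhds ⟨hx, Metric.mem_ball_self hr⟩), ?_⟩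
  have h1 : Y.vol (c.source ∩ c ⁻¹' Metric.ball (c x) r)
      = Y.locVol c (c.source ∩ c ⁻¹' Metric.ball (c x) r) := by
    rw [← Y.vol_restrict hc, Measure.restrict_apply hW.measurableSet]
    congr 1
    ext y; simp; tauto
  rw [h1, Y.locVol_apply c hW.measurableSet]
  have h2 : c.target ∩ c.symm ⁻¹' (c.source ∩ c ⁻¹' Metric.ball (c x) r)
      ⊆ Metric.closedBall (c x) r := fun z hz => by
    have := hz.2.2
    rw [Set.mem_preimage, c.right_inv hz.1] at this
    exact Metric.ball_subset_closedBall this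
  refine (lintegral_mono_set h2).trans_lt ?_
  obtain ⟨C, hC⟩ := ((isCompact_closedBall (c x) r).bddAbove_image
    ((Y.continuousOn_density hc).mono hrc))
  refine (setLIntegral_mono (g := fun _ => ENNReal.ofReal C) measurable_const fun z hz =>
    ENNReal.ofReal_le_ofReal (hC ⟨z, hz, rfl⟩)).trans_lt ?_
  rw [setLIntegral_const]
  exact ENNReal.mul_lt_top ENNReal.ofReal_lt_top (isCompact_closedBall _ _).measure_lt_top

end CalabiYau

/-! ### Sections over the whole manifold -/

section sections

variable {X : Type*} [TopologicalSpace X] [ChartedSpace E3 X]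
  {c c' : PHomeo X E3} {α β : LField X}

theorem IsSection.diff (hα : IsSection α) (hc : c ∈ atlas E3 X) {z : E3} (hz : z ∈ c.target) :
    RDiffAt (α c) z :=
  ((hα.1 c hc).contDiffAt (c.open_target.mem_nhds hz)).differentiableAt (by simp)

theorem IsSection.compat (hα : IsSection α) (hc : c ∈ atlas E3 X) (hc' : c' ∈ atlas E3 X)
    {x : X} (hx : x ∈ c.source) (hx' : x ∈ c'.source) :
    α c' (c' x) = gs (cm (jac c c' x)) (α c (c x)) := hα.2 c hc c' hc' x ⟨hx, hx'⟩

theorem mem_trans_source {x : X} (hx : x ∈ c.source) (hx' : x ∈ c'.source) :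
    c x ∈ (c.symm.trans c').source :=
  ⟨c.map_source hx, by
    change c.symm (c x) ∈ c'.source
    rwa [c.left_inv hx]⟩

theorem IsSection.eventuallyEq (hα : IsSection α) (hc : c ∈ atlas E3 X) (hc' : c' ∈ atlas E3 X)
    {z : E3} (hz : z ∈ (c.symm.trans c').source) :
    (fun y => α c' (c' (c.symm y))) =ᶠ[𝓝 z] fun y => gs (cm (jac c c' (c.symm y))) (α c y) := by
  filter_upwards [(c.symm.trans c').open_source.mem_nhds hz] with y hy
  rw [hα.compat hc hc' (c.map_target hy.1) hy.2, c.right_inv hy.1]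

theorem IsSection.congr (hα : IsSection α) (h : FieldEq α β) : IsSection β := by
  refine ⟨fun c hc => (hα.1 c hc).congr fun z hz => (h c hc z hz).symm, fun c hc c' hc' x hx => ?_⟩
  rw [← h c hc _ (c.map_source hx.1), ← h c' hc' _ (c'.map_source hx.2)]
  exact hα.2 c hc c' hc' x hx

theorem FieldEq.symm (h : FieldEq α β) : FieldEq β α := fun c hc z hz => (h c hc z hz).symm

theorem IsSection.add (hα : IsSection α) (hβ : IsSection β) : IsSection (α + β) :=
  ⟨fun c hc => (hα.1 c hc).add (hβ.1 c hc), fun c hc c' hc' x hx => by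
    change α c' (c' x) + β c' (c' x) = gs (cm _) (α c (c x) + β c (c x))
    rw [map_add, hα.compat hc hc' hx.1 hx.2, hβ.compat hc hc' hx.1 hx.2]⟩

theorem IsSection.map (hα : IsSection α) (T : PHomeo X E3 → E3 → Gr →ₗ[ℂ] Gr)
    (hT : ∀ c ∈ atlas E3 X, SmoothOn (fun z => T c z (α c z)) c.target)
    (h : ∀ c ∈ atlas E3 X, ∀ c' ∈ atlas E3 X, ∀ x ∈ c.source, x ∈ c'.source → ∀ a : Gr,
      T c' (c' x) (gs (cm (jac c c' x)) a) = gs (cm (jac c c' x)) (T c (c x) a)) :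
    IsSection (fun c z => T c z (α c z)) :=
  ⟨hT, fun c hc c' hc' x hx => by
    change T c' (c' x) (α c' (c' x)) = gs (cm _) (T c (c x) (α c (c x)))
    rw [hα.compat hc hc' hx.1 hx.2, h c hc c' hc' x hx.1 hx.2]⟩

theorem IsSection.smul (hα : IsSection α) (r : ℂ) : IsSection (r • α) :=
  hα.map (fun _ _ => r • LinearMap.id) (fun c hc => (hα.1 c hc).const_smul r)
    fun c _ c' _ x _ _ a => by simp

theorem IsSection.neg (hα : IsSection α) : IsSection (-α) := by
  have := hα.smul (-1)
  rwa [neg_one_smul] at this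

theorem IsSection.sub (hα : IsSection α) (hβ : IsSection β) : IsSection (α - β) := by
  rw [sub_eq_add_neg]; exact hα.add hβ.neg

theorem IsSection.par (hα : IsSection α) : IsSection (fun c z => par (α c z)) :=
  hα.map (fun _ _ => KS.par) (fun c hc => Kahler.smooth_lin KS.par (hα.1 c hc))
    fun c _ c' _ x _ _ a => par_gs _ _

theorem contDiffOn_gmul {a b : E3 → Gr} {U : Set E3} (ha : SmoothOn a U)
    (hb : SmoothOn b U) : SmoothOn (fun z => gmul (a z) (b z)) U := by
  refine contDiffOn_pi.2 fun K => ContDiffOn.sum fun I _ => ?_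
  exact (contDiffOn_const.mul (contDiffOn_pi.1 ha I)).mul (contDiffOn_pi.1 hb _)

theorem IsSection.wedge (hα : IsSection α) (hβ : IsSection β) : IsSection (wedge α β) :=
  ⟨fun c hc => contDiffOn_gmul (hα.1 c hc) (hβ.1 c hc), fun c hc c' hc' x hx => by
    change gmul (α c' (c' x)) (β c' (c' x)) = gs (cm _) (gmul (α c (c x)) (β c (c x)))
    rw [gs_gmul, hα.compat hc hc' hx.1 hx.2, hβ.compat hc hc' hx.1 hx.2]⟩

theorem IsSection.fsmul (hα : IsSection α) {χ : X → ℂ}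
    (hχ : ∀ c ∈ atlas E3 X, SmoothOn (fun z => χ (c.symm z)) c.target) :
    IsSection (fun c z => χ (c.symm z) • α c z) :=
  hα.map (fun c z => χ (c.symm z) • LinearMap.id)
    (fun c hc => (hχ c hc).smul (hα.1 c hc)) fun c _ c' _ x hx hx' a => by
      simp [c.left_inv hx, c'.left_inv hx']

end sections

namespace CalabiYau

variable {X : Type*} [TopologicalSpace X] [ChartedSpace E3 X] (Y : CalabiYau X)
  {c c' : PHomeo X E3} {α β : LField X}

theorem g_hermitian (hc : c ∈ atlas E3 X) {z : E3} (hz : z ∈ c.target) :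
    (Y.g c z).IsHermitian := (Y.g_posDef c hc z hz).1

theorem kahler (hc : c ∈ atlas E3 X) : Kahler (Y.s c) (Y.g c) c.target where
  isOpen := c.open_target
  hs := Y.s_holomorphic c hc
  hs0 := Y.s_ne_zero c hc
  hg i j := Y.g_smooth c hc i j
  hg0 z hz := (Y.g_posDef c hc z hz).det_pos.ne'
  closed z hz i j k := Y.g_closed c hc z hz i j k
  closedBar z hz i j k := by
    have h : ∀ i j k, pd (et k) (fun y => Y.g c y i j) z
        = conj (pd (th k) (fun y => Y.g c y j i) z) := fun i j k => by
      have h1 : (fun y => Y.g c y i j) =ᶠ[𝓝 z] fun y => conj (Y.g c y j i) := by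
        filter_upwards [c.open_target.mem_nhds hz] with y hy
        exact ((Y.g_hermitian hc hy).apply i j).symm
      rw [pd_congr _ h1, pd_conj, cconj_et]
    rw [h, h, Y.g_closed c hc z hz]

/-- The operator `Δ` in every chart. -/
def Dl (α : LField X) : LField X := fun c => dl (Y.s c) (α c)

/-- The operator `∂̄` in every chart. -/
def Db (α : LField X) : LField X := fun c => db (α c)

/-- Multiplication by the Kähler form. -/
def Lo (α : LField X) : LField X := fun c z => lo (Y.g c) z (α c z)

/-- Contraction with the Kähler form. -/
def Lam (α : LField X) : LField X := fun c z => lam (Y.g c) z (α c z)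

/-- The operator `S` in every chart. -/
def Sl (α : LField X) : LField X := fun c => sl (Y.g c) (α c)

/-- The operator `R` in every chart. -/
def Rl (α : LField X) : LField X := fun c => rl (Y.s c) (Y.g c) (α c)

theorem Sl_eq (α : LField X) : Y.Sl α = Db (Y.Lam α) - Y.Lam (Db α) := rfl

theorem Rl_eq (α : LField X) : Y.Rl α = Y.Dl (Y.Lam α) - Y.Lam (Y.Dl α) := rfl

theorem delta_eq (hα : IsSection α) : FieldEq (Y.delta α) (Y.Dl α) := fun c hc _ hz =>
  (Y.kahler hc).opDelta_base hz (hα.diff hc hz)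

theorem dbar_eq (hα : IsSection α) : FieldEq (Y.dbar α) (Db α) := fun c hc _ hz =>
  (Y.kahler hc).opDbar_base hz (hα.diff hc hz)

theorem opS_eq (hα : IsSection α) : FieldEq (Y.opS α) (Y.Sl α) := fun c hc _ hz =>
  (Y.kahler hc).opS_base hz (hα.diff hc hz)

theorem opR_eq (hα : IsSection α) : FieldEq (Y.opR α) (Y.Rl α) := fun c hc _ hz =>
  (Y.kahler hc).opR_base hz (hα.diff hc hz)

theorem Dl_congr (h : FieldEq α β) : FieldEq (Y.Dl α) (Y.Dl β) := fun c hc z hz =>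
  dl_congr (by filter_upwards [c.open_target.mem_nhds hz] with y hy using h c hc y hy)

theorem Db_congr (h : FieldEq α β) : FieldEq (Db α) (Db β) := fun c hc z hz =>
  db_congr (by filter_upwards [c.open_target.mem_nhds hz] with y hy using h c hc y hy)

variable [IsManifold 𝓘(ℂ, E3) ω X]

theorem isSection_Lo (hα : IsSection α) : IsSection (Y.Lo α) :=
  hα.map (fun c z => lo (Y.g c) z) (fun c hc => (Y.kahler hc).smooth_lo (hα.1 c hc))
    fun c hc c' hc' x hx hx' a => by
      have h := (trans_of_mem_atlas hc hc').det _ (mem_trans_source hx hx')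
      rw [c.left_inv hx] at h
      exact lo_cm h (Y.g_compat c hc c' hc' x ⟨hx, hx'⟩) a

theorem isSection_Lam (hα : IsSection α) : IsSection (Y.Lam α) :=
  hα.map (fun c z => lam (Y.g c) z) (fun c hc => (Y.kahler hc).smooth_lam (hα.1 c hc))
    fun c hc c' hc' x hx hx' a => by
      have h := (trans_of_mem_atlas hc hc').det _ (mem_trans_source hx hx')
      rw [c.left_inv hx] at h
      exact lam_cm h (Y.g_compat c hc c' hc' x ⟨hx, hx'⟩) a

theorem isSection_Dl (hα : IsSection α) : IsSection (Y.Dl α) := by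
  refine ⟨fun c hc => (Y.kahler hc).smooth_dl (hα.1 c hc), fun c hc c' hc' x hx => ?_⟩
  have hz := mem_trans_source hx.1 hx.2
  have hz' : c' (c.symm (c x)) ∈ c'.target := c'.map_source hz.2
  have h := (trans_of_mem_atlas hc hc').dl_trans hz (hα.diff hc hz.1) (hα.diff hc' hz')
    (hα.eventuallyEq hc hc' hz) ((Y.kahler hc').differentiableAt_s hz') (Y.s_ne_zero c' hc' _ hz')
    (s := Y.s c) (by
      filter_upwards [(c.symm.trans c').open_source.mem_nhds hz] with y hy
      rw [← Y.s_compat c hc c' hc' _ ⟨c.map_target hy.1, hy.2⟩, c.right_inv hy.1])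
  rw [c.left_inv hx.1] at h
  exact h

omit Y in
theorem isSection_Db (Y : CalabiYau X) (hα : IsSection α) : IsSection (Db α) := by
  refine ⟨fun c hc => (Y.kahler hc).smooth_db (hα.1 c hc), fun c hc c' hc' x hx => ?_⟩
  have hz := mem_trans_source hx.1 hx.2
  have h := (trans_of_mem_atlas hc hc').db_trans hz (hα.diff hc hz.1)
    (hα.diff hc' (c'.map_source hz.2)) (hα.eventuallyEq hc hc' hz)
  rw [c.left_inv hx.1] at h
  exact h

theorem isSection_Sl (hα : IsSection α) : IsSection (Y.Sl α) := by
  rw [Sl_eq]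
  exact (isSection_Db Y (Y.isSection_Lam hα)).sub (Y.isSection_Lam (isSection_Db Y hα))

theorem isSection_Rl (hα : IsSection α) : IsSection (Y.Rl α) := by
  rw [Rl_eq]
  exact (Y.isSection_Dl (Y.isSection_Lam hα)).sub (Y.isSection_Lam (Y.isSection_Dl hα))

end CalabiYau

/-! ### Scalars -/

section scalars

variable {X : Type*} [TopologicalSpace X] [ChartedSpace E3 X] {d d' : PHomeo X E3 → E3 → ℂ}

/-- A family of local functions is the family of coordinate expressions of one function. -/
def IsScalar (d : PHomeo X E3 → E3 → ℂ) : Prop := (∀ c ∈ atlas E3 X, ContinuousOn (d c) c.target) ∧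
  ∀ c ∈ atlas E3 X, ∀ c' ∈ atlas E3 X, ∀ x ∈ c.source, x ∈ c'.source → d c (c x) = d c' (c' x)

/-- The function with the given coordinate expressions. -/
def scal (d : PHomeo X E3 → E3 → ℂ) (x : X) : ℂ := d (chartAt E3 x) (chartAt E3 x x)

theorem IsScalar.scal_eq (hd : IsScalar d) {c : PHomeo X E3} (hc : c ∈ atlas E3 X)
    {x : X} (hx : x ∈ c.source) : scal d x = d c (c x) :=
  hd.2 _ (chart_mem_atlas E3 x) c hc x (mem_chart_source E3 x) hx

theorem IsScalar.continuous (hd : IsScalar d) : Continuous (scal d) := by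
  refine continuous_iff_continuousAt.2 fun x => ?_
  have hx := mem_chart_source E3 x
  have h1 : ContinuousAt (fun y => d (chartAt E3 x) (chartAt E3 x y)) x :=
    ContinuousAt.comp (f := chartAt E3 x) (g := d (chartAt E3 x))
      (((hd.1 _ (chart_mem_atlas E3 x)).continuousAt
      ((chartAt E3 x).open_target.mem_nhds ((chartAt E3 x).map_source hx))))
      ((chartAt E3 x).continuousAt hx)
  refine h1.congr ?_
  filter_upwards [(chartAt E3 x).open_source.mem_nhds hx] with y hy
  exact (hd.scal_eq (chart_mem_atlas E3 x) hy).symm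

theorem IsScalar.integrable (hd : IsScalar d) [CompactSpace X] [T2Space X] [MeasurableSpace X] [BorelSpace X]
    [IsManifold 𝓘(ℂ, E3) ω X] (Y : CalabiYau X) :
    MeasureTheory.Integrable (scal d) Y.vol := by
  have := Y.isFiniteMeasure_vol
  exact (hd.continuous.continuousOn.integrableOn_compact isCompact_univ).integrable_of_forall_notMem_eq_zero
    fun x hx => absurd (Set.mem_univ x) hx

end scalars

open MeasureTheory

/-! ### Integration of divergences -/

theorem integral_fderiv_eq_zero {V : E3 → ℂ} (hV : ContDiff ℝ 1 V) (hc : HasCompactSupport V)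
    (v : E3) : ∫ z, fderiv ℝ V z v = 0 := by
  have h1 : Continuous fun z => fderiv ℝ V z v :=
    (hV.continuous_fderiv (by simp)).clm_apply continuous_const
  have h2 : HasCompactSupport fun z => fderiv ℝ V z v := by
    refine (hc.fderiv ℝ).mono' ?_
    intro z hz
    refine subset_tsupport _ fun h => hz ?_
    simp [h]
  have := integral_smul_fderiv_eq_neg_fderiv_smul_of_integrable (μ := volume) (𝕜 := ℝ)
    (f := fun _ : E3 => (1 : ℝ)) (g := V) (v := v)
    (by simp) (by simpa using h1.integrable_of_hasCompactSupport h2)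
    (by simpa using hV.continuous.integrable_of_hasCompactSupport hc)
    (fun _ _ => differentiableAt_const _) (fun z _ => hV.differentiable (by simp) z)
  simpa using this

theorem integral_pd_eq_zero {V : E3 → ℂ} {U K : Set E3} (hU : IsOpen U) (hK : IsCompact K)
    (hKU : K ⊆ U) (hV : SmoothOn V U) (h0 : ∀ z ∈ U, z ∉ K → V z = 0) (k : Fin 6) :
    IntegrableOn (pd k V) U ∧ ∫ z in U, pd k V z = 0 := by
  classical
  set W : E3 → ℂ := U.indicator V with hW
  have hW0 : ∀ z ∉ K, W z = 0 := fun z hz => by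
    by_cases h : z ∈ U
    · rw [hW, Set.indicator_of_mem h, h0 z h hz]
    · rw [hW, Set.indicator_of_notMem h]
  have hWs : ContDiff ℝ ∞ W := by
    refine contDiff_iff_contDiffAt.2 fun z => ?_
    by_cases h : z ∈ U
    · refine (hV.contDiffAt (hU.mem_nhds h)).congr_of_eventuallyEq ?_
      filter_upwards [hU.mem_nhds h] with y hy using Set.indicator_of_mem hy _
    · refine (contDiffAt_const (c := (0 : ℂ))).congr_of_eventuallyEq ?_
      filter_upwards [hK.isClosed.isOpen_compl.mem_nhds (fun hz => h (hKU hz))] with y hy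
      exact hW0 y hy
  have hWc : HasCompactSupport W := HasCompactSupport.intro hK fun z hz => hW0 z hz
  have h1 : ∀ v, Integrable fun z => fderiv ℝ W z v := fun v => by
    refine Continuous.integrable_of_hasCompactSupport
      ((hWs.continuous_fderiv (by simp)).clm_apply continuous_const) ?_
    refine (hWc.fderiv ℝ).mono' fun z hz => subset_tsupport _ fun h => hz ?_
    simp [h]
  have h2 := integral_fderiv_eq_zero (hWs.of_le (by simp)) hWc
  have h3 : ∀ z ∈ U, pd k V z = pd k W z := fun z hz => by
    refine pd_congr k ?_
    filter_upwards [hU.mem_nhds hz] with y hy using (Set.indicator_of_mem hy _).symm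
  have h4 : ∀ z ∉ U, pd k W z = 0 := fun z hz => by
    have : W =ᶠ[𝓝 z] fun _ => 0 := by
      filter_upwards [hK.isClosed.isOpen_compl.mem_nhds (fun h => hz (hKU h))] with y hy
      exact hW0 y hy
    rw [pd_congr k this, pd_const]
  have h5 : Integrable (pd k W) ∧ ∫ z, pd k W z = 0 := by
    have h6 : pd k W = fun z => (1 / 2 : ℂ) * (fderiv ℝ W z (single (coordIdx k) 1)
          + coordSign k * fderiv ℝ W z (single (coordIdx k) Complex.I)) := by
      funext z; simp [pd_eq]
    rw [h6]
    refine ⟨((h1 _).add ((h1 _).const_mul _)).const_mul _, ?_⟩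
    rw [integral_const_mul, integral_add (h1 _) ((h1 _).const_mul _), integral_const_mul, h2, h2]
    simp
  refine ⟨(h5.1.integrableOn).congr_fun (fun z hz => (h3 z hz).symm) hU.measurableSet, ?_⟩
  rw [setIntegral_congr_fun hU.measurableSet h3, setIntegral_eq_integral_of_forall_compl_eq_zero
    fun z hz => h4 z hz, h5.2]

variable {X : Type*} [TopologicalSpace X] [ChartedSpace E3 X]
    [IsManifold 𝓘(ℂ, E3) ω X]

theorem isManifold_real : IsManifold 𝓘(ℝ, E3) ∞ X := by
  refine isManifold_of_contDiffOn _ _ _ fun c c' hc hc' => ?_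
  have := (trans_contDiffOn hc hc').restrict_scalars ℝ
  simpa [Function.comp_def] using this.of_le le_top

namespace CalabiYau

variable [T2Space X] [CompactSpace X] [MeasurableSpace X] [BorelSpace X] (Y : CalabiYau X)

variable {D : PHomeo X E3 → (E3 → Gr) → E3 → ℂ}
  {v : PHomeo X E3 → Fin 3 → E3 → Gr →ₗ[ℂ] ℂ} {e : Fin 3 → Fin 6}

/-- The divergence theorem for a section supported in a chart. -/
theorem integral_scal_local
    (hv : ∀ c ∈ atlas E3 X, ∀ a : E3 → Gr, SmoothOn a c.target →
      ∀ i, SmoothOn (fun y => v c i y (a y)) c.target)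
    (hD : ∀ c ∈ atlas E3 X, ∀ a : E3 → Gr, SmoothOn a c.target → ∀ z ∈ c.target,
      (‖Y.s c z‖ : ℂ) ^ 2 * D c a z = ∑ i, pd (e i) (fun y => v c i y (a y)) z)
    {α : LField X} (hα : IsSection α) (hs : IsScalar fun c => D c (α c))
    {c : PHomeo X E3} (hc : c ∈ atlas E3 X) {K : Set X} (hK : IsCompact K)
    (hKc : K ⊆ c.source) (h0 : ∀ c' ∈ atlas E3 X, ∀ x ∈ c'.source, x ∉ K → α c' (c' x) = 0) :
    ∫ x, scal (fun c => D c (α c)) x ∂Y.vol = 0 := by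
  have hz0 : ∀ c' ∈ atlas E3 X, ∀ x ∈ c'.source, x ∉ K → D c' (α c') (c' x) = 0 := by
    intro c' hc' x hx hxK
    have hz := c'.map_source hx
    have h1 := hD c' hc' _ (hα.1 c' hc') _ hz
    have h2 : ∀ᶠ y in 𝓝 (c' x), α c' y = 0 := by
      have h3 : c'.target ∩ c'.symm ⁻¹' Kᶜ ∈ 𝓝 (c' x) :=
        (c'.isOpen_inter_preimage_symm hK.isClosed.isOpen_compl).mem_nhds
          ⟨hz, by rw [Set.mem_preimage, c'.left_inv hx]; exact hxK⟩
      filter_upwards [h3] with y hy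
      rw [← c'.right_inv hy.1]
      exact h0 c' hc' _ (c'.map_target hy.1) hy.2
    rw [sum_eq_zero fun i _ => ?_] at h1
    · have h4 := norm_pos_iff.2 (Y.s_ne_zero c' hc' _ hz)
      exact (mul_eq_zero.1 h1).resolve_left (by exact_mod_cast (pow_pos h4 2).ne')
    · rw [pd_congr (f' := fun _ => 0) _ (by filter_upwards [h2] with y hy; rw [hy, map_zero]), pd_const]
  rw [Y.integral_vol hc (hs.continuous.continuousOn) fun x hx =>
    hz0 _ (chart_mem_atlas E3 x) x (mem_chart_source E3 x) fun h => hx (hKc h)]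
  have h1 : ∀ z ∈ c.target, (8 * ‖Y.s c z‖ ^ 2 : ℝ) • scal (fun c => D c (α c)) (c.symm z)
      = 8 * ∑ i, pd (e i) (fun y => v c i y (α c y)) z := fun z hz => by
    rw [hs.scal_eq hc (c.map_target hz), c.right_inv hz, ← hD c hc _ (hα.1 c hc) z hz,
      Complex.real_smul]
    push_cast
    ring
  rw [setIntegral_congr_fun c.open_target.measurableSet h1, integral_const_mul]
  have h2 : ∀ i, _ := fun i => integral_pd_eq_zero c.open_target (hK.image_of_continuousOn
    (c.continuousOn.mono hKc)) (by rintro _ ⟨x, hx, rfl⟩; exact c.map_source (hKc hx))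
    (hv c hc _ (hα.1 c hc) i) (fun z hz hzK => by
      have := h0 c hc (c.symm z) (c.map_target hz) fun h => hzK ⟨_, h, c.right_inv hz⟩
      rw [c.right_inv hz] at this
      rw [this, map_zero]) (e i)
  rw [integral_finsetSum _ fun i _ => (h2 i).1, sum_eq_zero fun i _ => (h2 i).2, mul_zero]

/-- The divergence theorem. -/
theorem integral_scal_eq_zero
    (hv : ∀ c ∈ atlas E3 X, ∀ a : E3 → Gr, SmoothOn a c.target →
      ∀ i, SmoothOn (fun y => v c i y (a y)) c.target)
    (hD : ∀ c ∈ atlas E3 X, ∀ a : E3 → Gr, SmoothOn a c.target → ∀ z ∈ c.target,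
      (‖Y.s c z‖ : ℂ) ^ 2 * D c a z = ∑ i, pd (e i) (fun y => v c i y (a y)) z)
    (hs : ∀ α : LField X, IsSection α → IsScalar fun c => D c (α c))
    {α : LField X} (hα : IsSection α) : ∫ x, scal (fun c => D c (α c)) x ∂Y.vol = 0 := by
  have := isManifold_real (X := X)
  obtain ⟨ρ, hρ⟩ := SmoothPartitionOfUnity.exists_isSubordinate 𝓘(ℝ, E3)
    (isClosed_univ (X := X)) (fun x : X => (chartAt E3 x).source)
    (fun x => (chartAt E3 x).open_source)
    (fun x _ => Set.mem_iUnion.2 ⟨x, mem_chart_source E3 x⟩)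
  have hfin : {i | (Function.support (ρ i)).Nonempty}.Finite :=
    ρ.locallyFinite.finite_nonempty_of_compact
  set F := hfin.toFinset with hF
  have hsum : ∀ x, ∑ i ∈ F, ((ρ i x : ℝ) : ℂ) = 1 := fun x => by
    rw [← Complex.ofReal_sum, ← Complex.ofReal_one, ← ρ.sum_eq_one (Set.mem_univ x),
      finsum_eq_sum_of_support_subset]
    intro i hi
    rw [hF, Set.Finite.coe_toFinset]
    exact ⟨x, hi⟩
  have hχ : ∀ i, ∀ c ∈ atlas E3 X,
      SmoothOn (fun z => ((ρ i (c.symm z) : ℝ) : ℂ)) c.target := fun i c hc => by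
    have h1 := (ρ i).contMDiff.comp_contMDiffOn
      (contMDiffOn_symm_of_mem_maximalAtlas (IsManifold.subset_maximalAtlas hc
        (I := 𝓘(ℝ, E3)) (n := ∞)))
    exact (Complex.ofRealCLM.contDiff.comp_contDiffOn (contMDiffOn_iff_contDiffOn.1 h1))
  set β : X → LField X := fun i c z => ((ρ i (c.symm z) : ℝ) : ℂ) • α c z with hβ
  have hβs : ∀ i, IsSection (β i) := fun i => hα.fsmul (χ := fun x => ((ρ i x : ℝ) : ℂ)) (hχ i)
  have hadd : ∀ x, scal (fun c => D c (α c)) x = ∑ i ∈ F, scal (fun c => D c (β i c)) x := by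
    intro x
    rw [scal]
    simp only [scal]
    set c := chartAt E3 x
    have hc : c ∈ atlas E3 X := chart_mem_atlas E3 x
    have hz : c x ∈ c.target := c.map_source (mem_chart_source E3 x)
    have h4 := norm_pos_iff.2 (Y.s_ne_zero c hc _ hz)
    refine mul_left_cancel₀ (a := (‖Y.s c (c x)‖ : ℂ) ^ 2) (by exact_mod_cast (pow_pos h4 2).ne') ?_
    rw [mul_sum, hD c hc _ (hα.1 c hc) _ hz,
      sum_ext fun i => hD c hc _ ((hβs i).1 c hc) _ hz, sum_comm]
    refine sum_ext fun j => ?_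
    rw [← pd_sum _ fun i _ => ((hv c hc _ ((hβs i).1 c hc) j).contDiffAt
      (c.open_target.mem_nhds hz)).differentiableAt (by simp)]
    refine pd_congr _ (.of_forall fun y => ?_)
    dsimp only [hβ]
    rw [← map_sum, ← sum_smul, hsum, one_smul]
  rw [integral_congr_ae (.of_forall hadd),
    integral_finsetSum _ fun i _ => (hs _ (hβs i)).integrable Y]
  refine sum_eq_zero fun i _ => ?_
  refine Y.integral_scal_local hv hD (hβs i) (hs _ (hβs i)) (chart_mem_atlas E3 i)
    (K := tsupport (ρ i)) (isClosed_tsupport _).isCompact (hρ i) fun c' hc' x hx hxK => ?_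
  change ((ρ i (c'.symm (c' x)) : ℝ) : ℂ) • _ = 0
  rw [c'.left_inv hx, image_eq_zero_of_notMem_tsupport hxK, Complex.ofReal_zero, zero_smul]

end CalabiYau

open MeasureTheory

theorem dg_gmul_univ (k : Fin 6) (x y : Gr) :
    gmul (dg k x) y univ = -gmul (par x) (dg k y) univ := by
  have h := congrFun (dg_gmul k x y) univ
  rw [dg_apply, if_pos (mem_univ k)] at h
  exact eq_neg_of_add_eq_zero_left h.symm

theorem contDiffOn_hdot {x y : E3 → Gr} {U : Set E3} (hx : SmoothOn x U)
    (hy : SmoothOn y U) : SmoothOn (fun z => hdot (x z) (y z)) U :=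
  ContDiffOn.sum fun K _ => (contDiffOn_pi.1 hx K).mul
    (Complex.conjCLE.contDiff.comp_contDiffOn (contDiffOn_pi.1 hy K))

namespace Kahler

variable {s : E3 → ℂ} {g : E3 → Mat3} {U : Set E3} {a b : E3 → Gr} (K : Kahler s g U)
include K

theorem smooth_gram {x : E3 → Gr} (hx : SmoothOn x U) :
    SmoothOn (fun z => gs (gram (g z)) (x z)) U := by
  refine contDiffOn_gs (fun i j => ?_) hx
  unfold gram
  induction i using six_cases with
  | hth i =>
    induction j using six_cases with
    | hth j => simpa using K.hg j i
    | het j => simpa using contDiffOn_const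
  | het i =>
    induction j using six_cases with
    | hth j => simpa using contDiffOn_const
    | het j => simpa using K.smooth_gInv j i

theorem trace_dl_sub {z : E3} (hz : z ∈ U) (ha : SmoothOn a U)
    (hb : SmoothOn b U) :
    s z ^ 2 * (gmul (dl s a z) (b z) - gmul (par (a z)) (dl s b z)) univ
      = ∑ i, pd (th i) (fun y => gmul (dg (th i) (s y • a y)) (s y • b y) univ) z := by
  have h1 : s z ^ 2 * (gmul (dl s a z) (b z) - gmul (par (a z)) (dl s b z)) univ
      = (gmul (s z • dl s a z) (s z • b z) - gmul (par (s z • a z)) (s z • dl s b z)) univ := by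
    simp only [map_smul, gmul_smul_left, gmul_smul_right, smul_smul, ← smul_sub, Pi.smul_apply,
      smul_eq_mul, sq]
  have ha' := K.differentiableAt (K.smooth_smul ha) hz
  have hb' := K.differentiableAt (K.smooth_smul hb) hz
  rw [h1, K.smul_dl hz (K.differentiableAt ha hz), K.smul_dl hz (K.differentiableAt hb hz), dv, dv,
    gmul_sum_left, gmul_sum_right, ← sum_sub_distrib, Finset.sum_apply]
  refine sum_ext fun i => ?_
  have h2 := differentiableAt_lin (dg (th i)) ha'
  have h3 := pd_gmul (th i) h2 hb'
  rw [← pd_apply (th i) (differentiableAt_gmul h2 hb'), h3, pd_lin _ (dg (th i)) ha', Pi.add_apply,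
    Pi.sub_apply, dg_gmul_univ (th i) _ (pd (th i) _ z), sub_eq_add_neg]

theorem trace_db {z : E3} (hz : z ∈ U) (ha : SmoothOn a U) : s z ^ 2 * db a z univ
      = ∑ i, pd (et i) (fun y => s y • s y • mg (et i) (a y) univ) z := by
  have ha' := K.differentiableAt ha hz
  have hs := (K.differentiableAt_s hz).restrictScalars ℝ
  rw [db, Finset.sum_apply, mul_sum]
  refine sum_ext fun i => ?_
  have h1 := differentiableAt_lin (mg (et i)) ha'
  have h2 : RDiffAt (fun y => mg (et i) (a y) univ) z := (differentiableAt_pi.1 h1) _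
  rw [pd_smul _ hs (hs.fun_smul h2), pd_smul _ hs h2, pd_et_of_holomorphic (K.differentiableAt_s hz),
    ← pd_apply _ h1, pd_lin _ (mg (et i)) ha']
  simp only [smul_eq_mul]
  ring

end Kahler

theorem ip_zero_left (g : Mat3) (y : Gr) : ip g 0 y = 0 := by
  rw [ip, map_zero]; simp [hdot]

theorem ip_zero_right (g : Mat3) (x : Gr) : ip g x 0 = 0 := by
  simp [ip, hdot]

theorem ip_neg_right (g : Mat3) (x y : Gr) : ip g x (-y) = -ip g x y := by
  rw [ip, hdot_neg_right, ip]

namespace CalabiYau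

variable {X : Type*} [TopologicalSpace X] [ChartedSpace E3 X] (Y : CalabiYau X)
  {α β : LField X}

/-- The trace density relative to the volume form, in every chart. -/
def tden (α : LField X) : PHomeo X E3 → E3 → ℂ := fun c z =>
  Y.s c z ^ 2 * α c z univ / (Complex.I * (‖Y.s c z‖ : ℂ) ^ 2)

theorem trDef_eq [MeasurableSpace X] (φ : MatField X) (α : LField X) :
    Y.trDef φ 0 α = ∫ x, scal (Y.tden α) x ∂Y.vol := by
  refine integral_congr_ae (.of_forall fun x => ?_)
  exact congrArg (· / _) (traceDensity_hol (s := Y.s (chartAt E3 x)) (g := Y.g (chartAt E3 x))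
    (A := φ (chartAt E3 x)) _ _)

theorem trDef_eq_tr [MeasurableSpace X] (φ : MatField X) (α : LField X) :
    Y.trDef φ 0 α = Y.tr α := by
  rw [tr, trDef_eq, trDef_eq]

/-- The pointwise inner product, in every chart. -/
def iden (α β : LField X) : PHomeo X E3 → E3 → ℂ := fun c z =>
  ip (Y.g c z) (α c z) (β c z)

theorem tr_congr [MeasurableSpace X] (h : FieldEq α β) : Y.tr α = Y.tr β := by
  rw [tr, trDef_eq, trDef_eq]
  refine integral_congr_ae (.of_forall fun x => ?_)
  simp only [scal, tden]
  rw [h _ (chart_mem_atlas E3 x) _ ((chartAt E3 x).map_source (mem_chart_source E3 x))]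

theorem tr_smul [MeasurableSpace X] (r : ℂ) (α : LField X) : Y.tr (r • α) = r * Y.tr α := by
  rw [tr, trDef_eq, trDef_eq, ← integral_const_mul]
  refine integral_congr_ae (.of_forall fun x => ?_)
  simp only [scal, tden, Pi.smul_apply, smul_eq_mul]
  ring

variable [IsManifold 𝓘(ℂ, E3) ω X]

theorem isScalar_tden (hα : IsSection α) : IsScalar (Y.tden α) := by
  refine ⟨fun c hc => ?_, fun c hc c' hc' x hx hx' => ?_⟩
  · have h1 := (Y.s_holomorphic c hc).continuousOn
    refine ((h1.pow 2).mul (continuousOn_pi.1 (hα.1 c hc).continuousOn _)).div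
      (continuousOn_const.mul ((Complex.continuous_ofReal.comp_continuousOn h1.norm).pow 2))
      fun z hz => ?_
    have := Y.s_ne_zero c hc z hz
    simp [this]
  · have hJ := (trans_of_mem_atlas hc hc').det _ (mem_trans_source hx hx')
    rw [c.left_inv hx] at hJ
    have hs := Y.s_ne_zero c' hc' _ (c'.map_source hx')
    have h1 : (cm (jac c c' x)).det
        = (jac c c' x).det * (conj (jac c c' x).det)⁻¹ := by
      rw [cm, blk_det, det_fromBlocks_zero₂₁, Matrix.det_conjTranspose, Matrix.det_nonsing_inv,
        Ring.inverse_eq_inv', star_inv₀]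
      rfl
    have h2 : (conj (jac c c' x).det) ≠ 0 := by simpa using hJ
    have h3 : (conj (Y.s c' (c' x))) ≠ 0 := by simpa using hs
    simp only [tden]
    rw [hα.compat hc hc' hx hx', gs_univ, h1, Y.s_compat c hc c' hc' x ⟨hx, hx'⟩, ←
      Complex.mul_conj', ← Complex.mul_conj', map_mul]
    field_simp

theorem isScalar_iden (hα : IsSection α) (hβ : IsSection β) : IsScalar (Y.iden α β) :=
  ⟨fun c hc => (contDiffOn_hdot ((Y.kahler hc).smooth_gram (hα.1 c hc)) (hβ.1 c hc)).continuousOn,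
    fun c hc c' hc' x hx hx' => by
      simp only [iden]
      rw [hα.compat hc hc' hx hx', hβ.compat hc hc' hx hx', ip_cm (Y.g_compat c hc c' hc' x ⟨hx, hx'⟩)]⟩

variable [T2Space X] [CompactSpace X] [MeasurableSpace X] [BorelSpace X]

theorem tr_add (hα : IsSection α) (hβ : IsSection β) : Y.tr (α + β) = Y.tr α + Y.tr β := by
  rw [tr, trDef_eq, trDef_eq, trDef_eq, ← integral_add ((Y.isScalar_tden hα).integrable Y)
    ((Y.isScalar_tden hβ).integrable Y)]
  refine integral_congr_ae (.of_forall fun x => ?_)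
  simp only [scal, tden, Pi.add_apply]
  ring

theorem tr_sub (hα : IsSection α) (hβ : IsSection β) : Y.tr (α - β) = Y.tr α - Y.tr β := by
  rw [sub_eq_add_neg, Y.tr_add hα hβ.neg, ← neg_one_smul ℂ β, tr_smul]
  ring

/-- `Δ` is symmetric for the trace. -/
theorem tr_Dl_wedge (hα : IsSection α) (hβ : IsSection β) :
    Y.tr (wedge (Y.Dl α) β) = Y.tr (wedge (fun c z => par (α c z)) (Y.Dl β)) := by
  have hs : ∀ α, IsSection α →
      IsSection (wedge (Y.Dl α) β - wedge (fun c z => par (α c z)) (Y.Dl β)) := fun α hα =>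
    ((Y.isSection_Dl hα).wedge hβ).sub (hα.par.wedge (Y.isSection_Dl hβ))
  rw [← sub_eq_zero, ← Y.tr_sub ((Y.isSection_Dl hα).wedge hβ) (hα.par.wedge (Y.isSection_Dl hβ)),
    tr, trDef_eq]
  refine Y.integral_scal_eq_zero (D := fun c a z => Y.s c z ^ 2 *
      (gmul (dl (Y.s c) a z) (β c z) - gmul (par (a z)) (dl (Y.s c) (β c) z)) univ
      / (Complex.I * (‖Y.s c z‖ : ℂ) ^ 2)) (e := th)
    (v := fun c i y => (-Complex.I) • (LinearMap.proj univ ∘ₗ (gmulL.flip (Y.s c y • β c y)) ∘ₗ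
      dg (th i) ∘ₗ (Y.s c y • LinearMap.id))) ?_ ?_ (fun α hα => Y.isScalar_tden (hs α hα)) hα
  · intro c hc a ha i
    have K := Y.kahler hc
    exact (contDiffOn_pi.1 (contDiffOn_gmul (Kahler.smooth_lin (dg (th i)) (K.smooth_smul ha))
      (K.smooth_smul (hβ.1 c hc))) univ).const_smul (-Complex.I)
  · intro c hc a ha z hz
    have K := Y.kahler hc
    have hs := norm_ne_zero_iff.2 (Y.s_ne_zero c hc z hz)
    rw [K.trace_dl_sub hz ha (hβ.1 c hc), Finset.sum_div, mul_sum]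
    refine sum_ext fun i => ?_
    have h1 : RDiffAt
        (fun y => gmul (dg (th i) (Y.s c y • a y)) (Y.s c y • β c y) univ) z :=
      K.differentiableAt (contDiffOn_pi.1 (contDiffOn_gmul (Kahler.smooth_lin (dg (th i))
        (K.smooth_smul ha)) (K.smooth_smul (hβ.1 c hc))) univ) hz
    change _ = pd (th i) (fun y => (-Complex.I) • gmul (dg (th i) (Y.s c y • a y))
      (Y.s c y • β c y) univ) z
    rw [pd_smul _ (differentiableAt_const _) h1, pd_const, zero_smul, add_zero, smul_eq_mul]
    have : (‖Y.s c z‖ : ℂ) ≠ 0 := by exact_mod_cast hs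
    field_simp
    rw [Complex.I_sq]
    ring

/-- The trace of a `∂̄`-exact element vanishes. -/
theorem tr_Db (hα : IsSection α) : Y.tr (Db α) = 0 := by
  rw [tr, trDef_eq]
  refine Y.integral_scal_eq_zero (D := fun c a z => Y.s c z ^ 2 * db a z univ
      / (Complex.I * (‖Y.s c z‖ : ℂ) ^ 2)) (e := et)
    (v := fun c i y => (-Complex.I) • (Y.s c y) • (Y.s c y) • (LinearMap.proj univ ∘ₗ
      mg (et i))) ?_ ?_ (fun α hα => Y.isScalar_tden (isSection_Db Y hα)) hα
  · intro c hc a ha i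
    have K := Y.kahler hc
    exact (K.contDiffOn_s.smul (K.contDiffOn_s.smul (contDiffOn_pi.1
      (Kahler.smooth_lin (mg (et i)) ha) univ))).const_smul (-Complex.I)
  · intro c hc a ha z hz
    have K := Y.kahler hc
    have hs := norm_ne_zero_iff.2 (Y.s_ne_zero c hc z hz)
    rw [K.trace_db hz ha, Finset.sum_div, mul_sum]
    refine sum_ext fun i => ?_
    have h1 : RDiffAt (fun y => Y.s c y • Y.s c y • mg (et i) (a y) univ) z :=
      K.differentiableAt (K.contDiffOn_s.smul (K.contDiffOn_s.smul (contDiffOn_pi.1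
        (Kahler.smooth_lin (mg (et i)) ha) univ))) hz
    change _ = pd (et i) (fun y => (-Complex.I) • Y.s c y • Y.s c y • mg (et i) (a y) univ) z
    rw [pd_smul _ (differentiableAt_const _) h1, pd_const, zero_smul, add_zero, smul_eq_mul]
    have : (‖Y.s c z‖ : ℂ) ≠ 0 := by exact_mod_cast hs
    field_simp
    rw [Complex.I_sq]
    ring

/-- `S` is adjoint to `Δ`. -/
theorem integral_iden (hα : IsSection α) (hβ : IsSection β) :
    ∫ x, scal (Y.iden (Y.Dl α) β) x ∂Y.vol = ∫ x, scal (Y.iden α (Y.Sl β)) x ∂Y.vol := by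
  have hs : ∀ α, IsSection α → IsScalar fun c z => Y.iden (Y.Dl α) β c z - Y.iden α (Y.Sl β) c z :=
    fun α hα => ⟨fun c hc => ((Y.isScalar_iden (Y.isSection_Dl hα) hβ).1 c hc).sub
      ((Y.isScalar_iden hα (Y.isSection_Sl hβ)).1 c hc), fun c hc c' hc' x hx hx' => by
        dsimp only
        rw [(Y.isScalar_iden (Y.isSection_Dl hα) hβ).2 c hc c' hc' x hx hx', (Y.isScalar_iden hα
          (Y.isSection_Sl hβ)).2 c hc c' hc' x hx hx']⟩
  rw [← sub_eq_zero, ← integral_sub ((Y.isScalar_iden (Y.isSection_Dl hα) hβ).integrable Y)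
    ((Y.isScalar_iden hα (Y.isSection_Sl hβ)).integrable Y)]
  refine Y.integral_scal_eq_zero (D := fun c a z => ip (Y.g c z) (dl (Y.s c) a z) (β c z)
      - ip (Y.g c z) (a z) (sl (Y.g c) (β c) z)) (e := th)
    (v := fun c i y =>
      { toFun := fun x => conj (Y.s c y) *
          hdot (gs (gram (Y.g c y)) (dg (th i) (Y.s c y • x))) (β c y)
        map_add' := fun x x' => by
          rw [smul_add, map_add, map_add, hdot_add_left, mul_add]
        map_smul' := fun r x => by
          rw [smul_comm, map_smul, map_smul, hdot_smul_left, RingHom.id_apply, smul_eq_mul]; ring })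
    ?_ ?_ hs hα
  · intro c hc a ha i
    have K := Y.kahler hc
    exact (Complex.conjCLE.contDiff.comp_contDiffOn K.contDiffOn_s).mul
      (contDiffOn_hdot (K.smooth_gram (Kahler.smooth_lin (dg (th i)) (K.smooth_smul ha))) (hβ.1 c hc))
  · intro c hc a ha z hz
    exact (Y.kahler hc).ip_dl_sub (fun y hy => Y.g_hermitian hc hy) ha (hβ.1 c hc) hz

theorem eq_zero_of_integral_iden (hα : IsSection α)
    (h : ∫ x, scal (Y.iden α α) x ∂Y.vol = 0) : FieldEq α 0 := by
  have hs := Y.isScalar_iden hα hα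
  have hr : ∀ x, ∃ r : ℝ, 0 ≤ r ∧ scal (Y.iden α α) x = r := fun x => by
    obtain ⟨r, h0, h1, -⟩ := ip_self (Y.g_posDef _ (chart_mem_atlas E3 x) _
      ((chartAt E3 x).map_source (mem_chart_source E3 x))) (α (chartAt E3 x) (chartAt E3 x x))
    exact ⟨r, h0, h1⟩
  have hcont : Continuous fun x => (scal (Y.iden α α) x).re := Complex.continuous_re.comp hs.continuous
  have h2 : ∫ x, (scal (Y.iden α α) x).re ∂Y.vol = 0 := by
    have := integral_re (hs.integrable Y)
    rw [h] at this
    simpa using this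
  have h3 : (fun x => (scal (Y.iden α α) x).re) = 0 := by
    refine (Continuous.ae_eq_iff_eq Y.vol hcont continuous_const).1 ?_
    refine (integral_eq_zero_iff_of_nonneg (fun x => ?_) ((hs.integrable Y).re)).1 h2
    obtain ⟨r, h0, h2⟩ := hr x
    change 0 ≤ (scal (Y.iden α α) x).re
    rw [h2, Complex.ofReal_re]
    exact h0
  intro c hc z hz
  obtain ⟨r, h0, h4, h5⟩ := ip_self (Y.g_posDef c hc z hz) (α c z)
  refine h5 ?_
  have h6 := congrFun h3 (c.symm z)
  simp only [Pi.zero_apply] at h6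
  rw [hs.scal_eq hc (c.map_target hz), c.right_inv hz, iden, h4, Complex.ofReal_re] at h6
  exact h6

theorem integral_iden_zero_left (h : FieldEq α 0) : ∫ x, scal (Y.iden α β) x ∂Y.vol = 0 := by
  rw [← integral_zero X ℂ (μ := Y.vol)]
  refine integral_congr_ae (.of_forall fun x => ?_)
  simp only [scal, iden]
  rw [h _ (chart_mem_atlas E3 x) _ ((chartAt E3 x).map_source (mem_chart_source E3 x))]
  exact ip_zero_left _ _

theorem integral_iden_zero_right (h : FieldEq β 0) : ∫ x, scal (Y.iden α β) x ∂Y.vol = 0 := by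
  rw [← integral_zero X ℂ (μ := Y.vol)]
  refine integral_congr_ae (.of_forall fun x => ?_)
  simp only [scal, iden]
  rw [h _ (chart_mem_atlas E3 x) _ ((chartAt E3 x).map_source (mem_chart_source E3 x))]
  exact ip_zero_right _ _

theorem Dl_Dl (hα : IsSection α) : FieldEq (Y.Dl (Y.Dl α)) 0 := fun c hc _ hz =>
  (Y.kahler hc).dl_dl (hα.1 c hc) hz

/-- Harmonic elements are annihilated by `Δ` and by `S`. -/
theorem harmonic_iff (hα : IsSection α) (h : FieldEq (Y.Dl (Y.Sl α) + Y.Sl (Y.Dl α)) 0) :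
    FieldEq (Y.Dl α) 0 ∧ FieldEq (Y.Sl α) 0 := by
  have s1 := Y.isSection_Sl hα
  have s2 := Y.isSection_Dl hα
  have s3 := Y.isSection_Dl s1
  have h1 : FieldEq (Y.Dl (Y.Sl α)) (-Y.Sl (Y.Dl α)) := fun c hc z hz =>
    eq_neg_of_add_eq_zero_left (h c hc z hz)
  have h2 : FieldEq (Y.Dl (Y.Sl α)) 0 := by
    refine Y.eq_zero_of_integral_iden s3 ?_
    have h3 : ∀ x, scal (Y.iden (Y.Dl (Y.Sl α)) (Y.Dl (Y.Sl α))) x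
        = -scal (Y.iden (Y.Dl (Y.Sl α)) (Y.Sl (Y.Dl α))) x := fun x => by
      simp only [scal, iden]
      conv_lhs => rw [h1 _ (chart_mem_atlas E3 x) _ ((chartAt E3 x).map_source (mem_chart_source E3 x))]
      conv_rhs => rw [h1 _ (chart_mem_atlas E3 x) _ ((chartAt E3 x).map_source (mem_chart_source E3 x))]
      exact ip_neg_right _ _ _
    rw [integral_congr_ae (.of_forall h3), integral_neg, ← Y.integral_iden s3 s2,
      Y.integral_iden_zero_left (Y.Dl_Dl s1), neg_zero]
  have h4 : FieldEq (Y.Sl (Y.Dl α)) 0 := fun c hc z hz => by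
    have := h1 c hc z hz
    rw [h2 c hc z hz] at this
    exact neg_eq_zero.1 this.symm
  refine ⟨Y.eq_zero_of_integral_iden s2 ?_, Y.eq_zero_of_integral_iden s1 ?_⟩
  · rw [Y.integral_iden hα s2, Y.integral_iden_zero_right h4]
  · rw [← Y.integral_iden s1 hα, Y.integral_iden_zero_left h2]

end CalabiYau

/-! ### Properties of the modes of a solution -/

theorem par_of_proj {p q : ℕ} {a : Gr} (h : a = proj p q a) : par a = (-1 : ℂ) ^ (p + q) • a := by
  funext K
  rw [par_apply, Pi.smul_apply, smul_eq_mul]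
  by_cases hK : thDeg K = p ∧ etDeg K = q
  · rw [← hK.1, ← hK.2, thDeg, etDeg, Finset.card_inter_add_card_sdiff]
  · rw [h, proj, if_neg hK, mul_zero, mul_zero]

theorem symm_of_sum_mg_mg {M : Mat3}
    (h : ∑ p, ∑ r, M p r • mg (et p) (mg (et r) gone) = 0) (p r : Fin 3) : M p r = M r p := by
  have h1 := congrArg (fun x => dg (et r) (dg (et p) x) ∅) h
  simp only [map_sum, map_smul, dg_mg, map_sub, map_zero, dg_gone, sub_zero, et_inj, Pi.zero_apply] at h1
  simp only [apply_ite (dg (et r)), apply_ite (mg (et _)), dg_mg, dg_gone, map_zero, sub_zero, et_inj, smul_sub,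
    sum_sub_distrib, smul_ite, smul_zero, sum_ite_eq, mem_univ, if_true, Pi.sub_apply,
    Finset.sum_apply, Pi.smul_apply, Pi.zero_apply, ite_apply] at h1
  simp [gone, sum_ite_eq] at h1
  exact sub_eq_zero.1 h1

theorem symm_of_sum_mg_wm {C : Fin 3 → Mat3}
    (h : ∑ k, mg (et k) (wm (C k) gone) = 0) (k m l : Fin 3) : C k m l = C l m k := by
  refine symm_of_sum_mg_mg (M := Matrix.of fun k l => C k m l) ?_ k l
  have h1 := congrArg (fun x => -dg (th m) x) h
  simp only [map_sum, dg_mg, th_ne_et, if_false, zero_sub, dg_th_wm, dg_gone, map_zero, add_zero,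
    map_smul, sum_neg_distrib, neg_neg, neg_zero] at h1
  exact h1

theorem symm_of_qed_wm {G A : Mat3} (h : qed Gᵀ (wm A gone) = 0) :
    Aᵀ * G = Gᵀ * A := by
  have h1 : ∑ p, ∑ r, (Gᵀ * A) p r • mg (et p) (mg (et r) gone) = 0 := by
    rw [← h, qed_apply]
    refine sum_ext fun p => ?_
    simp only [dg_th_wm, dg_gone, map_zero, add_zero, map_sum, map_smul, smul_sum, smul_smul,
      Matrix.mul_apply, sum_smul]
    exact sum_comm
  ext p r
  rw [symm_of_sum_mg_mg h1 p r, ← transpose_apply (Gᵀ * A), transpose_mul, transpose_transpose]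

theorem div_of_dv_wm {A : E3 → Mat3} {z : E3} (hA : MatDiff A z)
    (h : dv (fun y => wm (A y) gone) z = 0) (k : Fin 3) :
    ∑ l, pd (th l) (fun y => A y l k) z = 0 := by
  simp only [dv, pd_wm_gone hA, dg_th_wm, dg_gone, map_zero, add_zero] at h
  have h1 := congrArg (fun x => dg (et k) x ∅) h
  simp only [map_sum, map_smul, dg_mg, dg_gone, map_zero, sub_zero, et_inj, smul_ite, smul_zero,
    sum_ite_eq, mem_univ, if_true, Finset.sum_apply, Pi.smul_apply, Pi.zero_apply] at h1
  simpa [gone] using h1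

theorem proj_qed_wm (G A : Mat3) :
    qed G (wm A gone) = proj 0 2 (qed G (wm A gone)) := by
  have h : ∀ p r : Fin 3, pr 0 2 (mg (et p) (mg (et r) gone)) = mg (et p) (mg (et r) gone) := by
    intro p r
    funext K
    rw [pr_apply]
    split_ifs with hK
    · rfl
    · rw [mg_apply]
      split_ifs with h1
      · rw [mg_apply]
        split_ifs with h2
        · rw [gone, single_apply, if_neg, mul_zero, mul_zero]
          intro h3
          have e1 := deg_erase_et p K h1
          have e2 := deg_erase_et r _ h2
          have e3 : thDeg ∅ = 0 ∧ etDeg ∅ = 0 := by simp [thDeg, etDeg]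
          rw [h3] at e2
          exact hK ⟨by omega, by omega⟩
        · simp
      · rfl
  have h2 : qed G (wm A gone) = ∑ p, ∑ q, G p q • ∑ r, A q r • mg (et p) (mg (et r) gone) := by
    simp [qed_apply, dg_th_wm, dg_gone]
  rw [proj_eq, h2]
  simp [h]

theorem sl_congr {g : E3 → Mat3} {a b : E3 → Gr} {z : E3} (h : a =ᶠ[𝓝 z] b) :
    sl g a z = sl g b z := by
  rw [sl, sl, db_congr h, db_congr (h.mono fun y hy => by rw [hy])]

theorem rl_congr {s : E3 → ℂ} {g : E3 → Mat3} {a b : E3 → Gr} {z : E3}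
    (h : a =ᶠ[𝓝 z] b) : rl s g a z = rl s g b z := by
  rw [rl, rl, dl_congr h, dl_congr (h.mono fun y hy => by rw [hy])]

theorem db_zero (z : E3) : db 0 z = 0 := by
  simp only [db, Pi.zero_def, pd_const]
  exact sum_eq_zero fun k _ => map_zero _

theorem sl_zero (g : E3 → Mat3) (z : E3) : sl g 0 z = 0 := by
  have h : (fun y => lam g y ((0 : E3 → Gr) y)) = 0 := funext fun y => map_zero _
  rw [sl, h, db_zero, map_zero, sub_zero]

section fields

variable {X : Type*} [TopologicalSpace X] [ChartedSpace E3 X]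
  {c : PHomeo X E3} {α β f : LField X} {z : E3}

theorem FieldEq.eventuallyEq (h : FieldEq α β) (hc : c ∈ atlas E3 X) (hz : z ∈ c.target) :
    α c =ᶠ[𝓝 z] β c := by
  filter_upwards [c.open_target.mem_nhds hz] with y hy using h c hc y hy

theorem IsB.par_eq {p q : ℕ} (h : IsB p q f) (hc : c ∈ atlas E3 X) (hz : z ∈ c.target) :
    par (f c z) = (-1 : ℂ) ^ (p + q) • f c z := par_of_proj (h.2 c hc z hz)

theorem IsB.par_eq_self (h : IsB 1 1 f) (hc : c ∈ atlas E3 X) (hz : z ∈ c.target) :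
    par (f c z) = f c z := by
  rw [h.par_eq hc hz]; norm_num

theorem IsB.par_pd (h : IsB 1 1 f) (hc : c ∈ atlas E3 X) (hz : z ∈ c.target) (k : Fin 6) :
    par (pd k (f c) z) = pd k (f c) z := by
  rw [← pd_lin k par (h.1.diff hc hz)]
  refine pd_congr k ?_
  filter_upwards [c.open_target.mem_nhds hz] with y hy using h.par_eq_self hc hy

theorem IsB.eq_wm (h : IsB 1 1 f) (hc : c ∈ atlas E3 X) (hz : z ∈ c.target) :
    f c z = wm (KS.comp f c z) gone := KS.eq_wm (h.2 c hc z hz)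

theorem IsB.matDiff (h : IsB 1 1 f) (hc : c ∈ atlas E3 X) (hz : z ∈ c.target) :
    MatDiff (KS.comp f c) z := fun i j =>
  (differentiableAt_pi.1 (h.1.diff hc hz)) {th i, et j}

end fields

namespace CalabiYau

variable {X : Type*} [TopologicalSpace X] [ChartedSpace E3 X] (Y : CalabiYau X)
  {c : PHomeo X E3} {α β f : LField X} {z : E3}

theorem bullet_eq (hf : IsB 1 1 f) (hβ : IsSection β) : FieldEq (Y.bullet f β)
    (Y.Dl (wedge f β) - wedge (Y.Dl f) β - wedge f (Y.Dl β)) := by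
  intro c hc z hz
  have h1 : FieldEq (fun c z => parity (f c z)) f := fun c hc z hz => hf.par_eq_self hc hz
  have h2 : FieldEq (wedge (fun c z => parity (f c z)) β) (wedge f β) := fun c hc z hz =>
    congrArg (gmul · (β c z)) (h1 c hc z hz)
  have h3 : IsSection (fun c z => parity (f c z)) := hf.1.par
  change Y.delta _ c z - gmul (Y.delta _ c z) (β c z) - gmul (f c z) (Y.delta β c z) = _
  rw [Y.delta_eq hβ c hc z hz, (Y.delta_eq h3 c hc z hz).trans (Y.Dl_congr h1 c hc z hz),
    (Y.delta_eq (h3.wedge hβ) c hc z hz).trans (Y.Dl_congr h2 c hc z hz)]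
  rfl

theorem bullet_eq_bl (hf : IsB 1 1 f) (hβ : IsSection β) :
    FieldEq (Y.bullet f β) fun c => bl (f c) (β c) := by
  intro c hc z hz
  rw [Y.bullet_eq hf hβ c hc z hz]
  change dl (Y.s c) (fun y => gmul (f c y) (β c y)) z - gmul (dl (Y.s c) (f c) z) (β c z)
    - gmul (f c z) (dl (Y.s c) (β c) z) = _
  rw [dl_gmul (hf.1.diff hc hz) (hβ.diff hc hz) (hf.par_eq_self hc hz)
    fun i => hf.par_pd hc hz (th i)]
  abel

variable [IsManifold 𝓘(ℂ, E3) ω X]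

theorem laplacian_eq (hα : IsSection α) :
    FieldEq (Y.laplacian α) (Y.Dl (Y.Sl α) + Y.Sl (Y.Dl α)) := by
  intro c hc z hz
  have h1 := Y.opS_eq hα
  have h2 := Y.delta_eq hα
  have s1 := (Y.isSection_Sl hα).congr h1.symm
  have s2 := (Y.isSection_Dl hα).congr h2.symm
  change Y.delta (Y.opS α) c z + Y.opS (Y.delta α) c z = _
  rw [Y.delta_eq s1 c hc z hz, Y.opS_eq s2 c hc z hz, Y.Dl_congr h1 c hc z hz]
  exact congrArg _ (sl_congr (h2.eventuallyEq hc hz))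

theorem Lo_eq_zero (hX : ∀ β : LField X, IsB 0 2 β → FieldEq (Y.laplacian β) 0 → FieldEq β 0)
    (hf : IsB 1 1 f) (h0 : FieldEq (Y.Dl f) 0) (h1 : FieldEq (Y.Dl (Y.Sl (Y.Lo f))) 0) :
    FieldEq (Y.Lo f) 0 := by
  have hs := Y.isSection_Lo hf.1
  have h2 : FieldEq (Y.Dl (Y.Lo f)) 0 := fun c hc z hz => by
    refine ((Y.kahler hc).dl_lo hz (hf.1.diff hc hz)).trans ?_
    have := h0 c hc z hz
    rw [Dl] at this
    rw [this]
    exact map_zero _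
  refine hX _ ⟨hs, fun c hc z hz => ?_⟩ fun c hc z hz => ?_
  · simp only [Lo]
    rw [hf.eq_wm hc hz]
    exact proj_qed_wm _ _
  · rw [Y.laplacian_eq hs c hc z hz]
    change Y.Dl _ c z + Y.Sl _ c z = 0
    rw [h1 c hc z hz, Sl, sl_congr (h2.eventuallyEq hc hz)]
    exact (zero_add _).trans (sl_zero _ _)

variable [T2Space X] [CompactSpace X] [MeasurableSpace X] [BorelSpace X]
  {φs : ℕ → LField X}

theorem Dl_mode (hsol : Y.IsSolution φs) {n : ℕ} (hn : 1 ≤ n) : FieldEq (Y.Dl (φs n)) 0 := by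
  obtain rfl | h2 : n = 1 ∨ 2 ≤ n := by omega
  · have hs := (hsol.mem 1 le_rfl).1
    refine (Y.harmonic_iff hs fun c hc z hz => ?_).1
    rw [← Y.laplacian_eq hs c hc z hz, hsol.harmonic c hc z hz]
  · obtain ⟨β, hβ, h3⟩ := hsol.gauge n h2
    have hR := (Y.isSection_Rl hβ.1).congr (Y.opR_eq hβ.1).symm
    intro c hc z hz
    have h4 : FieldEq (φs n) (Y.Dl (Y.opR β)) := fun c hc z hz =>
      (h3 c hc z hz).trans (Y.delta_eq hR c hc z hz)
    rw [Y.Dl_congr h4 c hc z hz, Y.Dl_Dl hR c hc z hz]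

theorem modes (hX : ∀ β : LField X, IsB 0 2 β → FieldEq (Y.laplacian β) 0 → FieldEq β 0)
    (hsol : Y.IsSolution φs) (n : ℕ) : 1 ≤ n → FieldEq (Y.Lo (φs n)) 0 ∧ FieldEq (Db (φs n)
      + (1 / 2 : ℂ) • ∑ i ∈ Finset.Ico 1 n, fun c => bl (φs i c) (φs (n - i) c)) 0 := by
  induction n using Nat.strong_induction_on with
  | _ n ih =>
    intro hn
    have hB := hsol.mem n hn
    have hd := Y.Dl_mode hsol hn
    obtain rfl | h2 : n = 1 ∨ 2 ≤ n := by omega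
    · have hS : FieldEq (Y.Sl (φs 1)) 0 := by
        refine (Y.harmonic_iff hB.1 fun c hc z hz => ?_).2
        rw [← Y.laplacian_eq hB.1 c hc z hz, hsol.harmonic c hc z hz]
      have h3 : FieldEq (Y.Sl (Y.Lo (φs 1))) (Db (φs 1)) := fun c hc z hz => by
        refine ((Y.kahler hc).sl_lo (hB.1.1 c hc) hz).trans ?_
        have := hS c hc z hz
        rw [Sl] at this
        rw [this, Db]
        simp
      have h4 : FieldEq (Y.Lo (φs 1)) 0 := by
        refine Y.Lo_eq_zero hX hB hd fun c hc z hz => ?_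
        rw [Y.Dl_congr h3 c hc z hz]
        have := (Y.kahler hc).db_dl (hB.1.1 c hc) hz
        refine neg_eq_zero.1 (this.symm.trans ?_)
        exact (db_congr (hd.eventuallyEq hc hz)).trans (db_zero z)
      refine ⟨h4, fun c hc z hz => ?_⟩
      simp only [Finset.Ico_self, Finset.sum_empty, smul_zero, add_zero]
      rw [← h3 c hc z hz, Sl, sl_congr (h4.eventuallyEq hc hz)]
      exact sl_zero _ _
    · have heq : FieldEq (Db (φs n)
          + (1 / 2 : ℂ) • ∑ i ∈ Finset.Ico 1 n, fun c => bl (φs i c) (φs (n - i) c)) 0 := by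
        intro c hc z hz
        have := hsol.eqn n h2 c hc z hz
        simp only [Pi.add_apply, Pi.smul_apply, Finset.sum_apply] at this ⊢
        rw [Y.dbar_eq hB.1 c hc z hz, sum_congr rfl fun i hi => Y.bullet_eq_bl
          (hsol.mem i (Finset.mem_Ico.1 hi).1) (hsol.mem (n - i) (by
            have := Finset.mem_Ico.1 hi; omega)).1 c hc z hz] at this
        exact this
      refine ⟨Y.Lo_eq_zero hX hB hd fun c hc => ?_, heq⟩
      have K := Y.kahler hc
      obtain ⟨β, hβ, h3⟩ := hsol.gauge n h2
      have hR := (Y.isSection_Rl hβ.1).congr (Y.opR_eq hβ.1).symm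
      have h4 : ∀ z ∈ c.target, φs n c z = dl (Y.s c) (rl (Y.s c) (Y.g c) (β c)) z := fun z hz =>
        (h3 c hc z hz).trans ((Y.delta_eq hR c hc z hz).trans
          (Y.Dl_congr (Y.opR_eq hβ.1) c hc z hz))
      refine fun z hz => K.dl_sl_eq_zero (K.smooth_lo (hB.1.1 c hc)) (fun z hz => ?_)
        (fun z hz => ?_) (fun z hz => ?_) hz
      · rw [K.dl_lo hz (hB.1.diff hc hz)]
        exact (congrArg _ (hd c hc z hz)).trans (map_zero _)
      · rw [K.db_lo hz (hB.1.diff hc hz)]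
        have h5 := heq c hc z hz
        simp only [Pi.add_apply, Pi.smul_apply, Finset.sum_apply] at h5
        have h6 : ∀ i ∈ Finset.Ico 1 n, lo (Y.g c) z (bl (φs i c) (φs (n - i) c) z) = 0 := by
          intro i hi
          obtain ⟨hi1, hi2⟩ := Finset.mem_Ico.1 hi
          have b1 := hsol.mem i hi1
          have b2 := hsol.mem (n - i) (by omega)
          have d1 := b1.1.diff hc hz
          have d2 := b2.1.diff hc hz
          have h7 := dl_gmul (s := Y.s c) d1 d2 (b1.par_eq_self hc hz) fun i => b1.par_pd hc hz (th i)
          have e1 : dl (Y.s c) (φs i c) z = 0 := Y.Dl_mode hsol hi1 c hc z hz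
          have e2 : dl (Y.s c) (φs (n - i) c) z = 0 := Y.Dl_mode hsol (by omega) c hc z hz
          rw [e1, e2, gmul_zero_left, gmul_zero_right, zero_add, zero_add] at h7
          rw [← h7, ← K.dl_lo hz (differentiableAt_gmul d1 d2), dl_congr (b := fun _ => 0)]
          · simp [dl, pd_const]
          · filter_upwards [c.open_target.mem_nhds hz] with y hy
            have f1 : qed (Y.g c y)ᵀ (φs i c y) = 0 := (ih i hi2 hi1).1 c hc y hy
            have f2 : qed (Y.g c y)ᵀ (φs (n - i) c y) = 0 :=
              (ih (n - i) (by omega) (by omega)).1 c hc y hy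
            rw [lo, qed_gmul, f1, f2, gmul_zero_left, gmul_zero_right, add_zero]
        have h8 := congrArg (lo (Y.g c) z) h5
        rw [map_add, map_smul, map_sum, sum_congr rfl h6, sum_const_zero, smul_zero, add_zero] at h8
        exact h8.trans (map_zero _)
      · rw [← K.rl_lo_dl_rl (hβ.1.1 c hc) hz]
        refine rl_congr ?_
        filter_upwards [c.open_target.mem_nhds hz] with y hy
        rw [h4 y hy]

end CalabiYau

/-! ### Summation of the modes -/

/-- `wm A gone` as a linear function of `A`. -/
def wml : Mat3 →ₗ[ℂ] Gr where
  toFun A := wm A gone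
  map_add' A B := by simp [wm_apply, add_smul, sum_add_distrib]
  map_smul' r A := by simp [wm_apply, mul_smul, smul_sum]

theorem wml_apply (A : Mat3) : wml A = wm A gone := rfl

/-- Half of the bracket of two even elements. -/
def hl (f a : E3 → Gr) (z : E3) : Gr := ∑ l, gmul (dg (th l) (f z)) (pd (th l) a z)

theorem bl_eq_hl {f a : E3 → Gr} {z : E3} (h : ∀ k, par (pd k f z) = pd k f z) :
    bl f a z = hl a f z + hl f a z := by
  rw [bl, hl, hl, ← sum_add_distrib]
  exact sum_ext fun l => by rw [gmul_comm_of_even (h _)]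

theorem hl_wm {A B : E3 → Mat3} {f a : E3 → Gr} {z : E3} (hB : MatDiff B z)
    (hf : f z = wm (A z) gone) (ha : a =ᶠ[𝓝 z] fun y => wm (B y) gone) :
    hl f a z = ∑ k, mg (et k) (wml (∑ l, A z l k • pdm (th l) B z)) := by
  simp only [hl, hf, dg_th_wm, dg_gone, map_zero, add_zero, gmul_sum_left, gmul_smul_left, mg_gmul,
    gone_gmul, pd_congr _ ha, pd_wm_gone hB, map_sum, map_smul, wml_apply]
  exact sum_comm

theorem mg_et_wm_gone (k : Fin 3) (C : Mat3) : mg (et k) (wm C gone)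
    = -∑ p, mg (th p) (∑ q, C p q • mg (et k) (mg (et q) gone)) := by
  have e : ∀ p q, mg (et k) (mg (th p) (mg (et q) gone)) = -mg (th p) (mg (et k) (mg (et q) gone)) :=
    fun p q => mg_mg (et k) (th p) _
  rw [wm_apply]
  simp [e, sum_neg_distrib]

theorem sum_mg_wml_eq_zero {C : Fin 3 → Mat3}
    (h : ∀ k m l, C k m l = C l m k) : ∑ k, mg (et k) (wml (C k)) = 0 := by
  simp only [wml_apply, mg_et_wm_gone]
  rw [sum_neg_distrib, sum_comm, neg_eq_zero]
  refine sum_eq_zero fun p _ => ?_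
  rw [← map_sum, sum_mg_mg_symm et (fun k q => C k p q) (fun k q => h k p q) gone, map_zero]

/-- The derivative `pd k` as a function of the real derivative. -/
def pdL (k : Fin 6) : (E3 →L[ℝ] ℂ) →L[ℝ] ℂ :=
  (1 / 2 : ℂ) • (ContinuousLinearMap.apply ℝ ℂ (single (coordIdx k) 1 : E3)
    + coordSign k • ContinuousLinearMap.apply ℝ ℂ (single (coordIdx k) Complex.I : E3))

theorem pd_eq_pdL (k : Fin 6) (f : E3 → ℂ) (z : E3) : pd k f z = pdL k (fderiv ℝ f z) := pd_eq k f z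

/-- The product of two power series. -/
theorem tsum_mul_tsum_scaled {a b : ℕ → ℂ} (ha : Summable fun n => ‖a n‖)
    (hb : Summable fun n => ‖b n‖) {τ : ℂ} (hτ : ‖τ‖ ≤ 1) :
    HasSum (fun m => τ ^ (m + 2) * ∑ ij ∈ Finset.HasAntidiagonal.antidiagonal m, a ij.1 * b ij.2)
      ((∑' n, τ ^ (n + 1) * a n) * ∑' n, τ ^ (n + 1) * b n) := by
  have h : ∀ {a : ℕ → ℂ}, (Summable fun n => ‖a n‖) → Summable fun n => ‖τ ^ (n + 1) * a n‖ :=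
    fun ha => ha.of_nonneg_of_le (fun _ => norm_nonneg _) fun n => by
      rw [norm_mul, norm_pow]
      exact mul_le_of_le_one_left (norm_nonneg _) (pow_le_one₀ (norm_nonneg _) hτ)
  have e : (fun m => τ ^ (m + 2) * ∑ ij ∈ Finset.HasAntidiagonal.antidiagonal m, a ij.1 * b ij.2)
      = fun m => ∑ ij ∈ Finset.HasAntidiagonal.antidiagonal m, (τ ^ (ij.1 + 1) * a ij.1) * (τ ^ (ij.2 + 1) * b ij.2) := by
    funext m
    rw [mul_sum]
    refine sum_congr rfl fun ij hij => ?_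
    rw [← Finset.HasAntidiagonal.mem_antidiagonal.1 hij]
    ring
  rw [e, tsum_mul_tsum_eq_tsum_sum_antidiagonal_of_summable_norm (h ha) (h hb)]
  exact (summable_norm_sum_mul_antidiagonal_of_summable_norm (h ha) (h hb)).of_norm.hasSum

section series

variable {X : Type*} [TopologicalSpace X] [ChartedSpace E3 X]

/-- The family obtained by rescaling the massless mode. -/
def fam (φs : ℕ → LField X) (τ : ℂ) : MatField X := fun c z => Matrix.of fun i j =>
  ∑' n : ℕ, τ ^ (n + 1) * comp (φs (n + 1)) c z i j

variable {φs : ℕ → LField X} (hC : Converges φs) (hB : ∀ n, 1 ≤ n → IsB 1 1 (φs n))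
  {c : PHomeo X E3} (hc : c ∈ atlas E3 X) {z : E3} (hz : z ∈ c.target)
  {τ : ℂ}

include hC hc hz

theorem summable_mode : Summable fun n => ‖φs (n + 1) c z‖ := by
  obtain ⟨u, hu, h⟩ := hC.2 c hc {z} (Set.singleton_subset_iff.2 hz) isCompact_singleton
  exact hu.of_nonneg_of_le (fun _ => norm_nonneg _) fun n => (h n z rfl).1

theorem summable_comp (i j : Fin 3) : Summable fun n => ‖comp (φs (n + 1)) c z i j‖ :=
  (summable_mode hC hc hz).of_nonneg_of_le (fun _ => norm_nonneg _) fun n =>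
    norm_le_pi_norm (φs (n + 1) c z) _

theorem comp_total : comp (total φs) c z = fam φs 1 c z := by
  ext i j
  change (∑' n : ℕ, φs (n + 1) c z) {th i, et j} = ∑' n : ℕ, 1 ^ (n + 1) * _
  rw [tsum_apply (summable_mode hC hc hz).of_norm]
  simp [comp]

include hB

omit hC in
theorem hasFDerivAt_comp (n : ℕ) (i j : Fin 3) :
    HasFDerivAt (fun y => comp (φs (n + 1)) c y i j) (((ContinuousLinearMap.proj (R := ℝ)
      (φ := fun _ : Idx => ℂ) {th i, et j})).comp (fderiv ℝ (φs (n + 1) c) z)) z :=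
  ((ContinuousLinearMap.proj (R := ℝ) (φ := fun _ : Idx => ℂ)
    {th i, et j}).hasFDerivAt).comp z ((hB (n + 1) (by omega)).1.diff hc hz).hasFDerivAt

omit hC in
theorem norm_fderiv_comp_le (n : ℕ) (i j : Fin 3) :
    ‖fderiv ℝ (fun y => comp (φs (n + 1)) c y i j) z‖ ≤ ‖fderiv ℝ (φs (n + 1) c) z‖ := by
  rw [(hasFDerivAt_comp hB hc hz n i j).fderiv]
  refine ContinuousLinearMap.opNorm_le_bound _ (norm_nonneg _) fun v => ?_
  exact (norm_le_pi_norm (fderiv ℝ (φs (n + 1) c) z v) _).trans (ContinuousLinearMap.le_opNorm _ _)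

theorem summable_fderiv_comp (i j : Fin 3) :
    Summable fun n => ‖fderiv ℝ (fun y => comp (φs (n + 1)) c y i j) z‖ := by
  obtain ⟨u, hu, h⟩ := hC.2 c hc {z} (Set.singleton_subset_iff.2 hz) isCompact_singleton
  exact hu.of_nonneg_of_le (fun _ => norm_nonneg _) fun n =>
    (norm_fderiv_comp_le hB hc hz n i j).trans (h n z rfl).2

theorem summable_pd_comp (k : Fin 6) (i j : Fin 3) :
    Summable fun n => ‖pd k (fun y => comp (φs (n + 1)) c y i j) z‖ :=
  ((summable_fderiv_comp hC hB hc hz i j).mul_left ‖pdL k‖).of_nonneg_of_le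
    (fun _ => norm_nonneg _) fun n => by
      rw [pd_eq_pdL]; exact ContinuousLinearMap.le_opNorm _ _

theorem hasFDerivAt_fam (hτ : ‖τ‖ ≤ 1) (i j : Fin 3) : HasFDerivAt (fun y => fam φs τ c y i j)
    (∑' n : ℕ, τ ^ (n + 1) • fderiv ℝ (fun y => comp (φs (n + 1)) c y i j) z) z := by
  obtain ⟨r, hr, hrc⟩ := Metric.nhds_basis_closedBall.mem_iff.1 (c.open_target.mem_nhds hz)
  obtain ⟨u, hu, h⟩ := hC.2 c hc _ hrc (isCompact_closedBall z r)
  have hpow : ∀ n : ℕ, ‖τ ^ n‖ ≤ 1 := fun n => by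
    rw [norm_pow]; exact pow_le_one₀ (norm_nonneg _) hτ
  refine hasFDerivAt_tsum_of_isPreconnected hu Metric.isOpen_ball (convex_ball z r).isPreconnected
    (f := fun n y => τ ^ (n + 1) * comp (φs (n + 1)) c y i j)
    (f' := fun n y => τ ^ (n + 1) • fderiv ℝ (fun y => comp (φs (n + 1)) c y i j) y)
    (fun n y hy => ?_) (fun n y hy => ?_) (Metric.mem_ball_self hr) ?_ (Metric.mem_ball_self hr)
  · exact ((hasFDerivAt_comp hB hc (hrc (Metric.ball_subset_closedBall hy)) n
      i j).differentiableAt.hasFDerivAt).const_mul _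
  · have hy' := Metric.ball_subset_closedBall hy
    rw [norm_smul]
    exact (mul_le_of_le_one_left (norm_nonneg _) (hpow _)).trans
      ((norm_fderiv_comp_le hB hc (hrc hy') n i j).trans (h n y hy').2)
  · refine Summable.of_norm_bounded (summable_comp hC hc hz i j) fun n => ?_
    rw [norm_mul]
    exact mul_le_of_le_one_left (norm_nonneg _) (hpow _)

theorem matDiff_fam (hτ : ‖τ‖ ≤ 1) : MatDiff (fam φs τ c) z := fun i j =>
  (hasFDerivAt_fam hC hB hc hz hτ i j).differentiableAt

theorem hasSum_pd_fam (hτ : ‖τ‖ ≤ 1) (k : Fin 6) (i j : Fin 3) :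
    HasSum (fun n : ℕ => τ ^ (n + 1) * pd k (fun y => comp (φs (n + 1)) c y i j) z)
      (pd k (fun y => fam φs τ c y i j) z) := by
  have h1 : ∀ n : ℕ, τ ^ (n + 1) * pd k (fun y => comp (φs (n + 1)) c y i j) z
      = pdL k (τ ^ (n + 1) • fderiv ℝ (fun y => comp (φs (n + 1)) c y i j) z) := fun n => by
    rw [pd_eq_pdL]
    simp only [pdL, _root_.smul_apply, _root_.add_apply, ContinuousLinearMap.apply_apply, smul_eq_mul]
    ring
  simp only [h1]
  rw [pd_eq_pdL, (hasFDerivAt_fam hC hB hc hz hτ i j).fderiv]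
  refine (pdL k).hasSum (Summable.hasSum ?_)
  refine Summable.of_norm_bounded (summable_fderiv_comp hC hB hc hz i j) fun n => ?_
  rw [norm_smul, norm_pow]
  exact mul_le_of_le_one_left (norm_nonneg _) (pow_le_one₀ (norm_nonneg _) hτ)

end series

namespace CalabiYau

variable {X : Type*} [TopologicalSpace X] [ChartedSpace E3 X]
  [IsManifold 𝓘(ℂ, E3) ω X] [T2Space X] [CompactSpace X] [MeasurableSpace X]
  [BorelSpace X] (Y : CalabiYau X) {φs : ℕ → LField X}
  (hX : ∀ β : LField X, IsB 0 2 β → FieldEq (Y.laplacian β) 0 → FieldEq β 0)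
  (hsol : Y.IsSolution φs) (hC : Converges φs)
  {c : PHomeo X E3} (hc : c ∈ atlas E3 X) {z : E3} (hz : z ∈ c.target)
  {τ : ℂ} (hτ : ‖τ‖ ≤ 1)

include hX hsol hc hz

theorem mode_ks {n : ℕ} (hn : 1 ≤ n) (k m l : Fin 3) :
    pd (et k) (fun y => comp (φs n) c y m l) z + ∑ i ∈ Finset.Ico 1 n, ∑ p,
        comp (φs i) c z p k * pd (th p) (fun y => comp (φs (n - i)) c y m l) z
      = pd (et l) (fun y => comp (φs n) c y m k) z + ∑ i ∈ Finset.Ico 1 n, ∑ p,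
        comp (φs i) c z p l * pd (th p) (fun y => comp (φs (n - i)) c y m k) z := by
  have h := (Y.modes hX hsol n hn).2 c hc z hz
  simp only [Pi.add_apply, Pi.smul_apply, Finset.sum_apply] at h
  have hm : ∀ i, 1 ≤ i → (φs i c =ᶠ[𝓝 z] fun y => wm (comp (φs i) c y) gone) := fun i hi => by
    filter_upwards [c.open_target.mem_nhds hz] with y hy using (hsol.mem i hi).eq_wm hc hy
  have h1 : ∑ i ∈ Finset.Ico 1 n, bl (φs i c) (φs (n - i) c) z
      = (2 : ℂ) • ∑ i ∈ Finset.Ico 1 n, hl (φs i c) (φs (n - i) c) z := by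
    rw [sum_congr rfl fun i hi => bl_eq_hl fun k =>
      (hsol.mem i (Finset.mem_Ico.1 hi).1).par_pd hc hz k, sum_add_distrib, two_smul]
    congr 1
    have h2 := Finset.sum_Ico_reflect (fun i => hl (φs i c) (φs (n - i) c) z) 1 (Nat.le_succ n)
    rw [show n + 1 - n = 1 by omega, Nat.add_sub_cancel] at h2
    rw [← h2]
    refine sum_congr rfl fun i hi => ?_
    rw [Nat.sub_sub_self (Finset.mem_Ico.1 hi).2.le]
  have h3 : Db (φs n) c z = ∑ k, mg (et k) (wml (pdm (et k) (comp (φs n) c) z)) := by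
    simp [Db, db, pd_congr _ (hm n hn), pd_wm_gone ((hsol.mem n hn).matDiff hc hz), wml_apply]
  rw [h1, smul_smul, one_div, inv_mul_cancel₀ two_ne_zero, one_smul, h3,
    sum_congr rfl fun i hi => hl_wm ((hsol.mem (n - i) (by
      have := Finset.mem_Ico.1 hi; omega)).matDiff hc hz) ((hsol.mem i
      (Finset.mem_Ico.1 hi).1).eq_wm hc hz) (hm (n - i) (by have := Finset.mem_Ico.1 hi; omega)),
    sum_comm, ← sum_add_distrib] at h
  simp only [← map_sum, ← map_add] at h
  have h4 := symm_of_sum_mg_wm h k m l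
  simp only [Matrix.add_apply, Matrix.sum_apply, Matrix.smul_apply, smul_eq_mul] at h4
  exact h4

include hC hτ

theorem fam_ks (k l m : Fin 3) : pd (et k) (fun y => fam φs τ c y m l) z
        + ∑ p, fam φs τ c z p k * pd (th p) (fun y => fam φs τ c y m l) z
      = pd (et l) (fun y => fam φs τ c y m k) z
        + ∑ p, fam φs τ c z p l * pd (th p) (fun y => fam φs τ c y m k) z := by
  have hB := hsol.mem
  have key : ∀ k l, HasSum (fun n => τ ^ (n + 2) * (pd (et k) (fun y => comp (φs (n + 2)) c y m l) z
      + ∑ i ∈ Finset.Ico 1 (n + 2), ∑ p, comp (φs i) c z p k *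
        pd (th p) (fun y => comp (φs (n + 2 - i)) c y m l) z))
      (pd (et k) (fun y => fam φs τ c y m l) z - τ * pd (et k) (fun y => comp (φs 1) c y m l) z
        + ∑ p, fam φs τ c z p k * pd (th p) (fun y => fam φs τ c y m l) z) := by
    intro k l
    have h1 := (hasSum_nat_add_iff' 1).2 (hasSum_pd_fam hC hB hc hz hτ (et k) m l)
    have h2 := hasSum_sum fun p (_ : p ∈ univ) => tsum_mul_tsum_scaled
      (summable_comp hC hc hz p k) (summable_pd_comp hC hB hc hz (th p) m l) hτ
    simp only [Finset.sum_range_one, zero_add, pow_one] at h1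
    simp only [(hasSum_pd_fam hC hB hc hz hτ (th _) m l).tsum_eq] at h2
    refine (h1.add h2).congr_fun fun n => ?_
    rw [← mul_sum, mul_add, sum_comm]
    congr 2
    refine sum_ext fun p => ?_
    rw [Finset.Nat.sum_antidiagonal_eq_sum_range_succ_mk, Finset.sum_Ico_eq_sum_range]
    refine sum_congr (by simp) fun i hi => ?_
    have hi := Finset.mem_range.1 hi
    rw [show n + 2 - (1 + i) = n - i + 1 by omega, add_comm 1 i]
  have h1 := (key k l).unique ((key l k).congr_fun fun n => by
    rw [Y.mode_ks hX hsol hc hz (by omega)])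
  have h2 := Y.mode_ks hX hsol hc hz le_rfl k m l
  simp only [Finset.Ico_self, Finset.sum_empty, add_zero] at h2
  rw [h2] at h1
  linear_combination h1

omit hX in
theorem fam_div (k : Fin 3) : ∑ l, pd (th l) (fun y => Y.s c y * fam φs τ c y l k) z = 0 := by
  have hB := hsol.mem
  have K := Y.kahler hc
  have hs := (K.differentiableAt_s hz).restrictScalars ℝ
  have h1 : ∀ n : ℕ, ∑ l, (Y.s c z * pd (th l) (fun y => comp (φs (n + 1)) c y l k) z
      + pd (th l) (Y.s c) z * comp (φs (n + 1)) c z l k) = 0 := fun n => by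
    have hn := hB (n + 1) (by omega)
    have hm := hn.matDiff hc hz
    rw [← div_of_dv_wm (A := fun y => Y.s c y • comp (φs (n + 1)) c y)
      (fun i j => hs.fun_mul (hm i j)) ?_ k]
    · exact sum_ext fun l => (pd_mul _ hs (hm l k)).symm
    · have h2 := K.smul_dl hz (hn.1.diff hc hz)
      have h3 : dl (Y.s c) (φs (n + 1) c) z = 0 := Y.Dl_mode hsol (by omega) c hc z hz
      rw [h3, smul_zero] at h2
      rw [h2]
      refine dv_congr ?_
      filter_upwards [c.open_target.mem_nhds hz] with y hy
      rw [← wml_apply, map_smul, wml_apply, ← hn.eq_wm hc hy]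
  have h2 : ∀ l, HasSum (fun n => τ ^ (n + 1) * (Y.s c z * pd (th l) (fun y => comp (φs (n + 1)) c y l k) z
      + pd (th l) (Y.s c) z * comp (φs (n + 1)) c z l k))
      (pd (th l) (fun y => Y.s c y * fam φs τ c y l k) z) := fun l => by
    rw [pd_mul _ hs (matDiff_fam hC hB hc hz hτ l k)]
    have h3 : Summable fun n : ℕ => τ ^ (n + 1) * comp (φs (n + 1)) c z l k := by
      refine Summable.of_norm_bounded (summable_comp hC hc hz l k) fun n => ?_
      rw [norm_mul, norm_pow]
      exact mul_le_of_le_one_left (norm_nonneg _) (pow_le_one₀ (norm_nonneg _) hτ)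
    refine (((hasSum_pd_fam hC hB hc hz hτ (th l) l k).mul_left (Y.s c z)).add
      (h3.hasSum.mul_left (pd (th l) (Y.s c) z))).congr_fun fun n => ?_
    ring
  refine (hasSum_sum fun l (_ : l ∈ univ) => h2 l).unique ?_
  simp only [← mul_sum, h1, mul_zero]
  exact hasSum_zero

theorem fam_sym : (fam φs τ c z)ᵀ * Y.g c z = (Y.g c z)ᵀ * fam φs τ c z := by
  have h3 : ∀ i j, Summable fun n : ℕ => τ ^ (n + 1) * comp (φs (n + 1)) c z i j := fun i j => by
    refine Summable.of_norm_bounded (summable_comp hC hc hz i j) fun n => ?_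
    rw [norm_mul, norm_pow]
    exact mul_le_of_le_one_left (norm_nonneg _) (pow_le_one₀ (norm_nonneg _) hτ)
  ext i j
  simp only [Matrix.mul_apply, transpose_apply]
  refine (hasSum_sum fun p (_ : p ∈ univ) => (h3 p i).hasSum.mul_right (Y.g c z p j)).unique
    ((hasSum_sum fun p (_ : p ∈ univ) => (h3 p j).hasSum.mul_left (Y.g c z p i)).congr_fun
      fun n => ?_)
  have h4 : qed (Y.g c z)ᵀ (φs (n + 1) c z) = 0 :=
    (Y.modes hX hsol (n + 1) (by omega)).1 c hc z hz
  rw [(hsol.mem (n + 1) (by omega)).eq_wm hc hz] at h4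
  have h5 := congrFun (congrFun (symm_of_qed_wm h4) i) j
  simp only [Matrix.mul_apply, transpose_apply] at h5
  simp only [mul_assoc, mul_left_comm _ (τ ^ (n + 1)), ← mul_sum]
  rw [h5]

end CalabiYau

section conjugation

variable {X : Type*} [TopologicalSpace X]

theorem conjFamily_eq (φs : ℕ → LField X) (τ : ℂ) (c : PHomeo X E3) (z : E3) (j i : Fin 3) :
    conjFamily φs τ c z j i = conj (fam φs (conj τ) c z j i) := by
  simp only [conjFamily, fam, Matrix.of_apply]
  rw [Complex.conj_tsum]
  simp

theorem conjFamily_zero (φs : ℕ → LField X) : conjFamily φs 0 = 0 := by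
  funext c z
  ext j i
  simp [conjFamily]

end conjugation

namespace CalabiYau

variable {X : Type*} [TopologicalSpace X] [ChartedSpace E3 X]
  [IsManifold 𝓘(ℂ, E3) ω X] [T2Space X] [CompactSpace X] [MeasurableSpace X]
  [BorelSpace X] (Y : CalabiYau X) {φs : ℕ → LField X}
  (hX : ∀ β : LField X, IsB 0 2 β → FieldEq (Y.laplacian β) 0 → FieldEq β 0)
  (hsol : Y.IsSolution φs) (hC : Converges φs)
  {c : PHomeo X E3} (hc : c ∈ atlas E3 X) {z : E3} (hz : z ∈ c.target)
  {τ : ℂ} (hτ : ‖τ‖ ≤ 1)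

include hX hsol hc hz hC

theorem total_ks (k l m : Fin 3) : pd (et k) (fun y => comp (total φs) c y m l) z
        + ∑ p, comp (total φs) c z p k * pd (th p) (fun y => comp (total φs) c y m l) z
      = pd (et l) (fun y => comp (total φs) c y m k) z
        + ∑ p, comp (total φs) c z p l * pd (th p) (fun y => comp (total φs) c y m k) z := by
  have h : ∀ k i j, pd k (fun y => comp (total φs) c y i j) z = pd k (fun y => fam φs 1 c y i j) z :=
    fun k i j => pd_congr k (by
      filter_upwards [c.open_target.mem_nhds hz] with y hy; rw [comp_total hC hc hy])
  simp only [h, comp_total hC hc hz]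
  exact Y.fam_ks hX hsol hC hc hz (by simp) k l m

omit hX in
theorem total_div (k : Fin 3) : ∑ l, pd (th l) (fun y => Y.s c y * comp (total φs) c y l k) z = 0 := by
  rw [← Y.fam_div hsol hC hc hz (τ := 1) (by simp) k]
  refine sum_ext fun l => pd_congr _ ?_
  filter_upwards [c.open_target.mem_nhds hz] with y hy
  rw [comp_total hC hc hy]

theorem total_sym : (comp (total φs) c z)ᵀ * Y.g c z
    = (Y.g c z)ᵀ * comp (total φs) c z := by
  rw [comp_total hC hc hz]
  exact Y.fam_sym hX hsol hC hc hz (by simp)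

omit hX in
theorem Dl_total : dl (Y.s c) (total φs c) z = 0 := by
  have K := Y.kahler hc
  have hA := hC.1.matDiff hc hz
  have hs := (K.differentiableAt_s hz).restrictScalars ℝ
  refine (smul_eq_zero.1 ((K.smul_dl hz (hC.1.1.diff hc hz)).trans ?_)).resolve_left (K.hs0 z hz)
  rw [dv_congr (b := fun y => wm (Y.s c y • comp (total φs) c y) gone) (by
    filter_upwards [c.open_target.mem_nhds hz] with y hy
    rw [← wml_apply, map_smul, wml_apply, ← hC.1.eq_wm hc hy])]
  have hm : MatDiff (fun y => Y.s c y • comp (total φs) c y) z := fun i j => hs.fun_mul (hA i j)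
  simp only [dv, pd_wm_gone hm, dg_th_wm, dg_gone, map_zero, add_zero]
  rw [sum_comm]
  refine sum_eq_zero fun k _ => ?_
  rw [← sum_smul]
  exact (congrArg (· • _) (Y.total_div hsol hC hc hz k)).trans (zero_smul _ _)

include hτ in
theorem admissible (hr : τ ∈ regular φs c z) :
    (Y.geom (comp (total φs)) (conjFamily φs τ) c).Admissible z := by
  have K := Y.kahler hc
  have hτ' : ‖conj τ‖ ≤ 1 := by rwa [RCLike.norm_conj]
  have hA := hC.1.matDiff hc hz
  have hB := matDiff_fam hC hsol.mem hc hz hτ'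
  have hψ : ∀ i j, (fun y => conjFamily φs τ c y i j)
      = fun y => conj (fam φs (conj τ) c y i j) := fun i j =>
    funext fun y => conjFamily_eq φs τ c y i j
  have hnhds := c.open_target.mem_nhds hz
  refine
    { hs := K.differentiableAt_s hz
      hs0 := K.hs0 z hz
      hg := K.matDiff_g hz
      hg0 := K.hg0 z hz
      hφ := hA
      hψ := fun i j => ?_
      hd := hr
      ksφ := fun k l m => Y.total_ks hX hsol hC hc hz k l m
      ksψ := fun i l m => ?_
      divφ := Y.total_div hsol hC hc hz
      divψ := fun i => ?_
      symφ := ?_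
      symψ := ?_
      closed := (K.admissible hz).closed
      closedBar := (K.admissible hz).closedBar }
  · exact (hψ i j) ▸ differentiableAt_conj (hB i j)
  · have h := congrArg conj (Y.fam_ks hX hsol hC hc hz hτ' i l m)
    simp only [map_add, map_sum, map_mul] at h
    simp only [Geom.eTh, geom, smul_eq_mul, conjFamily_eq, pd_conj, cconj_th, cconj_et]
    exact h
  · have h := congrArg conj (Y.fam_div hsol hC hc hz hτ' i)
    rw [map_sum, map_zero] at h
    rw [← h]
    refine sum_ext fun m => ?_
    rw [← cconj_et, ← pd_conj]
    simp [geom, conjFamily_eq, map_mul]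
  · filter_upwards [hnhds] with y hy using Y.total_sym hX hsol hC hc hy
  · filter_upwards [hnhds] with y hy
    have h := Y.fam_sym hX hsol hC hc hy hτ'
    have hg : ∀ i j, conj (Y.g c y i j) = Y.g c y j i := fun i j =>
      (Y.g_hermitian hc hy).apply j i
    ext i j
    have h2 := congrArg conj (congrFun (congrFun h i) j)
    simp only [Matrix.mul_apply, transpose_apply, map_sum, map_mul, hg] at h2
    simp only [geom, Matrix.mul_apply, transpose_apply, conjFamily_eq]
    exact h2

end CalabiYau

/-! ### Analytic dependence on the parameter -/

section regularity

variable {V W : Type*} [NormedAddCommGroup V] [NormedSpace ℂ V] [NormedAddCommGroup W]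
  [NormedSpace ℂ W] {P : Set ℂ}

/-- `f` is complex differentiable on the part of the open unit disc in `P` and continuous on the
part of the closed disc. -/
structure Reg (P : Set ℂ) (f : ℂ → V) : Prop where
  diff : DifferentiableOn ℂ f (P ∩ Metric.ball 0 1)
  cont : ContinuousOn f (P ∩ Metric.closedBall 0 1)

theorem inter_ball_subset : P ∩ Metric.ball (0 : ℂ) 1 ⊆ P ∩ Metric.closedBall 0 1 :=
  Set.inter_subset_inter_right _ Metric.ball_subset_closedBall

namespace Reg

variable {f f' : ℂ → V}

theorem const (v : V) : Reg P fun _ => v := ⟨differentiableOn_const v, continuousOn_const⟩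

theorem add (h : Reg P f) (h' : Reg P f') : Reg P fun τ => f τ + f' τ :=
  ⟨h.diff.add h'.diff, h.cont.add h'.cont⟩

theorem sub (h : Reg P f) (h' : Reg P f') : Reg P fun τ => f τ - f' τ :=
  ⟨h.diff.sub h'.diff, h.cont.sub h'.cont⟩

theorem neg (h : Reg P f) : Reg P fun τ => -f τ := ⟨h.diff.neg, h.cont.neg⟩

theorem smul {r : ℂ → ℂ} (hr : Reg P r) (h : Reg P f) : Reg P fun τ => r τ • f τ :=
  ⟨hr.diff.smul h.diff, hr.cont.smul h.cont⟩

theorem mul {r r' : ℂ → ℂ} (hr : Reg P r) (h : Reg P r') : Reg P fun τ => r τ * r' τ := hr.smul h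

theorem inv {r : ℂ → ℂ} (hr : Reg P r) (h0 : ∀ τ ∈ P, r τ ≠ 0) : Reg P fun τ => (r τ)⁻¹ :=
  ⟨hr.diff.inv fun τ hτ => h0 τ hτ.1, hr.cont.inv₀ fun τ hτ => h0 τ hτ.1⟩

theorem sum {ι : Type*} {s : Finset ι} {F : ι → ℂ → V} (h : ∀ i, Reg P (F i)) :
    Reg P fun τ => ∑ i ∈ s, F i τ :=
  ⟨DifferentiableOn.fun_sum fun i _ => (h i).diff, continuousOn_finsetSum s fun i _ => (h i).cont⟩

theorem lin [FiniteDimensional ℂ V] (T : V →ₗ[ℂ] W) (h : Reg P f) : Reg P fun τ => T (f τ) :=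
  ⟨T.toContinuousLinearMap.differentiable.comp_differentiableOn h.diff,
    T.toContinuousLinearMap.continuous.comp_continuousOn h.cont⟩

theorem congr (h : Reg P f) (e : ∀ τ ∈ P, ‖τ‖ ≤ 1 → f' τ = f τ) : Reg P f' :=
  have e' : ∀ τ ∈ P ∩ Metric.closedBall 0 1, f' τ = f τ := fun τ hτ =>
    e τ hτ.1 (mem_closedBall_zero_iff.1 hτ.2)
  ⟨h.diff.congr fun τ hτ => e' τ (inter_ball_subset hτ), h.cont.congr e'⟩

theorem det {M : ℂ → Mat3} (h : ∀ i j, Reg P fun τ => M τ i j) :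
    Reg P fun τ => (M τ).det := by
  simp only [Matrix.det_fin_three]
  have h3 := fun i j k l m n => ((h i j).mul (h k l)).mul (h m n)
  exact (((((h3 _ _ _ _ _ _).sub (h3 _ _ _ _ _ _)).sub (h3 _ _ _ _ _ _)).add
    (h3 _ _ _ _ _ _)).add (h3 _ _ _ _ _ _)).sub (h3 _ _ _ _ _ _)

theorem matInv {M : ℂ → Mat3} (h : ∀ i j, Reg P fun τ => M τ i j)
    (h0 : ∀ τ ∈ P, (M τ).det ≠ 0) (i j : Fin 3) : Reg P fun τ => (M τ)⁻¹ i j := by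
  simp only [Matrix.inv_def, Ring.inverse_eq_inv', Matrix.smul_apply, smul_eq_mul,
    Matrix.adjugate_apply]
  refine ((det h).inv h0).mul (det fun a b => ?_)
  simp only [Matrix.updateRow_apply]
  split_ifs
  · exact const _
  · exact h a b

theorem tsum {a : ℕ → ℂ} (ha : Summable fun n => ‖a n‖) :
    Reg P fun τ => ∑' n, τ ^ (n + 1) * a n := by
  have h : ∀ n : ℕ, ∀ τ : ℂ, ‖τ‖ ≤ 1 → ‖τ ^ (n + 1) * a n‖ ≤ ‖a n‖ := fun n τ hτ => by
    rw [norm_mul, norm_pow]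
    exact mul_le_of_le_one_left (norm_nonneg _) (pow_le_one₀ (norm_nonneg _) hτ)
  refine ⟨(Complex.differentiableOn_tsum_of_summable_norm ha (fun n => by fun_prop) Metric.isOpen_ball
    fun n τ hτ => h n τ (mem_ball_zero_iff.1 hτ).le).mono Set.inter_subset_right,
    (continuousOn_tsum (fun n => by fun_prop) ha
      fun n τ hτ => h n τ (mem_closedBall_zero_iff.1 hτ)).mono Set.inter_subset_right⟩

theorem isHolomorphicLimit {T : ℂ → Gr} {L : Gr} (h : Reg P T)
    (hP : IsOpen (P ∩ Metric.ball 0 1)) (h0 : (0 : ℂ) ∈ P) (hL : T 0 = L) :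
    IsHolomorphicLimit P T L := by
  refine ⟨h.diff.analyticOnNhd hP, h.cont, hL ▸ ?_⟩
  exact (h.diff.differentiableAt (hP.mem_nhds ⟨h0, Metric.mem_ball_self one_pos⟩)).continuousAt

end Reg

variable [NormedSpace ℝ V] [IsScalarTower ℝ ℂ V]

/-- Regular dependence on the parameter of the value and the first derivatives at a point. -/
structure Reg1 (P : Set ℂ) (z : E3) (F : ℂ → E3 → V) : Prop where
  val : Reg P fun τ => F τ z
  der : ∀ k, Reg P fun τ => pd k (F τ) z
  diff : ∀ τ ∈ P, ‖τ‖ ≤ 1 → RDiffAt (F τ) z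

namespace Reg1

variable {z : E3} {F F' : ℂ → E3 → V}

theorem const {f : E3 → V} (hf : RDiffAt f z) : Reg1 P z fun _ => f :=
  ⟨Reg.const _, fun _ => Reg.const _, fun _ _ _ => hf⟩

theorem smul {r : ℂ → E3 → ℂ} (hr : Reg1 P z r) (h : Reg1 P z F) :
    Reg1 P z fun τ y => r τ y • F τ y :=
  ⟨hr.val.smul h.val, fun k => ((hr.val.smul (h.der k)).add ((hr.der k).smul h.val)).congr
    fun τ hτ h1 => pd_smul k (hr.diff τ hτ h1) (h.diff τ hτ h1),
    fun τ hτ h1 => (hr.diff τ hτ h1).fun_smul (h.diff τ hτ h1)⟩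

theorem mul {r r' : ℂ → E3 → ℂ} (hr : Reg1 P z r) (h : Reg1 P z r') :
    Reg1 P z fun τ y => r τ y * r' τ y := hr.smul h

theorem add (h : Reg1 P z F) (h' : Reg1 P z F') : Reg1 P z fun τ y => F τ y + F' τ y :=
  ⟨h.val.add h'.val, fun k => ((h.der k).add (h'.der k)).congr
    fun τ hτ h1 => pd_add k (h.diff τ hτ h1) (h'.diff τ hτ h1),
    fun τ hτ h1 => (h.diff τ hτ h1).fun_add (h'.diff τ hτ h1)⟩

theorem sub (h : Reg1 P z F) (h' : Reg1 P z F') : Reg1 P z fun τ y => F τ y - F' τ y :=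
  ⟨h.val.sub h'.val, fun k => ((h.der k).sub (h'.der k)).congr
    fun τ hτ h1 => pd_sub k (h.diff τ hτ h1) (h'.diff τ hτ h1),
    fun τ hτ h1 => (h.diff τ hτ h1).fun_sub (h'.diff τ hτ h1)⟩

theorem sum {ι : Type*} {s : Finset ι} {F : ι → ℂ → E3 → V} (h : ∀ i, Reg1 P z (F i)) :
    Reg1 P z fun τ y => ∑ i ∈ s, F i τ y :=
  ⟨Reg.sum fun i => (h i).val, fun k => (Reg.sum fun i => (h i).der k).congr
    fun τ hτ h1 => pd_sum k fun i _ => (h i).diff τ hτ h1,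
    fun τ hτ h1 => DifferentiableAt.fun_sum fun i _ => (h i).diff τ hτ h1⟩

theorem det {M : ℂ → E3 → Mat3} (h : ∀ i j, Reg1 P z fun τ y => M τ y i j) :
    Reg1 P z fun τ y => (M τ y).det := by
  simp only [Matrix.det_fin_three]
  have h3 := fun i j k l m n => ((h i j).mul (h k l)).mul (h m n)
  exact (((((h3 _ _ _ _ _ _).sub (h3 _ _ _ _ _ _)).sub (h3 _ _ _ _ _ _)).add
    (h3 _ _ _ _ _ _)).add (h3 _ _ _ _ _ _)).sub (h3 _ _ _ _ _ _)

end Reg1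

end regularity

section operators

variable {s : E3 → ℂ} {g A : E3 → Mat3} {ψ : ℂ → E3 → Mat3}
  {P : Set ℂ} {z : E3} (hA : MatDiff A z) (hψ : ∀ i j, Reg1 P z fun τ y => ψ τ y i j)
  (hP : ∀ τ ∈ P, (1 - A z * ψ τ z).det ≠ 0) {a : E3 → Gr}

include hψ

theorem reg_eTh (i : Fin 3) (f : E3 → ℂ) : Reg P fun τ => (Geom.mk s g A (ψ τ)).eTh i f z :=
  (Reg.const _).add (Reg.sum fun m => (hψ m i).val.smul (Reg.const _))

theorem reg_eEt (k i j : Fin 3) :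
    Reg P fun τ => (Geom.mk s g A (ψ τ)).eEt k (fun y => ψ τ y i j) z :=
  ((hψ i j).der _).add (Reg.sum fun _ => (Reg.const _).smul ((hψ i j).der _))

include hP

theorem reg_explDbar : Reg P fun τ => (Geom.mk s g A (ψ τ)).explDbar a z := by
  have hN : ∀ i j, Reg P fun τ => (Geom.mk s g A (ψ τ)).matN z i j := Reg.matInv (fun i j => by
    simp only [Geom.pairing, Matrix.sub_apply, Matrix.mul_apply]
    exact (Reg.const _).sub (Reg.sum fun p => (Reg.const _).mul (hψ p j).val)) hP
  have hNb : ∀ i j, Reg P fun τ => (Geom.mk s g A (ψ τ)).matNbar z i j := Reg.matInv (fun i j => by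
    simp only [Geom.pairingBar, Matrix.sub_apply, Matrix.mul_apply]
    exact (Reg.const _).sub (Reg.sum fun p => (hψ i p).val.mul (Reg.const _))) fun τ hτ => by
      rw [Geom.det_pairingBar]; exact hP τ hτ
  have hM : ∀ k i j, Reg P fun τ => (Geom.mk s g A (ψ τ)).symM k i j z := fun k i j => by
    unfold Geom.symM
    exact (reg_eTh (s := s) (g := g) (A := A) hψ i (fun y => A y k j)).add
      (Reg.sum fun m => (Reg.const (A z k m)).mul (reg_eEt (s := s) (g := g) (A := A) hψ j m i))
  have h1 : ∀ p i k, Reg P fun τ =>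
      ∑ s', (Geom.mk s g A (ψ τ)).matN z p s' * (Geom.mk s g A (ψ τ)).symM s' i k z :=
    fun p i k => Reg.sum fun s' => (hN p s').mul (hM s' i k)
  have h2 : ∀ k l j, Reg P fun τ => ∑ i, ∑ m, (Geom.mk s g A (ψ τ)).matN z i m * A z m l *
      (Geom.mk s g A (ψ τ)).eEt k (fun y => ψ τ y j i) z := fun k l j =>
    Reg.sum fun i => Reg.sum fun m => ((hN i m).mul (Reg.const _)).mul (reg_eEt (s := s) (g := g) hψ k j i)
  unfold Geom.explDbar
  simp only [gmul_gen]
  refine Reg.sum fun k => Reg.sum fun r => (hNb k r).smul (Reg.lin (mg (et r)) (Reg.sub (Reg.sub ?_ ?_) ?_))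
  · exact Reg.const ((Geom.mk s g A (ψ 0)).eEt k a z)
  · exact Reg.sum fun p => Reg.sum fun i => (h1 p i k).smul (Reg.const _)
  · exact Reg.sum fun l => Reg.sum fun j => (h2 k l j).smul (Reg.const _)

include hA

theorem reg_explDelta (hs : RDiffAt s z) (hs0 : s z ≠ 0) (ha : RDiffAt a z) :
    Reg P fun τ => (Geom.mk s g A (ψ τ)).explDelta a z := by
  have hO : Reg1 P z fun τ y => (Geom.mk s g A (ψ τ)).omegaCoeff y := by
    refine (Reg1.const hs).mul (Reg1.det fun i j => ?_)
    simp only [Geom.pairing, Matrix.sub_apply, Matrix.mul_apply]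
    exact (Reg1.const (differentiableAt_const _)).sub
      (Reg1.sum fun p => (Reg1.const (hA i p)).mul (hψ p j))
  have hD : ∀ i, Reg1 P z fun τ y => lder (th i) ((Geom.mk s g A (ψ τ)).omegaCoeff y • a y) := by
    intro i
    have := hO.smul (Reg1.const (P := P) (differentiableAt_lin (dg (th i)) ha))
    simp only [← map_smul] at this
    exact this
  exact ((hO.val.inv fun τ hτ => mul_ne_zero hs0 (hP τ hτ)).smul (Reg.sum fun i =>
    ((hD i).der (th i)).add (Reg.sum fun m => (hψ m i).val.smul ((hD i).der (et m))))).sub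
    (Reg.sum fun m => Reg.sum fun j => Reg.sum fun i => ((hψ j i).der _).smul (Reg.const _))

end operators

theorem zero_mem_regular {X : Type*} [TopologicalSpace X] (φs : ℕ → LField X)
    (c : PHomeo X E3) (z : E3) : 0 ∈ regular φs c z := by
  simp [regular, conjFamily_zero]

namespace CalabiYau

variable {X : Type*} [TopologicalSpace X] [ChartedSpace E3 X]
  [IsManifold 𝓘(ℂ, E3) ω X] [T2Space X] [CompactSpace X] [MeasurableSpace X]
  [BorelSpace X] (Y : CalabiYau X) {φs : ℕ → LField X}
  (hX : ∀ β : LField X, IsB 0 2 β → FieldEq (Y.laplacian β) 0 → FieldEq β 0)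
  (hsol : Y.IsSolution φs) (hC : Converges φs)
  {c : PHomeo X E3} (hc : c ∈ atlas E3 X) {z : E3} (hz : z ∈ c.target)

include hC hc hz hsol in
theorem reg1_conjFamily (P : Set ℂ) (i j : Fin 3) :
    Reg1 P z fun τ y => conjFamily φs τ c y i j := by
  have hB := hsol.mem
  have hn : ∀ {τ : ℂ}, ‖τ‖ ≤ 1 → ‖conj τ‖ ≤ 1 := fun h => by rwa [RCLike.norm_conj]
  have e : ∀ τ, (fun y => conjFamily φs τ c y i j)
      = fun y => conj (fam φs (conj τ) c y i j) := fun τ =>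
    funext fun y => conjFamily_eq φs τ c y i j
  refine ⟨Reg.tsum ?_, fun k => ?_, fun τ _ h1 => ?_⟩
  · simpa only [RCLike.norm_conj] using summable_comp hC hc hz i j
  · refine (Reg.tsum (a := fun n =>
      conj (pd (cconj k) (fun y => comp (φs (n + 1)) c y i j) z)) ?_).congr fun τ _ h1 => ?_
    · simpa only [RCLike.norm_conj] using summable_pd_comp hC hB hc hz (cconj k) i j
    · rw [e, pd_conj, ← (hasSum_pd_fam hC hB hc hz (hn h1) (cconj k) i j).tsum_eq, Complex.conj_tsum]
      simp
  · rw [e]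
    exact differentiableAt_conj (matDiff_fam hC hB hc hz (hn h1) i j)

include hC hc hz hsol in
theorem isOpen_regular : IsOpen (regular φs c z ∩ Metric.ball 0 1) := by
  have h : ContinuousOn (fun τ => (1 - comp (total φs) c z * conjFamily φs τ c z).det)
      (Metric.ball 0 1) := by
    have := (Reg.det (P := Set.univ) (M := fun τ => 1 - comp (total φs) c z * conjFamily φs τ c z)
      fun i j => by
        simp only [Matrix.sub_apply, Matrix.mul_apply]
        exact (Reg.const _).sub (Reg.sum fun p => (Reg.const _).mul
          (Y.reg1_conjFamily hsol hC hc hz Set.univ p j).val)).diff.continuousOn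
    simpa using this
  have := h.isOpen_inter_preimage Metric.isOpen_ball isOpen_ne (t := {w : ℂ | w ≠ 0})
  rwa [Set.inter_comm] at this

include hX hsol hC hc hz

theorem reg_opDbar {a : E3 → Gr} (ha : RDiffAt a z) : Reg (regular φs c z) fun τ =>
    (Y.geom (comp (total φs)) (conjFamily φs τ) c).opDbar a z :=
  (reg_explDbar (s := Y.s c) (g := Y.g c) (Y.reg1_conjFamily hsol hC hc hz _) fun τ hτ => hτ).congr
    fun τ hτ h1 => by
      have h := Y.admissible hX hsol hC hc hz h1 hτ
      exact Geom.opDbar_eq h.hs h.hs0 h.hφ h.hψ h.hd h.ksφ h.divφ ha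

theorem reg_opDelta {a : E3 → Gr} (ha : RDiffAt a z) : Reg (regular φs c z) fun τ =>
    (Y.geom (comp (total φs)) (conjFamily φs τ) c).opDelta a z := by
  have K := Y.kahler hc
  exact (reg_explDelta (s := Y.s c) (g := Y.g c) (hC.1.matDiff hc hz)
    (Y.reg1_conjFamily hsol hC hc hz _) (fun τ hτ => hτ)
    ((K.differentiableAt_s hz).restrictScalars ℝ) (K.hs0 z hz) ha).congr fun τ hτ h1 => by
      have h := Y.admissible hX hsol hC hc hz h1 hτ
      exact Geom.opDelta_eq (h.hs.restrictScalars ℝ) h.hs0 h.hφ h.hψ h.hd h.ksψ ha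

end CalabiYau

theorem Geom.Admissible.congr {s : E3 → ℂ} {g A ψ ψ' : E3 → Mat3} {z : E3}
    (h : (Geom.mk s g A ψ).Admissible z) (e : ψ =ᶠ[𝓝 z] ψ') : (Geom.mk s g A ψ').Admissible z := by
  have e0 : ψ z = ψ' z := e.self_of_nhds
  have e1 : ∀ k i j, pd k (fun y => ψ y i j) z = pd k (fun y => ψ' y i j) z := fun k i j =>
    pd_congr k (e.mono fun y hy => by simp only [hy])
  refine { h with
    hψ := fun i j => (h.hψ i j).congr_of_eventuallyEq (e.mono fun y hy => by
      change ψ' y i j = ψ y i j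
      rw [hy])
    hd := ?_
    ksψ := fun i l m => ?_
    divψ := fun i => ?_
    symψ := ?_ }
  · have := h.hd
    simp only [Geom.pairing, e0] at this ⊢
    exact this
  · have := h.ksψ i l m
    simp only [Geom.eTh, e0, e1] at this ⊢
    exact this
  · rw [← h.divψ i]
    exact sum_ext fun m => pd_congr _ (e.mono fun y hy => by
      change _ * ψ' y m i = _ * ψ y m i
      rw [hy])
  · filter_upwards [h.symψ, e] with y hy hy'
    rw [← hy']
    exact hy

theorem cube_add {a b : Gr} (hb : par b = b) :
    gmul (gmul (a + b) (a + b)) (a + b) = gmul (gmul a a) a + (3 : ℂ) • gmul (gmul a a) b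
      + (3 : ℂ) • gmul (gmul a b) b + gmul (gmul b b) b := by
  have h : ∀ x, gmul b x = gmul x b := fun x => gmul_comm_of_even hb x
  have h1 : gmul (gmul a b) a = gmul (gmul a a) b := by rw [gmul_assoc, h, gmul_assoc]
  have h2 : gmul (gmul b b) a = gmul (gmul a b) b := by rw [gmul_assoc, h, h]
  simp only [gmul_add_left, gmul_add_right, h a, h1, h2]
  module

section fields

variable {X : Type*} [TopologicalSpace X] {α β γ : LField X}

theorem wedge_add_left : wedge (α + β) γ = wedge α γ + wedge β γ :=
  funext fun _ => funext fun _ => gmul_add_left _ _ _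

theorem wedge_add_right : wedge α (β + γ) = wedge α β + wedge α γ :=
  funext fun _ => funext fun _ => gmul_add_right _ _ _

theorem wedge_sub_left : wedge (α - β) γ = wedge α γ - wedge β γ :=
  funext fun _ => funext fun _ => gmul_sub_left _ _ _

end fields

namespace CalabiYau

variable {X : Type*} [TopologicalSpace X] [ChartedSpace E3 X]
  [IsManifold 𝓘(ℂ, E3) ω X] [T2Space X] [CompactSpace X] [MeasurableSpace X]
  [BorelSpace X] (Y : CalabiYau X)

/-! ### The pairing defined by the trace -/

/-- The trace of a product. -/
def tw (α β : LField X) : ℂ := Y.tr (wedge α β)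

variable {α α' β β' γ : LField X}

theorem tw_congr (hα : FieldEq α α') (hβ : FieldEq β β') : Y.tw α β = Y.tw α' β' :=
  Y.tr_congr fun c hc z hz => by simp only [wedge, hα c hc z hz, hβ c hc z hz]

theorem tw_comm (hα : IsB 1 1 α) : Y.tw α β = Y.tw β α :=
  Y.tr_congr fun _ hc _ hz => gmul_comm_of_even (hα.par_eq_self hc hz) _

theorem tw_add_left (hα : IsSection α) (hα' : IsSection α') (hβ : IsSection β) :
    Y.tw (α + α') β = Y.tw α β + Y.tw α' β := by
  rw [tw, wedge_add_left, Y.tr_add (hα.wedge hβ) (hα'.wedge hβ), tw, tw]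

theorem tw_add_right (hα : IsSection α) (hβ : IsSection β) (hβ' : IsSection β') :
    Y.tw α (β + β') = Y.tw α β + Y.tw α β' := by
  rw [tw, wedge_add_right, Y.tr_add (hα.wedge hβ) (hα.wedge hβ'), tw, tw]

theorem tw_sub_left (hα : IsSection α) (hα' : IsSection α') (hβ : IsSection β) :
    Y.tw (α - α') β = Y.tw α β - Y.tw α' β := by
  rw [tw, wedge_sub_left, Y.tr_sub (hα.wedge hβ) (hα'.wedge hβ), tw, tw]

theorem tw_smul_left (r : ℂ) : Y.tw (r • α) β = r * Y.tw α β := by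
  rw [tw, tw, ← Y.tr_smul]
  exact Y.tr_congr fun _ _ _ _ => gmul_smul_left _ _ _

theorem tw_smul_right (r : ℂ) : Y.tw α (r • β) = r * Y.tw α β := by
  rw [tw, tw, ← Y.tr_smul]
  exact Y.tr_congr fun _ _ _ _ => gmul_smul_right _ _ _

theorem tw_zero_right (h : FieldEq β 0) : Y.tw α β = 0 := by
  have h1 : FieldEq β ((0 : ℂ) • β) := fun c hc z hz => by
    rw [h c hc z hz]; simp
  rw [Y.tw_congr (fun _ _ _ _ => rfl) h1, tw_smul_right, zero_mul]

theorem tw_par {r : ℂ} (h : ∀ c ∈ atlas E3 X, ∀ z ∈ c.target, par (α c z) = r • α c z) :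
    Y.tw (fun c z => par (α c z)) β = r * Y.tw α β := by
  rw [← tw_smul_left]
  exact Y.tw_congr h fun _ _ _ _ => rfl

theorem tw_Dl (hα : IsSection α) (hβ : IsSection β) {r : ℂ}
    (h : ∀ c ∈ atlas E3 X, ∀ z ∈ c.target, par (α c z) = r • α c z) :
    Y.tw (Y.Dl α) β = r * Y.tw α (Y.Dl β) := by
  rw [← Y.tw_par h]
  exact Y.tr_Dl_wedge hα hβ

theorem tw_Db (hα : IsSection α) (hβ : IsSection β) {r : ℂ}
    (h : ∀ c ∈ atlas E3 X, ∀ z ∈ c.target, par (α c z) = r • α c z) :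
    Y.tw (Db α) β = -(r * Y.tw α (Db β)) := by
  have s1 := isSection_Db Y hα
  have s2 := isSection_Db Y hβ
  rw [← Y.tw_par h, ← add_eq_zero_iff_eq_neg]
  refine ((Y.tr_add (s1.wedge hβ) (hα.par.wedge s2)).symm.trans ?_).trans (Y.tr_Db (hα.wedge hβ))
  exact Y.tr_congr fun c hc z hz => (db_gmul (hα.diff hc hz) (hβ.diff hc hz)).symm

/-- `∂̄` and `Δ` exchange under the trace of a product of odd elements. -/
theorem tw_Db_Dl (hα : IsB 2 1 α) (hβ : IsSection β) :
    Y.tw (Db α) (Y.Dl β) = Y.tw (Y.Dl α) (Db β) := by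
  have h : ∀ c ∈ atlas E3 X, ∀ z ∈ c.target, par (α c z) = (-1 : ℂ) • α c z := fun c hc z hz => by
    rw [hα.par_eq hc hz]; norm_num
  rw [Y.tw_Db hα.1 (Y.isSection_Dl hβ) h, Y.tw_Dl hα.1 (isSection_Db Y hβ) h,
    Y.tw_congr (α := α) (fun _ _ _ _ => rfl)
      (show FieldEq (Db (Y.Dl β)) ((-1 : ℂ) • Y.Dl (Db β)) from fun c hc z hz =>
        ((Y.kahler hc).db_dl (hβ.1 c hc) hz).trans (neg_one_smul ℂ _).symm), tw_smul_right]
  ring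

/-! ### The action around the condensate -/

theorem action_eq {φ : MatField X} {φ₁ Φ D F : LField X} (hD : IsSection D) (hΦ : IsSection Φ)
    (hF : IsSection F) (h : FieldEq (Y.dbarDef φ 0 γ) D) (h1 : FieldEq (φ₁ + Φ) F) :
    Y.action φ 0 φ₁ Φ γ = (1 / 6 : ℂ) * Y.tw (wedge F F) F - (1 / 2 : ℂ) * Y.tw D Φ := by
  rw [action, trDef_eq_tr, tw, tw, ← tr_smul, ← tr_smul, ← Y.tr_sub (((hF.wedge hF).wedge hF).smul
    _) ((hD.wedge hΦ).smul _)]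
  refine Y.tr_congr fun c hc z hz => ?_
  have h2 : φ₁ c z + Φ c z = F c z := h1 c hc z hz
  simp [wedge, h2, h c hc z hz]

theorem tw_cube_add {F Φ : LField X} (hF : IsSection F) (hΦ : IsB 1 1 Φ) :
    Y.tw (wedge (F + Φ) (F + Φ)) (F + Φ) = Y.tw (wedge F F) F + 3 * Y.tw (wedge F F) Φ
      + 3 * Y.tw (wedge F Φ) Φ + Y.tw (wedge Φ Φ) Φ := by
  have s1 := (hF.wedge hF).wedge hF
  have s2 := ((hF.wedge hF).wedge hΦ.1).smul 3
  have s3 := ((hF.wedge hΦ.1).wedge hΦ.1).smul 3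
  have s4 := (hΦ.1.wedge hΦ.1).wedge hΦ.1
  simp only [tw]
  rw [← tr_smul, ← tr_smul, ← Y.tr_add s1 s2, ← Y.tr_add (s1.add s2) s3, ← Y.tr_add ((s1.add s2).add
    s3) s4]
  exact Y.tr_congr fun c hc z hz => cube_add (hΦ.par_eq_self hc hz)

end CalabiYau

namespace CalabiYau

variable {X : Type*} [TopologicalSpace X] [ChartedSpace E3 X]
  [IsManifold 𝓘(ℂ, E3) ω X] [T2Space X] [CompactSpace X] [MeasurableSpace X]
  [BorelSpace X] (Y : CalabiYau X) {α f Φ : LField X} {φs : ℕ → LField X}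

theorem starBr_eq (hf : IsB 1 1 f) (hα : IsSection α) : FieldEq (Y.starBr f α)
    (Y.Rl (wedge f α) - wedge (Y.Rl f) α - wedge f (Y.Rl α)) := by
  intro c hc z hz
  have h1 : FieldEq (fun c z => parity (f c z)) f := fun c hc z hz => hf.par_eq_self hc hz
  have h2 : FieldEq (wedge (fun c z => parity (f c z)) α) (wedge f α) := fun c hc z hz =>
    congrArg (gmul · (α c z)) (h1 c hc z hz)
  have h3 : IsSection (fun c z => parity (f c z)) := hf.1.par
  change Y.opR _ c z - gmul (Y.opR _ c z) (α c z) - gmul (f c z) (Y.opR α c z) = _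
  rw [Y.opR_eq hα c hc z hz, (Y.opR_eq h3 c hc z hz).trans (rl_congr (h1.eventuallyEq hc hz)),
    (Y.opR_eq (h3.wedge hα) c hc z hz).trans (rl_congr (h2.eventuallyEq hc hz))]
  rfl

variable (hX : ∀ β : LField X, IsB 0 2 β → FieldEq (Y.laplacian β) 0 → FieldEq β 0)
  (hsol : Y.IsSolution φs) (hC : Converges φs)

include hX hsol hC

theorem dbarDef_total {a : E3 → Gr} {c : PHomeo X E3} (hc : c ∈ atlas E3 X) {z : E3}
    (hz : z ∈ c.target) (ha : RDiffAt a z) :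
    (hol (Y.s c) (Y.g c) (comp (total φs) c)).opDbar a z = db a z + bl (total φs c) a z := by
  have K := Y.kahler hc
  refine opDbar_hol (K.differentiableAt_s hz) (K.hs0 z hz) (hC.1.matDiff hc hz)
    (Y.total_ks hX hsol hC hc hz) (Y.total_div hsol hC hc hz) ha ?_
  filter_upwards [c.open_target.mem_nhds hz] with y hy using hC.1.eq_wm hc hy

theorem limit_dbar (hα : IsSection α) {c : PHomeo X E3} (hc : c ∈ atlas E3 X) {z : E3}
    (hz : z ∈ c.target) : IsHolomorphicLimit (regular φs c z)
      (fun τ => Y.dbarDef (comp (total φs)) (conjFamily φs τ) α c z)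
      ((Y.dbar α + Y.bullet (total φs) α) c z) := by
  refine (Y.reg_opDbar hX hsol hC hc hz (hα.diff hc hz)).isHolomorphicLimit
    (Y.isOpen_regular hsol hC hc hz) (zero_mem_regular φs c z) ?_
  rw [conjFamily_zero]
  refine (Y.dbarDef_total hX hsol hC hc hz (hα.diff hc hz)).trans ?_
  rw [Pi.add_apply, Pi.add_apply, Y.dbar_eq hα c hc z hz, Y.bullet_eq_bl hC.1 hα c hc z hz]
  rfl

theorem limit_delta (hα : IsSection α) {c : PHomeo X E3} (hc : c ∈ atlas E3 X) {z : E3}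
    (hz : z ∈ c.target) : IsHolomorphicLimit (regular φs c z)
      (fun τ => Y.deltaDef (comp (total φs)) (conjFamily φs τ) α c z) (Y.delta α c z) := by
  have K := Y.kahler hc
  refine (Y.reg_opDelta hX hsol hC hc hz (hα.diff hc hz)).isHolomorphicLimit
    (Y.isOpen_regular hsol hC hc hz) (zero_mem_regular φs c z) ?_
  rw [conjFamily_zero, Y.delta_eq hα c hc z hz]
  exact opDelta_hol (K.differentiableAt_s hz) (K.hs0 z hz) (hC.1.matDiff hc hz) (hα.diff hc hz)

theorem limit_S (hα : IsSection α) {c : PHomeo X E3} (hc : c ∈ atlas E3 X) {z : E3}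
    (hz : z ∈ c.target) : IsHolomorphicLimit (regular φs c z)
      (fun τ => Y.sDef (comp (total φs)) (conjFamily φs τ) α c z)
      ((Y.opS α + Y.starBr (total φs) α) c z) := by
  have K := Y.kahler hc
  have hb := K.differentiableAt (K.smooth_hodge (hα.1 c hc)) hz
  have hr := (Y.reg_opDbar hX hsol hC hc hz hb).lin (sgl ∘ₗ gs ((base (Y.s c) (Y.g c)).hmat z))
  refine (hr.congr fun τ hτ h1 => ?_).isHolomorphicLimit
    (Y.isOpen_regular hsol hC hc hz) (zero_mem_regular φs c z) ?_
  · have h := Y.admissible hX hsol hC hc hz h1 hτ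
    exact Geom.opS_eq_hodge h.hφ h.hψ h.hd h.symψ (α c)
  rw [conjFamily_zero]
  refine (opS_hol_eq_hodge (hC.1.matDiff hc hz)).trans ?_
  have h2 : Y.opS α c z = (base (Y.s c) (Y.g c)).hodge z
      (db (fun y => (base (Y.s c) (Y.g c)).hodge y (α c y)) z) := by
    refine (opS_hol_eq_hodge (A := 0) (mdiff_const 0)).trans ?_
    exact congrArg _ (K.opDbar_base hz hb)
  rw [Y.dbarDef_total hX hsol hC hc hz hb, Geom.hodge_add, Pi.add_apply, Pi.add_apply, h2,
    Y.starBr_eq hC.1 hα c hc z hz, K.hodge_bl (hC.1.1.1 c hc) (fun y hy => hC.1.eq_wm hc hy)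
      (fun y hy => Y.total_sym hX hsol hC hc hy) (fun y hy => Y.Dl_total hsol hC hc hy) (hα.1 c hc) hz]
  rfl

theorem limit_R (hα : IsSection α) {c : PHomeo X E3} (hc : c ∈ atlas E3 X) {z : E3}
    (hz : z ∈ c.target) : IsHolomorphicLimit (regular φs c z)
      (fun τ => Y.rDef (comp (total φs)) (conjFamily φs τ) α c z) (Y.opR α c z) := by
  have K := Y.kahler hc
  have hb := K.differentiableAt (K.smooth_hodge (hα.1 c hc)) hz
  have hr := ((Y.reg_opDelta hX hsol hC hc hz hb).lin
    (sgl ∘ₗ gs ((base (Y.s c) (Y.g c)).hmat z))).neg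
  refine (hr.congr fun τ hτ h1 => ?_).isHolomorphicLimit
    (Y.isOpen_regular hsol hC hc hz) (zero_mem_regular φs c z) ?_
  · have h := Y.admissible hX hsol hC hc hz h1 hτ
    exact Geom.opR_eq_hodge h.hφ h.hψ h.hd h.symψ (α c)
  rw [conjFamily_zero]
  refine (opR_hol_eq_hodge (hC.1.matDiff hc hz)).trans ?_
  rw [opDelta_hol (K.differentiableAt_s hz) (K.hs0 z hz) (hC.1.matDiff hc hz) hb]
  refine ((opR_hol_eq_hodge (A := 0) (mdiff_const 0)).trans ?_).symm
  exact congrArg (fun x => -(base (Y.s c) (Y.g c)).hodge z x) (K.opDelta_base hz hb)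

omit hX hsol in
theorem add_condensate : FieldEq (φs 1 + condensate φs) (total φs) := fun c hc z hz => by
  have h := (summable_mode hC hc hz).of_norm
  exact (h.tsum_eq_zero_add).symm

omit hX in
theorem isSection_condensate : IsSection (condensate φs) :=
  (hC.1.1.sub (hsol.mem 1 le_rfl).1).congr fun c hc z hz => by
    have h := add_condensate hC c hc z hz
    simp only [Pi.add_apply, Pi.sub_apply] at h ⊢
    rw [← h, add_sub_cancel_left]

theorem Db_condensate :
    FieldEq (Db (condensate φs)) ((-1 / 2 : ℂ) • Y.Dl (wedge (total φs) (total φs))) := by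
  intro c hc z hz
  have h1 := (Y.modes hX hsol 1 le_rfl).2 c hc z hz
  simp only [Finset.Ico_self, Finset.sum_empty, smul_zero, add_zero] at h1
  have hd := hC.1.1.diff hc hz
  have h2 : Db (total φs) c z = Db (φs 1) c z + Db (condensate φs) c z := by
    rw [← Db_congr (add_condensate hC) c hc z hz]
    exact db_add ((hsol.mem 1 le_rfl).1.diff hc hz) ((Y.isSection_condensate hsol hC).diff hc hz)
  rw [h1, Pi.zero_apply, Pi.zero_apply, zero_add] at h2
  have hm : total φs c =ᶠ[𝓝 z] fun y => wm (comp (total φs) c y) gone := by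
    filter_upwards [c.open_target.mem_nhds hz] with y hy using hC.1.eq_wm hc hy
  have hA := hC.1.matDiff hc hz
  have h3 : db (total φs c) z + hl (total φs c) (total φs c) z = 0 := by
    have h5 : db (total φs c) z = ∑ k, mg (et k) (wml (pdm (et k) (comp (total φs) c) z)) := by
      simp only [db, pd_congr _ hm, pd_wm_gone hA, wml_apply]
    rw [hl_wm hA hm.self_of_nhds hm, h5, ← sum_add_distrib]
    simp only [← map_add]
    refine sum_mg_wml_eq_zero fun k m l => ?_
    simpa only [Matrix.add_apply, Matrix.sum_apply, Matrix.smul_apply, smul_eq_mul, pdm_apply]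
      using Y.total_ks hX hsol hC hc hz k l m
  have h4 : Y.Dl (wedge (total φs) (total φs)) c z
      = (2 : ℂ) • hl (total φs c) (total φs c) z := by
    refine (dl_gmul hd hd (hC.1.par_eq_self hc hz) fun i => hC.1.par_pd hc hz (th i)).trans ?_
    rw [Y.Dl_total hsol hC hc hz, gmul_zero_left, gmul_zero_right, zero_add, zero_add,
      bl_eq_hl fun k => hC.1.par_pd hc hz k, two_smul]
  rw [Pi.smul_apply, Pi.smul_apply, h4, ← h2, Db, eq_neg_of_add_eq_zero_left h3]
  module

theorem action_condensate (hΦ : IsB 1 1 Φ) {γ₀ γ γ' : LField X}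
    (h0 : Y.IsPrimitive 0 0 (condensate φs) γ₀) (h1 : Y.IsPrimitive 0 0 (condensate φs + Φ) γ)
    (h2 : Y.IsPrimitive (comp (total φs)) 0 Φ γ') :
    Y.action 0 0 (φs 1) (condensate φs + Φ) γ
        = Y.action 0 0 (φs 1) (condensate φs) γ₀ + Y.action (comp (total φs)) 0 0 Φ γ' ∧
      ∀ χ : LField X, IsB 2 2 χ → FieldEq (Y.delta χ) (Y.dbar Φ + Y.bullet (total φs) Φ) →
        Y.action (comp (total φs)) 0 0 Φ γ'
          = Y.tr ((1 / 6 : ℂ) • wedge (wedge Φ Φ) Φ + (1 / 2 : ℂ) • wedge χ Φ) := by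
  obtain ⟨⟨s0, p0⟩, d0⟩ := h0
  obtain ⟨⟨s1, p1⟩, d1⟩ := h1
  obtain ⟨⟨s2, p2⟩, d2⟩ := h2
  have rfl' : ∀ α : LField X, FieldEq α α := fun _ _ _ _ _ => rfl
  have sc := Y.isSection_condensate hsol hC
  have sφ := hC.1.1
  have e0 : FieldEq (Y.Dl γ₀) (condensate φs) := fun c hc z hz =>
    (Y.delta_eq s0 c hc z hz).symm.trans (d0 c hc z hz)
  have e1 : FieldEq (Y.Dl γ) (condensate φs + Φ) := fun c hc z hz =>
    (Y.delta_eq s1 c hc z hz).symm.trans (d1 c hc z hz)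
  have e2 : FieldEq (Y.Dl γ') Φ := fun c hc z hz =>
    (opDelta_hol ((Y.kahler hc).differentiableAt_s hz) (Y.s_ne_zero c hc z hz) (hC.1.matDiff hc hz)
      (s2.diff hc hz)).symm.trans (d2 c hc z hz)
  have odd : ∀ {γ : LField X}, IsB 2 1 γ → ∀ c ∈ atlas E3 X, ∀ z ∈ c.target,
      par (γ c z) = (-1 : ℂ) • γ c z := fun h c hc z hz => by rw [h.par_eq hc hz]; norm_num
  have even : ∀ {γ : LField X}, IsB 1 1 γ → ∀ c ∈ atlas E3 X, ∀ z ∈ c.target,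
      par (γ c z) = (1 : ℂ) • γ c z := fun h c hc z hz => by rw [h.par_eq_self hc hz, one_smul]
  have dΦ : FieldEq (Y.Dl Φ) 0 := fun c hc z hz =>
    (Y.Dl_congr e2 c hc z hz).symm.trans (Y.Dl_Dl s2 c hc z hz)
  have sδ : IsB 2 1 (γ - γ₀) := ⟨s1.sub s0, fun c hc z hz => by
    have a1 : γ c z = proj 2 1 (γ c z) := p1 c hc z hz
    have a0 : γ₀ c z = proj 2 1 (γ₀ c z) := p0 c hc z hz
    change γ c z - γ₀ c z = proj 2 1 (γ c z - γ₀ c z)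
    rw [proj_eq, map_sub, ← proj_eq, ← proj_eq, ← a1, ← a0]⟩
  have eδ : FieldEq (Y.Dl (γ - γ₀)) Φ := fun c hc z hz => by
    have a1 := e1 c hc z hz
    have a2 := dl_add (s := Y.s c) (sδ.1.diff hc hz) (s0.diff hc hz)
    simp only [Pi.sub_apply, sub_add_cancel] at a2
    have a3 : Y.Dl γ c z = Y.Dl (γ - γ₀) c z + Y.Dl γ₀ c z := a2
    rw [e0 c hc z hz, a1, add_comm] at a3
    exact (add_right_cancel a3).symm
  have dbδ : FieldEq (Db γ) (Db γ₀ + Db (γ - γ₀)) := fun c hc z hz => by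
    have a2 := db_add (s0.diff hc hz) (sδ.1.diff hc hz)
    simp only [Pi.sub_apply, add_sub_cancel] at a2
    exact a2
  have t0 := isSection_Db Y s0
  have t2 := isSection_Db Y s2
  have tδ := isSection_Db Y sδ.1
  have sFF := sφ.wedge sφ
  have A1 := Y.action_eq (φ := 0) (φ₁ := φs 1) (γ := γ) (Φ := condensate φs + Φ) (t0.add tδ)
    (sc.add hΦ.1) (sφ.add hΦ.1) (fun c hc z hz => (Y.dbar_eq s1 c hc z hz).trans (dbδ c hc z hz))
    (fun c hc z hz => by
      rw [← add_assoc]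
      exact congrArg (· + Φ c z) (add_condensate hC c hc z hz))
  have A0 := Y.action_eq (φ := 0) (φ₁ := φs 1) (γ := γ₀) (Φ := condensate φs) t0 sc sφ
    (Y.dbar_eq s0) (add_condensate hC)
  have b1 : FieldEq (Y.dbarDef (comp (total φs)) 0 γ')
      (Db γ' + (Y.Dl (wedge (total φs) γ') - wedge (total φs) Φ)) := fun c hc z hz => by
    have a1 := dl_gmul (s := Y.s c) (sφ.diff hc hz) (s2.diff hc hz) (hC.1.par_eq_self hc hz)
      fun i => hC.1.par_pd hc hz (th i)
    have a2 : dl (Y.s c) (γ' c) z = Φ c z := e2 c hc z hz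
    rw [Y.Dl_total hsol hC hc hz, gmul_zero_left, zero_add, a2] at a1
    refine (Y.dbarDef_total hX hsol hC hc hz (s2.diff hc hz)).trans ?_
    exact congrArg (db (γ' c) z + ·) (eq_sub_of_add_eq' a1.symm)
  have sφγ := Y.isSection_Dl (sφ.wedge s2)
  have sφΦ := sφ.wedge hΦ.1
  have A2 := Y.action_eq (φ₁ := 0) (t2.add (sφγ.sub sφΦ)) hΦ.1 hΦ.1 b1
    (fun c hc z hz => zero_add (Φ c z))
  have zero1 : Y.tw (Y.Dl (wedge (total φs) γ')) Φ = 0 := by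
    rw [Y.tw_Dl (sφ.wedge s2) hΦ.1 (r := -1) (fun c hc z hz => by
      change par (gmul (total φs c z) (γ' c z)) = (-1 : ℂ) • gmul (total φs c z) (γ' c z)
      rw [par_gmul, hC.1.par_eq_self hc hz, odd ⟨s2, p2⟩ c hc z hz, gmul_smul_right]),
      Y.tw_zero_right dΦ, mul_zero]
  have i1 : Y.tw (Db (γ - γ₀)) (condensate φs) = Y.tw (Db γ₀) Φ := by
    rw [← Y.tw_congr (rfl' _) e0, Y.tw_Db_Dl sδ s0, Y.tw_congr eδ (rfl' _), Y.tw_comm hΦ]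
  have i2 : Y.tw (Db (γ - γ₀)) (condensate φs)
      = (1 / 2 : ℂ) * Y.tw (wedge (total φs) (total φs)) Φ := by
    have hff := Y.tw_Dl sδ.1 sFF (odd sδ)
    rw [Y.tw_congr eδ (rfl' _), Y.tw_comm hΦ] at hff
    rw [Y.tw_Db sδ.1 sc (odd sδ), Y.tw_congr (rfl' _) (Y.Db_condensate hX hsol hC), tw_smul_right,
      hff]
    ring
  have i3 : Y.tw (Db (γ - γ₀)) Φ = Y.tw (Db γ') Φ := by
    rw [← Y.tw_congr (rfl' _) e2, Y.tw_Db_Dl sδ s2, Y.tw_congr eδ (rfl' _), ← Y.tw_congr e2 (rfl'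
      _), ← Y.tw_Db_Dl ⟨s2, p2⟩ s2, Y.tw_congr (rfl' _) e2]
  constructor
  · rw [A1, A0, A2, Y.tw_cube_add sφ hΦ, Y.tw_add_left t0 tδ (sc.add hΦ.1), Y.tw_add_right t0 sc
      hΦ.1, Y.tw_add_right tδ sc hΦ.1, Y.tw_add_left t2 (sφγ.sub sφΦ) hΦ.1, Y.tw_sub_left sφγ sφΦ
      hΦ.1, zero1]
    linear_combination (-1 / 2 : ℂ) * i3 - i2 + (1 / 2 : ℂ) * i1
  · intro χ hχ hχd
    have c1 : FieldEq (Y.Dl χ) (Db Φ + Y.Dl (wedge (total φs) Φ)) := fun c hc z hz => by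
      rw [← Y.delta_eq hχ.1 c hc z hz, hχd c hc z hz, Pi.add_apply, Pi.add_apply, Y.dbar_eq hΦ.1 c
        hc z hz, Y.bullet_eq hC.1 hΦ.1 c hc z hz]
      have a1 : Y.Dl (total φs) c z = 0 := Y.Dl_total hsol hC hc hz
      have a2 : Y.Dl Φ c z = 0 := dΦ c hc z hz
      simp only [Pi.sub_apply, Pi.add_apply, wedge, a1, a2, gmul_zero_left, gmul_zero_right, sub_zero]
    have c2 : Y.tw χ Φ = Y.tw (Db Φ) γ' + Y.tw (Y.Dl (wedge (total φs) Φ)) γ' := by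
      rw [← Y.tw_add_left (isSection_Db Y hΦ.1) (Y.isSection_Dl sφΦ) s2, ← Y.tw_congr c1 (rfl' _),
        Y.tw_Dl hχ.1 s2 (r := 1) (fun c hc z hz => by rw [hχ.par_eq hc hz]; norm_num), one_mul,
        Y.tw_congr (rfl' _) e2]
    have c3 : Y.tw (Y.Dl (wedge (total φs) Φ)) γ' = Y.tw (wedge (total φs) Φ) Φ := by
      rw [Y.tw_Dl sφΦ s2 (r := 1) (fun c hc z hz => by
        change par (gmul (total φs c z) (Φ c z)) = (1 : ℂ) • gmul (total φs c z) (Φ c z)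
        rw [par_gmul, hC.1.par_eq_self hc hz, hΦ.par_eq_self hc hz, one_smul]), one_mul,
        Y.tw_congr (rfl' _) e2]
    have c4 : Y.tw (Db Φ) γ' = -Y.tw (Db γ') Φ := by
      rw [Y.tw_Db hΦ.1 s2 (even hΦ), one_mul, Y.tw_comm hΦ]
    rw [A2, Y.tr_add (((hΦ.1.wedge hΦ.1).wedge hΦ.1).smul _) ((hχ.1.wedge hΦ.1).smul _), tr_smul,
      tr_smul, Y.tw_add_left t2 (sφγ.sub sφΦ) hΦ.1, Y.tw_sub_left sφγ sφΦ hΦ.1, zero1]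
    change _ = (1 / 6 : ℂ) * Y.tw (wedge Φ Φ) Φ + (1 / 2 : ℂ) * Y.tw χ Φ
    rw [c2, c3, c4]
    ring

end CalabiYau

end KS

end

theorem mainTheorem6 {X : Type*} [TopologicalSpace X] [T2Space X] [CompactSpace X]
    [ChartedSpace E3 X] [IsManifold (modelWithCornersSelf ℂ E3) ω X]
    [MeasurableSpace X] [BorelSpace X]
    (Y : CalabiYau X)
    (hX : ∀ β : LField X, IsB 0 2 β → FieldEq (Y.laplacian β) 0 → FieldEq β 0)
    (φs : ℕ → LField X) (hsol : Y.IsSolution φs) (hconv : Converges φs) :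
    -- at `τ = 1` the family of deformations is the manifold with complex structure `φ`
    (∀ c ∈ atlas E3 X, ∀ z ∈ c.target,
      conjFamily φs 1 c z = conjMat (comp (total φs)) c z) ∧
    -- the four operators on the deformed Calabi-Yau manifold, in the frame `e_I f^J`
    (∀ α : LField X, IsSection α → ∀ c ∈ atlas E3 X, ∀ z ∈ c.target, 1 ∈ regular φs c z →
      Y.dbarDef (comp (total φs)) (conjMat (comp (total φs))) α c z
          = (Y.geom (comp (total φs)) (conjMat (comp (total φs))) c).explDbar (α c) z ∧
      Y.deltaDef (comp (total φs)) (conjMat (comp (total φs))) α c z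
          = (Y.geom (comp (total φs)) (conjMat (comp (total φs))) c).explDelta (α c) z ∧
      Y.sDef (comp (total φs)) (conjMat (comp (total φs))) α c z
          = (Y.geom (comp (total φs)) (conjMat (comp (total φs))) c).explS (α c) z ∧
      Y.rDef (comp (total φs)) (conjMat (comp (total φs))) α c z
          = (Y.geom (comp (total φs)) (conjMat (comp (total φs))) c).explR (α c) z) ∧
    -- the holomorphic limits of the four operators
    (∀ α : LField X, IsSection α → ∀ c ∈ atlas E3 X, ∀ z ∈ c.target,
      IsHolomorphicLimit (regular φs c z)
        (fun τ => Y.dbarDef (comp (total φs)) (conjFamily φs τ) α c z)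
        ((Y.dbar α + Y.bullet (total φs) α) c z) ∧
      IsHolomorphicLimit (regular φs c z)
        (fun τ => Y.deltaDef (comp (total φs)) (conjFamily φs τ) α c z)
        (Y.delta α c z) ∧
      IsHolomorphicLimit (regular φs c z)
        (fun τ => Y.sDef (comp (total φs)) (conjFamily φs τ) α c z)
        ((Y.opS α + Y.starBr (total φs) α) c z) ∧
      IsHolomorphicLimit (regular φs c z)
        (fun τ => Y.rDef (comp (total φs)) (conjFamily φs τ) α c z)
        (Y.opR α c z)) ∧
    -- the fluctuation action around the condensate is the action of the holomorphic deformation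
    (∀ Φ γ₀ γ γ' : LField X, IsB 1 1 Φ →
      Y.IsPrimitive 0 0 (condensate φs) γ₀ →
      Y.IsPrimitive 0 0 (condensate φs + Φ) γ →
      Y.IsPrimitive (comp (total φs)) 0 Φ γ' →
      Y.action 0 0 (φs 1) (condensate φs + Φ) γ
          = Y.action 0 0 (φs 1) (condensate φs) γ₀ + Y.action (comp (total φs)) 0 0 Φ γ' ∧
      ∀ χ : LField X, IsB 2 2 χ →
        FieldEq (Y.delta χ) (Y.dbar Φ + Y.bullet (total φs) Φ) →
        Y.action (comp (total φs)) 0 0 Φ γ'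
          = Y.tr ((1 / 6 : ℂ) • wedge (wedge Φ Φ) Φ + (1 / 2 : ℂ) • wedge χ Φ)) ∧
    -- the deformed trace is the original one
    (∀ α : LField X, IsSection α → Y.trDef (comp (total φs)) 0 α = Y.tr α) := by
  have hconj : ∀ c ∈ atlas E3 X, ∀ z ∈ c.target,
      conjFamily φs 1 c z = conjMat (comp (total φs)) c z := fun c hc z hz => by
    ext j i
    rw [conjFamily_eq, map_one, ← comp_total hconv hc hz]
    rfl
  refine ⟨hconj, fun α hα c hc z hz hr => ?_, fun α hα c hc z hz =>
    ⟨Y.limit_dbar hX hsol hconv hα hc hz, Y.limit_delta hX hsol hconv hα hc hz,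
      Y.limit_S hX hsol hconv hα hc hz, Y.limit_R hX hsol hconv hα hc hz⟩,
    fun Φ γ₀ γ γ' hΦ h0 h1 h2 => Y.action_condensate hX hsol hconv hΦ h0 h1 h2,
    fun α _ => Y.trDef_eq_tr _ α⟩
  have h : (Y.geom (comp (total φs)) (conjMat (comp (total φs))) c).Admissible z :=
    (Y.admissible hX hsol hconv hc hz norm_one.le hr).congr (by
      filter_upwards [c.open_target.mem_nhds hz] with y hy using hconj c hc y hy)
  have ha := hα.diff hc hz
  exact ⟨Geom.opDbar_eq h.hs h.hs0 h.hφ h.hψ h.hd h.ksφ h.divφ ha,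
    Geom.opDelta_eq (h.hs.restrictScalars ℝ) h.hs0 h.hφ h.hψ h.hd h.ksψ ha,
    h.opS_eq ha, h.opR_eq ha⟩
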